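/- **Data.** Let $\kappa_{abc}$ ($a,b,c=1,\dots,b_2$) be symmetric triple intersection numbers, with the ample classes $p=(p^a)$ forming a set closed under addition, on which $\kappa_{abc}p^ap'^bp''^c>0$ and $\kappa_{ab}=\kappa_{abc}p^c$ has signature $(1,b_2-1)$. Let $n\ge 2$ and let $\hat\gamma_i=(p_i^a,q_{i,a})$, $i=1,\dots,n$, be (real) charges with $p_i$ ample. Put $\gamma_{ij}=p_j^aq_{i,a}-p_i^aq_{j,a}$, $\boldsymbol x\cdot\boldsymbol y=\sum_{i}\kappa_{abc}p_i^ax_i^by_i^c$, $v_{ij,k}^a=\delta_{ki}p_j^a-\delta_{kj}p_i^a$, and, for $\tau_2>0$, $x_i^a=\sqrt{2\tau_2}\,\kappa_i^{ab}q_{i,b}$, where $\kappa_i^{ab}$ is the inverse of $\kappa_{abc}p_i^c$. When charges are added, $\hat\gamma_B=\sum_{i\in B}\hat\gamma_i$ for a set $B$ of indices, and $\boldsymbol v_{BC}=\sum_{i\in B,j\in C}\boldsymbol v_{ij}$. **Trees.** $\mathbb T^{\ell}_n$ is the set of unrooted trees with $n$ labeled vertices; the edges are oriented arbitrarily, $s(e),t(e)$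 are the source and target of $e$, and $\mathcal T_e^{s},\mathcal T_e^t$ are the two parts of $\mathcal T\setminus e$ containing them. $\mathbb T^\ell_{n-2m,m}$ is the set of marked trees, i.e. trees with $n-2m$ vertices, where the vertex $v$ has $m_v\ge0$ marks and carries $2m_v+1$ of the $n$ charges, $\sum_v m_v=m$, each charge being carried by exactly one vertex. $\mathbb T_n^{\rm S}$ is the set of planar rooted (Schröder) trees with leaves carrying $\hat\gamma_1,\dots,\hat\gamma_n$ from left to right, in which each non-leaf vertex has at least two children and carries the sum of their charges; $V_T$ is the set of non-leaf vertices, $n_T=|V_T|$, and $v_0$ is the root. Rational coefficients are defined by $$a_{\mathcal T}=\frac1{n_{\mathcal T}}\sum_{v}(-1)^{n_v^+}\prod_{s}a_{\mathcal T_s(v)},\qquad a_\bullet=1,\qquad e_{\mathcal T}=-\sum_{m=1}^{n_{\mathcal T}-1}\ \sum_{\cup_{k=1}^m\mathcal T_k\simeq\mathcal T}e_{\mathcal T/\{\mathcal T_k\}}\prod_{k=1}^m a_{\mathcal T_k},\qquad e_\bullet=1,$$ where $n_{\mathcal T}$ is the number of vertices, $n_v^+$ the number of edges coming in at $v$, $\mathcal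 T_s(v)$ are the trees left after removing $v$, and $\mathcal T/\{\mathcal T_k\}$ is $\mathcal T$ with each of the disjoint subtrees $\mathcal T_k$, which together contain all vertices, collapsed to a vertex. **Functions.** Let $E_r(M;u)=\int_{\mathbb R^r}du'\,e^{-\pi|u-u'|^2}\prod_i{\rm sgn}((M^{\rm tr}u')_i)$, let $\Phi^E_r(\{\boldsymbol v_e\};\boldsymbol x)=E_r(B\cdot V;B\cdot\boldsymbol x)$, where $V$ is the matrix of the vectors $\boldsymbol v_e$ and $B$ is an orthonormal basis of their (positive definite) span, and let $\Phi^E_{\mathcal T}(\boldsymbol x)=\Phi^E_{|E_{\mathcal T}|}(\{\boldsymbol v_e\};\boldsymbol x)$ with $\boldsymbol v_e=\sum_{i\in\mathcal T^s_e}\sum_{j\in\mathcal T^t_e}\boldsymbol v_{ij}$. Let $\mathcal D(\boldsymbol v)=\boldsymbol v\cdot(\boldsymbol x+\frac1{2\pi}\partial_{\boldsymbol x})$ and $\mathcal D(\boldsymbol v,\boldsymbol y)=\boldsymbol v\cdot(\boldsymbol y+\frac1{2\pi}\partial_{\boldsymbol x})$; the operators $\mathcal D(\boldsymbol v,\boldsymbol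 y)$ with the same $\boldsymbol y$ commute. Let $\mathcal D_{m}=\sum_{\mathcal T\in\mathbb T^\ell_{2m+1}}a_{\mathcal T}\prod_{e}\mathcal D(\boldsymbol v_{s(e)t(e)})$ for a vertex carrying $2m+1$ charges, the sum being over trees labeled by these charges. The original functions are $$\mathcal E_n(\{\hat\gamma_i\};\tau_2)=\frac{(\sqrt{2\tau_2})^{1-n}}{n!}\sum_{m=0}^{\lfloor (n-1)/2\rfloor}\sum_{\mathcal T\in\mathbb T^\ell_{n-2m,m}}\Big[\prod_v\mathcal D_{m_v}\prod_e\mathcal D(\boldsymbol v_{s(e)t(e)})\Big]\Phi^E_{\mathcal T}(\boldsymbol x),$$ and the simplified functions are $$\mathscr E_n(\{\hat\gamma_i\};\tau_2)=\frac{(\sqrt{2\tau_2})^{1-n}}{n!}\sum_{\mathcal T\in\mathbb T^\ell_{n}}\Big[\prod_e\mathcal D(\boldsymbol v_{s(e)t(e)},\boldsymbol y)\Big]\Phi^E_{\mathcal T}(\boldsymbol x)\Big|_{\boldsymbol y=\boldsymbol x}.$$ **Statement.** (i) As $\tau_2\to\infty$ with fixed charges, both functions have a limit, so that $\mathcal E_n=\mathcal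 E_n^{(0)}+\mathcal E_n^{(+)}$ and $\mathscr E_n=\mathscr E_n^{(0)}+\mathscr E_n^{(+)}$ with first terms independent of $\tau_2$ and second terms tending to $0$. If $\sum_{i\in S,\,j\notin S}\gamma_{ij}\neq0$ for every nonempty proper subset $S$ of $\{1,\dots,n\}$, the second terms are $O(e^{-c\tau_2})$ for some $c>0$ (which may depend on the charges). (ii) The constant part of $\mathscr E_n$ is $$\mathscr E_n^{(0)}(\{\hat\gamma_i\})=\frac1{n!}\sum_{\mathcal T\in\mathbb T_n^\ell}\Big(\prod_{e\in E_{\mathcal T}}\gamma_{s(e)t(e)}\Big)\sum_{\mathcal J\subseteq E_{\mathcal T}}e_{\mathcal T_{\mathcal J}}\prod_{e\in\mathcal J}\delta_{\Gamma_e}\prod_{e\in E_{\mathcal T}\setminus\mathcal J}{\rm sgn}(\Gamma_e),\qquad \Gamma_e=\sum_{i\in\mathcal T^s_e}\sum_{j\in\mathcal T^t_e}\gamma_{ij},$$ where ${\rm sgn}(0)=0$, $\delta_\Gamma$ is $1$ for $\Gamma=0$ and $0$ otherwise, and $\mathcal T_{\mathcal J}$ is $\mathcal T$ with the edges not in $\mathcal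 J$ contracted. (iii) For $v\in V_T$ with $k_v$ children let $\mathcal E_v$ be $\mathcal E_{k_v}$ at the charges of these children, and similarly for the other functions. Then the kernel $$\mathscr R_n(\{\hat\gamma_i\};\tau_2)=\frac1{2^{n-1}}\sum_{T\in\mathbb T_n^{\rm S}}(-1)^{n_T-1}\mathcal E^{(+)}_{v_0}\prod_{v\in V_T\setminus\{v_0\}}\mathcal E^{(0)}_v$$ of the modular completion of D4-D2-D0 generating functions, which enters the completion symmetrized over the charges, can be computed with the simplified functions: for all $\tau_2>0$, $${\rm Sym}\,\mathscr R_n(\{\hat\gamma_i\};\tau_2)={\rm Sym}\,\Big\{\frac1{2^{n-1}}\sum_{T\in\mathbb T_n^{\rm S}}(-1)^{n_T-1}\mathscr E^{(+)}_{v_0}\prod_{v\in V_T\setminus\{v_0\}}\mathscr E^{(0)}_v\Big\},$$ where ${\rm Sym}$ is the average over all permutations of $\hat\gamma_1,\dots,\hat\gamma_n$. So all contributions of trees with marks cancel. -/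

import Mathlib

open Filter Topology MeasureTheory Asymptotics
open scoped ContDiff

noncomputable section

/-! ## Trees -/

/-- A finite oriented graph: a finite set of vertices and a finite set of arcs `(s(e), t(e))`.
It is used for trees and the graphs obtained from them by deletion and contraction. -/
structure OrientedGraph (V : Type) where
  verts : Finset V
  arcs : Finset (V × V)

namespace OrientedGraph

/-- Being connected by a path of arcs, whatever their orientation. -/
def Linked {V : Type} (D : OrientedGraph V) (u w : V) : Prop :=
  Relation.EqvGen (fun a c => (a, c) ∈ D.arcs) u w

/-- A chosen representative of the connected component of `u`. -/
def rep {V : Type} (D : OrientedGraph V) (u : V) : V :=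
  (Quotient.mk (Relation.EqvGen.setoid (fun a c => (a, c) ∈ D.arcs)) u).out

open Classical in
/-- The connected component of `u`. -/
def component {V : Type} (D : OrientedGraph V) (u : V) : OrientedGraph V where
  verts := D.verts.filter fun w => D.Linked u w
  arcs := D.arcs.filter fun e => D.Linked u e.1

open Classical in
/-- Remove a vertex with all arcs at it. -/
def removeVertex {V : Type} (D : OrientedGraph V) (v : V) : OrientedGraph V where
  verts := D.verts.erase v
  arcs := D.arcs.filter fun e => e.1 ≠ v ∧ e.2 ≠ v

open Classical in
/-- Remove a set of arcs, keeping all vertices. -/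
def removeArcs {V : Type} (D : OrientedGraph V) (K : Finset (V × V)) : OrientedGraph V where
  verts := D.verts
  arcs := D.arcs \ K

open Classical in
/-- For a set `K` of arcs, contract all arcs which are not in `K`. The vertices of the result are
the connected components of the graph without `K`, each named by its representative; its arcs are
those of `K`. -/
def contract {V : Type} (D : OrientedGraph V) (K : Finset (V × V)) : OrientedGraph V where
  verts := D.verts.image (D.removeArcs K).rep
  arcs := K.image fun e => ((D.removeArcs K).rep e.1, (D.removeArcs K).rep e.2)

open Classical in
/-- The arcs at the vertex `v`. -/
def arcsAt {V : Type} (D : OrientedGraph V) (v : V) : Finset (V × V) :=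
  D.arcs.filter fun e => e.1 = v ∨ e.2 = v

open Classical in
/-- The number of incoming arcs at `v`. -/
def inDegree {V : Type} (D : OrientedGraph V) (v : V) : ℕ :=
  (D.arcs.filter fun e => e.2 = v).card

open Classical in
/-- The end of the arc `e` other than `v`. -/
def otherEnd {V : Type} (v : V) (e : V × V) : V := if e.1 = v then e.2 else e.1

open Classical in
/-- The vertices of the part containing the source of `e` after removing the arc `e`. -/
def sourceSide {V : Type} (D : OrientedGraph V) (e : V × V) : Finset V :=
  ((D.removeArcs {e}).component e.1).verts

open Classical in
/-- The vertices of the part containing the target of `e` after removing the arc `e`. -/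
def targetSide {V : Type} (D : OrientedGraph V) (e : V × V) : Finset V :=
  ((D.removeArcs {e}).component e.2).verts

theorem card_component_removeVertex_lt {V : Type} (D : OrientedGraph V) (v w : V)
    (hv : v ∈ D.verts) : ((D.removeVertex v).component w).verts.card < D.verts.card := by
  classical
  refine lt_of_le_of_lt (Finset.card_le_card (Finset.filter_subset _ _)) ?_
  exact Finset.card_erase_lt_of_mem hv

theorem card_arcs_contract_lt {V : Type} (D : OrientedGraph V) (K : Finset (V × V))
    (hK : K ⊂ D.arcs) : (D.contract K).arcs.card < D.arcs.card := by
  classical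
  exact lt_of_le_of_lt Finset.card_image_le (Finset.card_lt_card hK)

/-- The rational coefficient `a_T` of an oriented tree:
`a_T = (1 / n_T) ∑_v (-1)^{n_v^+} ∏_s a_{T_s(v)}`, where the `T_s(v)` are the trees left after
removing `v`, one for each arc at `v`. For the one-vertex tree the formula gives `1`. -/
def coeffA {V : Type} (D : OrientedGraph V) : ℚ :=
  (1 / (D.verts.card : ℚ)) * ∑ v ∈ D.verts.attach,
    (-1) ^ D.inDegree v.1 *
      ∏ e ∈ D.arcsAt v.1, coeffA ((D.removeVertex v.1).component (otherEnd v.1 e))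
termination_by D.verts.card
decreasing_by exact card_component_removeVertex_lt D v.1 _ v.2

open Classical in
/-- The rational coefficient `e_T` of an oriented tree: `e_• = 1` and
`e_T = - ∑_{m < n_T} ∑_{T_1 ∪ … ∪ T_m ≃ T} e_{T/{T_k}} ∏_k a_{T_k}`.
A decomposition of `T` into disjoint subtrees covering all the vertices is given by the set `K`
of the arcs that lie in no subtree; there are fewer subtrees than vertices iff `K` is proper. -/
def coeffE {V : Type} (D : OrientedGraph V) : ℚ :=
  if D.arcs = ∅ then 1 else
    -∑ K ∈ D.arcs.ssubsets.attach, coeffE (D.contract K.1) *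
      ∏ r ∈ D.verts.image (D.removeArcs K.1).rep, coeffA ((D.removeArcs K.1).component r)
termination_by D.arcs.card
decreasing_by exact card_arcs_contract_lt D K.1 (Finset.mem_ssubsets.1 K.2)

end OrientedGraph

open Classical in
/-- The unrooted labeled trees whose vertices are labeled by (and identified with) `V`. -/
def labeledTrees (V : Type) [Fintype V] : Finset (SimpleGraph V) :=
  Finset.univ.filter fun G => G.IsTree

open Classical in
/-- A tree with an (arbitrary) choice of orientation of each of its edges. -/
def orient {V : Type} [Fintype V] (G : SimpleGraph V) : OrientedGraph V where
  verts := Finset.univ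
  arcs := G.edgeFinset.image fun e => Quot.out e

/-- Planar rooted trees whose leaves carry labels and all of whose other vertices have at least
two (ordered) children. -/
inductive SchroederTree (L : Type) : Type where
  | leaf (l : L) : SchroederTree L
  | node (k : ℕ) (children : Fin (k + 2) → SchroederTree L) : SchroederTree L

namespace SchroederTree

/-- The labels of the leaves from left to right. -/
def frontier {L : Type} : SchroederTree L → List L
  | leaf l => [l]
  | node _ ch => (List.ofFn fun i => (ch i).frontier).flatten

/-- The number `n_T` of vertices which are not leaves. -/
def numVertices {L : Type} : SchroederTree L → ℕ
  | leaf _ => 0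
  | node _ ch => 1 + ∑ i, (ch i).numVertices

/-- The charge of the root: leaves carry given charges, and any other vertex carries the sum of
the charges of its children. -/
def charge {L M : Type} [AddCommMonoid M] (γ : L → M) : SchroederTree L → M
  | leaf l => γ l
  | node _ ch => ∑ i, (ch i).charge γ

/-- The product of `w_v = w_{k_v} (charges of the children of v)` over all vertices `v` which are
not leaves. -/
def weightProd {L M : Type} [AddCommMonoid M] (γ : L → M) (w : (k : ℕ) → (Fin k → M) → ℝ) :
    SchroederTree L → ℝ
  | leaf _ => 1
  | node k ch => w (k + 2) (fun i => (ch i).charge γ) * ∏ i, (ch i).weightProd γ w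

/-- The same product, but with another weight `w₀` at the root vertex. -/
def rootedWeightProd {L M : Type} [AddCommMonoid M] (γ : L → M)
    (w₀ w : (k : ℕ) → (Fin k → M) → ℝ) : SchroederTree L → ℝ
  | leaf _ => 1
  | node k ch => w₀ (k + 2) (fun i => (ch i).charge γ) * ∏ i, (ch i).weightProd γ w

theorem one_le_length_frontier {L : Type} (T : SchroederTree L) : 1 ≤ T.frontier.length := by
  induction T with
  | leaf l => simp [frontier]
  | node k ch ih =>
    simp only [frontier, List.length_flatten, List.map_ofFn, List.sum_ofFn]
    calc 1 ≤ (ch 0).frontier.length := ih 0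
      _ ≤ _ := Finset.single_le_sum (f := fun i => (ch i).frontier.length)
        (fun _ _ => Nat.zero_le _) (Finset.mem_univ 0)

theorem finite_length_le (L : Type) [Finite L] (N : ℕ) :
    {T : SchroederTree L | T.frontier.length ≤ N}.Finite := by
  induction N with
  | zero =>
    convert Set.finite_empty (α := SchroederTree L)
    ext T
    have := T.one_le_length_frontier
    simp only [Set.mem_ofPred_eq, Set.mem_empty_iff_false, iff_false]
    omega
  | succ N ih =>
    have h1 : (Set.range (leaf : L → SchroederTree L)).Finite := Set.finite_range _
    have h2 : (⋃ k ∈ Finset.range N, (fun ch => node k ch) ''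
        (Set.univ.pi fun _ : Fin (k + 2) =>
          {T : SchroederTree L | T.frontier.length ≤ N})).Finite :=
      Set.Finite.biUnion (Finset.finite_toSet _) fun k _ => (Set.Finite.pi fun _ => ih).image _
    refine (h1.union h2).subset ?_
    intro T hT
    cases T with
    | leaf l => exact Or.inl ⟨l, rfl⟩
    | node k ch =>
      right
      simp only [Set.mem_ofPred_eq, frontier, List.length_flatten, List.map_ofFn,
        List.sum_ofFn, Function.comp_def] at hT
      have key : ∀ i, (ch i).frontier.length + (k + 1) ≤ N + 1 := by
        intro i
        have h3 : ∑ j, (ch j).frontier.length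
            = (ch i).frontier.length + ∑ j ∈ Finset.univ.erase i, (ch j).frontier.length :=
          (Finset.add_sum_erase _ _ (Finset.mem_univ i)).symm
        have h4 : (Finset.univ.erase i).card • 1
            ≤ ∑ j ∈ Finset.univ.erase i, (ch j).frontier.length :=
          Finset.card_nsmul_le_sum _ _ _ fun j _ => (ch j).one_le_length_frontier
        rw [Finset.card_erase_of_mem (Finset.mem_univ i), Finset.card_univ, Fintype.card_fin,
          smul_eq_mul, mul_one] at h4
        omega
      have hk := key 0
      have h0 := (ch 0).one_le_length_frontier
      refine Set.mem_biUnion (x := k) ?_ ⟨ch, ?_, rfl⟩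
      · simp only [Finset.coe_range, Set.mem_Iio]; omega
      · intro i _
        have := key i
        simp only [Set.mem_ofPred_eq]; omega

theorem finite_frontier_eq (n : ℕ) :
    {T : SchroederTree (Fin n) | T.frontier = List.finRange n}.Finite :=
  (finite_length_le (Fin n) n).subset fun T hT => by
    simp only [Set.mem_ofPred_eq] at hT ⊢
    simp [hT]

end SchroederTree

/-- The Schröder trees with `n` leaves, numbered from left to right. -/
def schroederTrees (n : ℕ) : Finset (SchroederTree (Fin n)) :=
  (SchroederTree.finite_frontier_eq n).toFinset

/-! ## Charges and the bilinear form -/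

/-- Reduced charges `(p^a, q_a)`. -/
abbrev Charge (b : ℕ) : Type := (Fin b → ℝ) × (Fin b → ℝ)

/-- The trilinear form `κ_{abc} x^a y^b z^c`. -/
def triple {b : ℕ} (κ : Fin b → Fin b → Fin b → ℝ) (x y z : Fin b → ℝ) : ℝ :=
  ∑ a, ∑ c, ∑ d, κ a c d * x a * y c * z d

/-- The matrix `κ_{ab} = κ_{abc} p^c`. -/
def kappaMatrix {b : ℕ} (κ : Fin b → Fin b → Fin b → ℝ) (p : Fin b → ℝ) :
    Matrix (Fin b) (Fin b) ℝ :=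
  Matrix.of fun a c => ∑ d, κ a c d * p d

/-- A symmetric matrix has signature `(1, b - 1)`: there is a positive vector, on the orthogonal
complement of which the form is negative definite. -/
def HasSignatureOne {b : ℕ} (A : Matrix (Fin b) (Fin b) ℝ) : Prop :=
  A.IsSymm ∧ ∃ v : Fin b → ℝ, 0 < v ⬝ᵥ A.mulVec v ∧
    ∀ w : Fin b → ℝ, w ≠ 0 → v ⬝ᵥ A.mulVec w = 0 → w ⬝ᵥ A.mulVec w < 0

/-- The triple intersection numbers `κ_{abc}` and the set of classes of ample divisors: `κ` is
symmetric, a sum of ample classes is ample, ample divisors have positive triple intersections,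
and `κ_{abc} p^c` has signature `(1, b - 1)` for `p` ample. -/
structure IsAmpleCone {b : ℕ} (κ : Fin b → Fin b → Fin b → ℝ) (ample : Set (Fin b → ℝ)) :
    Prop where
  symm₁₂ : ∀ a c d, κ a c d = κ c a d
  symm₂₃ : ∀ a c d, κ a c d = κ a d c
  add_mem : ∀ p ∈ ample, ∀ p' ∈ ample, p + p' ∈ ample
  triple_pos : ∀ p ∈ ample, ∀ p' ∈ ample, ∀ p'' ∈ ample, 0 < triple κ p p' p''
  signature : ∀ p ∈ ample, HasSignatureOne (kappaMatrix κ p)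

/-- The Dirac product `γ_{12} = p_2^a q_{1,a} - p_1^a q_{2,a}`. -/
def dirac {b : ℕ} (γ₁ γ₂ : Charge b) : ℝ := γ₂.1 ⬝ᵥ γ₁.2 - γ₁.1 ⬝ᵥ γ₂.2

/-- The `n b`-dimensional vectors `x_i^a`. -/
abbrev Vec (n b : ℕ) : Type := Fin n → Fin b → ℝ

/-- The bilinear form `x · y = ∑_i κ_{abc} p_i^a x_i^b y_i^c`. -/
def dot {n b : ℕ} (κ : Fin b → Fin b → Fin b → ℝ) (γ : Fin n → Charge b) (x y : Vec n b) : ℝ :=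
  ∑ i, triple κ (γ i).1 (x i) (y i)

/-- The vector `v_{ij}` with components `v_{ij,k}^a = δ_{ki} p_j^a - δ_{kj} p_i^a`. -/
def vPair {n b : ℕ} (γ : Fin n → Charge b) (i j : Fin n) : Vec n b := fun k a =>
  (if k = i then (γ j).1 a else 0) - (if k = j then (γ i).1 a else 0)

/-- The vector `v_{BC} = ∑_{i ∈ B} ∑_{j ∈ C} v_{ij}` for two vertices carrying sets `B`, `C` of
charges. -/
def vBlock {n b : ℕ} (γ : Fin n → Charge b) (B C : Finset (Fin n)) : Vec n b :=
  ∑ i ∈ B, ∑ j ∈ C, vPair γ i j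

/-- The vector with components `x_i^a = √(2 τ₂) κ_i^{ab} q_{i,b}`, where `κ_i^{ab}` is the inverse
of `κ_{abc} p_i^c`. -/
def xVec {n b : ℕ} (κ : Fin b → Fin b → Fin b → ℝ) (γ : Fin n → Charge b) (τ₂ : ℝ) : Vec n b :=
  fun i => √(2 * τ₂) • (kappaMatrix κ (γ i).1)⁻¹.mulVec (γ i).2

/-! ## Generalized error functions -/

/-- `E_n(M; u) = ∫ du' exp(-π ∑_i (u_i - u'_i)²) ∏_i sgn((Mᵗ u')_i)`. -/
def genErf {ι : Type} [Fintype ι] (M : Matrix ι ι ℝ) (u : ι → ℝ) : ℝ :=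
  ∫ u' : ι → ℝ, Real.exp (-Real.pi * ∑ i, (u i - u' i) ^ 2) *
    ∏ i, Real.sign (M.transpose.mulVec u' i)

/-- `B` is an orthonormal basis, with respect to the form, of the span of the vectors `v`. -/
def IsOrthonormalBasisOfSpan {n b : ℕ} {ι : Type} (κ : Fin b → Fin b → Fin b → ℝ)
    (γ : Fin n → Charge b) (v B : ι → Vec n b) : Prop :=
  (∀ i, dot κ γ (B i) (B i) = 1) ∧ (∀ i j, i ≠ j → dot κ γ (B i) (B j) = 0) ∧
    Submodule.span ℝ (Set.range B) = Submodule.span ℝ (Set.range v)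

open Classical in
/-- The boosted generalized error function `Φ^E({v_i}; x) = E(B·v; B·x)`, with `B` an orthonormal
basis of the span of the linearly independent vectors `v_i`, which is assumed to be positive
definite (otherwise the value is a dummy). It does not depend on the choice of `B`. -/
def boostedErf {n b : ℕ} {ι : Type} [Fintype ι] (κ : Fin b → Fin b → Fin b → ℝ)
    (γ : Fin n → Charge b) (v : ι → Vec n b) (x : Vec n b) : ℝ :=
  if h : ∃ B : ι → Vec n b, IsOrthonormalBasisOfSpan κ γ v B then
    genErf (Matrix.of fun i j => dot κ γ (h.choose i) (v j)) (fun i => dot κ γ (h.choose i) x)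
  else 0

/-- The vector `v_e`, the sum of the `v_{ij}` over `i` in the part of the tree at the source of `e`
and `j` in the part at the target of `e`; `w i j` is the vector `v_{ij}` for two vertices. -/
def edgeVec {n b : ℕ} {V : Type} (D : OrientedGraph V) (w : V → V → Vec n b) (e : V × V) :
    Vec n b :=
  ∑ i ∈ D.sourceSide e, ∑ j ∈ D.targetSide e, w i j

/-- The generalized error function `Φ^E_T` of a tree, with parameters the vectors `v_e`. -/
def treeErf {n b : ℕ} {V : Type} (κ : Fin b → Fin b → Fin b → ℝ) (γ : Fin n → Charge b)
    (D : OrientedGraph V) (w : V → V → Vec n b) : Vec n b → ℝ :=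
  boostedErf κ γ fun e : D.arcs => edgeVec D w e.1

/-! ## Differential operators -/

/-- `D(v) = v · (x + (1/2π) ∂_x)`. -/
def opD {n b : ℕ} (κ : Fin b → Fin b → Fin b → ℝ) (γ : Fin n → Charge b) (v : Vec n b)
    (F : Vec n b → ℝ) : Vec n b → ℝ :=
  fun x => dot κ γ v x * F x + 1 / (2 * Real.pi) * fderiv ℝ F x v

/-- `D(v, y) = v · (y + (1/2π) ∂_x)`. -/
def opDy {n b : ℕ} (κ : Fin b → Fin b → Fin b → ℝ) (γ : Fin n → Charge b) (v y : Vec n b)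
    (F : Vec n b → ℝ) : Vec n b → ℝ :=
  fun x => dot κ γ v y * F x + 1 / (2 * Real.pi) * fderiv ℝ F x v

/-- Apply a product of operators to a function. -/
def applyOps {n b : ℕ} (ops : List ((Vec n b → ℝ) → (Vec n b → ℝ))) (F : Vec n b → ℝ) :
    Vec n b → ℝ :=
  ops.foldr (fun O f => O f) F

/-- The operator `D_m({p_s}) = ∑_T a_T ∏_e D(v_{s(e)t(e)})` of a vertex carrying the set `B` of
`2 m + 1` charges; the sum is over the unrooted trees labeled by `B`. -/
def opMark {n b : ℕ} (κ : Fin b → Fin b → Fin b → ℝ) (γ : Fin n → Charge b) (B : Finset (Fin n))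
    (F : Vec n b → ℝ) : Vec n b → ℝ :=
  fun x => ∑ G ∈ labeledTrees B, ((orient G).coeffA : ℝ) *
    applyOps ((orient G).arcs.toList.map fun e => opD κ γ (vPair γ e.1.1 e.2.1)) F x

/-! ## The original functions, with marked trees -/

open Classical in
/-- The ways to distribute `n` charges among `k` vertices such that each vertex carries an odd
number `1 + 2 m_v` of charges: partitions of the charges into `k` sets of odd size. There are
then `(n - k) / 2` marks. -/
def markedVertexSets (n k : ℕ) : Finset (Finset (Finset (Fin n))) :=
  Finset.univ.filter fun P => P.card = k ∧ (∀ B ∈ P, Odd B.card) ∧ ∀ i, ∃! B, B ∈ P ∧ i ∈ B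

/-- The function
`Φ_n(x) = (1/n!) ∑_m ∑_T [∏_v D_{m_v}({p_{v,s}}) ∏_e D(v_{s(e)t(e)})] Φ^E_T(x)`,
the inner sum being over the marked unrooted labeled trees with `n - 2m` vertices and `m` marks. -/
def markedPhi {n b : ℕ} (κ : Fin b → Fin b → Fin b → ℝ) (γ : Fin n → Charge b) (x : Vec n b) : ℝ :=
  1 / (n.factorial : ℝ) * ∑ m ∈ Finset.range ((n - 1) / 2 + 1),
    ∑ P ∈ markedVertexSets n (n - 2 * m), ∑ G ∈ labeledTrees P,
      applyOps (P.toList.map fun B => opMark κ γ B)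
        (applyOps ((orient G).arcs.toList.map fun e => opD κ γ (vBlock γ e.1.1 e.2.1))
          (treeErf κ γ (orient G) fun B C => vBlock γ B.1 C.1)) x

/-- The original function `𝓔_n({γ_i}; τ₂)`. -/
def markedE {b : ℕ} (κ : Fin b → Fin b → Fin b → ℝ) (n : ℕ) (γ : Fin n → Charge b) (τ₂ : ℝ) : ℝ :=
  markedPhi κ γ (xVec κ γ τ₂) / √(2 * τ₂) ^ (n - 1)

/-! ## The simplified functions, without marked trees -/

/-- `Φ_n(x) = (1/n!) ∑_T [∏_e D(v_{s(e)t(e)}, y)] Φ^E_T(x) |_{y=x}`, the sum being over the unrooted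
labeled trees with `n` vertices. -/
def simplePhi {n b : ℕ} (κ : Fin b → Fin b → Fin b → ℝ) (γ : Fin n → Charge b) (x : Vec n b) : ℝ :=
  1 / (n.factorial : ℝ) * ∑ G ∈ labeledTrees (Fin n),
    applyOps ((orient G).arcs.toList.map fun e => opDy κ γ (vPair γ e.1 e.2) x)
      (treeErf κ γ (orient G) (vPair γ)) x

/-- The simplified function `ℰ_n({γ_i}; τ₂)`. -/
def simpleE {b : ℕ} (κ : Fin b → Fin b → Fin b → ℝ) (n : ℕ) (γ : Fin n → Charge b) (τ₂ : ℝ) : ℝ :=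
  simplePhi κ γ (xVec κ γ τ₂) / √(2 * τ₂) ^ (n - 1)

/-- `Γ_e`, the sum of `γ_{ij}` over `i` in the part of the tree at the source of `e` and `j` in the
part at the target of `e`. -/
def edgeDirac {n b : ℕ} (γ : Fin n → Charge b) (D : OrientedGraph (Fin n))
    (e : Fin n × Fin n) : ℝ :=
  ∑ i ∈ D.sourceSide e, ∑ j ∈ D.targetSide e, dirac (γ i) (γ j)

/-- `κ_T = ∏_e γ_{s(e)t(e)}`. -/
def treeKappa {n b : ℕ} (γ : Fin n → Charge b) (D : OrientedGraph (Fin n)) : ℝ :=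
  ∏ e ∈ D.arcs, dirac (γ e.1) (γ e.2)

/-- `S_T = ∑_{J ⊆ E_T} e_{T_J} ∏_{e ∈ J} δ_{Γ_e} ∏_{e ∈ E_T ∖ J} sgn(Γ_e)`, where `T_J` is obtained
from `T` by contracting the edges not in `J`. -/
def treeSign {n b : ℕ} (γ : Fin n → Charge b) (D : OrientedGraph (Fin n)) : ℝ :=
  ∑ J ∈ D.arcs.powerset, ((D.contract J).coeffE : ℝ) *
    (∏ e ∈ J, if edgeDirac γ D e = 0 then 1 else 0) *
    ∏ e ∈ D.arcs \ J, Real.sign (edgeDirac γ D e)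

/-- `ℰ_n^{(0)}({γ_i}) = (1/n!) ∑_T κ_T S_T`. -/
def simpleEConst {b : ℕ} (n : ℕ) (γ : Fin n → Charge b) : ℝ :=
  1 / (n.factorial : ℝ) * ∑ G ∈ labeledTrees (Fin n),
    treeKappa γ (orient G) * treeSign γ (orient G)

/-! ## The kernels -/

/-- The constant part of a function of `τ₂`, i.e. its limit as `τ₂ → ∞`. -/
def constPart (f : ℝ → ℝ) : ℝ := limUnder atTop f

/-- The remaining part, which vanishes as `τ₂ → ∞`. -/
def decayingPart (f : ℝ → ℝ) (τ₂ : ℝ) : ℝ := f τ₂ - constPart f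

/-- The Schröder tree sum
`2^{1-n} ∑_T (-1)^{n_T - 1} f^{(+)}_{v₀} ∏_{v ≠ v₀} f^{(0)}_v`, where `f^{(0)}` and `f^{(+)}` are
the constant and the decaying part of `f`. -/
def kernelR {b : ℕ} (f : (k : ℕ) → (Fin k → Charge b) → ℝ → ℝ) (n : ℕ) (γ : Fin n → Charge b)
    (τ₂ : ℝ) : ℝ :=
  1 / 2 ^ (n - 1) * ∑ T ∈ schroederTrees n, (-1) ^ (T.numVertices - 1) *
    T.rootedWeightProd γ (fun k δ => decayingPart (f k δ) τ₂) (fun k δ => constPart (f k δ))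

/-- Symmetrization over the charges, with weight `1/n!`. -/
def symmetrize {b n : ℕ} (R : (Fin n → Charge b) → ℝ) (γ : Fin n → Charge b) : ℝ :=
  1 / (n.factorial : ℝ) * ∑ σ : Equiv.Perm (Fin n), R (γ ∘ σ)

/-- Charges in generic position: the Dirac product of the total charges of two complementary
nonempty sets of charges never vanishes. -/
def GenericCharges {b n : ℕ} (γ : Fin n → Charge b) : Prop :=
  ∀ S : Finset (Fin n), S.Nonempty → Sᶜ.Nonempty → dirac (∑ i ∈ S, γ i) (∑ i ∈ Sᶜ, γ i) ≠ 0

end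

noncomputable section

open Finset
open Real (exp sign)
open Function (Surjective Injective)
open scoped Classical

/-! ## Oriented trees as sets of arcs -/

/-- Sets of arcs. -/
abbrev Arcs (V : Type) : Type := Finset (V × V)

section

variable {V : Type} {R : Arcs V} {e : V × V} {c : V → ℝ}

/-- Two vertices are linked by a path of arcs, whatever their orientation. -/
abbrev Lk (R : Arcs V) (u w : V) : Prop := Relation.EqvGen (fun a c => (a, c) ∈ R) u w

/-- No arc can be removed without separating its ends. -/
def IsForest (R : Arcs V) : Prop := ∀ e ∈ R, ¬ Lk (R.erase e) e.1 e.2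

/-- A forest in which any two vertices are linked. -/
def IsOTree (R : Arcs V) : Prop := IsForest R ∧ ∀ u w, Lk R u w

/-- The oriented trees with vertex set `V`. -/
def otrees (V : Type) [Fintype V] : Finset (Arcs V) := univ.filter IsOTree

lemma mem_otrees [Fintype V] : R ∈ otrees V ↔ IsOTree R := by simp [otrees]

lemma Lk.refl (u : V) : Lk R u u := Relation.EqvGen.refl u

lemma Lk.symm {u w : V} (h : Lk R u w) : Lk R w u := Relation.EqvGen.symm _ _ h

lemma Lk.trans {u v w : V} (h : Lk R u v) (h' : Lk R v w) :
    Lk R u w := Relation.EqvGen.trans _ _ _ h h'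

lemma Lk.of_mem (h : e ∈ R) : Lk R e.1 e.2 := Relation.EqvGen.rel _ _ h

/-- A function which takes equal values at the ends of each arc is constant on linked vertices. -/
lemma Lk.eq_of {V α : Type} {R : Arcs V} {u w : V} (h : Lk R u w) (φ : V → α)
    (hφ : ∀ e ∈ R, φ e.1 = φ e.2) : φ u = φ w := by
  induction h with
  | rel a c hac => exact hφ _ hac
  | refl a => rfl
  | symm a c _ ih => exact ih.symm
  | trans a c d _ _ ih1 ih2 => exact ih1.trans ih2

lemma Lk.map {V W : Type} {R : Arcs V} {R' : Arcs W} {u w : V} (h : Lk R u w)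
    (f : V → W) (hf : ∀ e ∈ R, Lk R' (f e.1) (f e.2)) : Lk R' (f u) (f w) := by
  induction h with
  | rel a c hac => exact hf _ hac
  | refl a => exact Lk.refl _
  | symm a c _ ih => exact ih.symm
  | trans a c d _ _ ih1 ih2 => exact ih1.trans ih2

lemma Lk.mono {R R' : Arcs V} {u w : V} (h : Lk R u w) (hR : R ⊆ R') :
    Lk R' u w := h.map id fun _ he => Lk.of_mem (hR he)

lemma IsForest.mono {R R' : Arcs V} (h : IsForest R') (hR : R ⊆ R') :
    IsForest R := fun e he hl => h e (hR he) (hl.mono (erase_subset_erase _ hR))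

lemma IsForest.ne (h : IsForest R) (he : e ∈ R) : e.1 ≠ e.2 := fun h' => h e he (h' ▸ Lk.refl _)

lemma IsForest.swap_notMem (h : IsForest R) (he : e ∈ R) : e.swap ∉ R := fun h' => by
  refine h e he (Lk.symm (Lk.of_mem (e := e.swap) ?_))
  refine mem_erase.2 ⟨fun h'' => h.ne he ?_, h'⟩; grind

/-- The difference of the coordinate vectors at the ends of an arc. -/
def dv (e : V × V) : V → ℝ := Pi.single e.1 1 - Pi.single e.2 1

lemma dv_swap (e : V × V) : dv e.swap = -dv e := by simp [dv]

/-- The vertices linked to the source of `e` after the removal of `e`. -/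
def side [Fintype V] (R : Arcs V) (e : V × V) : Finset V :=
  univ.filter fun k => Lk (R.erase e) e.1 k

/-- The flow through `e` in a tree for given sources `c` at the vertices. -/
def flow [Fintype V] (R : Arcs V) (e : V × V) : (V → ℝ) →ₗ[ℝ] ℝ :=
  ∑ k ∈ side R e, LinearMap.proj k

lemma flow_apply [Fintype V] (R : Arcs V) (e : V × V) (c : V → ℝ) :
    flow R e c = ∑ k ∈ side R e, c k := by simp [flow]

lemma sum_single_eq_ite (s : Finset V) (v : V) :
    ∑ k ∈ s, (Pi.single v 1 : V → ℝ) k = if v ∈ s then 1 else 0 := by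
  simp_all

lemma sum_dv (s : Finset V) (e : V × V) :
    ∑ k ∈ s, dv e k = (if e.1 ∈ s then 1 else 0) - if e.2 ∈ s then 1 else 0 := by
  simp only [dv, Pi.sub_apply, sum_sub_distrib, sum_single_eq_ite]

lemma sum_univ_dv [Fintype V] (e : V × V) : ∑ k, dv e k = 0 := by simp [sum_dv]

lemma flow_dv [Fintype V] (hR : IsForest R) {e e' : V × V}
    (he : e ∈ R) (he' : e' ∈ R) : flow R e (dv e') = if e' = e then 1 else 0 := by
  rw [flow_apply, sum_dv]; simp only [side, mem_filter_univ]; split_ifs with h1 h2 h3 h3 h3 h3 h3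
  all_goals first | rfl | simp
  · subst h3; exact absurd h2 (hR _ he)
  · exact absurd (h1.trans (Lk.of_mem (mem_erase.2 ⟨h3, he'⟩))) h2
  · subst h3; exact absurd (Lk.refl _) h1
  · rename_i h4; exact absurd (h4.trans (Lk.of_mem (mem_erase.2 ⟨h3, he'⟩)).symm) h1
  · subst h3; exact absurd (Lk.refl _) h1

lemma flow_of_repr [Fintype V] (hR : IsForest R)
    {g : V × V → ℝ} (h : c = ∑ e ∈ R, g e • dv e) (he : e ∈ R) : flow R e c = g e := by
  rw [h, map_sum]; rw [sum_eq_single e]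
  · rw [map_smul, flow_dv hR he he]; simp
  · intro e' he' hne; rw [map_smul, flow_dv hR he he']; simp [hne]
  grind

lemma Lk.dv_mem_span {u w : V} (h : Lk R u w) :
    dv (u, w) ∈ Submodule.span ℝ (dv '' (R : Set (V × V))) := by
  induction h with
  | rel a c hac => exact Submodule.subset_span ⟨_, hac, rfl⟩
  | refl a => simp [dv]
  | symm a c _ ih =>
    have : dv (c, a) = -dv (a, c) := by simp [dv]
    simp_all
  | trans a c d _ _ ih1 ih2 =>
    have : dv (a, d) = dv (a, c) + dv (c, d) := by simp [dv]
    rw [this]; exact add_mem ih1 ih2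

lemma mem_span_dv_iff :
    c ∈ Submodule.span ℝ (dv '' (R : Set (V × V))) ↔ ∃ g : V × V → ℝ, c = ∑ e ∈ R, g e • dv e := by
  rw [Submodule.mem_span_image_finset_iff_exists_fun]; constructor
  · rintro ⟨g, hg⟩; refine ⟨fun e => if h : e ∈ R then g ⟨e, h⟩ else 0, ?_⟩
    rw [← hg, ← sum_coe_sort R]; exact sum_congr rfl fun e _ => by simp [e.2]
  · rintro ⟨g, hg⟩; refine ⟨fun e => g e, ?_⟩; rw [hg, ← sum_coe_sort R]

lemma eq_sum_flow_of_mem_span [Fintype V] (hR : IsForest R)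
    (h : c ∈ Submodule.span ℝ (dv '' (R : Set (V × V)))) : c = ∑ e ∈ R, flow R e c • dv e := by
  obtain ⟨g, hg⟩ := mem_span_dv_iff.1 h
  conv_lhs => rw [hg]
  exact sum_congr rfl fun e he => by rw [flow_of_repr hR hg he]

lemma mem_span_of_sum_eq_zero [Fintype V] (hR : ∀ u w, Lk R u w) (hc : ∑ k, c k = 0) :
    c ∈ Submodule.span ℝ (dv '' (R : Set (V × V))) := by
  cases isEmpty_or_nonempty V with
  | inl h => rw [Subsingleton.elim c 0]; exact zero_mem _
  | inr h =>
    obtain ⟨v⟩ := h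
    have : c = ∑ k, c k • dv (k, v) := by
      simp only [dv, smul_sub, sum_sub_distrib, ← sum_smul, hc, zero_smul, sub_zero]; ext j
      simp [Finset.sum_apply, Pi.single_apply]
    rw [this]; exact Submodule.sum_mem _ fun k _ => Submodule.smul_mem _ _ (hR k v).dv_mem_span

lemma IsOTree.eq_sum_flow [Fintype V] (hR : IsOTree R)
    (hc : ∑ k, c k = 0) : c = ∑ e ∈ R, flow R e c • dv e :=
  eq_sum_flow_of_mem_span hR.1 (mem_span_of_sum_eq_zero hR.2 hc)

lemma isForest_iff_linearIndep [Fintype V] :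
    IsForest R ↔ ∀ g : V × V → ℝ, ∑ e ∈ R, g e • dv e = 0 → ∀ e ∈ R, g e = 0 := by
  constructor
  · intro hR g hg e he; rw [← flow_of_repr hR hg.symm he, map_zero]
  · intro h e he hl; obtain ⟨g, hg⟩ := mem_span_dv_iff.1 hl.dv_mem_span
    have := h (fun e' => if e' = e then -1 else g e') ?_ e he
    · simp at this
    · rw [← add_sum_erase _ _ he]
      have h2 : ∑ e' ∈ R.erase e, (if e' = e then -1 else g e') • dv e' =
          ∑ e' ∈ R.erase e, g e' • dv e' :=
        sum_congr rfl fun e' he' => by grind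
      rw [h2, ← hg]; simp

/-- Reverse the orientation of the arc `e`. -/
def flipArc (R : Arcs V) (e : V × V) : Arcs V :=
  insert e.swap (R.erase e)

lemma lk_flipArc (he : e ∈ R) {u w : V} : Lk (flipArc R e) u w ↔ Lk R u w := by
  constructor
  · intro h; refine h.map id fun e' he' => ?_; rcases mem_insert.1 he' with rfl | h'
    · exact (Lk.of_mem he).symm
    · exact Lk.of_mem (mem_of_mem_erase h')
  · intro h; refine h.map id fun e' he' => ?_; by_cases h' : e' = e
    · subst h'; exact Lk.symm (Lk.of_mem (e := e'.swap) (mem_insert_self _ _))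
    · exact Lk.of_mem (mem_insert_of_mem (mem_erase.2 ⟨h', he'⟩))

lemma sum_flipArc {M : Type*} [AddCommMonoid M] (hR : IsForest R) (he : e ∈ R) (f : V × V → M) :
    ∑ e' ∈ flipArc R e, f e' = f e.swap + ∑ e' ∈ R.erase e, f e' :=
  sum_insert fun h => hR.swap_notMem he (mem_of_mem_erase h)

lemma prod_flipArc {M : Type*} [CommMonoid M] (hR : IsForest R) (he : e ∈ R) (f : V × V → M) :
    ∏ e' ∈ flipArc R e, f e' = f e.swap * ∏ e' ∈ R.erase e, f e' :=
  prod_insert fun h => hR.swap_notMem he (mem_of_mem_erase h)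

lemma IsForest.flipArc [Fintype V] (hR : IsForest R) (he : e ∈ R) : IsForest (flipArc R e) := by
  rw [isForest_iff_linearIndep]; intro g hg
  have hne : e.swap ≠ e := fun h => hR.swap_notMem he (h ▸ he); rw [sum_flipArc hR he] at hg
  have key := (isForest_iff_linearIndep.1 hR) (fun e' => if e' = e then -g e.swap else g e') (by
    rw [← add_sum_erase _ _ he, ← hg]; congr 1
    · simp [dv_swap]
    · exact sum_congr rfl fun e' he' => by rw [if_neg (mem_erase.1 he').1])
  intro e' he'; rcases mem_insert.1 he' with rfl | h'
  · simpa using key e he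
  grind

lemma IsOTree.flipArc [Fintype V] (hR : IsOTree R) (he : e ∈ R) : IsOTree (flipArc R e) :=
  ⟨hR.1.flipArc he, fun u w => (lk_flipArc he).2 (hR.2 u w)⟩

lemma flow_flipArc [Fintype V] (hR : IsOTree R) (he : e ∈ R) (hc : ∑ k, c k = 0) :
    flow (flipArc R e) e.swap c = -flow R e c ∧
    ∀ e' ∈ R, e' ≠ e → flow (flipArc R e) e' c = flow R e' c := by
  have hrep : c = ∑ e' ∈ _root_.flipArc R e,
      (if e' = e.swap then -flow R e c else flow R e' c) • dv e' := by
    rw [sum_flipArc hR.1 he]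
    conv_lhs => rw [hR.eq_sum_flow hc, ← add_sum_erase _ _ he]
    congr 1
    · simp [dv_swap]
    · refine sum_congr rfl fun e' he' => ?_; rw [if_neg]; rintro rfl
      exact hR.1.swap_notMem he (mem_of_mem_erase he')
  constructor
  · rw [flow_of_repr (hR.1.flipArc he) hrep (mem_insert_self _ _), if_pos rfl]
  · intro e' he' hne
    rw [flow_of_repr (hR.1.flipArc he) hrep (mem_insert_of_mem (mem_erase.2 ⟨hne, he'⟩)), if_neg]
    rintro rfl; exact hR.1.swap_notMem he he'

/-- Invariance under the reversal of arcs of trees. -/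
def FlipInv {V M : Type} (F : Arcs V → M) : Prop :=
  ∀ D, IsOTree D → ∀ e ∈ D, F (flipArc D e) = F D

/-- The undirected graph of a set of arcs. -/
def undirected (R : Arcs V) : SimpleGraph V :=
  SimpleGraph.fromRel fun a c => (a, c) ∈ R

lemma lk_iff_reachable {u w : V} : Lk R u w ↔ (undirected R).Reachable u w := by
  constructor
  · intro h
    induction h with
    | rel a c hac =>
      by_cases hac' : a = c
      · simp_all
      · refine SimpleGraph.Adj.reachable ?_; simp [undirected, SimpleGraph.fromRel_adj, hac', hac]
    | refl a => simp_all
    | symm a c _ ih => exact ih.symm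
    | trans a c d _ _ ih1 ih2 => exact ih1.trans ih2
  · rintro ⟨p⟩
    induction p with
    | nil => exact Lk.refl _
    | cons h _ ih =>
      refine Lk.trans ?_ ih; rw [undirected, SimpleGraph.fromRel_adj] at h; rcases h.2 with h | h
      · exact Lk.of_mem (e := (_, _)) h
      · exact (Lk.of_mem (e := (_, _)) h).symm

lemma mem_orient_arcs [Fintype V] (G : SimpleGraph V) :
    e ∈ (orient G).arcs ↔ s(e.1, e.2) ∈ G.edgeSet ∧ Quot.out s(e.1, e.2) = e := by
  simp only [orient, mem_image, SimpleGraph.mem_edgeFinset]; constructor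
  · rintro ⟨a, ha, rfl⟩; have : s((Quot.out a).1, (Quot.out a).2) = a := Quot.out_eq a
    rw [this]; exact ⟨ha, rfl⟩
  grind

lemma orient_arcs_cases (a c : V) :
    (Quot.out s(a, c) : V × V) = (a, c) ∨ (Quot.out s(a, c) : V × V) = (c, a) := by
  have : s((Quot.out s(a, c) : V × V).1, (Quot.out s(a, c) : V × V).2) = s(a, c) := Quot.out_eq _
  grind

lemma undirected_orient [Fintype V] (G : SimpleGraph V) : undirected (orient G).arcs = G := by
  ext a c; rw [undirected, SimpleGraph.fromRel_adj, mem_orient_arcs, mem_orient_arcs]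
  simp only [SimpleGraph.mem_edgeSet]; constructor
  · rintro ⟨_, h | h⟩
    · exact h.1
    · exact h.1.symm
  · intro h; refine ⟨h.ne, ?_⟩; rcases orient_arcs_cases a c with h' | h'
    · grind
    · exact Or.inr ⟨h.symm, by grind⟩

lemma swap_notMem_orient [Fintype V] {G : SimpleGraph V}
    (he : e ∈ (orient G).arcs) : e.swap ∉ (orient G).arcs := by
  intro h; rw [mem_orient_arcs] at he h; have h1 := h.2
  simp only [Prod.fst_swap, Prod.snd_swap] at h1; rw [Sym2.eq_swap, he.2] at h1
  have := congrArg Prod.fst h1; have h2 := he.1; rw [this] at h2; simp at h2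

lemma reachable_deleteEdges_of_lk (hsw : e.swap ∉ R) {u w : V} :
    Lk (R.erase e) u w ↔ ((undirected R).deleteEdges {s(e.1, e.2)}).Reachable u w := by
  rw [lk_iff_reachable]
  have : undirected (R.erase e) = (undirected R).deleteEdges {s(e.1, e.2)} := by
    ext a c
    simp only [undirected, SimpleGraph.fromRel_adj, SimpleGraph.deleteEdges_adj,
      mem_erase, Set.mem_singleton_iff, Sym2.eq_iff]
    constructor <;> grind
  rw [this]

lemma isOTree_orient [Fintype V] {G : SimpleGraph V} (hG : G.IsTree) : IsOTree (orient G).arcs := by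
  constructor
  · intro e he hl; rw [reachable_deleteEdges_of_lk (swap_notMem_orient he), undirected_orient] at hl
    have := SimpleGraph.isAcyclic_iff_forall_adj_isBridge.1 hG.2
      (show G.Adj e.1 e.2 from ((mem_orient_arcs G).1 he).1)
    exact SimpleGraph.isBridge_iff.1 this hl
  · intro u w; rw [lk_iff_reachable, undirected_orient]; exact hG.1.preconnected u w

lemma IsOTree.isTree_undirected [Nonempty V] (hR : IsOTree R) : (undirected R).IsTree := by
  refine ⟨⟨fun u w => lk_iff_reachable.1 (hR.2 u w)⟩, ?_⟩
  rw [SimpleGraph.isAcyclic_iff_forall_adj_isBridge]; intro a c hac; rw [SimpleGraph.isBridge_iff]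
  have hac' := hac; rw [undirected, SimpleGraph.fromRel_adj] at hac'; rcases hac'.2 with h | h
  · rw [← reachable_deleteEdges_of_lk (e := (a, c)) (hR.1.swap_notMem h)]; exact hR.1 _ h
  · rw [Sym2.eq_swap, ← reachable_deleteEdges_of_lk (e := (c, a)) (hR.1.swap_notMem h)]
    exact fun h' => hR.1 _ h h'.symm

/-- Reverse all the arcs in `s`. -/
def flipArcs (R s : Arcs V) : Arcs V := s.image Prod.swap ∪ R \ s

lemma FlipInv.flipArcs {V M : Type} [Fintype V] {F : Arcs V → M} (hF : FlipInv F)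
    {R : Arcs V} (hR : IsOTree R) {s : Arcs V} (hs : s ⊆ R) :
    IsOTree (flipArcs R s) ∧ F (flipArcs R s) = F R := by
  induction s using Finset.induction_on with
  | empty => simpa [_root_.flipArcs] using hR
  | insert e s hes ih =>
    have he : e ∈ R := hs (mem_insert_self _ _)
    obtain ⟨h1, h2⟩ := ih fun x hx => hs (mem_insert_of_mem hx)
    have hmem : e ∈ _root_.flipArcs R s := mem_union_right _ (Finset.mem_sdiff.2 ⟨he, hes⟩)
    have heq : _root_.flipArcs R (insert e s) = flipArc (_root_.flipArcs R s) e := by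
      ext x
      have h3 : x ∈ s.image Prod.swap → x ≠ e := by
        rintro hx rfl; obtain ⟨y, hy, rfl⟩ := mem_image.1 hx
        exact hR.1.swap_notMem (hs (mem_insert_of_mem hy)) he
      simp only [_root_.flipArcs, flipArc, image_insert, mem_union,
        mem_insert, Finset.mem_sdiff, mem_erase, not_or]
      tauto
    rw [heq]; exact ⟨h1.flipArc hmem, (hF _ h1 _ hmem).trans h2⟩

lemma orient_undirected_flip [Fintype V] {G : SimpleGraph V} {D : Arcs V}
    (hD : IsForest D) (h : undirected D = G) :
    D = flipArcs (orient G).arcs ((orient G).arcs \ D) := by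
  have key : ∀ a c : V, ((a, c) ∈ D ∨ (c, a) ∈ D) ↔
      ((a, c) ∈ (orient G).arcs ∨ (c, a) ∈ (orient G).arcs) := by
    intro a c; by_cases hac : a = c
    · subst hac; simp only [or_self]; constructor
      · intro h'; exact absurd rfl (hD.ne h')
      · intro h'; have := ((mem_orient_arcs G).1 h').1; simp at this
    · have h1 : (undirected D).Adj a c ↔ (undirected (orient G).arcs).Adj a c := by
        rw [h, undirected_orient]
      simpa [undirected, SimpleGraph.fromRel_adj, hac] using h1
  ext ⟨a, c⟩; have := key a c; have h2 : (a, c) ∈ D → (c, a) ∉ D := fun h => hD.swap_notMem h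
  simp only [flipArcs, mem_union, mem_image, Finset.mem_sdiff, Prod.exists,
    Prod.swap_prod_mk, Prod.mk.injEq]
  grind

lemma card_orient_arcs [Fintype V] {G : SimpleGraph V} (hG : G.IsTree) :
    (orient G).arcs.card = Fintype.card V - 1 := by
  have h := hG.card_edgeFinset; rw [orient, card_image_of_injective]
  · grind
  · intro a c h'; rw [← Quot.out_eq a, ← Quot.out_eq c]; exact congrArg _ h'

lemma sum_otrees {V M : Type} [Fintype V] [Nonempty V] [AddCommMonoid M]
    {F : Arcs V → M} (hF : FlipInv F) :
    ∑ D ∈ otrees V, F D = 2 ^ (Fintype.card V - 1) • ∑ G ∈ labeledTrees V, F (orient G).arcs := by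
  have hmap : ∀ D ∈ otrees V, undirected D ∈ labeledTrees V := by
    intro D hD; simp only [labeledTrees, mem_filter_univ]; exact (mem_otrees.1 hD).isTree_undirected
  rw [← sum_fiberwise_of_maps_to hmap, smul_sum]; refine sum_congr rfl fun G hG => ?_
  simp only [labeledTrees, mem_filter_univ] at hG; have h0 := isOTree_orient hG
  rw [← card_orient_arcs hG, ← card_powerset, ← sum_const]
  refine sum_bij' (fun D _ => (orient G).arcs \ D)
    (fun s _ => flipArcs (orient G).arcs s) ?_ ?_ ?_ ?_ ?_
  · grind
  · intro s hs; have hs := mem_powerset.1 hs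
    refine mem_filter.2 ⟨mem_otrees.2 (hF.flipArcs h0 hs).1, ?_⟩
    conv_rhs => rw [← undirected_orient G]
    ext a c
    simp only [undirected, SimpleGraph.fromRel_adj, flipArcs, mem_union, mem_image,
      Finset.mem_sdiff, Prod.exists, Prod.swap_prod_mk, Prod.mk.injEq]
    constructor
    · rintro ⟨h, h' | h'⟩
      · rcases h' with ⟨x, y, h', rfl, rfl⟩ | h'
        · exact ⟨h, Or.inr (hs h')⟩
        · exact ⟨h, Or.inl h'.1⟩
      · rcases h' with ⟨x, y, h', rfl, rfl⟩ | h'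
        · exact ⟨h, Or.inl (hs h')⟩
        · exact ⟨h, Or.inr h'.1⟩
    grind
  · intro D hD; obtain ⟨h1, h2⟩ := mem_filter.1 hD
    exact (orient_undirected_flip (mem_otrees.1 h1).1 h2).symm
  · intro s hs; have hs := mem_powerset.1 hs; ext e
    simp only [flipArcs, Finset.mem_sdiff, mem_union, mem_image, not_or, not_and, not_not]
    constructor
    · grind
    · intro h; refine ⟨hs h, ?_, fun _ => h⟩; rintro ⟨x, hx, rfl⟩
      exact h0.1.swap_notMem (hs hx) (hs h)
  · intro D hD; obtain ⟨h1, h2⟩ := mem_filter.1 hD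
    rw [← (hF.flipArcs h0 (s := (orient G).arcs \ D) sdiff_subset).2,
      ← orient_undirected_flip (mem_otrees.1 h1).1 h2]

end

section

variable {V Q : Type} [Fintype V] {π : V → Q} {H : Arcs V} {B : Q → Finset V}

/-! ## Completions of a forest to a tree -/

/-- The pair of the images of the ends of an arc. -/
abbrev bar (π : V → Q) (e : V × V) : Q × Q := (π e.1, π e.2)

/-- The sums over the fibres of `π`. -/
def pushSum (π : V → Q) : (V → ℝ) →ₗ[ℝ] (Q → ℝ) where
  toFun c q := ∑ v with π v = q, c v
  map_add' c d := by ext q; simp [sum_add_distrib]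
  map_smul' r c := by ext q; simp [mul_sum]

lemma pushSum_apply (π : V → Q) (c : V → ℝ) (q : Q) : pushSum π c q = ∑ v with π v = q, c v := rfl

lemma pushSum_dv (π : V → Q) (e : V × V) : pushSum π (dv e) = dv (bar π e) := by
  ext q; rw [pushSum_apply, sum_dv]; simp [dv, Pi.single_apply, eq_comm]

lemma sum_pushSum [Fintype Q] (π : V → Q) (c : V → ℝ) : ∑ q, pushSum π c q = ∑ v, c v := by
  simp only [pushSum_apply]; exact sum_fiberwise _ _ _

/-- The linked classes of `H` are the fibres of `π`. -/
def HasClasses (H : Arcs V) (π : V → Q) : Prop :=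
  ∀ u w, Lk H u w ↔ π u = π w

lemma lk_union_of_lk_image {H K : Arcs V} (hπ : Surjective π) (hH : HasClasses H π) {q q' : Q}
    (h : Lk (K.image (bar π)) q q') {u w : V} (hu : π u = q) (hw : π w = q') : Lk (H ∪ K) u w := by
  have hmono : ∀ {x y : V}, π x = π y → Lk (H ∪ K) x y := fun h =>
    ((hH _ _).2 h).mono subset_union_left
  have hsec : ∀ q, π (Function.surjInv hπ q) = q := Function.surjInv_eq hπ
  have h1 : Lk (H ∪ K) (Function.surjInv hπ q) (Function.surjInv hπ q') := by
    refine h.map _ fun a ha => ?_; obtain ⟨e, he, rfl⟩ := mem_image.1 ha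
    exact ((hmono (hsec _)).trans (Lk.of_mem (mem_union_right _ he))).trans (hmono (hsec _).symm)
  exact ((hmono (by rw [hsec, hu])).trans h1).trans (hmono (by rw [hsec, hw]))

lemma isOTree_union_iff [Fintype Q] {H K : Arcs V}
    (hπ : Surjective π) (hF : IsForest H) (hH : HasClasses H π) : (Disjoint K H ∧ IsOTree (H ∪ K)) ↔
    (Set.InjOn (bar π) (K : Set (V × V)) ∧ IsOTree (K.image (bar π))) := by
  constructor
  · rintro ⟨hd, hT⟩
    have hsub : ∀ e ∈ K, H ∪ K.erase e ⊆ (H ∪ K).erase e := by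
      intro e he x hx; rcases mem_union.1 hx with hx | hx
      · exact mem_erase.2 ⟨fun h => disjoint_left.1 hd he (h ▸ hx), mem_union_left _ hx⟩
      · grind
    have hinj : Set.InjOn (bar π) (K : Set (V × V)) := by
      intro e he e' he' heq; by_contra hne
      refine hT.1 e (mem_union_right _ he) (Lk.mono ?_ (hsub e he))
      refine lk_union_of_lk_image hπ hH (q := π e.1) (q' := π e.2) ?_ rfl rfl
      exact Lk.of_mem (e := bar π e) (mem_image.2
        ⟨e', mem_erase.2 ⟨fun h => hne h.symm, he'⟩, heq.symm⟩)
    refine ⟨hinj, ?_, ?_⟩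
    · intro a ha hl; obtain ⟨e, he, rfl⟩ := mem_image.1 ha
      refine hT.1 e (mem_union_right _ he) (Lk.mono ?_ (hsub e he))
      refine lk_union_of_lk_image hπ hH (hl.mono ?_) rfl rfl; intro x hx
      obtain ⟨hx1, hx2⟩ := mem_erase.1 hx; obtain ⟨e', he', rfl⟩ := mem_image.1 hx2; grind
    · intro q q'; obtain ⟨u, rfl⟩ := hπ q; obtain ⟨w, rfl⟩ := hπ q'
      refine (hT.2 u w).map π fun e he => ?_; rcases mem_union.1 he with he | he
      · rw [(hH _ _).1 (Lk.of_mem he)]; exact Lk.refl _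
      · exact Lk.of_mem (e := bar π e) (mem_image_of_mem _ he)
  · rintro ⟨hinj, hT⟩
    have hd : Disjoint K H := by
      rw [disjoint_left]; intro e he he'
      exact hT.1.ne (mem_image_of_mem (bar π) he) ((hH _ _).1 (Lk.of_mem he'))
    refine ⟨hd, ?_, fun u w => lk_union_of_lk_image hπ hH (hT.2 (π u) (π w)) rfl rfl⟩
    rw [isForest_iff_linearIndep]; intro g hg; rw [sum_union hd.symm] at hg
    have h1 : ∑ e ∈ K, g e • dv (bar π e) = 0 := by
      have := congrArg (pushSum π) hg
      simp only [map_add, map_sum, map_smul, pushSum_dv, map_zero] at this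
      rw [sum_eq_zero, zero_add] at this
      · exact this
      · intro e he; rw [bar, (hH _ _).1 (Lk.of_mem he)]; simp [dv]
    have hK : ∀ e ∈ K, g e = 0 := by
      intro e he; have h2 := congrArg (flow (K.image (bar π)) (bar π e)) h1
      rw [map_sum, map_zero, sum_eq_single e] at h2
      · rw [map_smul, flow_dv hT.1 (mem_image_of_mem _ he) (mem_image_of_mem _ he)] at h2
        simpa using h2
      · intro e' he' hne
        rw [map_smul, flow_dv hT.1 (mem_image_of_mem _ he) (mem_image_of_mem _ he'),
          if_neg fun h => hne (hinj he' he h), smul_zero]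
      · exact fun h => absurd he h
    have h3 : ∑ e ∈ H, g e • dv e = 0 := by
      rwa [sum_eq_zero (s := K), add_zero] at hg
      intro e he; rw [hK e he, zero_smul]
    intro e he; rcases mem_union.1 he with he | he
    · exact (isForest_iff_linearIndep.1 hF) g h3 e he
    · exact hK e he

lemma flow_pushSum [Fintype Q] {H K : Arcs V}
    (hπ : Surjective π) (hF : IsForest H) (hH : HasClasses H π)
    (hd : Disjoint K H) (hT : IsOTree (H ∪ K)) {c : V → ℝ} (hc : ∑ v, c v = 0) {e : V × V}
    (he : e ∈ K) : flow (K.image (bar π)) (bar π e) (pushSum π c) = flow (H ∪ K) e c := by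
  obtain ⟨hinj, hT'⟩ := (isOTree_union_iff hπ hF hH).1 ⟨hd, hT⟩
  conv_lhs => rw [hT.eq_sum_flow hc]
  simp only [map_sum, map_smul, pushSum_dv]
  rw [sum_union hd.symm, sum_eq_zero (s := H), zero_add, sum_eq_single e]
  · rw [flow_dv hT'.1 (mem_image_of_mem _ he) (mem_image_of_mem _ he)]; simp
  · intro e' he' hne
    rw [flow_dv hT'.1 (mem_image_of_mem _ he) (mem_image_of_mem _ he'),
      if_neg fun h => hne (hinj he' he h), smul_zero]
  · grind
  · intro e' he'; have h0 : dv (bar π e') = 0 := by rw [bar, (hH _ _).1 (Lk.of_mem he')]; simp [dv]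
    rw [h0]; simp

/-- A product of sums over fibres as a sum over partial sections. -/
lemma sum_prod_sections {α β M : Type*} [Fintype α] [DecidableEq α] [DecidableEq β]
    [CommSemiring M] (f : α → β) (w : α → M) (D : Finset β) :
    ∑ K ∈ univ.filter (fun K : Finset α => Set.InjOn f (K : Set α) ∧ K.image f = D), ∏ e ∈ K, w e =
    ∏ a ∈ D, ∑ e with f e = a, w e := by
  induction D using Finset.induction_on with
  | empty =>
    rw [prod_empty, sum_eq_single ∅]
    · simp
    · simp_all
    · intro h; simp at h
  | insert a D ha ih =>
    rw [prod_insert ha, ← ih, sum_mul_sum, ← sum_product']; symm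
    have hnot : ∀ e : α, ∀ K : Finset α, f e = a → K.image f = D → e ∉ K := by
      rintro e K rfl rfl he; exact ha (mem_image_of_mem _ he)
    refine sum_bij (fun x _ => insert x.1 x.2) ?_ ?_ ?_ ?_
    · rintro ⟨e, K⟩ hx; simp only [mem_product, mem_filter_univ] at hx ⊢
      obtain ⟨he, hK1, hK2⟩ := hx; refine ⟨?_, by rw [image_insert, he, hK2]⟩
      rw [coe_insert, Set.injOn_insert (by simpa using hnot e K he hK2)]; refine ⟨hK1, ?_⟩
      rintro ⟨x, hx, hx'⟩; exact ha (by rw [← hK2, ← he, ← hx']; exact mem_image_of_mem _ hx)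
    · rintro ⟨e, K⟩ hx ⟨e', K'⟩ hx' heq; simp only [mem_product, mem_filter_univ] at hx hx' heq
      have h1 : e ∈ insert e' K' := heq ▸ mem_insert_self _ _
      have h2 : e = e' := by
        rcases mem_insert.1 h1 with h | h
        · exact h
        · exact absurd h (hnot e K' hx.1 hx'.2.2)
      subst h2; have h3 := congrArg (fun s => s.erase e) heq
      simp only [erase_insert (hnot e K hx.1 hx.2.2), erase_insert (hnot e K' hx'.1 hx'.2.2)] at h3
      rw [h3]
    · intro K hK; simp only [mem_filter_univ] at hK; obtain ⟨hK1, hK2⟩ := hK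
      obtain ⟨e, he, hea⟩ := mem_image.1 (hK2 ▸ mem_insert_self a D)
      refine ⟨(e, K.erase e), ?_, insert_erase he⟩; simp only [mem_product, mem_filter_univ]
      refine ⟨hea, hK1.mono (by simp), ?_⟩; ext x; have hx := Finset.ext_iff.1 hK2 x
      simp only [mem_image, mem_insert, mem_erase] at hx ⊢; constructor
      · rintro ⟨y, ⟨hy1, hy2⟩, rfl⟩; rcases hx.1 ⟨y, hy2, rfl⟩ with h | h
        · exact absurd (hK1 hy2 he (h.trans hea.symm)) hy1
        · exact h
      · intro h; obtain ⟨y, hy, rfl⟩ := hx.2 (Or.inr h)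
        exact ⟨y, ⟨fun h' => ha (by rw [← hea, ← h']; exact h), hy⟩, rfl⟩
    grind

/-- The sets of arcs which complete a forest to a tree. -/
def completions (H : Arcs V) : Finset (Arcs V) :=
  univ.filter fun K => Disjoint K H ∧ IsOTree (H ∪ K)

lemma sum_completions {V Q A M : Type} [Fintype V] [Fintype Q] [CommSemiring A]
    [AddCommMonoid M] [Module A M] {π : V → Q} {H : Arcs V}
    (hπ : Surjective π) (hF : IsForest H) (hH : HasClasses H π) (w : V × V → A) (k : Arcs Q → M) :
    ∑ K ∈ completions H, (∏ e ∈ K, w e) • k (K.image (bar π)) =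
    ∑ D ∈ otrees Q, (∏ a ∈ D, ∑ e with bar π e = a, w e) • k D := by
  have hmap : ∀ K ∈ completions H, K.image (bar π) ∈ otrees Q := fun K hK =>
    mem_otrees.2 ((isOTree_union_iff hπ hF hH).1 (mem_filter.1 hK).2).2
  rw [← sum_fiberwise_of_maps_to hmap]; refine sum_congr rfl fun D hD => ?_
  rw [← sum_prod_sections (bar π) w D, sum_smul]; refine sum_congr ?_ fun K hK => by grind
  ext K; simp only [completions, mem_filter, mem_univ, true_and]; rw [isOTree_union_iff hπ hF hH]
  constructor
  · grind
  · rintro ⟨h1, h2⟩; exact ⟨⟨h1, h2 ▸ mem_otrees.1 hD⟩, h2⟩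

/-- The forests with vertex set `V`. -/
def forests (V : Type) [Fintype V] : Finset (Arcs V) := univ.filter IsForest

/-- Sums over subsets of the arcs of trees, organized by the complementary forest. -/
lemma sum_otrees_powerset {V M : Type} [Fintype V] [AddCommMonoid M] (F : Arcs V → Arcs V → M) :
    ∑ D ∈ otrees V, ∑ K ∈ D.powerset, F (D \ K) K =
    ∑ H ∈ forests V, ∑ K ∈ completions H, F H K := by
  rw [sum_sigma', sum_sigma']
  refine sum_bij' (fun x _ => ⟨x.1 \ x.2, x.2⟩) (fun x _ => ⟨x.1 ∪ x.2, x.2⟩) ?_ ?_ ?_ ?_ ?_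
  · rintro ⟨D, K⟩ h
    simp only [mem_sigma, mem_powerset, mem_otrees, forests, completions, mem_filter_univ] at h ⊢
    refine ⟨h.1.1.mono sdiff_subset, disjoint_sdiff, ?_⟩; rw [sdiff_union_of_subset h.2]; exact h.1
  · rintro ⟨H, K⟩ h
    simp only [mem_sigma, mem_powerset, mem_otrees, forests, completions, mem_filter_univ] at h ⊢
    grind
  · rintro ⟨D, K⟩ h; simp_all
  · rintro ⟨H, K⟩ h; simp only [mem_sigma, completions, mem_filter] at h
    simp only [Sigma.mk.injEq, heq_eq_eq, and_true]; rw [union_sdiff_cancel_right h.2.2.1.symm]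
  · intro x _; rfl

/-! ## Forests with given classes -/

/-- The arcs of `H` between elements of `S`. -/
def restr (S : Finset V) (H : Arcs V) : Arcs S :=
  univ.filter fun e => ((e.1 : V), (e.2 : V)) ∈ H

/-- The union of sets of arcs on the blocks `B q`. -/
def glue (B : Q → Finset V) (D : ∀ q, Finset (B q × B q)) : Arcs V :=
  univ.filter fun e => ∃ q, ∃ h1 : e.1 ∈ B q, ∃ h2 : e.2 ∈ B q,
    ((⟨e.1, h1⟩, ⟨e.2, h2⟩) : B q × B q) ∈ D q

lemma mem_restr {S : Finset V} {e : S × S} :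
    e ∈ restr S H ↔ ((e.1 : V), (e.2 : V)) ∈ H := by simp [restr]

lemma mem_erase_arc {R : Arcs V} {e e' : V × V} : e' ∈ R.erase e ↔ e' ≠ e ∧ e' ∈ R := mem_erase

lemma IsForest.restr (hF : IsForest H) (S : Finset V) : IsForest (restr S H) := by
  intro e he hl; refine hF _ (mem_restr.1 he) (hl.map Subtype.val fun e' he' => ?_)
  obtain ⟨h1, h2⟩ := mem_erase_arc.1 he'
  refine Lk.of_mem (e := ((e'.1 : V), (e'.2 : V))) (mem_erase_arc.2 ⟨fun h => h1 ?_,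
    mem_restr.1 h2⟩)
  grind

lemma lk_restrict {S : Finset V} {D : Arcs S} (hS : ∀ e ∈ H, (e.1 ∈ S ↔ e.2 ∈ S) ∧
    ∀ h1 : e.1 ∈ S, ∀ h2 : e.2 ∈ S, Lk D ⟨e.1, h1⟩ ⟨e.2, h2⟩)
    {u w : S} (h : Lk H (u : V) (w : V)) : Lk D u w := by
  have := h.eq_of (fun v => ∃ hv : v ∈ S, Lk D u ⟨v, hv⟩) fun e he => by
    obtain ⟨h1, h2⟩ := hS e he; refine propext ⟨?_, ?_⟩
    · rintro ⟨hv, hl⟩; exact ⟨h1.1 hv, hl.trans (h2 hv (h1.1 hv))⟩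
    · rintro ⟨hv, hl⟩; exact ⟨h1.2 hv, hl.trans (h2 (h1.2 hv) hv).symm⟩
  obtain ⟨_, h'⟩ := this.mp ⟨u.2, Lk.refl _⟩; exact h'

lemma isOTree_restr (hB : ∀ v q, v ∈ B q ↔ π v = q) (hF : IsForest H)
    (hH : HasClasses H π) (q : Q) : IsOTree (restr (B q) H) := by
  refine ⟨hF.restr _, fun u w => ?_⟩; refine lk_restrict (H := H) (fun e he => ?_) ((hH _ _).2 ?_)
  · have := (hH _ _).1 (Lk.of_mem he)
    refine ⟨by rw [hB, hB, this], fun h1 h2 => Lk.of_mem (e := (_, _)) (mem_restr.2 he)⟩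
  grind

lemma restr_glue (hB : ∀ v q, v ∈ B q ↔ π v = q) (D : ∀ q, Finset (B q × B q)) (q : Q) :
    restr (B q) (glue B D) = D q := by
  ext e; simp only [mem_restr, glue, mem_filter_univ]; grind

lemma glue_restr (hB : ∀ v q, v ∈ B q ↔ π v = q) (hH : HasClasses H π) :
    glue B (fun q => restr (B q) H) = H := by
  ext e; simp only [mem_restr, glue, mem_filter_univ]; constructor
  · grind
  · intro h; exact ⟨π e.1, (hB _ _).2 rfl, (hB _ _).2 ((hH _ _).1 (Lk.of_mem h)).symm, h⟩

lemma glue_isForest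
    (hB : ∀ v q, v ∈ B q ↔ π v = q) {D : ∀ q, Finset (B q × B q)} (hD : ∀ q, IsOTree (D q)) :
    IsForest (glue B D) ∧ HasClasses (glue B D) π := by
  have hmem : ∀ e, e ∈ glue B D → π e.1 = π e.2 := by
    intro e he; simp only [glue, mem_filter_univ] at he; obtain ⟨q, h1, h2, _⟩ := he; grind
  refine ⟨?_, fun u w => ⟨fun h => h.eq_of π hmem, fun h => ?_⟩⟩
  · intro e he hl; have he' := he; simp only [glue, mem_filter_univ] at he'
    obtain ⟨q, h1, h2, h⟩ := he'
    refine (hD q).1 _ h (lk_restrict (H := (glue B D).erase e) (u := ⟨e.1, h1⟩) (w := ⟨e.2, h2⟩)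
      (fun x hx => ?_) hl)
    obtain ⟨hx1, hx2⟩ := mem_erase_arc.1 hx; refine ⟨by rw [hB, hB, hmem x hx2], fun h3 h4 => ?_⟩
    simp only [glue, mem_filter_univ] at hx2; obtain ⟨q', h5, h6, h7⟩ := hx2
    have : q' = q := ((hB _ _).1 h5).symm.trans ((hB _ _).1 h3); subst this
    refine Lk.of_mem (e := (_, _)) (mem_erase_arc.2 ⟨fun h8 => hx1 ?_, h7⟩); grind
  · have h3 := (hD (π u)).2 ⟨u, (hB _ _).2 rfl⟩ ⟨w, (hB _ _).2 h.symm⟩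
    refine h3.map Subtype.val fun e he => Lk.of_mem (e := ((e.1 : V), (e.2 : V))) ?_
    simp only [glue, mem_filter_univ]; grind

lemma sum_forests_classes {V Q M : Type} [Fintype V] [Fintype Q] [CommSemiring M] {π : V → Q}
    {B : Q → Finset V} (hB : ∀ v q, v ∈ B q ↔ π v = q) (h : ∀ q, Finset (B q × B q) → M) :
    ∑ H ∈ (forests V).filter (fun H => HasClasses H π), ∏ q, h q (restr (B q) H) =
    ∏ q, ∑ D ∈ otrees (B q), h q D := by
  rw [prod_univ_sum]
  refine sum_bij' (fun H _ q => restr (B q) H) (fun D _ => glue B D) ?_ ?_ ?_ ?_ ?_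
  · intro H hH; simp only [forests, mem_filter, mem_univ, true_and] at hH
    simp only [Fintype.mem_piFinset, mem_otrees]; exact fun q => isOTree_restr hB hH.1 hH.2 q
  · intro D hD; simp only [Fintype.mem_piFinset, mem_otrees] at hD
    simp only [forests, mem_filter, mem_univ, true_and]; exact glue_isForest hB hD
  · intro H hH; exact glue_restr hB (mem_filter.1 hH).2
  · intro D _; funext q; exact restr_glue hB D q
  · intro H _; rfl

lemma prod_eq_prod_restr {V Q M : Type} [Fintype V] [Fintype Q] [CommMonoid M] {π : V → Q}
    {B : Q → Finset V} (hB : ∀ v q, v ∈ B q ↔ π v = q) {H : Arcs V}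
    (hH : HasClasses H π) (f : V × V → M) :
    ∏ e ∈ H, f e = ∏ q, ∏ e ∈ restr (B q) H, f ((e.1 : V), (e.2 : V)) := by
  rw [← prod_fiberwise H (fun e => π e.1)]; refine prod_congr rfl fun q _ => ?_; symm
  refine prod_bij (fun e _ => ((e.1 : V), (e.2 : V))) ?_ ?_ ?_ ?_
  · intro e he; exact mem_filter.2 ⟨mem_restr.1 he, (hB _ _).1 e.1.2⟩
  · grind
  · intro e he; obtain ⟨h1, h2⟩ := mem_filter.1 he
    refine ⟨(⟨e.1, (hB _ _).2 h2⟩, ⟨e.2, (hB _ _).2 ?_⟩), mem_restr.2 h1, rfl⟩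
    rw [← (hH _ _).1 (Lk.of_mem h1), h2]
  · intro e _; rfl

/-! ## Exchange of two arcs of a tree -/

/-- Replace the arc `(i, j)` by the arc `(k, i)`. -/
def exchange (D : Arcs V) (i j k : V) : Arcs V :=
  insert (k, i) (D.erase (i, j))

lemma exchange_props {D : Arcs V} (hD : IsOTree D) {i j k : V}
    (hij : (i, j) ∈ D) (hjk : (j, k) ∈ D) :
    (k, i) ∉ D ∧ IsOTree (exchange D i j k) ∧ ∀ c : V → ℝ, ∑ v, c v = 0 →
    flow (exchange D i j k) (j, k) c = flow D (j, k) c - flow D (i, j) c ∧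
    flow (exchange D i j k) (k, i) c = -flow D (i, j) c ∧
    ∀ e ∈ D, e ≠ (i, j) → e ≠ (j, k) → flow (exchange D i j k) e c = flow D e c := by
  have hne : i ≠ j := hD.1.ne hij; have hne' : j ≠ k := hD.1.ne hjk
  have hjk' : (j, k) ∈ D.erase (i, j) := by simp [hjk, hne.symm]
  have hki : (k, i) ∉ D := by
    intro h
    refine hD.1 _ hij (Lk.symm (Lk.trans (Lk.of_mem (e := (j, k)) hjk')
      (Lk.of_mem (e := (k, i)) ?_)))
    simp only [mem_erase, ne_eq, Prod.mk.injEq, not_and]; exact ⟨fun _ h => hne h, h⟩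
  have hki' : (k, i) ∉ D.erase (i, j) := fun h => hki (mem_of_mem_erase h)
  have hdv : dv (i, j) = -dv (j, k) - dv (k, i) := by simp only [dv]; abel
  have hsum : ∀ g : V × V → ℝ, ∑ e ∈ exchange D i j k, g e • dv e =
      g (k, i) • dv (k, i) + (g (j, k) • dv (j, k) +
        ∑ e ∈ (D.erase (i, j)).erase (j, k), g e • dv e) := by
    intro g; rw [exchange, sum_insert hki', ← add_sum_erase _ _ hjk']
  have hsumD : ∀ g : V × V → ℝ, ∑ e ∈ D, g e • dv e = g (i, j) • dv (i, j) + (g (j, k) • dv (j, k) +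
        ∑ e ∈ (D.erase (i, j)).erase (j, k), g e • dv e) := by
    intro g; rw [← add_sum_erase _ _ hij, ← add_sum_erase _ _ hjk']
  have hother : ∀ e ∈ (D.erase (i, j)).erase (j, k), e ≠ (i, j) ∧ e ≠ (j, k) ∧ e ≠ (k, i) := by
    intro e he; simp only [mem_erase] at he; exact ⟨he.2.1, he.1, fun h => hki (h ▸ he.2.2)⟩
  have hforest : IsForest (exchange D i j k) := by
    rw [isForest_iff_linearIndep]; intro g hg; rw [hsum] at hg
    have key := (isForest_iff_linearIndep.1 hD.1)
      (fun e => if e = (i, j) then -g (k, i) else if e = (j, k) then g (j, k) - g (k, i) else g e)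
      (by
        rw [hsumD, ← hg]
        have : ∑ e ∈ (D.erase (i, j)).erase (j, k), (if e = (i, j) then -g (k, i) else
            if e = (j, k) then g (j, k) - g (k, i) else g e) • dv e =
            ∑ e ∈ (D.erase (i, j)).erase (j, k), g e • dv e :=
          sum_congr rfl fun e he => by grind
        rw [this, if_pos rfl, if_neg (by simp [hne.symm]), if_pos rfl, hdv]; module)
    intro e he; have hk := key _ hij; rw [if_pos rfl, neg_eq_zero] at hk
    rcases mem_insert.1 he with rfl | he
    · exact hk
    · grind
  refine ⟨hki, ⟨hforest, fun u w => (hD.2 u w).map id fun e he => ?_⟩, fun c hc => ?_⟩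
  · by_cases h : e = (i, j)
    · subst h; refine Lk.symm (Lk.trans (Lk.of_mem (e := (j, k)) ?_) (Lk.of_mem (e := (k, i)) ?_))
      · exact mem_insert_of_mem hjk'
      · exact mem_insert_self _ _
    · exact Lk.of_mem (mem_insert_of_mem (mem_erase.2 ⟨h, he⟩))
  · have hrep : c = ∑ e ∈ exchange D i j k, (if e = (k, i) then -flow D (i, j) c else
        if e = (j, k) then flow D (j, k) c - flow D (i, j) c else flow D e c) • dv e := by
      rw [hsum]
      conv_lhs => rw [hD.eq_sum_flow hc, hsumD, hdv]
      have : ∑ e ∈ (D.erase (i, j)).erase (j, k), (if e = (k, i) then -flow D (i, j) c else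
          if e = (j, k) then flow D (j, k) c - flow D (i, j) c else flow D e c) • dv e =
          ∑ e ∈ (D.erase (i, j)).erase (j, k), flow D e c • dv e :=
        sum_congr rfl fun e he => by grind
      rw [this, if_pos rfl, if_neg (by rintro h; exact hki (h ▸ hjk)), if_pos rfl]; module
    refine ⟨?_, ?_, ?_⟩
    · rw [flow_of_repr hforest hrep (mem_insert_of_mem hjk'),
        if_neg (by rintro h; exact hki (h ▸ hjk)), if_pos rfl]
    · rw [flow_of_repr hforest hrep (mem_insert_self _ _), if_pos rfl]
    · intro e he h1 h2
      rw [flow_of_repr hforest hrep (mem_insert_of_mem (mem_erase.2 ⟨h1, he⟩)),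
        if_neg (by rintro rfl; exact hki he), if_neg h2]

/-- The trees with a chain of two arcs `i → j → k`. -/
def chains (V : Type) [Fintype V] : Finset (Arcs V × V × V × V) :=
  univ.filter fun x => IsOTree x.1 ∧ (x.2.1, x.2.2.1) ∈ x.1 ∧ (x.2.2.1, x.2.2.2) ∈ x.1

/-- Rotate a chain: `i → j → k` becomes `j → k → i`. -/
def rotate (x : Arcs V × V × V × V) : Arcs V × V × V × V :=
  (exchange x.1 x.2.1 x.2.2.1 x.2.2.2, x.2.2.1, x.2.2.2, x.2.1)

lemma rotate_mem {x : Arcs V × V × V × V} (hx : x ∈ chains V) : rotate x ∈ chains V := by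
  obtain ⟨D, i, j, k⟩ := x; simp only [chains, mem_filter_univ] at hx; obtain ⟨hD, hij, hjk⟩ := hx
  simp only [chains, rotate, mem_filter_univ]
  refine ⟨(exchange_props hD hij hjk).2.1, ?_, mem_insert_self _ _⟩
  refine mem_insert_of_mem (mem_erase.2 ⟨?_, hjk⟩); have := hD.1.ne hij; grind

lemma sum_chains_eq_zero (h : Arcs V × V × V × V → ℝ)
    (hh : ∀ x ∈ chains V, h x + h (rotate x) + h (rotate (rotate x)) = 0) :
    ∑ x ∈ chains V, h x = 0 := by
  have hinj : Set.InjOn rotate (chains V : Set (Arcs V × V × V × V)) := by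
    rintro ⟨D, i, j, k⟩ hx ⟨D', i', j', k'⟩ hx' heq
    simp only [chains, coe_filter, mem_univ, true_and, Set.mem_ofPred_eq] at hx hx'
    simp only [rotate, Prod.mk.injEq] at heq; obtain ⟨h1, rfl, rfl, rfl⟩ := heq
    have key : ∀ {D : Arcs V}, IsOTree D → (i, j) ∈ D → (j, k) ∈ D →
        D = insert (i, j) ((exchange D i j k).erase (k, i)) := by
      intro D hD hij hjk; have := (exchange_props hD hij hjk).1
      rw [exchange, erase_insert (fun h => this (mem_of_mem_erase h)), insert_erase hij]
    grind
  have hsum : ∀ g : Arcs V × V × V × V → ℝ, ∑ x ∈ chains V, g (rotate x) = ∑ x ∈ chains V, g x := by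
    intro g
    have himg : (chains V).image rotate = chains V :=
      eq_of_subset_of_card_le (image_subset_iff.2 fun x hx => rotate_mem hx) (by grind)
    conv_rhs => rw [← himg, sum_image hinj]
  have h1 := hsum h; have h2 := hsum fun x => h (rotate x); have h3 := sum_eq_zero hh
  rw [sum_add_distrib, sum_add_distrib, h2, h1] at h3; linarith

end

section

variable {V : Type} {R : Arcs V} {U : Finset V} {D : OrientedGraph V}

/-! ## Sign averages over orderings -/

/-- The sign with which the arcs of `R` inside `U` at `v` contribute when `v` is the largest
element of `U`. -/
def vsign (R : Arcs V) (U : Finset V) (v : V) : ℚ :=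
  ∏ e ∈ R with (e.1 ∈ U ∧ e.2 ∈ U) ∧ (e.1 = v ∨ e.2 = v), if e.2 = v then -1 else 1

/-- The average of `∏ sgn (u_s - u_t)` over all orderings of `U`, the product being over the
arcs of `R` inside `U`. -/
def sgnAvg (R : Arcs V) (U : Finset V) : ℚ :=
  if U = ∅ then 1 else
    (1 / (U.card : ℚ)) * ∑ v ∈ U.attach, vsign R U v.1 * sgnAvg R (U.erase v.1)
termination_by U.card
decreasing_by grind

lemma sgnAvg_empty (R : Arcs V) : sgnAvg R ∅ = 1 := by rw [sgnAvg, if_pos rfl]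

lemma card_mul_sgnAvg (R : Arcs V) (hU : U.Nonempty) :
    (U.card : ℚ) * sgnAvg R U = ∑ v ∈ U, vsign R U v * sgnAvg R (U.erase v) := by
  have h0 : (U.card : ℚ) ≠ 0 := by exact_mod_cast hU.card_pos.ne'
  rw [sgnAvg, if_neg hU.ne_empty, ← mul_assoc, mul_one_div_cancel h0, one_mul,
    sum_attach U fun v => vsign R U v * sgnAvg R (U.erase v)]

lemma eq_sgnAvg_of_rec (R : Arcs V) (f : Finset V → ℚ) {W : Finset V} (h0 : f ∅ = 1)
    (h : ∀ U ⊆ W, U.Nonempty → (U.card : ℚ) * f U = ∑ v ∈ U, vsign R U v * f (U.erase v)) :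
    ∀ U ⊆ W, f U = sgnAvg R U := by
  intro U
  induction U using strongInduction with
  | H U ih =>
    intro hU; rcases U.eq_empty_or_nonempty with rfl | hne
    · rw [h0, sgnAvg_empty]
    · have h1 : (U.card : ℚ) ≠ 0 := by exact_mod_cast hne.card_pos.ne'
      refine mul_left_cancel₀ h1 ?_; rw [h U hU hne, card_mul_sgnAvg R hne]
      refine sum_congr rfl fun v hv => ?_; grind

lemma vsign_congr {R R' : Arcs V} (h : ∀ e : V × V, e.1 ∈ U → e.2 ∈ U → (e ∈ R ↔ e ∈ R')) (v : V) :
    vsign R U v = vsign R' U v := by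
  unfold vsign; refine prod_congr ?_ fun _ _ => rfl; grind

lemma sgnAvg_congr {R R' : Arcs V} (h : ∀ e : V × V, e.1 ∈ U → e.2 ∈ U → (e ∈ R ↔ e ∈ R')) :
    sgnAvg R U = sgnAvg R' U := by
  refine eq_sgnAvg_of_rec R' (sgnAvg R) (W := U) (sgnAvg_empty R) (fun U' hU' hne => ?_) U
    subset_rfl
  rw [card_mul_sgnAvg R hne]; refine sum_congr rfl fun v _ => ?_
  rw [vsign_congr fun e h1 h2 => h e (hU' h1) (hU' h2)]

lemma vsign_union {U U' : Finset V}
    (hR : ∀ e ∈ R, e.1 ∈ U ∪ U' → e.2 ∈ U ∪ U' → (e.1 ∈ U ↔ e.2 ∈ U)) {v : V} (hv : v ∈ U) :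
    vsign R (U ∪ U') v = vsign R U v := by
  unfold vsign; refine prod_congr ?_ fun _ _ => rfl; grind

lemma sgnAvg_union : ∀ {U U' : Finset V}, Disjoint U U' →
    (∀ e ∈ R, e.1 ∈ U ∪ U' → e.2 ∈ U ∪ U' → (e.1 ∈ U ↔ e.2 ∈ U)) →
    sgnAvg R (U ∪ U') = sgnAvg R U * sgnAvg R U' := by
  intro U U'
  induction hn : (U ∪ U').card using Nat.strong_induction_on generalizing U U' with
  | _ n ih =>
    intro hd hR; rcases (U ∪ U').eq_empty_or_nonempty with he | hne
    · obtain ⟨h1, h2⟩ := union_eq_empty.1 he; rw [he, h1, h2, sgnAvg_empty, mul_one]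
    · have hR' : ∀ e ∈ R, e.1 ∈ U' ∪ U → e.2 ∈ U' ∪ U → (e.1 ∈ U' ↔ e.2 ∈ U') := by
        intro e he h1 h2; rw [union_comm] at h1 h2; have h3 := hR e he h1 h2
        have h4 : e.1 ∈ U → e.1 ∉ U' := fun h => disjoint_left.1 hd h
        have h5 : e.2 ∈ U → e.2 ∉ U' := fun h => disjoint_left.1 hd h; rw [mem_union] at h1 h2
        tauto
      have h1 : ((U ∪ U').card : ℚ) ≠ 0 := by exact_mod_cast hne.card_pos.ne'
      refine mul_left_cancel₀ h1 ?_; rw [card_mul_sgnAvg R hne, sum_union hd]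
      have hU : ∑ v ∈ U, vsign R (U ∪ U') v * sgnAvg R ((U ∪ U').erase v) =
          (∑ v ∈ U, vsign R U v * sgnAvg R (U.erase v)) * sgnAvg R U' := by
        rw [sum_mul]; refine sum_congr rfl fun v hv => ?_
        have h2 : (U ∪ U').erase v = U.erase v ∪ U' := by
          rw [erase_union_distrib, erase_eq_of_notMem (s := U') (disjoint_left.1 hd hv)]
        have h3 : ∀ x, x ∈ U.erase v ∪ U' → x ∈ U ∪ U' := fun x hx =>
          union_subset_union_left (erase_subset _ _) hx
        rw [vsign_union hR hv, h2, ih (U.erase v ∪ U').card ?_ rfl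
          (hd.mono_left (erase_subset _ _)) ?_, mul_assoc]
        · rw [← hn, ← h2]; exact card_erase_lt_of_mem (mem_union_left _ hv)
        · intro e he h4 h5; have := hR e he (h3 _ h4) (h3 _ h5)
          have h6 : ∀ x, x ∈ U.erase v ∪ U' → (x ∈ U.erase v ↔ x ∈ U) := by
            intro x hx; refine ⟨fun h => mem_of_mem_erase h, fun h => ?_⟩
            rcases mem_union.1 hx with hx | hx
            · exact hx
            · exact absurd hx (disjoint_left.1 hd h)
          rw [h6 _ h4, h6 _ h5, this]
      have hU' : ∑ v ∈ U', vsign R (U ∪ U') v * sgnAvg R ((U ∪ U').erase v) =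
          sgnAvg R U * ∑ v ∈ U', vsign R U' v * sgnAvg R (U'.erase v) := by
        rw [mul_sum]; refine sum_congr rfl fun v hv => ?_
        have h2 : (U ∪ U').erase v = U ∪ U'.erase v := by
          rw [erase_union_distrib, erase_eq_of_notMem (s := U) (disjoint_right.1 hd hv)]
        have h3 : ∀ x, x ∈ U ∪ U'.erase v → x ∈ U ∪ U' := fun x hx =>
          union_subset_union_right (erase_subset _ _) hx
        have h7 : vsign R (U ∪ U') v = vsign R U' v := by rw [union_comm, vsign_union hR' hv]
        rw [h7, h2, ih (U ∪ U'.erase v).card ?_ rfl (hd.mono_right (erase_subset _ _)) ?_]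
        · ring
        · rw [← hn, ← h2]; exact card_erase_lt_of_mem (mem_union_right _ hv)
        · intro e he h4 h5; exact hR e he (h3 _ h4) (h3 _ h5)
      rw [hU, hU', card_union_of_disjoint hd]
      have h8 : ∀ W : Finset V, (W.card : ℚ) * sgnAvg R W =
          ∑ v ∈ W, vsign R W v * sgnAvg R (W.erase v) := by
        intro W; rcases W.eq_empty_or_nonempty with rfl | h
        · simp
        · exact card_mul_sgnAvg R h
      grind

lemma sgnAvg_biUnion {V ι : Type} {R : Arcs V} (s : Finset ι) (B : ι → Finset V)
    (hd : ∀ i ∈ s, ∀ j ∈ s, i ≠ j → Disjoint (B i) (B j))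
    (hR : ∀ e ∈ R, ∀ i ∈ s, ∀ j ∈ s, e.1 ∈ B i → e.2 ∈ B j → i = j) :
    sgnAvg R (s.biUnion B) = ∏ i ∈ s, sgnAvg R (B i) := by
  induction s using Finset.induction_on with
  | empty => simp [sgnAvg_empty]
  | insert a s ha ih =>
    have hm : ∀ {x}, x ∈ s → x ∈ insert a s := fun h => mem_insert_of_mem h
    have ha' := mem_insert_self a s; rw [biUnion_insert, prod_insert ha, sgnAvg_union, ih]
    · exact fun i hi j hj => hd i (hm hi) j (hm hj)
    · exact fun e he i hi j hj => hR e he i (hm hi) j (hm hj)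
    · rw [disjoint_biUnion_right]; intro i hi; exact hd a ha' i (hm hi) fun h => ha (h ▸ hi)
    grind

lemma vsign_insert {e : V × V} (he : e ∉ R) (h1 : e.1 ∈ U) (h2 : e.2 ∈ U) (v : V) :
    vsign (insert e R) U v = (if e.2 = v then -1 else 1) * vsign R U v := by
  unfold vsign; rw [filter_insert]; grind

lemma sgnAvg_insert_of_notMem {e : V × V}
    (h : e.1 ∉ U ∨ e.2 ∉ U) : sgnAvg (insert e R) U = sgnAvg R U := by
  refine sgnAvg_congr fun x h1 h2 => ?_; grind

lemma sgnAvg_insert_swap {e : V × V} (hne : e.1 ≠ e.2)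
    (he : e ∉ R) (he' : e.swap ∉ R) : ∀ {U : Finset V}, e.1 ∈ U → e.2 ∈ U →
    sgnAvg (insert e.swap R) U = -sgnAvg (insert e R) U := by
  intro U
  induction U using strongInduction with
  | H U ih =>
    intro h1 h2; have hne' : U.Nonempty := ⟨_, h1⟩
    have h0 : (U.card : ℚ) ≠ 0 := by exact_mod_cast hne'.card_pos.ne'
    refine mul_left_cancel₀ h0 ?_
    rw [mul_neg, card_mul_sgnAvg _ hne', card_mul_sgnAvg _ hne', ← sum_neg_distrib]
    refine sum_congr rfl fun v hv => ?_
    rw [vsign_insert he' (by simpa) (by simpa), vsign_insert he h1 h2]; by_cases hv1 : e.1 = v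
    · subst hv1
      rw [sgnAvg_insert_of_notMem (Or.inr (by simp)), sgnAvg_insert_of_notMem (Or.inl (by simp)),
        if_neg hne.symm]
      simp
    · by_cases hv2 : e.2 = v
      · subst hv2
        rw [sgnAvg_insert_of_notMem (Or.inl (by simp)), sgnAvg_insert_of_notMem (Or.inr (by simp))]
        simp [hne]
      grind

lemma sgnAvg_chain {i j k : V} (hij : i ≠ j) (hjk : j ≠ k)
    (hik : i ≠ k) (h1 : (i, j) ∉ R) (h2 : (j, k) ∉ R) (h3 : (k, i) ∉ R) :
    ∀ {U : Finset V}, i ∈ U → j ∈ U → k ∈ U →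
    sgnAvg (insert (i, j) (insert (j, k) R)) U + sgnAvg (insert (j, k) (insert (k, i) R)) U +
    sgnAvg (insert (k, i) (insert (i, j) R)) U = -sgnAvg R U := by
  intro U
  induction U using strongInduction with
  | H U ih =>
    intro hi hj hk; have hne' : U.Nonempty := ⟨_, hi⟩
    have h0 : (U.card : ℚ) ≠ 0 := by exact_mod_cast hne'.card_pos.ne'
    have e1 : (i, j) ∉ insert (j, k) R := by simp [h1, hij]
    have e2 : (j, k) ∉ insert (k, i) R := by simp [h2, hjk]
    have e3 : (k, i) ∉ insert (i, j) R := by simp [h3, hik.symm]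
    refine mul_left_cancel₀ h0 ?_
    rw [mul_add, mul_add, mul_neg, card_mul_sgnAvg _ hne', card_mul_sgnAvg _ hne',
      card_mul_sgnAvg _ hne', card_mul_sgnAvg _ hne', ← sum_add_distrib,
      ← sum_add_distrib, ← sum_neg_distrib]
    refine sum_congr rfl fun v hv => ?_
    rw [vsign_insert e1 hi hj, vsign_insert h2 hj hk, vsign_insert e2 hj hk, vsign_insert h3 hk hi,
      vsign_insert e3 hk hi, vsign_insert h1 hi hj]
    by_cases hvi : i = v
    · subst hvi
      rw [sgnAvg_insert_of_notMem (e := (i, j)) (Or.inl (by simp)), insert_comm (j, k) (k, i),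
        sgnAvg_insert_of_notMem (e := (k, i)) (Or.inr (by simp)),
        sgnAvg_insert_of_notMem (e := (k, i)) (Or.inr (by simp)),
        sgnAvg_insert_of_notMem (e := (i, j)) (Or.inl (by simp))]
      grind
    · by_cases hvj : j = v
      · subst hvj
        rw [sgnAvg_insert_of_notMem (e := (i, j)) (Or.inr (by simp)), insert_comm (k, i) (i, j),
          sgnAvg_insert_of_notMem (e := (i, j)) (Or.inr (by simp)),
          sgnAvg_insert_of_notMem (e := (j, k)) (Or.inl (by simp)),
          sgnAvg_insert_of_notMem (e := (j, k)) (Or.inl (by simp))]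
        simp [hjk.symm, hij]
      · by_cases hvk : k = v
        · subst hvk
          rw [sgnAvg_insert_of_notMem (e := (k, i)) (Or.inl (by simp)), insert_comm (i, j) (j, k),
            sgnAvg_insert_of_notMem (e := (j, k)) (Or.inr (by simp)),
            sgnAvg_insert_of_notMem (e := (j, k)) (Or.inr (by simp)),
            sgnAvg_insert_of_notMem (e := (k, i)) (Or.inl (by simp))]
          simp [hik, hjk]
        grind

/-- The number of arcs of `R` inside `U` at `v`. -/
def vdeg (R : Arcs V) (U : Finset V) (v : V) : ℕ :=
  (R.filter fun e => (e.1 ∈ U ∧ e.2 ∈ U) ∧ (e.1 = v ∨ e.2 = v)).card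

lemma card_mul_sgnAvg_min (hR : ∀ e ∈ R, e.1 ≠ e.2) (hU : U.Nonempty) : (U.card : ℚ) * sgnAvg R U =
    ∑ v ∈ U, (-1) ^ vdeg R U v * vsign R U v * sgnAvg R (U.erase v) := by
  obtain ⟨p, hp⟩ : ∃ p : Finset V → V → ℚ, ∀ U v, p U v =
      ∏ e ∈ R with (e.1 ∈ U ∧ e.2 ∈ U) ∧ (e.1 = v ∨ e.2 = v), if e.2 = v then (1 : ℚ) else -1 :=
    ⟨_, fun _ _ => rfl⟩
  have hmin : ∀ U v, (-1) ^ vdeg R U v * vsign R U v = p U v := by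
    intro U v; rw [hp, vdeg, vsign, ← prod_const, ← prod_mul_distrib]
    refine prod_congr rfl fun e _ => ?_; split_ifs <;> norm_num
  simp only [hmin]
  have hcomm : ∀ (U : Finset V), ∀ v ∈ U, ∀ w ∈ U, v ≠ w →
      vsign R U v * p (U.erase v) w = p U w * vsign R (U.erase w) v := by
    intro U v hv w hw hvw; simp only [hp, vsign, prod_filter, ← prod_mul_distrib]
    refine prod_congr rfl fun e he => ?_; have := hR e he; grind
  induction U using strongInduction with
  | H U ih =>
    have h0 : (U.card : ℚ) ≠ 0 := by exact_mod_cast hU.card_pos.ne'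
    rcases Nat.lt_or_ge 1 U.card with hc | hc
    · have h1 : ((U.card : ℚ) - 1) ≠ 0 := by
        have : (1 : ℚ) < U.card := by exact_mod_cast hc
        linarith
      have hcard : ∀ v ∈ U, ((U.erase v).card : ℚ) = U.card - 1 := by
        intro v hv; rw [card_erase_of_mem hv, Nat.cast_sub (by omega)]; simp
      have hne : ∀ v ∈ U, (U.erase v).Nonempty := by
        intro v hv; rw [← Finset.card_pos, card_erase_of_mem hv]; omega
      refine mul_left_cancel₀ h1 ?_; rw [card_mul_sgnAvg R hU, mul_sum, mul_sum]
      have hL : ∀ v ∈ U, ((U.card : ℚ) - 1) * (vsign R U v * sgnAvg R (U.erase v)) =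
          ∑ w ∈ U.erase v, p U w * (vsign R (U.erase w) v * sgnAvg R ((U.erase w).erase v)) := by
        intro v hv; rw [mul_left_comm, ← hcard v hv, ih _ (erase_ssubset hv) (hne v hv), mul_sum]
        refine sum_congr rfl fun w hw => ?_
        rw [← mul_assoc, ← mul_assoc, hcomm U v hv w (mem_of_mem_erase hw)
          (mem_erase.1 hw).1.symm, erase_right_comm]
      have hRr : ∀ w ∈ U, ((U.card : ℚ) - 1) * (p U w * sgnAvg R (U.erase w)) =
          ∑ v ∈ U.erase w, p U w * (vsign R (U.erase w) v * sgnAvg R ((U.erase w).erase v)) := by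
        intro w hw; rw [mul_left_comm, ← hcard w hw, card_mul_sgnAvg R (hne w hw), mul_sum]
      rw [sum_congr rfl hL, sum_congr rfl hRr]; refine sum_comm' fun v w => ?_
      simp only [mem_erase, ne_eq]; tauto
    · obtain ⟨v, rfl⟩ := card_eq_one.1 (le_antisymm hc hU.card_pos); rw [card_mul_sgnAvg R hU]
      simp only [sum_singleton]; congr 1
      have h1 : R.filter (fun e => (e.1 ∈ ({v} : Finset V) ∧ e.2 ∈ ({v} : Finset V)) ∧
          (e.1 = v ∨ e.2 = v)) = ∅ := by
        refine filter_eq_empty_iff.2 ?_; rintro e he ⟨⟨h1, h2⟩, _⟩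
        exact hR e he ((mem_singleton.1 h1).trans (mem_singleton.1 h2).symm)
      rw [vsign, hp, h1, prod_empty, prod_empty]

lemma sgnAvg_parity (hR : ∀ e ∈ R, e.1 ≠ e.2) (U : Finset V) :
    sgnAvg R U = (-1) ^ (R.filter fun e => e.1 ∈ U ∧ e.2 ∈ U).card * sgnAvg R U := by
  induction U using strongInduction with
  | H U ih =>
    rcases U.eq_empty_or_nonempty with rfl | hU
    · simp
    · have h0 : (U.card : ℚ) ≠ 0 := by exact_mod_cast hU.card_pos.ne'
      refine mul_left_cancel₀ h0 ?_; rw [mul_left_comm, card_mul_sgnAvg_min hR hU]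
      conv_lhs => rw [← card_mul_sgnAvg_min hR hU, card_mul_sgnAvg R hU]
      rw [mul_sum]; refine sum_congr rfl fun v hv => ?_
      have hcard : (R.filter fun e => e.1 ∈ U ∧ e.2 ∈ U).card = vdeg R U v +
          (R.filter fun e => e.1 ∈ U.erase v ∧ e.2 ∈ U.erase v).card := by
        rw [vdeg, ← card_union_of_disjoint]
        · congr 1; ext e; simp only [mem_filter, mem_union, mem_erase]; tauto
        · rw [disjoint_left]; intro e h1 h2; simp only [mem_filter, mem_erase] at h1 h2; tauto
      conv_lhs => rw [ih _ (erase_ssubset hv)]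
      rw [hcard, pow_add]
      have h2 : ((-1 : ℚ) ^ vdeg R U v) * (-1) ^ vdeg R U v = 1 := by rw [← mul_pow]; norm_num
      grind

lemma sgnAvg_eq_zero_of_odd (hR : ∀ e ∈ R, e.1 ≠ e.2)
    (h : Odd (R.filter fun e => e.1 ∈ U ∧ e.2 ∈ U).card) : sgnAvg R U = 0 := by
  have := sgnAvg_parity hR U; rw [h.neg_one_pow] at this; linarith

lemma sgnAvg_restr [Fintype V] (S : Finset V) (H : Arcs V) :
    ∀ U : Finset S, sgnAvg (restr S H) U = sgnAvg H (U.map (Function.Embedding.subtype _)) := by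
  intro U; symm
  refine eq_sgnAvg_of_rec (restr S H)
    (fun U => sgnAvg H (U.map (Function.Embedding.subtype _))) (W := U) ?_ (fun U' _ hne => ?_) U
    subset_rfl
  · simp [sgnAvg_empty]
  · have h1 : (U'.map (Function.Embedding.subtype _)).Nonempty := by simpa using hne
    have h2 := card_mul_sgnAvg H h1; rw [card_map] at h2; simp only [h2, sum_map]
    refine sum_congr rfl fun v hv => ?_; congr 1
    · unfold vsign; symm; refine prod_bij (fun e _ => ((e.1 : V), (e.2 : V))) ?_ ?_ ?_ ?_
      · intro e he; simp only [mem_filter, mem_restr] at he; obtain ⟨h3, ⟨h4, h5⟩, h6⟩ := he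
        refine mem_filter.2 ⟨h3, ⟨Finset.mem_map.2 ⟨_, h4, rfl⟩, Finset.mem_map.2 ⟨_, h5, rfl⟩⟩, ?_⟩
        rcases h6 with h6 | h6
        · exact Or.inl (by rw [← h6]; rfl)
        · exact Or.inr (by rw [← h6]; rfl)
      · intro e _ e' _ h
        exact Prod.ext (Subtype.ext (congrArg Prod.fst h)) (Subtype.ext (congrArg Prod.snd h))
      · intro e he; obtain ⟨h3, ⟨h4, h5⟩, h6⟩ := mem_filter.1 he
        obtain ⟨a, ha, ha'⟩ := Finset.mem_map.1 h4; obtain ⟨c, hc, hc'⟩ := Finset.mem_map.1 h5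
        have hee : e = ((a : V), (c : V)) := Prod.ext ha'.symm hc'.symm
        refine ⟨(a, c), ?_, hee.symm⟩; simp only [mem_filter, mem_restr]
        refine ⟨hee ▸ h3, ⟨ha, hc⟩, ?_⟩; rcases h6 with h6 | h6
        · exact Or.inl (Subtype.ext (ha'.trans h6))
        · exact Or.inr (Subtype.ext (hc'.trans h6))
      · intro e _; by_cases h : e.2 = v
        · rw [if_pos h, if_pos]; rw [h]; rfl
        · rw [if_neg h, if_neg]; exact fun h' => h (Subtype.ext h')
    simp_all

lemma sgnAvg_eq_prod_restr {V Q : Type} [Fintype V] [Fintype Q] {π : V → Q} {B : Q → Finset V}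
    (hB : ∀ v q, v ∈ B q ↔ π v = q) {H : Arcs V} (hH : HasClasses H π) :
    sgnAvg H univ = ∏ q, sgnAvg (restr (B q) H) univ := by
  have h1 : (univ : Finset V) = univ.biUnion B := by ext v; simp [hB]
  rw [h1, sgnAvg_biUnion]
  · refine prod_congr rfl fun q _ => ?_; rw [sgnAvg_restr]; congr 1; ext v; simp
  · intro i _ j _ hij; rw [disjoint_left]; grind
  · intro e he i _ j _ h2 h3; rw [← (hB _ _).1 h2, ← (hB _ _).1 h3]; exact (hH _ _).1 (Lk.of_mem he)

/-! ## The coefficients `a_T` -/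

/-- The hypotheses under which an oriented graph is a tree. -/
structure OrientedGraph.IsTreeLike {V : Type} (D : OrientedGraph V) : Prop where
  forest : IsForest D.arcs
  mem_verts : ∀ e ∈ D.arcs, e.1 ∈ D.verts ∧ e.2 ∈ D.verts
  linked : ∀ u ∈ D.verts, ∀ w ∈ D.verts, Lk D.arcs u w

lemma OrientedGraph.lk_component {o u w : V}
    (hu : D.Linked o u) (h : D.Linked u w) : Lk (D.component o).arcs u w := by
  have := Lk.eq_of (R := D.arcs) h (fun x => D.Linked o x ∧ Lk (D.component o).arcs u x)
    fun e he => by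
      have hl : D.Linked e.1 e.2 := Lk.of_mem he
      have hm : D.Linked o e.1 → e ∈ (D.component o).arcs := fun h =>
        mem_filter.2 ⟨he, h⟩
      refine propext ⟨?_, ?_⟩
      · rintro ⟨h1, h2⟩; exact ⟨Lk.trans h1 hl, h2.trans (Lk.of_mem (hm h1))⟩
      · rintro ⟨h1, h2⟩; have h3 : D.Linked o e.1 := Lk.trans h1 (Lk.symm hl)
        exact ⟨h3, h2.trans (Lk.of_mem (hm h3)).symm⟩
  exact (this.mp ⟨hu, Lk.refl _⟩).2

lemma OrientedGraph.isTreeLike_component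
    (hF : IsForest D.arcs) (hm : ∀ e ∈ D.arcs, e.1 ∈ D.verts ∧ e.2 ∈ D.verts) (o : V) :
    (D.component o).IsTreeLike where
  forest := hF.mono (filter_subset _ _)
  mem_verts e he := by
    obtain ⟨h1, h2⟩ := mem_filter.1 he
    exact ⟨mem_filter.2 ⟨(hm e h1).1, h2⟩,
      mem_filter.2 ⟨(hm e h1).2, Lk.trans h2 (Lk.of_mem h1)⟩⟩
  linked u hu w hw := lk_component (mem_filter.1 hu).2
    (Lk.trans (Lk.symm (mem_filter.1 hu).2) (mem_filter.1 hw).2)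

lemma OrientedGraph.sgnAvg_component (o : V) :
    sgnAvg (D.component o).arcs (D.component o).verts = sgnAvg D.arcs (D.component o).verts := by
  refine sgnAvg_congr fun e h1 _ => ?_; simp only [component, mem_filter] at h1 ⊢; grind

lemma OrientedGraph.coeffA_eq (D : OrientedGraph V) (hD : D.IsTreeLike)
    (hne : D.verts.Nonempty) : D.coeffA = sgnAvg D.arcs D.verts := by
  induction hn : D.verts.card using Nat.strong_induction_on generalizing D with
  | _ n ih =>
    have h0 : (D.verts.card : ℚ) ≠ 0 := by exact_mod_cast hne.card_pos.ne'
    rw [coeffA]; refine mul_left_cancel₀ h0 ?_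
    rw [← mul_assoc, mul_one_div_cancel h0, one_mul, card_mul_sgnAvg _ hne,
      sum_attach D.verts fun v => (-1) ^ D.inDegree v *
        ∏ e ∈ D.arcsAt v, ((D.removeVertex v).component (otherEnd v e)).coeffA]
    refine sum_congr rfl fun v hv => ?_
    have hremF : IsForest (D.removeVertex v).arcs := hD.forest.mono (filter_subset _ _)
    have hremM : ∀ e ∈ (D.removeVertex v).arcs,
        e.1 ∈ (D.removeVertex v).verts ∧ e.2 ∈ (D.removeVertex v).verts := by
      intro e he; obtain ⟨h1, h2⟩ := mem_filter.1 he
      exact ⟨mem_erase.2 ⟨h2.1, (hD.mem_verts e h1).1⟩, mem_erase.2 ⟨h2.2, (hD.mem_verts e h1).2⟩⟩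
    have hother : ∀ e ∈ D.arcsAt v, otherEnd v e ∈ D.verts.erase v ∧
        Lk {e} v (otherEnd v e) ∧ Lk {e} e.1 e.2 := by
      intro e he; obtain ⟨h1, h2⟩ := mem_filter.1 he; have h3 := hD.forest.ne h1
      have h4 : Lk {e} e.1 e.2 := Lk.of_mem (mem_singleton_self e); unfold otherEnd
      split_ifs with h5
      · exact ⟨mem_erase.2 ⟨fun h => h3 (h5.trans h.symm), (hD.mem_verts e h1).2⟩, h5 ▸ h4, h4⟩
      · have h6 := h2.resolve_left h5
        exact ⟨mem_erase.2 ⟨h5, (hD.mem_verts e h1).1⟩, h6 ▸ h4.symm, h4⟩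
    have hsep : ∀ e ∈ D.arcsAt v, ∀ e' ∈ D.arcsAt v,
        Lk (D.removeVertex v).arcs (otherEnd v e) (otherEnd v e') → e = e' := by
      intro e he e' he' hl; by_contra hne'; have h1 := (mem_filter.1 he).1
      have h2 : (D.removeVertex v).arcs ⊆ D.arcs.erase e := by
        intro x hx; obtain ⟨h3, h4⟩ := mem_filter.1 hx; refine mem_erase.2 ⟨?_, h3⟩; rintro rfl
        rcases (mem_filter.1 he).2 with h5 | h5
        · exact h4.1 h5
        · exact h4.2 h5
      have h3 : Lk (D.arcs.erase e) v (otherEnd v e') := (hother e' he').2.1.mono (by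
        rw [singleton_subset_iff]; exact mem_erase.2 ⟨fun h => hne' h.symm, (mem_filter.1 he').1⟩)
      have h4 : Lk (D.arcs.erase e) v (otherEnd v e) := h3.trans (hl.mono h2).symm
      refine hD.forest e h1 ?_; obtain ⟨h5, h6⟩ := mem_filter.1 he; unfold otherEnd at h4
      split_ifs at h4 with h7
      · rw [h7]; exact h4
      · rw [h6.resolve_left h7]; exact h4.symm
    congr 1
    · have h1 : ∀ e ∈ D.arcs, (e.1 ∈ D.verts ∧ e.2 ∈ D.verts) := hD.mem_verts
      rw [vsign, prod_ite, prod_const, prod_const_one, mul_one, inDegree]; congr 2; grind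
    · have h1 : D.verts.erase v = (D.arcsAt v).biUnion fun e =>
          ((D.removeVertex v).component (otherEnd v e)).verts := by
        ext w; simp only [mem_biUnion, component, mem_filter]; constructor
        · intro hw
          have := (hD.linked v hv w (mem_of_mem_erase hw)).eq_of
            (fun x => x = v ∨ ∃ e ∈ D.arcsAt v, Lk (D.removeVertex v).arcs (otherEnd v e) x)
            fun e he => by
              have h3 := hD.forest.ne he; by_cases h1 : e.1 = v
              · refine propext ⟨fun _ => Or.inr ⟨e, mem_filter.2 ⟨he, Or.inl h1⟩, ?_⟩,
                  fun _ => Or.inl h1⟩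
                rw [otherEnd, if_pos h1]; exact Lk.refl _
              · by_cases h2 : e.2 = v
                · refine propext ⟨fun _ => Or.inl h2, fun _ => Or.inr
                    ⟨e, mem_filter.2 ⟨he, Or.inr h2⟩, ?_⟩⟩
                  rw [otherEnd, if_neg h1]; exact Lk.refl _
                · have h4 : Lk (D.removeVertex v).arcs e.1 e.2 :=
                    Lk.of_mem (mem_filter.2 ⟨he, h1, h2⟩)
                  simp only [h1, h2, false_or]; refine propext ⟨?_, ?_⟩
                  · rintro ⟨e', he', h5⟩; exact ⟨e', he', h5.trans h4⟩
                  · rintro ⟨e', he', h5⟩; exact ⟨e', he', h5.trans h4.symm⟩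
          rcases this.mp (Or.inl rfl) with h | ⟨e, he, h⟩
          · grind
          · exact ⟨e, he, hw, h⟩
        · rintro ⟨e, _, hw, _⟩; exact hw
      have hcongr : sgnAvg D.arcs (D.verts.erase v) =
          sgnAvg (D.removeVertex v).arcs (D.verts.erase v) := by
        refine sgnAvg_congr fun e h2 h3 => ?_; simp only [removeVertex, mem_filter]
        exact ⟨fun h => ⟨h, (mem_erase.1 h2).1, (mem_erase.1 h3).1⟩, fun h => h.1⟩
      rw [hcongr, h1, sgnAvg_biUnion]
      · refine prod_congr rfl fun e he => ?_
        rw [← sgnAvg_component, ih _ ?_ _ (isTreeLike_component hremF hremM _) ?_ rfl]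
        · rw [← hn]; exact card_component_removeVertex_lt D v _ hv
        · exact ⟨otherEnd v e, mem_filter.2 ⟨(hother e he).1, Lk.refl _⟩⟩
      · intro e he e' he' hne'; rw [disjoint_left]; intro x hx hx'
        exact hne' (hsep e he e' he' (Lk.trans (mem_filter.1 hx).2 (Lk.symm (mem_filter.1 hx').2)))
      · intro x hx e he e' he' h2 h3
        exact hsep e he e' he' (Lk.trans (Lk.trans (mem_filter.1 h2).2 (Lk.of_mem hx))
          (Lk.symm (mem_filter.1 h3).2))

lemma coeffA_orient [Fintype V] [Nonempty V] {G : SimpleGraph V} (hG : G.IsTree) :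
    (orient G).coeffA = sgnAvg (orient G).arcs univ :=
  OrientedGraph.coeffA_eq _ ⟨(isOTree_orient hG).1, fun _ _ => ⟨mem_univ _, mem_univ _⟩,
    fun u _ w _ => (isOTree_orient hG).2 u w⟩ univ_nonempty

lemma OrientedGraph.linked_rep (D : OrientedGraph V) (u : V) : D.Linked u (D.rep u) := by
  have : Quotient.mk (Relation.EqvGen.setoid (fun a c => (a, c) ∈ D.arcs)) (D.rep u) =
      Quotient.mk (Relation.EqvGen.setoid (fun a c => (a, c) ∈ D.arcs)) u := Quotient.out_eq _
  exact Lk.symm (R := D.arcs) (Quotient.exact this)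

lemma OrientedGraph.rep_eq_iff (D : OrientedGraph V) {u w : V} :
    D.rep u = D.rep w ↔ D.Linked u w := by
  constructor
  · intro h; have h1 := D.linked_rep u; have h2 := D.linked_rep w; rw [h] at h1
    exact Lk.trans h1 (Lk.symm h2)
  · intro h; unfold rep; congr 1; exact Quotient.sound h

lemma OrientedGraph.rep_mem
    (hm : ∀ e ∈ D.arcs, e.1 ∈ D.verts ∧ e.2 ∈ D.verts) {u : V} (hu : u ∈ D.verts) :
    D.rep u ∈ D.verts := by
  have := Lk.eq_of (R := D.arcs) (D.linked_rep u) (fun x => x ∈ D.verts)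
    fun e he => propext ⟨fun _ => (hm e he).2, fun _ => (hm e he).1⟩
  exact this.mp hu

lemma OrientedGraph.prod_coeffA (hF : IsForest D.arcs)
    (hm : ∀ e ∈ D.arcs, e.1 ∈ D.verts ∧ e.2 ∈ D.verts) :
    ∏ r ∈ D.verts.image D.rep, (D.component r).coeffA = sgnAvg D.arcs D.verts := by
  have hr : ∀ r ∈ D.verts.image D.rep, r ∈ D.verts ∧ D.rep r = r := by
    intro r hr; obtain ⟨u, hu, rfl⟩ := mem_image.1 hr
    exact ⟨rep_mem hm hu, (D.rep_eq_iff.2 (D.linked_rep u)).symm⟩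
  have h1 : D.verts = (D.verts.image D.rep).biUnion fun r => (D.component r).verts := by
    ext w; simp only [mem_biUnion, component, mem_filter]; constructor
    · intro hw; exact ⟨D.rep w, mem_image_of_mem _ hw, hw, Lk.symm (D.linked_rep w)⟩
    · grind
  conv_rhs => rw [h1]
  rw [sgnAvg_biUnion]
  · refine prod_congr rfl fun r h => ?_
    rw [coeffA_eq _ (isTreeLike_component hF hm r)
      ⟨r, mem_filter.2 ⟨(hr r h).1, Lk.refl _⟩⟩, sgnAvg_component]
  · intro r h r' h' hne; rw [disjoint_left]; intro x hx hx'; refine hne ?_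
    rw [← (hr r h).2, ← (hr r' h').2, D.rep_eq_iff]
    exact Lk.trans (mem_filter.1 hx).2 (Lk.symm (mem_filter.1 hx').2)
  · intro e he r h r' h' h2 h3; rw [← (hr r h).2, ← (hr r' h').2, D.rep_eq_iff]
    exact Lk.trans (Lk.trans (mem_filter.1 h2).2 (Lk.of_mem he)) (Lk.symm (mem_filter.1 h3).2)

end

/-! ## The bilinear form -/

/-- Arrays of triple intersection numbers. -/
abbrev Triples (b : ℕ) : Type := Fin b → Fin b → Fin b → ℝ

/-- Families of charges. -/
abbrev Charges (n b : ℕ) : Type := Fin n → Charge b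

/-- Functions of families of charges of any length. -/
abbrev ChargeFn (b : ℕ) : Type := (k : ℕ) → Charges k b → ℝ

section

variable {n b : ℕ} {κ : Triples b} {ample : Set (Fin b → ℝ)}

/-- The trilinear form as a linear function of its last argument. -/
def tripleL (κ : Triples b) (x y : Fin b → ℝ) : (Fin b → ℝ) →ₗ[ℝ] ℝ where
  toFun := triple κ x y
  map_add' z z' := by simp only [triple, Pi.add_apply, mul_add, sum_add_distrib]
  map_smul' r z := by
    simp only [triple, Pi.smul_apply, smul_eq_mul, RingHom.id_apply, mul_sum]
    refine sum_congr rfl fun _ _ => sum_congr rfl fun _ _ =>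
      sum_congr rfl fun _ _ => by ring

lemma triple_comm₂₃ (hκ : IsAmpleCone κ ample) (x y z : Fin b → ℝ) :
    triple κ x y z = triple κ x z y := by
  unfold triple; refine sum_congr rfl fun a _ => ?_; rw [sum_comm]
  refine sum_congr rfl fun c _ => sum_congr rfl fun d _ => ?_; rw [hκ.symm₂₃]; ring

lemma triple_comm₁₂ (hκ : IsAmpleCone κ ample) (x y z : Fin b → ℝ) :
    triple κ x y z = triple κ y x z := by
  unfold triple; rw [sum_comm]
  refine sum_congr rfl fun a _ => sum_congr rfl fun c _ =>
    sum_congr rfl fun d _ => ?_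
  rw [hκ.symm₁₂]; ring

lemma triple_sum_right {ι : Type*} (s : Finset ι) (x y : Fin b → ℝ) (f : ι → Fin b → ℝ) :
    triple κ x y (∑ i ∈ s, f i) = ∑ i ∈ s, triple κ x y (f i) := map_sum (tripleL κ x y) f s

lemma triple_sum_left (hκ : IsAmpleCone κ ample) {ι : Type*} (s : Finset ι) (y z : Fin b → ℝ)
    (f : ι → Fin b → ℝ) : triple κ (∑ i ∈ s, f i) y z = ∑ i ∈ s, triple κ (f i) y z := by
  rw [triple_comm₁₂ hκ, triple_comm₂₃ hκ, triple_sum_right]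
  exact sum_congr rfl fun i _ => by rw [triple_comm₂₃ hκ, triple_comm₁₂ hκ]

lemma triple_zero_right (x y : Fin b → ℝ) : triple κ x y 0 = 0 := map_zero (tripleL κ x y)

lemma triple_sub_right (x y z z' : Fin b → ℝ) :
    triple κ x y (z - z') = triple κ x y z - triple κ x y z' := map_sub (tripleL κ x y) z z'

/-- The bilinear form as a linear function of its second argument. -/
def dotL (κ : Triples b) (γ : Charges n b) (x : Vec n b) :
    Vec n b →ₗ[ℝ] ℝ where
  toFun := dot κ γ x
  map_add' z z' := by
    simp only [dot, Pi.add_apply, ← sum_add_distrib]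
    exact sum_congr rfl fun i _ => map_add (tripleL κ _ _) _ _
  map_smul' r z := by
    simp only [dot, Pi.smul_apply, RingHom.id_apply, smul_eq_mul, mul_sum]
    exact sum_congr rfl fun i _ => map_smul (tripleL κ _ _) _ _

lemma dotL_apply (γ : Charges n b) (x y : Vec n b) : dotL κ γ x y = dot κ γ x y := rfl

lemma dot_comm (hκ : IsAmpleCone κ ample) (γ : Charges n b) (x y : Vec n b) :
    dot κ γ x y = dot κ γ y x := by
  unfold dot; exact sum_congr rfl fun i _ => triple_comm₂₃ hκ _ _ _

lemma dot_vPair (hκ : IsAmpleCone κ ample) (γ : Charges n b) (i j : Fin n) (x : Vec n b) :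
    dot κ γ (vPair γ i j) x = triple κ (γ i).1 (γ j).1 (x i) - triple κ (γ i).1 (γ j).1 (x j) := by
  have h : ∀ k, triple κ (γ k).1 (vPair γ i j k) (x k) =
      (if k = i then triple κ (γ i).1 (γ j).1 (x i) else 0) -
        if k = j then triple κ (γ i).1 (γ j).1 (x j) else 0 := by
    intro k
    have : vPair γ i j k = (if k = i then (γ j).1 else 0) - if k = j then (γ i).1 else 0 := by
      ext a; simp only [vPair, Pi.sub_apply]; congr 1 <;> split_ifs <;> simp
    rw [this, triple_comm₂₃ hκ, triple_sub_right]; congr 1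
    · split_ifs with h
      · rw [h, triple_comm₂₃ hκ]
      · exact triple_zero_right _ _
    · split_ifs with h
      · rw [h, triple_comm₂₃ hκ, triple_comm₁₂ hκ]
      · exact triple_zero_right _ _
  simp only [dot, h, sum_sub_distrib, sum_ite_eq', mem_univ, if_true]

lemma vPair_swap (γ : Charges n b) (i j : Fin n) : vPair γ j i = -vPair γ i j := by
  funext k a; simp [vPair]

/-- The sum of the vectors `v_{kj}` over all `j`. -/
def vVert (γ : Charges n b) (k : Fin n) : Vec n b := ∑ j, vPair γ k j

lemma vVert_apply (γ : Charges n b) (k l : Fin n) :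
    vVert γ k l = (if l = k then ∑ j, (γ j).1 else 0) - (γ k).1 := by
  funext a; simp only [vVert, Finset.sum_apply, vPair, sum_sub_distrib, Pi.sub_apply]; congr 1
  · split_ifs <;> simp
  · simp

/-- The weight `(p p_i p_j)` with `p` the sum of all the `p_k`. -/
def tW (κ : Triples b) (γ : Charges n b) (i j : Fin n) : ℝ :=
  triple κ (γ i).1 (γ j).1 (∑ k, (γ k).1)

lemma tW_comm (hκ : IsAmpleCone κ ample) (γ : Charges n b) (i j : Fin n) :
    tW κ γ i j = tW κ γ j i := triple_comm₁₂ hκ _ _ _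

lemma tW_pos (hκ : IsAmpleCone κ ample) {γ : Charges n b} (hγ : ∀ i, (γ i).1 ∈ ample)
    (i j : Fin n) : 0 < tW κ γ i j := by
  rw [tW, triple_sum_right]
  exact sum_pos (fun k _ => hκ.triple_pos _ (hγ i) _ (hγ j) _ (hγ k)) ⟨i, mem_univ _⟩

lemma dot_vPair_vVert (hκ : IsAmpleCone κ ample) (γ : Charges n b) (i j k : Fin n) :
    dot κ γ (vPair γ i j) (vVert γ k) = tW κ γ i j * dv (i, j) k := by
  rw [dot_vPair hκ, vVert_apply, vVert_apply, triple_sub_right, triple_sub_right,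
    sub_sub_sub_cancel_right, tW]
  simp only [dv, Pi.sub_apply, Pi.single_apply, mul_sub, mul_ite, mul_one, mul_zero]; congr 1
  · by_cases h : i = k
    · grind
    · rw [if_neg h, if_neg (Ne.symm h), triple_zero_right]
  · by_cases h : j = k
    · grind
    · rw [if_neg h, if_neg (Ne.symm h), triple_zero_right]

lemma dot_vPair_vPair_chain (hκ : IsAmpleCone κ ample) (γ : Charges n b) {i j k : Fin n}
    (hij : i ≠ j) (hjk : j ≠ k) (hik : i ≠ k) :
    dot κ γ (vPair γ i j) (vPair γ j k) = -triple κ (γ i).1 (γ j).1 (γ k).1 := by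
  have h1 : vPair γ j k i = 0 := by funext a; simp [vPair, hij, hik]
  have h2 : vPair γ j k j = (γ k).1 := by funext a; simp [vPair, hjk]
  rw [dot_vPair hκ, h1, h2, triple_zero_right, zero_sub]

lemma dot_vPair_vPair_disjoint (hκ : IsAmpleCone κ ample) (γ : Charges n b)
    {i j k l : Fin n} (hik : i ≠ k) (hil : i ≠ l) (hjk : j ≠ k) (hjl : j ≠ l) :
    dot κ γ (vPair γ i j) (vPair γ k l) = 0 := by
  have h1 : vPair γ k l i = 0 := by funext a; simp [vPair, hik, hil]
  have h2 : vPair γ k l j = 0 := by funext a; simp [vPair, hjk, hjl]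
  rw [dot_vPair hκ, h1, h2, triple_zero_right, sub_zero]

/-- The numbers `v_k · x`. -/
def Xmap (κ : Triples b) (γ : Charges n b) : Vec n b →ₗ[ℝ] (Fin n → ℝ) :=
  LinearMap.pi fun k => dotL κ γ (vVert γ k)

lemma Xmap_apply (γ : Charges n b) (x : Vec n b) (k : Fin n) :
    Xmap κ γ x k = dot κ γ (vVert γ k) x := rfl

lemma Xmap_vPair (hκ : IsAmpleCone κ ample) (γ : Charges n b) (i j : Fin n) :
    Xmap κ γ (vPair γ i j) = tW κ γ i j • dv (i, j) := by
  funext k; rw [Xmap_apply, dot_comm hκ, dot_vPair_vVert hκ]; rfl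

lemma dot_sum_left (hκ : IsAmpleCone κ ample) {ι : Type*} (s : Finset ι) (γ : Charges n b)
    (f : ι → Vec n b) (x : Vec n b) : dot κ γ (∑ i ∈ s, f i) x = ∑ i ∈ s, dot κ γ (f i) x := by
  rw [dot_comm hκ, ← dotL_apply, map_sum]
  exact sum_congr rfl fun i _ => by rw [dotL_apply, dot_comm hκ]

lemma dot_smul_left (hκ : IsAmpleCone κ ample) (γ : Charges n b) (r : ℝ) (v x : Vec n b) :
    dot κ γ (r • v) x = r * dot κ γ v x := by
  rw [dot_comm hκ, ← dotL_apply, map_smul, dotL_apply, dot_comm hκ]; rfl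

lemma sum_sum_eq_zero_of_antisymm {ι M : Type*} [AddCommGroup M] [Module ℝ M] (s : Finset ι)
    {w : ι → ι → M} (hw : ∀ i j, w j i = -w i j) : ∑ i ∈ s, ∑ j ∈ s, w i j = 0 := by
  have h : ∑ i ∈ s, ∑ j ∈ s, w i j = -∑ i ∈ s, ∑ j ∈ s, w i j := by
    conv_lhs => rw [sum_comm]
    simp only [← sum_neg_distrib]; exact sum_congr rfl fun i _ => sum_congr rfl fun j _ => hw i j
  have h2 : (2 : ℝ) • ∑ i ∈ s, ∑ j ∈ s, w i j = 0 := by rw [two_smul]; nth_rewrite 2 [h]; simp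
  exact (smul_eq_zero.1 h2).resolve_left two_ne_zero

lemma sum_Xmap (hκ : IsAmpleCone κ ample) (γ : Charges n b) (x : Vec n b) :
    ∑ k, Xmap κ γ x k = 0 := by
  simp only [Xmap_apply, ← dot_sum_left hκ, vVert]
  rw [sum_sum_eq_zero_of_antisymm _ (vPair_swap γ), ← dotL_apply, ← neg_zero, ← neg_zero]
  have := dot_smul_left hκ γ 0 0 x; rw [zero_smul, zero_mul] at this; simpa [dotL_apply] using this

lemma dot_vVert_vVert (hκ : IsAmpleCone κ ample) (γ : Charges n b) (k l : Fin n) :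
    dot κ γ (vVert γ k) (vVert γ l) = ∑ j, tW κ γ k j * dv (k, j) l := by
  conv_lhs => rw [vVert]
  rw [dot_sum_left hκ]; exact sum_congr rfl fun j _ => dot_vPair_vVert hκ γ k j l

lemma sum_dot_vVert (hκ : IsAmpleCone κ ample) (γ : Charges n b) (c : Fin n → ℝ) :
    ∑ k, ∑ l, c k * dot κ γ (vVert γ k) (vVert γ l) * c l =
    (1 / 2) * ∑ k, ∑ j, tW κ γ k j * (c k - c j) ^ 2 := by
  have h1 : ∑ k, ∑ l, c k * dot κ γ (vVert γ k) (vVert γ l) * c l =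
      ∑ k, ∑ j, tW κ γ k j * (c k * (c k - c j)) := by
    refine sum_congr rfl fun k _ => ?_; simp only [dot_vVert_vVert hκ, mul_sum, sum_mul]
    rw [sum_comm]; refine sum_congr rfl fun j _ => ?_
    have : ∑ l, dv (k, j) l * c l = c k - c j := by
      simp [dv, sub_mul, sum_sub_distrib, Pi.single_apply]
    rw [← this, mul_sum, mul_sum]; exact sum_congr rfl fun l _ => by ring
  have h2 : ∑ k, ∑ j, tW κ γ k j * (c k * (c k - c j)) =
      ∑ k, ∑ j, tW κ γ k j * (c j * (c j - c k)) := by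
    rw [sum_comm]; exact sum_congr rfl fun k _ => sum_congr rfl fun j _ => by rw [tW_comm hκ]
  have h3 : ∑ k, ∑ j, tW κ γ k j * (c k - c j) ^ 2 =
      ∑ k, ∑ j, tW κ γ k j * (c k * (c k - c j)) + ∑ k, ∑ j, tW κ γ k j * (c j * (c j - c k)) := by
    simp only [← sum_add_distrib]; exact sum_congr rfl fun k _ => sum_congr rfl fun j _ => by ring
  grind

lemma quad_pos (hκ : IsAmpleCone κ ample) {γ : Charges n b} (hγ : ∀ i, (γ i).1 ∈ ample)
    {c : Fin n → ℝ} {i j : Fin n} (hij : c i ≠ c j) :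
    0 < ∑ k, ∑ l, c k * dot κ γ (vVert γ k) (vVert γ l) * c l := by
  rw [sum_dot_vVert hκ]
  have h : ∀ k j, 0 ≤ tW κ γ k j * (c k - c j) ^ 2 := fun k j =>
    mul_nonneg (tW_pos hκ hγ k j).le (sq_nonneg _)
  refine mul_pos (by norm_num) (sum_pos' (fun k _ => sum_nonneg fun j _ => h k j)
    ⟨i, mem_univ _, sum_pos' (fun j _ => h i j) ⟨j, mem_univ _, ?_⟩⟩)
  exact mul_pos (tW_pos hκ hγ i j) (by have := sub_ne_zero.2 hij; positivity)

/-! ## The vectors at the edges of a tree -/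

lemma sourceSide_eq {V : Type} [Fintype V] (D : Arcs V) (e : V × V) :
    OrientedGraph.sourceSide ⟨univ, D⟩ e = side D e := by
  ext k
  simp only [OrientedGraph.sourceSide, OrientedGraph.component, OrientedGraph.removeArcs, side,
    OrientedGraph.Linked, sdiff_singleton_eq_erase, mem_filter, mem_univ,
    true_and]

lemma targetSide_eq {V : Type} [Fintype V] {D : Arcs V} (hD : IsOTree D) {e : V × V}
    (he : e ∈ D) : OrientedGraph.targetSide ⟨univ, D⟩ e = (side D e)ᶜ := by
  have h1 : OrientedGraph.targetSide ⟨univ, D⟩ e = univ.filter fun k => Lk (D.erase e) e.2 k := by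
    ext k
    simp only [OrientedGraph.targetSide, OrientedGraph.component, OrientedGraph.removeArcs,
      OrientedGraph.Linked, sdiff_singleton_eq_erase, mem_filter, mem_univ,
      true_and]
  rw [h1]; ext k; simp only [mem_filter, mem_univ, true_and, mem_compl, side]; constructor
  · intro h h'; exact hD.1 e he (h'.trans h.symm)
  · intro h
    have := (hD.2 e.1 k).eq_of (fun x => Lk (D.erase e) e.1 x ∨ Lk (D.erase e) e.2 x) fun x hx => by
      by_cases hxe : x = e
      · subst hxe; exact propext ⟨fun _ => Or.inr (Lk.refl _), fun _ => Or.inl (Lk.refl _)⟩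
      · have h1 : Lk (D.erase e) x.1 x.2 := Lk.of_mem (mem_erase.2 ⟨hxe, hx⟩)
        exact propext ⟨Or.imp (fun h => h.trans h1) fun h => h.trans h1,
          Or.imp (fun h => h.trans h1.symm) fun h => h.trans h1.symm⟩
    exact (this.mp (Or.inl (Lk.refl _))).resolve_left h

lemma sum_sides {V M : Type} [Fintype V] [AddCommGroup M] [Module ℝ M] {D : Arcs V}
    (hD : IsOTree D) {e : V × V} (he : e ∈ D) {w : V → V → M} (hw : ∀ i j, w j i = -w i j) :
    ∑ i ∈ OrientedGraph.sourceSide ⟨univ, D⟩ e,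
    ∑ j ∈ OrientedGraph.targetSide ⟨univ, D⟩ e, w i j = ∑ i ∈ side D e, ∑ j, w i j := by
  rw [sourceSide_eq, targetSide_eq hD he]
  have h1 : ∀ i, ∑ j, w i j = ∑ j ∈ side D e, w i j + ∑ j ∈ (side D e)ᶜ, w i j := fun i =>
    (sum_add_sum_compl _ _).symm
  simp only [h1, sum_add_distrib, sum_sum_eq_zero_of_antisymm _ hw, zero_add]

lemma edgeDirac_eq (γ : Charges n b) {D : Arcs (Fin n)} (hD : IsOTree D)
    {e : Fin n × Fin n} (he : e ∈ D) :
    edgeDirac γ ⟨univ, D⟩ e = flow D e fun i => ∑ j, dirac (γ i) (γ j) := by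
  rw [edgeDirac, sum_sides hD he, flow_apply]; intro i j; simp only [dirac]; ring

/-- The block of charges over a vertex. -/
def fiber {V : Type} (π : Fin n → V) (v : V) : Finset (Fin n) := univ.filter fun k => π k = v

lemma sum_vBlock {V : Type} [Fintype V] (γ : Charges n b) (π : Fin n → V) (v : V) :
    ∑ w, vBlock γ (fiber π v) (fiber π w) = ∑ k ∈ fiber π v, vVert γ k := by
  simp only [vBlock, vVert]; rw [sum_comm]; refine sum_congr rfl fun k _ => ?_
  exact sum_fiberwise _ _ _

lemma vBlock_swap (γ : Charges n b) (B C : Finset (Fin n)) : vBlock γ C B = -vBlock γ B C := by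
  simp only [vBlock]; rw [sum_comm]; simp only [← sum_neg_distrib]
  exact sum_congr rfl fun i _ => sum_congr rfl fun j _ => vPair_swap γ _ _

lemma edgeVec_eq {V : Type} [Fintype V] (γ : Charges n b) (π : Fin n → V)
    {D : Arcs V} (hD : IsOTree D) {e : V × V} (he : e ∈ D) :
    edgeVec ⟨univ, D⟩ (fun v w => vBlock γ (fiber π v) (fiber π w)) e =
    ∑ k with π k ∈ side D e, vVert γ k := by
  rw [edgeVec, sum_sides hD he]
  · simp only [sum_vBlock]
    have := sum_fiberwise_of_maps_to (s := univ.filter fun k => π k ∈ side D e)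
      (t := side D e) (g := π) (fun k hk => (mem_filter.1 hk).2) fun k => vVert γ k
    rw [← this]; refine sum_congr rfl fun v hv => sum_congr ?_ fun _ _ => rfl; ext k
    simp only [fiber, mem_filter_univ]; grind
  · intro i j; exact vBlock_swap γ _ _

lemma flow_pushSum_eq {V : Type} [Fintype V] (π : Fin n → V) (D : Arcs V) (e : V × V)
    (c : Fin n → ℝ) : flow D e (pushSum π c) = ∑ k with π k ∈ side D e, c k := by
  rw [flow_apply]; simp only [pushSum_apply]
  have := sum_fiberwise_of_maps_to (s := univ.filter fun k => π k ∈ side D e)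
    (t := side D e) (g := π) (fun k hk => (mem_filter.1 hk).2) c
  rw [← this]; refine sum_congr rfl fun v hv => sum_congr ?_ fun _ _ => rfl; grind

lemma dot_edgeVec (hκ : IsAmpleCone κ ample) {V : Type} [Fintype V] (γ : Charges n b)
    (π : Fin n → V) {D : Arcs V} (hD : IsOTree D) {e : V × V} (he : e ∈ D) (x : Vec n b) :
    dot κ γ (edgeVec ⟨univ, D⟩ (fun v w => vBlock γ (fiber π v) (fiber π w)) e) x =
    flow D e (pushSum π (Xmap κ γ x)) := by
  rw [edgeVec_eq γ π hD he, dot_sum_left hκ, flow_pushSum_eq]; rfl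

lemma vPair_eq_vBlock (γ : Charges n b) :
    vPair γ = fun i j => vBlock γ (fiber id i) (fiber id j) := by
  funext i j; simp [vBlock, fiber, filter_eq']

lemma dot_edgeVec_pos (hκ : IsAmpleCone κ ample) {V : Type} [Fintype V] {γ : Charges n b}
    (hγ : ∀ i, (γ i).1 ∈ ample) {π : Fin n → V} (hπ : Surjective π)
    {D : Arcs V} (hD : IsOTree D) {y : D → ℝ} (hy : y ≠ 0) : 0 < dot κ γ
    (∑ e, y e • edgeVec ⟨univ, D⟩ (fun v w => vBlock γ (fiber π v) (fiber π w)) e.1)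
    (∑ e, y e • edgeVec ⟨univ, D⟩ (fun v w => vBlock γ (fiber π v) (fiber π w)) e.1) := by
  obtain ⟨e₀, he₀⟩ := Function.ne_iff.1 hy
  let C : V → ℝ := fun v => ∑ e : D, if v ∈ side D e.1 then y e else 0
  have hite : ∀ (a c : Prop) [Decidable a] [Decidable c] (r : ℝ), (if a then r else 0) - (if c then r else 0) =
      r * ((if a then 1 else 0) - if c then 1 else 0) := by
    intro a c _ _ r; split_ifs <;> ring
  have hC : C e₀.1.1 - C e₀.1.2 = y e₀ := by
    simp only [C, ← sum_sub_distrib]; rw [sum_eq_single e₀]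
    · have := flow_dv hD.1 e₀.2 e₀.2; rw [flow_apply, sum_dv] at this
      rw [hite, this, if_pos rfl, mul_one]
    · intro e _ hne; have := flow_dv hD.1 e.2 e₀.2; rw [flow_apply, sum_dv] at this
      rw [hite, this, if_neg fun h => hne (Subtype.ext h.symm), mul_zero]
    · simp
  have hW : ∑ e, y e • edgeVec ⟨univ, D⟩
      (fun v w => vBlock γ (fiber π v) (fiber π w)) e.1 = ∑ k, C (π k) • vVert γ k := by
    simp only [C, sum_smul]; rw [sum_comm]; refine sum_congr rfl fun e _ => ?_
    rw [edgeVec_eq γ π hD e.2, smul_sum, sum_filter]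
    exact sum_congr rfl fun k _ => by split_ifs <;> simp
  have hq : dot κ γ (∑ k, C (π k) • vVert γ k) (∑ k, C (π k) • vVert γ k) =
      ∑ k, ∑ l, C (π k) * dot κ γ (vVert γ k) (vVert γ l) * C (π l) := by
    rw [dot_sum_left hκ]; refine sum_congr rfl fun k _ => ?_; rw [← dotL_apply, map_sum]
    refine sum_congr rfl fun l _ => ?_
    rw [dotL_apply, dot_smul_left hκ, ← dotL_apply, map_smul, dotL_apply, smul_eq_mul]; ring
  rw [hW, hq]; obtain ⟨i, hi⟩ := hπ e₀.1.1; obtain ⟨j, hj⟩ := hπ e₀.1.2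
  refine quad_pos hκ hγ (c := fun k => C (π k)) (i := i) (j := j) ?_; simp only [hi, hj]; intro h
  simp_all

end

/-! ## Positive definite families -/

open scoped MatrixOrder in
lemma exists_isOrthonormalBasisOfSpan {n b : ℕ} {κ : Triples b}
    {ample : Set (Fin b → ℝ)} (hκ : IsAmpleCone κ ample) {ι : Type} [Fintype ι]
    (γ : Charges n b) (v : ι → Vec n b)
    (hv : ∀ y : ι → ℝ, y ≠ 0 → 0 < dot κ γ (∑ i, y i • v i) (∑ i, y i • v i)) :
    ∃ B : ι → Vec n b, IsOrthonormalBasisOfSpan κ γ v B := by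
  have hdd : ∀ y z : ι → ℝ, dot κ γ (∑ i, y i • v i) (∑ j, z j • v j) =
      ∑ i, ∑ j, y i * dot κ γ (v i) (v j) * z j := by
    intro y z; rw [dot_sum_left hκ]; refine sum_congr rfl fun k _ => ?_; rw [← dotL_apply, map_sum]
    refine sum_congr rfl fun l _ => ?_
    rw [dotL_apply, dot_smul_left hκ, ← dotL_apply, map_smul, dotL_apply, smul_eq_mul]; ring
  let A : Matrix ι ι ℝ := Matrix.of fun i j => dot κ γ (v i) (v j)
  have hA : A.PosDef := by
    refine Matrix.PosDef.of_dotProduct_mulVec_pos ?_ fun y hy => ?_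
    · ext k l; simp [A, Matrix.conjTranspose_apply, dot_comm hκ γ (v l)]
    · have := hv y hy; rw [hdd] at this
      have h2 : star y ⬝ᵥ A.mulVec y = ∑ i, ∑ j, y i * dot κ γ (v i) (v j) * y j := by
        simp only [dotProduct, Matrix.mulVec, A, Matrix.of_apply, mul_sum,
          Pi.star_apply, star_trivial]
        exact sum_congr rfl fun k _ => sum_congr rfl fun l _ => by ring
      grind
  obtain ⟨C, hC⟩ := CStarAlgebra.nonneg_iff_eq_star_mul_self.mp hA.posSemidef.nonneg
  have hCdet : IsUnit C.det := by
    have h1 := hA.det_pos; rw [hC, Matrix.det_mul] at h1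
    exact isUnit_iff_ne_zero.2 fun h => by simp_all
  have hCC : C * C⁻¹ = 1 := Matrix.mul_nonsing_inv _ hCdet
  have hCC' : C⁻¹ * C = 1 := Matrix.nonsing_inv_mul _ hCdet
  have hgram : ∀ i k, dot κ γ (∑ j, C⁻¹ j i • v j) (∑ j, C⁻¹ j k • v j) =
      (1 : Matrix ι ι ℝ) i k := by
    intro i k
    have h1 : (C⁻¹).transpose * A * C⁻¹ = 1 := by
      rw [hC, Matrix.star_eq_conjTranspose, Matrix.mul_assoc, Matrix.mul_assoc, hCC, Matrix.mul_one]
      have : C.conjTranspose = C.transpose := by ext; simp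
      rw [this, ← Matrix.transpose_mul, hCC, Matrix.transpose_one]
    rw [← h1, hdd]
    simp only [Matrix.mul_apply, Matrix.transpose_apply, A, Matrix.of_apply, sum_mul]; rw [sum_comm]
  refine ⟨fun i => ∑ j, C⁻¹ j i • v j, ?_, ?_, ?_⟩
  · intro i; rw [hgram, Matrix.one_apply_eq]
  · simp_all
  · apply le_antisymm
    · rw [Submodule.span_le]; rintro _ ⟨i, rfl⟩
      exact Submodule.sum_mem _ fun j _ => Submodule.smul_mem _ _ (Submodule.subset_span ⟨j, rfl⟩)
    · rw [Submodule.span_le]; rintro _ ⟨j, rfl⟩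
      have : v j = ∑ i, C i j • ∑ l, C⁻¹ l i • v l := by
        simp only [smul_sum, smul_smul]; rw [sum_comm]
        have h2 : ∀ l, ∑ i, (C i j * C⁻¹ l i) • v l = (1 : Matrix ι ι ℝ) l j • v l := by
          intro l; rw [← hCC', Matrix.mul_apply, sum_smul]
          exact sum_congr rfl fun i _ => by rw [mul_comm]
        simp [h2, Matrix.one_apply]
      rw [SetLike.mem_coe, this]
      exact Submodule.sum_mem _ fun i _ => Submodule.smul_mem _ _ (Submodule.subset_span ⟨i, rfl⟩)

/-- The boosted error function of a positive definite family as a generalized error function. -/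
lemma boostedErf_eq_genErf {n b : ℕ} {κ : Triples b}
    {ample : Set (Fin b → ℝ)} (hκ : IsAmpleCone κ ample) {ι : Type} [Fintype ι]
    (γ : Charges n b) (v : ι → Vec n b)
    (hv : ∀ y : ι → ℝ, y ≠ 0 → 0 < dot κ γ (∑ i, y i • v i) (∑ i, y i • v i)) :
    ∃ (M : Matrix ι ι ℝ) (B : ι → Vec n b), (∀ i j, ∑ k, M k i * M k j = dot κ γ (v i) (v j)) ∧
    (∀ x j, ∑ i, M i j * dot κ γ (B i) x = dot κ γ (v j) x) ∧
    ∀ x, boostedErf κ γ v x = genErf M fun i => dot κ γ (B i) x := by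
  have h := exists_isOrthonormalBasisOfSpan hκ γ v hv; obtain ⟨h1, h2, h3⟩ := h.choose_spec
  set B := h.choose
  have hexp : ∀ j, v j = ∑ i, dot κ γ (B i) (v j) • B i := by
    intro j; have hmem : v j ∈ Submodule.span ℝ (Set.range B) := h3 ▸ Submodule.subset_span ⟨j, rfl⟩
    obtain ⟨a, ha⟩ := (Submodule.mem_span_range_iff_exists_fun ℝ).1 hmem; rw [← ha]
    refine sum_congr rfl fun i _ => ?_; congr 1; rw [← dotL_apply, map_sum, sum_eq_single i]
    · rw [map_smul, dotL_apply, h1, smul_eq_mul, mul_one]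
    · intro k _ hk; rw [map_smul, dotL_apply, h2 i k hk.symm, smul_zero]
    · simp
  have hx : ∀ x j, ∑ i, dot κ γ (B i) (v j) * dot κ γ (B i) x = dot κ γ (v j) x := by
    intro x j
    conv_rhs => rw [hexp j, dot_sum_left hκ]
    exact sum_congr rfl fun i _ => (dot_smul_left hκ γ _ _ _).symm
  refine ⟨Matrix.of fun i j => dot κ γ (B i) (v j), B, ?_, hx, ?_⟩
  · intro i j; exact hx (v j) i
  · intro x; rw [boostedErf, dif_pos h]

/-! ## The standard Gaussian measure -/

section

variable {ι ι' α : Type} [Fintype ι] [Fintype ι'] [Fintype α]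

/-- The Gaussian weight `exp(-π |w|²)`. -/
def gaussWeight (w : ι → ℝ) : ℝ := exp (-Real.pi * ∑ i, w i ^ 2)

lemma gaussWeight_pos (w : ι → ℝ) : 0 < gaussWeight w := Real.exp_pos _

lemma gaussWeight_eq_prod (w : ι → ℝ) : gaussWeight w = ∏ i, exp (-Real.pi * w i ^ 2) := by
  rw [gaussWeight, mul_sum, Real.exp_sum]

lemma continuous_gaussWeight : Continuous (gaussWeight : (ι → ℝ) → ℝ) := by
  unfold gaussWeight; fun_prop

lemma integrable_gaussWeight : Integrable (gaussWeight : (ι → ℝ) → ℝ) := by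
  have : (gaussWeight : (ι → ℝ) → ℝ) = fun w => ∏ i, exp (-Real.pi * w i ^ 2) := by
    funext w; exact gaussWeight_eq_prod w
  rw [this]; exact Integrable.fintype_prod fun _ => integrable_exp_neg_mul_sq Real.pi_pos

/-- The standard Gaussian measure, of density `exp(-π |w|²)`. -/
def stdGauss (ι : Type) [Fintype ι] : Measure (ι → ℝ) :=
  volume.withDensity fun w => ENNReal.ofReal (gaussWeight w)

lemma integral_stdGauss {E : Type*} [NormedAddCommGroup E] [NormedSpace ℝ E]
    (f : (ι → ℝ) → E) : ∫ w, f w ∂stdGauss ι = ∫ w, gaussWeight w • f w := by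
  have h := integral_withDensity_eq_integral_smul (μ := (volume : Measure (ι → ℝ)))
    (f := fun w => Real.toNNReal (gaussWeight w))
    (continuous_gaussWeight.measurable.real_toNNReal) f
  rw [stdGauss]; refine h.trans (integral_congr_ae (ae_of_all _ fun w => ?_))
  simp only [NNReal.smul_def, Real.coe_toNNReal _ (gaussWeight_pos w).le]

instance isFiniteMeasure_stdGauss : IsFiniteMeasure (stdGauss ι) :=
  isFiniteMeasure_withDensity_ofReal integrable_gaussWeight.2

lemma linear_eq_sum (L : (ι → ℝ) →ₗ[ℝ] ℝ) (w : ι → ℝ) : L w = ∑ k, L (Pi.single k 1) * w k := by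
  conv_lhs => rw [← univ_sum_single w, map_sum]
  refine sum_congr rfl fun k _ => ?_
  rw [← mul_one (w k), ← smul_eq_mul (w k), Pi.single_smul, map_smul]; simp [mul_comm]

lemma charFunDual_stdGauss (L : StrongDual ℝ (ι → ℝ)) : charFunDual (stdGauss ι) L =
    ((exp (-(∑ k, L (Pi.single k 1) ^ 2) / (4 * Real.pi)) : ℝ) : ℂ) := by
  rw [charFunDual_apply, integral_stdGauss]
  have h := GaussianFourier.integral_cexp_neg_mul_sum_add (ι := ι) (b := (Real.pi : ℂ))
    (by simpa using Real.pi_pos) fun k => (L (Pi.single k 1) : ℂ) * Complex.I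
  have h1 : ((Real.pi : ℂ) / Real.pi) ^ (Fintype.card ι / 2 : ℂ) = 1 := by
    rw [div_self (by exact_mod_cast Real.pi_ne_zero), Complex.one_cpow]
  rw [h1, one_mul] at h
  have hL : ∀ w : ι → ℝ, L w = ∑ k, L (Pi.single k 1) * w k := linear_eq_sum L.toLinearMap
  have h2 : ∀ w : ι → ℝ, gaussWeight w • Complex.exp (L w * Complex.I) =
      Complex.exp (-(Real.pi : ℂ) * ∑ i, (w i : ℂ) ^ 2 +
        ∑ i, (L (Pi.single i 1) : ℂ) * Complex.I * w i) := by
    intro w; rw [Complex.exp_add, gaussWeight, Complex.real_smul, hL w]; push_cast; congr 2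
    rw [sum_mul]; exact sum_congr rfl fun _ _ => by ring
  simp only [h2, h]; push_cast; congr 1; simp only [mul_pow, Complex.I_sq, ← sum_mul]; ring

instance isProbabilityMeasure_stdGauss : IsProbabilityMeasure (stdGauss ι) := by
  constructor; have h := charFunDual_stdGauss (ι := ι) 0; rw [charFunDual_apply] at h
  simp only [zero_apply, Complex.ofReal_zero, zero_mul, Complex.exp_zero,
    integral_const, ne_eq, OfNat.ofNat_ne_zero, not_false_eq_true, zero_pow, sum_const_zero,
    neg_zero, zero_div, Real.exp_zero, Complex.ofReal_one] at h
  have h2 : (stdGauss ι).real Set.univ = 1 := by have := congrArg Complex.re h; simpa using this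
  rw [Measure.real, ENNReal.toReal_eq_one_iff] at h2; exact h2

lemma linearMap_measurable (A : (ι → ℝ) →ₗ[ℝ] (α → ℝ)) : Measurable A :=
  A.continuous_of_finiteDimensional.measurable

/-- The law of a linear image of the standard Gaussian measure depends only on the covariance. -/
lemma stdGauss_map_eq (A : (ι → ℝ) →ₗ[ℝ] (α → ℝ)) (A' : (ι' → ℝ) →ₗ[ℝ] (α → ℝ))
    (h : ∀ i j, ∑ k, A (Pi.single k 1) i * A (Pi.single k 1) j =
    ∑ k, A' (Pi.single k 1) i * A' (Pi.single k 1) j) :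
    (stdGauss ι).map A = (stdGauss ι').map A' := by
  have key : ∀ {ι : Type} [Fintype ι] (A : (ι → ℝ) →ₗ[ℝ] (α → ℝ)) (L : StrongDual ℝ (α → ℝ)),
      charFunDual ((stdGauss ι).map A) L = ((exp (-(∑ i, ∑ j, L (Pi.single i 1) *
        L (Pi.single j 1) * ∑ k, A (Pi.single k 1) i * A (Pi.single k 1) j) /
          (4 * Real.pi)) : ℝ) : ℂ) := by
    intro ι _ A L; have := charFunDual_map (μ := stdGauss ι) (LinearMap.toContinuousLinearMap A) L
    rw [LinearMap.coe_toContinuousLinearMap'] at this; rw [this, charFunDual_stdGauss]; congr 4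
    have hL : ∀ w : α → ℝ, L w = ∑ k, L (Pi.single k 1) * w k := linear_eq_sum L.toLinearMap
    simp only [ContinuousLinearMap.comp_apply, LinearMap.coe_toContinuousLinearMap']
    simp only [mul_sum]; rw [sum_congr rfl fun k _ => by rw [hL, sq, sum_mul_sum]]
    rw [sum_comm]; refine sum_congr rfl fun i _ => ?_; rw [sum_comm]
    exact sum_congr rfl fun j _ => sum_congr rfl fun k _ => by ring
  have : IsFiniteMeasure ((stdGauss ι).map A) := inferInstance
  have : IsFiniteMeasure ((stdGauss ι').map A') := inferInstance
  refine Measure.ext_of_charFunDual (funext fun L => ?_); rw [key, key]; simp only [h]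

lemma genErf_eq_integral (M : Matrix ι ι ℝ) (u : ι → ℝ) :
    genErf M u = ∫ w, ∏ i, sign (M.transpose.mulVec u i + M.transpose.mulVec w i) ∂stdGauss ι := by
  rw [integral_stdGauss, genErf]; rw [← integral_add_left_eq_self _ u]
  refine integral_congr_ae (ae_of_all _ fun w => ?_)
  simp only [Pi.add_apply, sub_add_cancel_left, neg_sq, gaussWeight, smul_eq_mul, Matrix.mulVec_add]

lemma stdGauss_absolutelyContinuous : stdGauss ι ≪ volume := withDensity_absolutelyContinuous _ _

lemma ae_linear_ne (l : (ι → ℝ) →ₗ[ℝ] ℝ) (hl : l ≠ 0) (c : ℝ) : ∀ᵐ w ∂stdGauss ι, c + l w ≠ 0 := by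
  refine stdGauss_absolutelyContinuous.ae_le ?_
  obtain ⟨w₀, hw₀⟩ : ∃ w₀, l w₀ ≠ 0 := by by_contra! h; exact hl (LinearMap.ext h)
  have h := Measure.addHaar_affineSubspace (volume : Measure (ι → ℝ))
    (AffineSubspace.mk' (-(c / l w₀) • w₀) (LinearMap.ker l)) fun h => by
      have h2 := congrArg AffineSubspace.direction h
      rw [AffineSubspace.direction_mk', AffineSubspace.direction_top, LinearMap.ker_eq_top] at h2
      exact hl h2
  refine measure_mono_null (fun w hw => ?_) h
  simp only [Set.mem_compl_iff, Set.mem_ofPred_eq, not_not] at hw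
  rw [SetLike.mem_coe, AffineSubspace.mem_mk', LinearMap.mem_ker, vsub_eq_sub, map_sub, map_smul,
    smul_eq_mul]
  field_simp; linarith

end

/-! ## Smoothing by Gaussian kernels -/

section

/-- The polynomials of the derivatives of `exp(-π x²)`. -/
def gaussPoly : ℕ → Polynomial ℝ
  | 0 => 1
  | j + 1 => Polynomial.derivative (gaussPoly j) -
      Polynomial.C (2 * Real.pi) * Polynomial.X * gaussPoly j

/-- The derivatives of `exp(-π x²)`. -/
def gaussDeriv (j : ℕ) (x : ℝ) : ℝ := (gaussPoly j).eval x * exp (-Real.pi * x ^ 2)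

lemma gaussDeriv_zero (x : ℝ) : gaussDeriv 0 x = exp (-Real.pi * x ^ 2) := by
  simp [gaussDeriv, gaussPoly]

lemma hasDerivAt_gaussDeriv (j : ℕ) (x : ℝ) :
    HasDerivAt (gaussDeriv j) (gaussDeriv (j + 1) x) x := by
  have h1 := (gaussPoly j).hasDerivAt x
  have h2 : HasDerivAt (fun x : ℝ => exp (-Real.pi * x ^ 2))
      (exp (-Real.pi * x ^ 2) * (-Real.pi * (2 * x))) x := by
    have := (((hasDerivAt_id x).pow 2).const_mul (-Real.pi)).exp; simpa using this
  have h3 := h1.mul h2; refine h3.congr_deriv ?_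
  simp only [gaussDeriv, gaussPoly, Polynomial.eval_sub, Polynomial.eval_mul, Polynomial.eval_C,
    Polynomial.eval_X]
  ring

lemma exists_eval_mul_exp_le (p : Polynomial ℝ) :
    ∃ C : ℝ, 0 ≤ C ∧ ∀ x : ℝ, |p.eval x| * exp (-(Real.pi / 2) * x ^ 2) ≤ C := by
  induction p using Polynomial.induction_on' with
  | add p q hp hq =>
    obtain ⟨C, hC, hp⟩ := hp; obtain ⟨C', hC', hq⟩ := hq
    refine ⟨C + C', add_nonneg hC hC', fun x => ?_⟩; rw [Polynomial.eval_add]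
    have := mul_le_mul_of_nonneg_right (abs_add_le (p.eval x) (q.eval x))
      (Real.exp_pos (-(Real.pi / 2) * x ^ 2)).le
    grind
  | monomial k a =>
    refine ⟨|a| * (1 + k.factorial), by positivity, fun x => ?_⟩
    have h1 : |x| ^ k ≤ 1 + x ^ (2 * k) := by
      have : 0 ≤ (|x| ^ k - 1) ^ 2 := sq_nonneg _
      have h2 : x ^ (2 * k) = (|x| ^ k) ^ 2 := by rw [← pow_mul, mul_comm k, pow_mul, pow_mul, sq_abs]
      have h3 : 0 ≤ |x| ^ k := by positivity
      rw [h2]; nlinarith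
    have h4 : x ^ (2 * k) ≤ k.factorial * exp (Real.pi / 2 * x ^ 2) := by
      have h5 := Real.pow_div_factorial_le_exp (x := Real.pi / 2 * x ^ 2) (by positivity) k
      rw [div_le_iff₀ (by positivity)] at h5
      have h6 : x ^ (2 * k) ≤ (Real.pi / 2 * x ^ 2) ^ k := by
        rw [pow_mul]; refine pow_le_pow_left₀ (sq_nonneg x) ?_ k; have := Real.pi_gt_three
        nlinarith [sq_nonneg x]
      linarith
    have h7 : exp (Real.pi / 2 * x ^ 2) * exp (-(Real.pi / 2) * x ^ 2) = 1 := by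
      rw [← Real.exp_add]; simp
    have h8 : exp (-(Real.pi / 2) * x ^ 2) ≤ 1 := by
      rw [Real.exp_le_one_iff]; have := Real.pi_pos; nlinarith [sq_nonneg x]
    rw [Polynomial.eval_monomial, abs_mul, abs_pow, mul_assoc]
    refine mul_le_mul_of_nonneg_left ?_ (abs_nonneg a)
    calc |x| ^ k * exp (-(Real.pi / 2) * x ^ 2)
        ≤ (1 + k.factorial * exp (Real.pi / 2 * x ^ 2)) * exp (-(Real.pi / 2) * x ^ 2) :=
          mul_le_mul_of_nonneg_right (by linarith) (Real.exp_pos _).le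
      _ = exp (-(Real.pi / 2) * x ^ 2) + k.factorial := by grind
      _ ≤ 1 + k.factorial := by linarith

lemma exists_gaussDeriv_le (j : ℕ) :
    ∃ C : ℝ, 0 ≤ C ∧ ∀ x : ℝ, |gaussDeriv j x| ≤ C * exp (-(Real.pi / 2) * x ^ 2) := by
  obtain ⟨C, hC, h⟩ := exists_eval_mul_exp_le (gaussPoly j); refine ⟨C, hC, fun x => ?_⟩
  have h1 : exp (-Real.pi * x ^ 2) =
      exp (-(Real.pi / 2) * x ^ 2) * exp (-(Real.pi / 2) * x ^ 2) := by
    rw [← Real.exp_add]; ring_nf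
  rw [gaussDeriv, abs_mul, abs_of_pos (Real.exp_pos _), h1, ← mul_assoc]
  exact mul_le_mul_of_nonneg_right (h x) (Real.exp_pos _).le

variable {ι : Type} [Fintype ι]

/-- The partial derivatives of `exp(-π |z|²)`. -/
def gaussKernel (m : ι → ℕ) (z : ι → ℝ) : ℝ := ∏ i, gaussDeriv (m i) (z i)

lemma gaussKernel_zero (z : ι → ℝ) : gaussKernel 0 z = gaussWeight z := by
  simp [gaussKernel, gaussDeriv_zero, gaussWeight_eq_prod]

lemma hasFDerivAt_gaussKernel (m : ι → ℕ) (z : ι → ℝ) : HasFDerivAt (gaussKernel m)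
    (∑ i, gaussKernel (m + Pi.single i 1) z • ContinuousLinearMap.proj (R := ℝ)
        (φ := fun _ : ι => ℝ) i) z := by
  have h : ∀ i : ι, HasFDerivAt (fun z : ι → ℝ => gaussDeriv (m i) (z i))
      (gaussDeriv (m i + 1) (z i) • ContinuousLinearMap.proj (R := ℝ) (φ := fun _ : ι => ℝ) i)
      z := by
    intro i
    exact (hasDerivAt_gaussDeriv (m i) (z i)).comp_hasFDerivAt z
      (ContinuousLinearMap.proj (R := ℝ) (φ := fun _ : ι => ℝ) i).hasFDerivAt
  have h2 := HasFDerivAt.finsetProd (u := univ) fun i _ => h i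
  have h3 : (gaussKernel m : (ι → ℝ) → ℝ) = fun z => ∏ i, gaussDeriv (m i) (z i) := rfl; rw [h3]
  refine h2.congr_fderiv (sum_congr rfl fun i _ => ?_); rw [smul_smul]; congr 1
  rw [gaussKernel, ← mul_prod_erase _ _ (mem_univ i), mul_comm]; congr 1
  · simp
  · refine prod_congr rfl fun j hj => ?_; simp_all

lemma continuous_gaussKernel (m : ι → ℕ) : Continuous (gaussKernel m) :=
  continuous_iff_continuousAt.2 fun z => (hasFDerivAt_gaussKernel m z).continuousAt

lemma exists_gaussKernel_le (m : ι → ℕ) :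
    ∃ C : ℝ, 0 ≤ C ∧ ∀ z, |gaussKernel m z| ≤ C * ∏ i, exp (-(Real.pi / 2) * z i ^ 2) := by
  choose C hC h using fun i => exists_gaussDeriv_le (m i)
  refine ⟨∏ i, C i, prod_nonneg fun i _ => hC i, fun z => ?_⟩
  rw [gaussKernel, abs_prod, ← prod_mul_distrib]
  exact prod_le_prod (fun i _ => abs_nonneg _) fun i _ => h i _

lemma integrable_prod_exp {a : ℝ} (ha : 0 < a) (u : ι → ℝ) :
    Integrable fun w : ι → ℝ => ∏ i, exp (-a * (w i - u i) ^ 2) :=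
  Integrable.fintype_prod (f := fun i x => exp (-a * (x - u i) ^ 2)) fun i =>
    (integrable_exp_neg_mul_sq ha).comp_sub_right (u i)

/-- Smoothing of a function by a kernel. -/
def smoothK (s : (ι → ℝ) → ℝ) (m : ι → ℕ) (u : ι → ℝ) : ℝ :=
  ∫ w, gaussKernel m (w - u) * s w

variable {s : (ι → ℝ) → ℝ}

lemma integrable_gaussKernel_mul (hs : Measurable s) {K : ℝ} (hK : ∀ w, |s w| ≤ K)
    (m : ι → ℕ) (u : ι → ℝ) : Integrable fun w => gaussKernel m (w - u) * s w := by
  obtain ⟨C, hC, h⟩ := exists_gaussKernel_le m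
  refine Integrable.mono' (((integrable_prod_exp (ι := ι) (a := Real.pi / 2)
    (by positivity) u).const_mul C).mul_const K) ?_ (ae_of_all _ fun w => ?_)
  · exact (((continuous_gaussKernel m).comp (continuous_id.sub continuous_const)).measurable.mul
      hs).aestronglyMeasurable
  · rw [Real.norm_eq_abs, abs_mul]
    exact mul_le_mul (h _) (hK w) (abs_nonneg _)
      (mul_nonneg hC (prod_nonneg fun _ _ => (Real.exp_pos _).le))

lemma hasFDerivAt_smoothK (hs : Measurable s) {K : ℝ} (hK : ∀ w, |s w| ≤ K)
    (m : ι → ℕ) (u : ι → ℝ) : HasFDerivAt (smoothK s m)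
    (∑ i, (-smoothK s (m + Pi.single i 1) u) • ContinuousLinearMap.proj (R := ℝ)
        (φ := fun _ : ι => ℝ) i) u := by
  have hK0 : 0 ≤ K := (abs_nonneg _).trans (hK 0)
  choose C hC hCk using fun i : ι => exists_gaussKernel_le (m + Pi.single i 1)
  let F' : (ι → ℝ) → (ι → ℝ) → ((ι → ℝ) →L[ℝ] ℝ) := fun u w =>
    ∑ i, (-(gaussKernel (m + Pi.single i 1) (w - u) * s w)) •
      ContinuousLinearMap.proj (R := ℝ) (φ := fun _ : ι => ℝ) i
  let bd : (ι → ℝ) → ℝ := fun w => ∑ i, (C i * (∏ _j : ι, exp (Real.pi / 2)) * K) *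
    ∏ j, exp (-(Real.pi / 4) * (w j - u j) ^ 2)
  have hproj : ∀ i : ι, ‖ContinuousLinearMap.proj (R := ℝ) (φ := fun _ : ι => ℝ) i‖ ≤ 1 := by
    intro i; refine ContinuousLinearMap.opNorm_le_bound _ zero_le_one fun z => ?_
    rw [one_mul]; exact norm_le_pi_norm z i
  have hmain := hasFDerivAt_integral_of_dominated_of_fderiv_le (μ := volume) (𝕜 := ℝ)
    (F := fun u w => gaussKernel m (w - u) * s w) (F' := F') (x₀ := u) (bound := bd)
    (s := Metric.ball u 1) (Metric.ball_mem_nhds u one_pos)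
    (Eventually.of_forall fun u => (integrable_gaussKernel_mul hs hK m u).aestronglyMeasurable)
    (integrable_gaussKernel_mul hs hK m u) ?_ ?_ ?_ ?_
  · refine hmain.congr_fderiv ?_; simp only [F']; rw [integral_finsetSum]
    · refine sum_congr rfl fun i _ => ?_; rw [integral_smul_const, integral_neg, smoothK]
    · intro i _; exact (integrable_gaussKernel_mul hs hK _ u).neg.smul_const _
  · refine aestronglyMeasurable_fun_sum _ fun i _ => ?_
    exact (integrable_gaussKernel_mul hs hK _ u).neg.aestronglyMeasurable.smul_const _
  · refine ae_of_all _ fun w x hx => ?_; refine (norm_sum_le _ _).trans (sum_le_sum fun i _ => ?_)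
    rw [norm_smul, norm_neg, Real.norm_eq_abs, abs_mul]
    have h1 : ∏ j, exp (-(Real.pi / 2) * (w - x) j ^ 2) ≤
        (∏ _j : ι, exp (Real.pi / 2)) * ∏ j, exp (-(Real.pi / 4) * (w j - u j) ^ 2) := by
      rw [← prod_mul_distrib]; refine prod_le_prod (fun _ _ => (Real.exp_pos _).le) fun j _ => ?_
      rw [← Real.exp_add]; refine Real.exp_le_exp.2 ?_
      have h2 : |x j - u j| < 1 := by
        have := (norm_le_pi_norm (x - u) j).trans_lt (mem_ball_iff_norm.1 hx); simpa using this
      have h3 : (x j - u j) ^ 2 ≤ 1 := by rw [← sq_abs]; nlinarith [abs_nonneg (x j - u j)]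
      have h4 : (w j - u j) ^ 2 ≤ 2 * (w j - x j) ^ 2 + 2 := by
        nlinarith [sq_nonneg ((w j - x j) - (x j - u j))]
      have := Real.pi_pos; simp only [Pi.sub_apply]; nlinarith
    calc |gaussKernel (m + Pi.single i 1) (w - x)| * |s w| *
          ‖ContinuousLinearMap.proj (R := ℝ) (φ := fun _ : ι => ℝ) i‖
        ≤ (C i * ((∏ _j : ι, exp (Real.pi / 2)) *
            ∏ j, exp (-(Real.pi / 4) * (w j - u j) ^ 2))) * K * 1 := by
          refine mul_le_mul (mul_le_mul ((hCk i _).trans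
            (mul_le_mul_of_nonneg_left h1 (hC i))) (hK w) (abs_nonneg _) ?_) (hproj i)
            (norm_nonneg _) ?_
          · exact mul_nonneg (hC i) (by positivity)
          · exact mul_nonneg (mul_nonneg (hC i) (by positivity)) hK0
      _ = _ := by ring
  · refine integrable_finsetSum _ fun i _ => ?_
    exact (integrable_prod_exp (by positivity) u).const_mul _
  · refine ae_of_all _ fun w x _ => ?_
    have h1 := (hasFDerivAt_gaussKernel m (w - x)).comp x ((hasFDerivAt_id x).const_sub w)
    have h2 := h1.mul_const (s w); refine h2.congr_fderiv ?_; ext z; simp [F', mul_sum]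
    exact sum_congr rfl fun i _ => by ring

/-- The decay of a smoothed function whose argument is far from the support. -/
lemma exists_smoothK_le {K : ℝ} (hK : ∀ w, |s w| ≤ K) (m : ι → ℕ) :
    ∃ C : ℝ, ∀ (u : ι → ℝ) (r : ℝ), 0 ≤ r → (∀ w, (∀ i, |w i| < r) → s (u + w) = 0) →
    |smoothK s m u| ≤ C * exp (-(Real.pi / 4) * r ^ 2) := by
  have hK0 : 0 ≤ K := (abs_nonneg _).trans (hK 0); obtain ⟨C, hC, hk⟩ := exists_gaussKernel_le m
  refine ⟨C * K * ∫ z : ι → ℝ, ∏ i, exp (-(Real.pi / 4) * (z i - 0) ^ 2), ?_⟩; intro u r hr h0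
  have h1 : smoothK s m u = ∫ z, gaussKernel m z * s (u + z) := by
    rw [smoothK, ← integral_add_left_eq_self _ u]; simp
  rw [h1, ← Real.norm_eq_abs]; refine (norm_integral_le_integral_norm _).trans ?_
  rw [← integral_const_mul, ← integral_mul_const]
  refine integral_mono_of_nonneg (ae_of_all _ fun _ => norm_nonneg _) ?_ (ae_of_all _ fun z => ?_)
  · exact (((integrable_prod_exp (by positivity) 0).const_mul _).mul_const _)
  · have hnn : 0 ≤ ∏ i, exp (-(Real.pi / 4) * z i ^ 2) := prod_nonneg fun _ _ => (Real.exp_pos _).le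
    simp only [sub_zero, Real.norm_eq_abs, abs_mul]; by_cases hz : ∀ i, |z i| < r
    · rw [h0 z hz, abs_zero, mul_zero]
      exact mul_nonneg (mul_nonneg (mul_nonneg hC hK0) hnn) (Real.exp_pos _).le
    · push Not at hz; obtain ⟨i, hi⟩ := hz
      have h2 : ∏ i, exp (-(Real.pi / 2) * z i ^ 2) ≤
          (∏ i, exp (-(Real.pi / 4) * z i ^ 2)) * exp (-(Real.pi / 4) * r ^ 2) := by
        have h3 : ∏ i, exp (-(Real.pi / 2) * z i ^ 2) = (∏ i, exp (-(Real.pi / 4) * z i ^ 2)) *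
              ∏ i, exp (-(Real.pi / 4) * z i ^ 2) := by
          rw [← prod_mul_distrib]; exact prod_congr rfl fun j _ => by rw [← Real.exp_add]; ring_nf
        rw [h3]; refine mul_le_mul_of_nonneg_left ?_ hnn
        rw [← Real.exp_sum, Real.exp_le_exp, ← mul_sum]
        have h4 : r ^ 2 ≤ ∑ j, z j ^ 2 := by
          refine le_trans ?_ (single_le_sum (f := fun j => z j ^ 2)
            (fun j _ => sq_nonneg (z j)) (mem_univ i))
          rw [← sq_abs (z i)]; exact pow_le_pow_left₀ hr hi 2
        have := Real.pi_pos; nlinarith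
      calc |gaussKernel m z| * |s (u + z)|
          ≤ (C * ∏ i, exp (-(Real.pi / 2) * z i ^ 2)) * K :=
            mul_le_mul (hk z) (hK _) (abs_nonneg _) (mul_nonneg hC
              (prod_nonneg fun _ _ => (Real.exp_pos _).le))
        _ ≤ (C * ((∏ i, exp (-(Real.pi / 4) * z i ^ 2)) *
              exp (-(Real.pi / 4) * r ^ 2))) * K :=
            mul_le_mul_of_nonneg_right (mul_le_mul_of_nonneg_left h2 hC) hK0
        _ = _ := by ring

/-- The span of all derivatives of a smoothed function, as functions on a space mapped to the
space of its arguments. -/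
def smoothSpan {E : Type} [NormedAddCommGroup E] [NormedSpace ℝ E] (s : (ι → ℝ) → ℝ)
    (L : E →L[ℝ] (ι → ℝ)) : Submodule ℝ (E → ℝ) :=
  Submodule.span ℝ (Set.range fun m : ι → ℕ => fun x => smoothK s m (L x))

variable {E : Type} [NormedAddCommGroup E] [NormedSpace ℝ E] {L : E →L[ℝ] (ι → ℝ)}

lemma differentiable_of_mem_smoothSpan (hs : Measurable s) {K : ℝ} (hK : ∀ w, |s w| ≤ K)
    {G : E → ℝ} (hG : G ∈ smoothSpan s L) :
    Differentiable ℝ G ∧ ∀ h, (fun x => fderiv ℝ G x h) ∈ smoothSpan s L := by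
  induction hG using Submodule.span_induction with
  | mem G hG =>
    obtain ⟨m, rfl⟩ := hG
    have h1 : ∀ x, HasFDerivAt (fun x => smoothK s m (L x)) _ x := fun x =>
      (hasFDerivAt_smoothK hs hK m (L x)).comp x L.hasFDerivAt
    refine ⟨fun x => (h1 x).differentiableAt, fun h => ?_⟩
    have h2 : (fun x => fderiv ℝ (fun x => smoothK s m (L x)) x h) =
        ∑ i, (-(L h i)) • fun x => smoothK s (m + Pi.single i 1) (L x) := by
      funext x; rw [(h1 x).fderiv]; simp [mul_comm]
    rw [h2]
    exact Submodule.sum_mem _ fun i _ => Submodule.smul_mem _ _ (Submodule.subset_span ⟨_, rfl⟩)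
  | zero =>
    refine ⟨differentiable_const (0 : ℝ), fun h => ?_⟩
    have : (fun x => fderiv ℝ (0 : E → ℝ) x h) = 0 := by
      funext x
      have : fderiv ℝ (0 : E → ℝ) x = 0 := by
        have := fderiv_const_apply (𝕜 := ℝ) (E := E) (x := x) (0 : ℝ); exact this
      rw [this]; rfl
    simp_all
  | add G G' _ _ h h' =>
    refine ⟨h.1.add h'.1, fun v => ?_⟩
    have : (fun x => fderiv ℝ (G + G') x v) =
        (fun x => fderiv ℝ G x v) + fun x => fderiv ℝ G' x v := by
      funext x; rw [fderiv_add (h.1 x) (h'.1 x)]; rfl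
    rw [this]; exact Submodule.add_mem _ (h.2 v) (h'.2 v)
  | smul a G _ h =>
    refine ⟨h.1.const_smul a, fun v => ?_⟩
    have : (fun x => fderiv ℝ (a • G) x v) = a • fun x => fderiv ℝ G x v := by
      funext x; rw [fderiv_const_smul (h.1 x)]; rfl
    rw [this]; exact Submodule.smul_mem _ _ (h.2 v)

lemma contDiff_of_mem_smoothSpan [FiniteDimensional ℝ E] (hs : Measurable s) {K : ℝ}
    (hK : ∀ w, |s w| ≤ K) {G : E → ℝ} (hG : G ∈ smoothSpan s L) : ContDiff ℝ ∞ G := by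
  rw [contDiff_infty]; intro k
  induction k generalizing G with
  | zero => exact contDiff_zero.2 (differentiable_of_mem_smoothSpan hs hK hG).1.continuous
  | succ k ih =>
    have h := differentiable_of_mem_smoothSpan hs hK hG
    have := (contDiff_succ_iff_fderiv_apply (𝕜 := ℝ) (n := (k : WithTop ℕ∞)) (f := G)).2
      ⟨h.1, fun hk => absurd hk (by simp), fun y => ih (h.2 y)⟩
    exact_mod_cast this

lemma exists_bound_of_mem_smoothSpan {K : ℝ} (hK : ∀ w, |s w| ≤ K)
    {G : E → ℝ} (hG : G ∈ smoothSpan s L) :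
    ∃ C : ℝ, ∀ (x : E) (r : ℝ), 0 ≤ r → (∀ w, (∀ i, |w i| < r) → s (L x + w) = 0) →
    |G x| ≤ C * exp (-(Real.pi / 4) * r ^ 2) := by
  induction hG using Submodule.span_induction with
  | mem G hG =>
    obtain ⟨m, rfl⟩ := hG; obtain ⟨C, h⟩ := exists_smoothK_le hK m
    exact ⟨C, fun x r hr h0 => h _ r hr h0⟩
  | zero => exact ⟨0, fun x r _ _ => by simp⟩
  | add G G' _ _ h h' =>
    obtain ⟨C, h⟩ := h; obtain ⟨C', h'⟩ := h'; refine ⟨C + C', fun x r hr h0 => ?_⟩; rw [add_mul]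
    exact (abs_add_le _ _).trans (add_le_add (h x r hr h0) (h' x r hr h0))
  | smul a G _ h =>
    obtain ⟨C, h⟩ := h; refine ⟨|a| * C, fun x r hr h0 => ?_⟩
    rw [Pi.smul_apply, smul_eq_mul, abs_mul, mul_assoc]
    exact mul_le_mul_of_nonneg_left (h x r hr h0) (abs_nonneg a)

end

/-! ## Gaussian noise on the vertices of a weighted complete graph -/

section

variable {V V' : Type} [Fintype V] [Fintype V']
variable {t : V → V → ℝ}

/-- The projection to vectors of sum zero. -/
def meanFree : (V → ℝ) →ₗ[ℝ] (V → ℝ) where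
  toFun c := fun v => c v - (∑ k, c k) / Fintype.card V
  map_add' c c' := by
    funext v; simp only [Pi.add_apply, sum_add_distrib]; ring
  map_smul' r c := by
    funext v
    simp only [Pi.smul_apply, smul_eq_mul, ← mul_sum, RingHom.id_apply]; ring

lemma meanFree_of_sum {c : V → ℝ} (hc : ∑ k, c k = 0) : meanFree c = c := by
  funext v; simp [meanFree, hc]

lemma meanFree_dv (e : V × V) : meanFree (dv e) = dv e := meanFree_of_sum (sum_univ_dv e)

lemma sum_meanFree (c : V → ℝ) : ∑ k, meanFree c k = 0 := by
  simp only [meanFree, LinearMap.coe_mk, AddHom.coe_mk, sum_sub_distrib, sum_const,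
    card_univ, nsmul_eq_mul]
  rcases isEmpty_or_nonempty V with h | h
  · simp
  · field_simp; ring

lemma meanFree_one : meanFree (fun _ : V => (1 : ℝ)) = 0 := by
  funext v; have : Nonempty V := ⟨v⟩; simp [meanFree]

/-- Symmetric positive weights on the edges of a complete graph. -/
def IsWeight (t : V → V → ℝ) : Prop := (∀ i j, t i j = t j i) ∧ ∀ i j, 0 < t i j

lemma sum_weight_quad (ht : IsWeight t) (f g : V → ℝ) : ∑ i, f i * ∑ a, t i a * (g i - g a) =
    1 / 2 * ∑ i, ∑ a, t i a * (f i - f a) * (g i - g a) := by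
  have h1 : ∑ i, f i * ∑ a, t i a * (g i - g a) = ∑ i, ∑ a, t i a * (f i * (g i - g a)) := by
    refine sum_congr rfl fun i _ => ?_; rw [mul_sum]; exact sum_congr rfl fun a _ => by ring
  have h2 : ∑ i, ∑ a, t i a * (f i * (g i - g a)) = ∑ i, ∑ a, t i a * (f a * (g a - g i)) := by
    rw [sum_comm]; exact sum_congr rfl fun i _ => sum_congr rfl fun a _ => by rw [ht.1]
  have h3 : ∑ i, ∑ a, t i a * (f i - f a) * (g i - g a) =
      ∑ i, ∑ a, t i a * (f i * (g i - g a)) + ∑ i, ∑ a, t i a * (f a * (g a - g i)) := by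
    simp only [← sum_add_distrib]; exact sum_congr rfl fun i _ => sum_congr rfl fun a _ => by ring
  grind

/-- The covariance matrix of the noise. -/
def noiseCov (t : V → V → ℝ) : Matrix V V ℝ :=
  Matrix.of fun i j => ∑ a, t i a * dv (i, a) j + 1

lemma noiseCov_quad (ht : IsWeight t) (f g : V → ℝ) : ∑ i, ∑ j, f i * noiseCov t i j * g j =
    1 / 2 * ∑ i, ∑ a, t i a * (f i - f a) * (g i - g a) + (∑ i, f i) * ∑ j, g j := by
  rw [← sum_weight_quad ht, sum_mul, ← sum_add_distrib]; refine sum_congr rfl fun i _ => ?_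
  have h : ∀ a, ∑ j, dv (i, a) j * g j = g i - g a := fun a => by
    simp [dv, sub_mul, sum_sub_distrib, Pi.single_apply]
  simp only [← h, mul_sum, noiseCov, Matrix.of_apply]; rw [sum_comm, ← sum_add_distrib]
  refine sum_congr rfl fun j _ => ?_; rw [mul_add, add_mul, mul_one, mul_sum, sum_mul]; grind

open scoped MatrixOrder in
lemma exists_noise (ht : IsWeight t) :
    ∃ L : (V → ℝ) ≃ₗ[ℝ] (V → ℝ), ∀ i j, ∑ k, L (Pi.single k 1) i * L (Pi.single k 1) j =
    noiseCov t i j := by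
  have hA : (noiseCov t).PosDef := by
    refine Matrix.PosDef.of_dotProduct_mulVec_pos ?_ fun y hy => ?_
    · ext i j; rw [Matrix.conjTranspose_apply, star_trivial]
      have h1 := noiseCov_quad ht (Pi.single i 1) (Pi.single j 1)
      have h2 := noiseCov_quad ht (Pi.single j 1) (Pi.single i 1)
      have h3 : ∀ i j : V, ∑ a, ∑ b, (Pi.single i 1 : V → ℝ) a * noiseCov t a b *
          (Pi.single j 1 : V → ℝ) b = noiseCov t i j := by
        intro i j; simp [Pi.single_apply, ite_mul, sum_ite_eq']
      rw [h3] at h1 h2; rw [h1, h2]; congr 1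
      · congr 1; exact sum_congr rfl fun _ _ => sum_congr rfl fun _ _ => by ring
      · ring
    · have h2 : star y ⬝ᵥ (noiseCov t).mulVec y = ∑ i, ∑ j, y i * noiseCov t i j * y j := by
        simp only [dotProduct, Matrix.mulVec, mul_sum, Pi.star_apply, star_trivial]
        exact sum_congr rfl fun k _ => sum_congr rfl fun l _ => by ring
      rw [h2, noiseCov_quad ht]
      have hnn : ∀ i a, 0 ≤ t i a * (y i - y a) * (y i - y a) := fun i a => by
        rw [mul_assoc]; exact mul_nonneg (ht.2 i a).le (mul_self_nonneg _)
      have hnn2 : 0 ≤ ∑ i, ∑ a, t i a * (y i - y a) * (y i - y a) :=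
        sum_nonneg fun i _ => sum_nonneg fun a _ => hnn i a
      by_cases hs : ∑ i, y i = 0
      · obtain ⟨i, hi⟩ := Function.ne_iff.1 hy
        obtain ⟨j, hj⟩ : ∃ j, y i ≠ y j := by
          by_contra! h
          have : ∑ j, y j = Fintype.card V * y i := by
            rw [sum_congr rfl fun j _ => (h j).symm]; simp
          rw [this] at hs
          have hc : (Fintype.card V : ℝ) ≠ 0 := by
            have : Nonempty V := ⟨i⟩; exact_mod_cast Fintype.card_ne_zero
          exact hi ((mul_eq_zero.1 hs).resolve_left hc)
        have : 0 < ∑ i, ∑ a, t i a * (y i - y a) * (y i - y a) :=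
          sum_pos' (fun i _ => sum_nonneg fun a _ => hnn i a)
            ⟨i, mem_univ _, sum_pos' (fun a _ => hnn i a) ⟨j, mem_univ _, by
              rw [mul_assoc]; exact mul_pos (ht.2 i j) (mul_self_pos.2 (sub_ne_zero.2 hj))⟩⟩
        rw [hs]; linarith
      · have := mul_self_pos.2 hs; linarith
  obtain ⟨C, hC⟩ := CStarAlgebra.nonneg_iff_eq_star_mul_self.mp hA.posSemidef.nonneg
  have hCdet : IsUnit C.det := by
    have h1 := hA.det_pos; rw [hC, Matrix.det_mul] at h1
    exact isUnit_iff_ne_zero.2 fun h => by rw [h, mul_zero] at h1; exact lt_irrefl _ h1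
  have hCT : IsUnit C.transpose.det := by rwa [Matrix.det_transpose]
  refine ⟨Matrix.toLin'OfInv (Matrix.nonsing_inv_mul _ hCT) (Matrix.mul_nonsing_inv _ hCT),
    fun i j => ?_⟩
  have h1 : ∀ k i, Matrix.toLin'OfInv (Matrix.nonsing_inv_mul _ hCT)
      (Matrix.mul_nonsing_inv _ hCT) (Pi.single k 1) i = C k i := by
    intro k i; change C.transpose.mulVec (Pi.single k 1) i = C k i
    rw [Matrix.mulVec_single_one]; rfl
  rw [hC, Matrix.star_eq_conjTranspose, Matrix.mul_apply]; simp_all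

/-- A linear automorphism turning the standard Gaussian measure into the noise. -/
def noise (t : V → V → ℝ) : (V → ℝ) ≃ₗ[ℝ] (V → ℝ) :=
  if h : IsWeight t then (exists_noise h).choose else LinearEquiv.refl ℝ _

lemma noise_cov (ht : IsWeight t) (f g : (V → ℝ) →ₗ[ℝ] ℝ) :
    ∑ k, f (meanFree (noise t (Pi.single k 1))) * g (meanFree (noise t (Pi.single k 1))) =
    1 / 2 * ∑ i, ∑ j, t i j * f (dv (i, j)) * g (dv (i, j)) := by
  have hL : ∀ i j, ∑ k, noise t (Pi.single k 1) i * noise t (Pi.single k 1) j = noiseCov t i j := by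
    rw [noise, dif_pos ht]; exact (exists_noise ht).choose_spec
  let F : V → ℝ := fun i => f (meanFree (Pi.single i 1))
  let G : V → ℝ := fun i => g (meanFree (Pi.single i 1))
  have hF : ∀ w, f (meanFree w) = ∑ i, F i * w i := linear_eq_sum (f ∘ₗ meanFree)
  have hG : ∀ w, g (meanFree w) = ∑ i, G i * w i := linear_eq_sum (g ∘ₗ meanFree)
  have hF1 : ∑ i, F i = 0 := by
    have := hF fun _ => 1; rw [meanFree_one, map_zero] at this; simpa using this.symm
  have hFd : ∀ i j, F i - F j = f (dv (i, j)) := by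
    intro i j; rw [← meanFree_dv, dv, map_sub, map_sub]
  have hGd : ∀ i j, G i - G j = g (dv (i, j)) := by
    intro i j; rw [← meanFree_dv, dv, map_sub, map_sub]
  simp only [hF, hG, ← hFd, ← hGd]; have := noiseCov_quad ht F G
  rw [hF1, zero_mul, add_zero] at this; rw [← this]; simp only [sum_mul_sum, ← hL]
  simp only [mul_sum, sum_mul]; rw [sum_comm]; refine sum_congr rfl fun i _ => ?_; rw [sum_comm]
  exact sum_congr rfl fun j _ => sum_congr rfl fun k _ => by ring

/-- The average of a function over the noise around a point. -/
def smear (t : V → V → ℝ) (s : (V → ℝ) → ℝ) (c : V → ℝ) : ℝ :=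
  ∫ w, s (c + noise t w) ∂stdGauss V

lemma smear_congr {s s' : (V → ℝ) → ℝ} {c : V → ℝ}
    (h : ∀ᵐ w ∂stdGauss V, s (c + noise t w) = s' (c + noise t w)) :
    smear t s c = smear t s' c := integral_congr_ae h

lemma noise_measurable (t : V → V → ℝ) : Measurable (noise t) :=
  linearMap_measurable (noise t).toLinearMap

/-- Averages of functions of linear combinations of noise depend only on the covariance. -/
lemma smear_comp_eq {ι : Type} [Fintype ι] {t : V → V → ℝ} {t' : V' → V' → ℝ} (ht : IsWeight t)
    (ht' : IsWeight t') (f : ι → (V → ℝ) →ₗ[ℝ] ℝ) (f' : ι → (V' → ℝ) →ₗ[ℝ] ℝ)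
    (hff : ∀ a b, ∑ i, ∑ j, t i j * f a (dv (i, j)) * f b (dv (i, j)) =
    ∑ i, ∑ j, t' i j * f' a (dv (i, j)) * f' b (dv (i, j)))
    {g : (ι → ℝ) → ℝ} (hg : Measurable g) {c : V → ℝ} {c' : V' → ℝ}
    (hc : ∀ a, f a (meanFree c) = f' a (meanFree c')) :
    smear t (fun x => g fun a => f a (meanFree x)) c =
    smear t' (fun x => g fun a => f' a (meanFree x)) c' := by
  let A : (V → ℝ) →ₗ[ℝ] (ι → ℝ) := LinearMap.pi fun a => f a ∘ₗ meanFree ∘ₗ (noise t).toLinearMap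
  let A' : (V' → ℝ) →ₗ[ℝ] (ι → ℝ) :=
    LinearMap.pi fun a => f' a ∘ₗ meanFree ∘ₗ (noise t').toLinearMap
  have hA : (stdGauss V).map A = (stdGauss V').map A' := by
    refine stdGauss_map_eq A A' fun i j => ?_
    exact (noise_cov ht (f i) (f j)).trans ((congrArg _ (hff i j)).trans
      (noise_cov ht' (f' i) (f' j)).symm)
  let G : (ι → ℝ) → ℝ := fun z => g fun a => f a (meanFree c) + z a
  have hG : Measurable G := hg.comp (by fun_prop)
  have h1 : smear t (fun x => g fun a => f a (meanFree x)) c = ∫ w, G (A w) ∂stdGauss V := by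
    simp only [smear, map_add]; rfl
  have h2 : smear t' (fun x => g fun a => f' a (meanFree x)) c' = ∫ w, G (A' w) ∂stdGauss V' := by
    simp only [smear, map_add, ← hc]; rfl
  rw [h1, h2, ← integral_map (linearMap_measurable A).aemeasurable hG.aestronglyMeasurable, hA,
    integral_map (linearMap_measurable A').aemeasurable hG.aestronglyMeasurable]

lemma measurable_sign : Measurable sign := by
  unfold sign
  exact Measurable.ite measurableSet_Iio measurable_const
    (Measurable.ite measurableSet_Ioi measurable_const measurable_const)

lemma abs_sign_le (x : ℝ) : |sign x| ≤ 1 := by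
  rcases Real.sign_apply_eq x with h | h | h <;> rw [h] <;> simp

lemma genErf_eq_smear {ι : Type} [Fintype ι] {t : V → V → ℝ} (ht : IsWeight t)
    (f : ι → (V → ℝ) →ₗ[ℝ] ℝ) (M : Matrix ι ι ℝ) (u : ι → ℝ) (hM : ∀ a b, ∑ k, M k a * M k b =
    1 / 2 * ∑ i, ∑ j, t i j * f a (dv (i, j)) * f b (dv (i, j)))
    {c : V → ℝ} (hu : ∀ a, ∑ k, M k a * u k = f a (meanFree c)) :
    genErf M u = smear t (fun x => ∏ a, sign (f a (meanFree x))) c := by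
  rw [genErf_eq_integral]
  let A : (V → ℝ) →ₗ[ℝ] (ι → ℝ) := LinearMap.pi fun a => f a ∘ₗ meanFree ∘ₗ (noise t).toLinearMap
  let A' : (ι → ℝ) →ₗ[ℝ] (ι → ℝ) := Matrix.mulVecLin M.transpose
  have hA : (stdGauss ι).map A' = (stdGauss V).map A := by
    refine stdGauss_map_eq A' A fun i j => ?_
    refine Eq.trans ?_ ((hM i j).trans (noise_cov ht (f i) (f j)).symm)
    refine sum_congr rfl fun k _ => ?_; simp [A']
  let G : (ι → ℝ) → ℝ := fun z => ∏ a, sign (f a (meanFree c) + z a)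
  have hG : Measurable G := measurable_fun_prod _ fun a _ => measurable_sign.comp (by fun_prop)
  have h1 : smear t (fun x => ∏ a, sign (f a (meanFree x))) c = ∫ w, G (A w) ∂stdGauss V := by
    simp only [smear, map_add]; rfl
  have h2 : ∫ w, ∏ i, sign (M.transpose.mulVec u i + M.transpose.mulVec w i) ∂stdGauss ι =
      ∫ w, G (A' w) ∂stdGauss ι := by
    refine integral_congr_ae (ae_of_all _ fun w => prod_congr rfl fun a _ => ?_); congr 2
    rw [← hu]; rfl
  rw [h2, h1, ← integral_map (linearMap_measurable A).aemeasurable hG.aestronglyMeasurable, ← hA,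
    integral_map (linearMap_measurable A').aemeasurable hG.aestronglyMeasurable]

lemma ae_noise_ne (t : V → V → ℝ) (f : (V → ℝ) →ₗ[ℝ] ℝ) {e : V × V} (hf : f (dv e) ≠ 0)
    (c : V → ℝ) : ∀ᵐ w ∂stdGauss V, f (meanFree (c + noise t w)) ≠ 0 := by
  have := ae_linear_ne (f ∘ₗ meanFree ∘ₗ (noise t).toLinearMap) (fun h => hf ?_) (f (meanFree c))
  · simp_all
  · have := LinearMap.congr_fun h ((noise t).symm (dv e)); simpa [meanFree_dv] using this

/-! ### Smoothness -/

lemma smear_eq_smoothK (t : V → V → ℝ) (s : (V → ℝ) → ℝ) (c : V → ℝ) :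
    smear t s c = smoothK (fun w => s (noise t w)) 0 ((noise t).symm c) := by
  rw [smear, integral_stdGauss, smoothK, ← integral_add_left_eq_self
    (fun w => gaussKernel 0 (w - (noise t).symm c) * s (noise t w)) ((noise t).symm c)]
  refine integral_congr_ae (ae_of_all _ fun w => ?_); simp [gaussKernel_zero]

/-- The inverse of the noise map composed with a linear map. -/
def noiseInv {E : Type} [NormedAddCommGroup E] [NormedSpace ℝ E] [FiniteDimensional ℝ E]
    (t : V → V → ℝ) (X : E →ₗ[ℝ] (V → ℝ)) : E →L[ℝ] (V → ℝ) :=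
  LinearMap.toContinuousLinearMap ((noise t).symm.toLinearMap ∘ₗ X)

lemma smear_mem_smoothSpan {E : Type} [NormedAddCommGroup E] [NormedSpace ℝ E]
    [FiniteDimensional ℝ E] (t : V → V → ℝ) (s : (V → ℝ) → ℝ) (X : E →ₗ[ℝ] (V → ℝ)) :
    (fun x => smear t s (X x)) ∈ smoothSpan (fun w => s (noise t w)) (noiseInv t X) := by
  refine Submodule.subset_span ⟨0, ?_⟩; funext x; rw [smear_eq_smoothK]; rfl

/-- Measurable functions with values in a bounded interval. -/
def IsBddMeas (s : (V → ℝ) → ℝ) : Prop := Measurable s ∧ ∃ K : ℝ, ∀ w, |s w| ≤ K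

lemma IsBddMeas.comp_noise {s : (V → ℝ) → ℝ} (hs : IsBddMeas s) (t : V → V → ℝ) :
    IsBddMeas fun w => s (noise t w) :=
  ⟨hs.1.comp (noise_measurable t), hs.2.imp fun _ h _ => h _⟩

lemma IsBddMeas.const (a : ℝ) : IsBddMeas fun _ : V → ℝ => a :=
  ⟨measurable_const, |a|, fun _ => le_rfl⟩

lemma IsBddMeas.add {s s' : (V → ℝ) → ℝ} (hs : IsBddMeas s) (hs' : IsBddMeas s') :
    IsBddMeas fun w => s w + s' w := by
  obtain ⟨h, K, hK⟩ := hs; obtain ⟨h', K', hK'⟩ := hs'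
  exact ⟨h.add h', K + K', fun w => (abs_add_le _ _).trans (add_le_add (hK w) (hK' w))⟩

lemma IsBddMeas.mul {s s' : (V → ℝ) → ℝ} (hs : IsBddMeas s) (hs' : IsBddMeas s') :
    IsBddMeas fun w => s w * s' w := by
  obtain ⟨h, K, hK⟩ := hs; obtain ⟨h', K', hK'⟩ := hs'
  exact ⟨h.mul h', K * K', fun w => by
    rw [abs_mul]; exact mul_le_mul (hK w) (hK' w) (abs_nonneg _) ((abs_nonneg _).trans (hK w))⟩

lemma IsBddMeas.sum {ι : Type*} {S : Finset ι} {s : ι → (V → ℝ) → ℝ}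
    (hs : ∀ i ∈ S, IsBddMeas (s i)) : IsBddMeas fun w => ∑ i ∈ S, s i w := by
  induction S using Finset.induction_on with
  | empty => simpa using IsBddMeas.const (V := V) 0
  | insert i S hi ih =>
    simp only [sum_insert hi]
    exact (hs i (mem_insert_self _ _)).add (ih fun j hj => hs j (mem_insert_of_mem hj))

lemma IsBddMeas.prod {ι : Type*} {S : Finset ι} {s : ι → (V → ℝ) → ℝ}
    (hs : ∀ i ∈ S, IsBddMeas (s i)) : IsBddMeas fun w => ∏ i ∈ S, s i w := by
  induction S using Finset.induction_on with
  | empty => simpa using IsBddMeas.const (V := V) 1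
  | insert i S hi ih =>
    simp only [prod_insert hi]
    exact (hs i (mem_insert_self _ _)).mul (ih fun j hj => hs j (mem_insert_of_mem hj))

lemma isBddMeas_sign (f : (V → ℝ) →ₗ[ℝ] ℝ) : IsBddMeas fun c => sign (f c) :=
  ⟨measurable_sign.comp f.continuous_of_finiteDimensional.measurable, 1, fun _ => abs_sign_le _⟩

lemma IsBddMeas.integrable {s : (V → ℝ) → ℝ} (hs : IsBddMeas s) (t : V → V → ℝ) (c : V → ℝ) :
    Integrable (fun w => s (c + noise t w)) (stdGauss V) := by
  obtain ⟨h, K, hK⟩ := hs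
  refine Integrable.of_bound (h.comp (measurable_const.add
    (noise_measurable t))).aestronglyMeasurable K (ae_of_all _ fun w => hK _)

lemma contDiff_smear {E : Type} [NormedAddCommGroup E] [NormedSpace ℝ E]
    [FiniteDimensional ℝ E] (t : V → V → ℝ) {s : (V → ℝ) → ℝ} (hs : IsBddMeas s)
    (X : E →ₗ[ℝ] (V → ℝ)) : ContDiff ℝ ∞ fun x => smear t s (X x) := by
  obtain ⟨h, K, hK⟩ := hs.comp_noise t
  exact contDiff_of_mem_smoothSpan h hK (smear_mem_smoothSpan t s X)

end

/-! ## The error function of a tree -/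

section

variable {n b : ℕ} {κ : Triples b} {ample : Set (Fin b → ℝ)}

lemma isWeight_tW (hκ : IsAmpleCone κ ample) {γ : Charges n b}
    (hγ : ∀ i, (γ i).1 ∈ ample) : IsWeight (tW κ γ) := ⟨tW_comm hκ γ, tW_pos hκ hγ⟩

lemma edgeVec_eq_sum_vPair {V : Type} [Fintype V] (γ : Charges n b) (π : Fin n → V)
    {D : Arcs V} (hD : IsOTree D) {e : V × V} (he : e ∈ D) :
    edgeVec ⟨univ, D⟩ (fun v w => vBlock γ (fiber π v) (fiber π w)) e =
    (1 / 2 : ℝ) • ∑ i, ∑ j, flow D e (pushSum π (dv (i, j))) • vPair γ i j := by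
  rw [edgeVec_eq γ π hD he]; let z : Fin n → ℝ := fun k => if π k ∈ side D e then 1 else 0
  have h1 : ∑ k with π k ∈ side D e, vVert γ k = ∑ i, ∑ j, z i • vPair γ i j := by
    rw [sum_filter]; refine sum_congr rfl fun i _ => ?_; simp only [z, vVert]; split_ifs <;> simp
  have h2 : ∀ i j, flow D e (pushSum π (dv (i, j))) = z i - z j := by
    intro i j; rw [flow_pushSum_eq, sum_dv]; simp [z]
  have h3 : ∑ i, ∑ j, z j • vPair γ i j = -∑ i, ∑ j, z i • vPair γ i j := by
    conv_lhs => rw [sum_comm]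
    simp only [← sum_neg_distrib]
    exact sum_congr rfl fun i _ => sum_congr rfl fun j _ => by rw [vPair_swap, smul_neg]
  simp only [h2, sub_smul, sum_sub_distrib, h3, h1, sub_neg_eq_add, ← two_smul ℝ]; simp_all

lemma dot_edgeVec_edgeVec (hκ : IsAmpleCone κ ample) {V : Type} [Fintype V]
    (γ : Charges n b) (π : Fin n → V) {D : Arcs V} (hD : IsOTree D) {e e' : V × V}
    (he : e ∈ D) (he' : e' ∈ D) :
    dot κ γ (edgeVec ⟨univ, D⟩ (fun v w => vBlock γ (fiber π v) (fiber π w)) e)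
    (edgeVec ⟨univ, D⟩ (fun v w => vBlock γ (fiber π v) (fiber π w)) e') =
    1 / 2 * ∑ i, ∑ j, tW κ γ i j * flow D e (pushSum π (dv (i, j))) *
    flow D e' (pushSum π (dv (i, j))) := by
  rw [dot_edgeVec hκ γ π hD he, edgeVec_eq_sum_vPair γ π hD he']
  simp only [map_smul, map_sum, Xmap_vPair hκ, smul_eq_mul]; grind

/-- The error function of a tree is the average of the product of signs of the flows. -/
lemma treeErf_eq_smear (hκ : IsAmpleCone κ ample) {V : Type} [Fintype V] {γ : Charges n b}
    (hγ : ∀ i, (γ i).1 ∈ ample) {π : Fin n → V} (hπ : Surjective π)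
    {D : Arcs V} (hD : IsOTree D) (x : Vec n b) :
    treeErf κ γ ⟨univ, D⟩ (fun v w => vBlock γ (fiber π v) (fiber π w)) x =
    smear (tW κ γ) (fun c => ∏ e ∈ D, sign (flow D e (pushSum π (meanFree c)))) (Xmap κ γ x) := by
  obtain ⟨M, B, hM, hB, hE⟩ := boostedErf_eq_genErf hκ γ
    (fun e : D => edgeVec ⟨univ, D⟩ (fun v w => vBlock γ (fiber π v) (fiber π w)) e.1)
    fun y hy => dot_edgeVec_pos hκ hγ hπ hD hy
  have h := genErf_eq_smear (isWeight_tW hκ hγ) (fun e : D => flow D e.1 ∘ₗ pushSum π) M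
    (fun i => dot κ γ (B i) x) (fun a b => (hM a b).trans
      (dot_edgeVec_edgeVec hκ γ π hD a.2 b.2)) (c := Xmap κ γ x) fun a => (hB x a).trans (by
        rw [dot_edgeVec hκ γ π hD a.2, meanFree_of_sum (sum_Xmap hκ γ x)]; rfl)
  rw [treeErf, hE, h]; refine congrArg (fun s => smear (tW κ γ) s _) (funext fun c => ?_)
  exact prod_coe_sort D fun e => sign (flow D e (pushSum π (meanFree c)))

end

/-! ## Algebra of differential operators -/

section

variable (E : Type) [NormedAddCommGroup E] [NormedSpace ℝ E]

/-- The space of smooth functions. -/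
def smoothFns : Submodule ℝ (E → ℝ) where
  carrier := {F | ContDiff ℝ ∞ F}
  add_mem' hF hG := by
    rw [Set.mem_ofPred_eq] at *
    exact hF.add hG
  zero_mem' := by
    rw [Set.mem_ofPred_eq]
    exact contDiff_const
  smul_mem' a _ hF := by
    rw [Set.mem_ofPred_eq] at *
    exact hF.const_smul a

variable {E}

lemma mem_smoothFns {F : E → ℝ} : F ∈ smoothFns E ↔ ContDiff ℝ ∞ F := by
  rw [smoothFns, ← SetLike.mem_coe]; simp_all

lemma smoothFns_contDiff (F : smoothFns E) : ContDiff ℝ ∞ F.1 := mem_smoothFns.1 F.2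

lemma smoothFns_differentiable (F : smoothFns E) : Differentiable ℝ F.1 :=
  (smoothFns_contDiff F).differentiable (by simp)

/-- The derivative in a given direction. -/
def dirOp (h : E) : Module.End ℝ (smoothFns E) where
  toFun F := ⟨fun x => fderiv ℝ F.1 x h, mem_smoothFns.2
    (((smoothFns_contDiff F).fderiv_right (m := ∞) (by simp)).clm_apply contDiff_const)⟩
  map_add' F G := by
    ext x
    change fderiv ℝ (F.1 + G.1) x h = _
    rw [fderiv_add (smoothFns_differentiable F x) (smoothFns_differentiable G x)]; rfl
  map_smul' a F := by
    ext x
    change fderiv ℝ (a • F.1) x h = _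
    rw [fderiv_const_smul (smoothFns_differentiable F x)]; rfl

/-- Multiplication by a smooth function. -/
def mulOp (g : smoothFns E) : Module.End ℝ (smoothFns E) where
  toFun F := ⟨fun x => g.1 x * F.1 x,
    mem_smoothFns.2 ((smoothFns_contDiff g).mul (smoothFns_contDiff F))⟩
  map_add' F G := by ext x; exact mul_add _ _ _
  map_smul' a F := by ext x; exact mul_left_comm _ _ _

variable [FiniteDimensional ℝ E] (B : E →ₗ[ℝ] E →ₗ[ℝ] ℝ) (y : E)

/-- The function `x ↦ v · (x - y)`. -/
def linFn (v : E) : smoothFns E :=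
  ⟨fun x => B v (x - y), mem_smoothFns.2 ((LinearMap.toContinuousLinearMap (B v)).contDiff.comp
    (contDiff_id.sub contDiff_const))⟩

/-- The operator `v · (y + l (x - y) + (1/2π) ∂)`. -/
def opL (l : ℝ) (v : E) : Module.End ℝ (smoothFns E) :=
  B v y • 1 + l • mulOp (linFn B y v) + (1 / (2 * Real.pi)) • dirOp v

variable {B y}

lemma opL_apply (l : ℝ) (v : E) (F : smoothFns E) (x : E) : (opL B y l v F).1 x =
    B v y * F.1 x + l * (B v (x - y) * F.1 x) + 1 / (2 * Real.pi) * fderiv ℝ F.1 x v := rfl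

lemma mulOp_linFn_comm (v w : E) : mulOp (linFn B y v) * mulOp (linFn B y w) =
    mulOp (linFn B y w) * mulOp (linFn B y v) := by
  ext F x; exact mul_left_comm _ _ _

lemma dirOp_mul_mulOp (v w : E) : dirOp v * mulOp (linFn B y w) =
    mulOp (linFn B y w) * dirOp v + B w v • 1 := by
  ext F x
  change fderiv ℝ ((fun x => B w (x - y)) * F.1) x v =
    B w (x - y) * fderiv ℝ F.1 x v + B w v * F.1 x
  have h1 : HasFDerivAt (fun x => B w (x - y)) (LinearMap.toContinuousLinearMap (B w)) x :=
    (LinearMap.toContinuousLinearMap (B w)).hasFDerivAt.comp x ((hasFDerivAt_id x).sub_const y)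
  rw [(h1.mul (smoothFns_differentiable F x).hasFDerivAt).fderiv]; simp [mul_comm]

lemma dirOp_comm (v w : E) : (dirOp v * dirOp w : Module.End ℝ (smoothFns E)) =
    dirOp w * dirOp v := by
  ext F x; have h2 : ContDiff ℝ ∞ F.1 := smoothFns_contDiff F
  have hd : DifferentiableAt ℝ (fderiv ℝ F.1) x :=
    (ContDiff.fderiv_right (m := ∞) h2 (by simp)).differentiable (by simp) x
  have key : ∀ v w : E, fderiv ℝ (fun x => fderiv ℝ F.1 x w) x v =
      fderiv ℝ (fderiv ℝ F.1) x v w := by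
    intro v w; rw [fderiv_clm_apply hd (differentiableAt_const w)]; simp
  change fderiv ℝ (fun x => fderiv ℝ F.1 x w) x v = fderiv ℝ (fun x => fderiv ℝ F.1 x v) x w
  rw [key, key]
  exact (h2.contDiffAt.isSymmSndFDerivAt (by simpa using WithTop.coe_le_coe.2 (le_top : (2 : ℕ∞) ≤ ⊤))).eq v w

lemma opL_mul_mulOp (hB : ∀ v w, B v w = B w v) (l : ℝ) (v w : E) :
    opL B y l v * mulOp (linFn B y w) =
    mulOp (linFn B y w) * opL B y l v + (B v w / (2 * Real.pi)) • 1 := by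
  simp only [opL, add_mul, mul_add, smul_mul_assoc, mul_smul_comm, one_mul, mul_one,
    mulOp_linFn_comm v w, dirOp_mul_mulOp, smul_add, smul_smul, hB w v]
  grind

lemma opL_comm (hB : ∀ v w, B v w = B w v) (l : ℝ) (v w : E) :
    opL B y l v * opL B y l w = opL B y l w * opL B y l v := by
  conv_lhs => rw [opL.eq_1 B y l w]
  conv_rhs => rw [opL.eq_1 B y l w]
  simp only [mul_add, add_mul, mul_smul_comm, smul_mul_assoc, mul_one, one_mul, opL_mul_mulOp hB]
  have h : opL B y l v * dirOp w = dirOp w * opL B y l v - (l * B v w) • 1 := by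
    simp only [opL, mul_add, add_mul, mul_smul_comm, smul_mul_assoc, mul_one, one_mul,
      dirOp_mul_mulOp, dirOp_comm v w, smul_add, smul_smul]
    abel
  have h' : (1 / (2 * Real.pi)) • ((l * B v w) • (1 : Module.End ℝ (smoothFns E))) =
      l • ((B v w / (2 * Real.pi)) • (1 : Module.End ℝ (smoothFns E))) := by
    rw [smul_smul, smul_smul]; congr 1; ring
  have h3 : ∀ (r : ℝ) (P Q : Module.End ℝ (smoothFns E)), r • (P - Q) = r • P - r • Q :=
    fun r P Q => smul_sub r P Q
  rw [h, h3, h', smul_add]; abel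

lemma opL_add (l : ℝ) (v w : E) : opL B y l (v + w) = opL B y l v + opL B y l w := by
  ext F x; change (opL B y l (v + w) F).1 x = (opL B y l v F).1 x + (opL B y l w F).1 x
  simp only [opL_apply, map_add, LinearMap.add_apply]; ring

lemma opL_smul (l r : ℝ) (v : E) : opL B y l (r • v) = r • opL B y l v := by
  ext F x; change (opL B y l (r • v) F).1 x = r * (opL B y l v F).1 x
  simp only [opL_apply, map_smul, LinearMap.smul_apply, smul_eq_mul]; ring

lemma opL_neg (l : ℝ) (v : E) : opL B y l (-v) = -opL B y l v := by
  have := opL_smul (B := B) (y := y) l (-1) v; rw [neg_one_smul] at this; rw [this]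
  exact neg_one_smul ℝ (opL B y l v)

lemma opL_sum (l : ℝ) {ι : Type*} (s : Finset ι) (v : ι → E) :
    opL B y l (∑ i ∈ s, v i) = ∑ i ∈ s, opL B y l (v i) := by
  induction s using Finset.induction_on with
  | empty =>
    have := opL_smul (B := B) (y := y) l 0 0; simpa using this
  | insert a s ha ih => rw [sum_insert ha, sum_insert ha, opL_add, ih]

variable (B y)

/-- The ring generated by the operators `opL B y l v` and the scalars. -/
def opRing (_hB : ∀ v w, B v w = B w v) (l : ℝ) : Type :=
  Subring.closure (Set.range (opL B y l) ∪
    Set.range fun r : ℝ => r • (1 : Module.End ℝ (smoothFns E)))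

variable {B} (hB : ∀ v w, B v w = B w v)

instance opRing.commRing (l : ℝ) : CommRing (opRing B y hB l) :=
  Subring.closureCommRingOfComm (by
    rintro _ (⟨v, rfl⟩ | ⟨r, rfl⟩) _ (⟨w, rfl⟩ | ⟨q, rfl⟩)
    · exact opL_comm hB l v w
    · simp_all
    · simp_all
    · simp only [mul_smul_comm, smul_mul_assoc, mul_one, smul_smul, mul_comm])

/-- An operator of the ring as an endomorphism. -/
def opRing.toEnd (l : ℝ) : opRing B y hB l →+* Module.End ℝ (smoothFns E) where
  toFun := Subtype.val
  map_one' := rfl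
  map_mul' _ _ := rfl
  map_zero' := rfl
  map_add' _ _ := rfl

/-- The constants of the ring. -/
def opConst (l r : ℝ) : opRing B y hB l :=
  ⟨r • 1, Subring.subset_closure (Or.inr ⟨r, rfl⟩)⟩

instance opRing.module (l : ℝ) : Module (opRing B y hB l) (smoothFns E) :=
  Module.compHom _ (opRing.toEnd y hB l)

/-- The generators of the ring. -/
def opGen (l : ℝ) (v : E) : opRing B y hB l :=
  ⟨opL B y l v, Subring.subset_closure (Or.inl ⟨v, rfl⟩)⟩

lemma opRing.smul_def (l : ℝ) (r : opRing B y hB l) (F : smoothFns E) :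
    r • F = opRing.toEnd y hB l r F := rfl

lemma opRing.toEnd_injective (l : ℝ) : Injective (opRing.toEnd y hB l) := Subtype.val_injective

lemma opConst_smul (l r : ℝ) (F : smoothFns E) : opConst y hB l r • F = r • F := rfl

lemma opGen_sum (l : ℝ) {ι : Type*} (s : Finset ι) (v : ι → E) :
    opGen y hB l (∑ i ∈ s, v i) = ∑ i ∈ s, opGen y hB l (v i) := by
  refine opRing.toEnd_injective y hB l ?_; rw [map_sum]; exact opL_sum l s v

lemma opGen_neg (l : ℝ) (v : E) : opGen y hB l (-v) = -opGen y hB l v := by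
  refine opRing.toEnd_injective y hB l ?_; rw [map_neg]; exact opL_neg l v

/-- Products of the operators. -/
def opProd {α : Type} (v : α → E) (s : Finset α) (l : ℝ) : Module.End ℝ (smoothFns E) :=
  opRing.toEnd y hB l (∏ e ∈ s, opGen y hB l (v e))

lemma opProd_insert {α : Type} [DecidableEq α] (v : α → E) {s : Finset α} {a : α} (ha : a ∉ s) (l : ℝ) :
    opProd y hB v (insert a s) l = opL B y l (v a) * opProd y hB v s l := by
  rw [opProd, prod_insert ha, map_mul]; rfl

lemma opL_eq (l : ℝ) (v : E) : opL B y l v = opL B y 0 v + l • mulOp (linFn B y v) := by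
  simp only [opL, zero_smul, add_zero]; abel

/-- The derivative of a product of operators with respect to the parameter. -/
def opProdDeriv {α : Type} [DecidableEq α] (v : α → E) (s : Finset α) (l : ℝ) : Module.End ℝ (smoothFns E) :=
  ∑ e ∈ s, mulOp (linFn B y (v e)) * opProd y hB v (s.erase e) l +
    (1 / (4 * Real.pi)) • ∑ e ∈ s, ∑ e' ∈ s.erase e,
      B (v e) (v e') • opProd y hB v ((s.erase e).erase e') l

lemma opProdDeriv_insert {α : Type} [DecidableEq α] (v : α → E) {s : Finset α} {a : α} (ha : a ∉ s) (l : ℝ) :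
    opProdDeriv y hB v (insert a s) l = opL B y l (v a) * opProdDeriv y hB v s l +
    mulOp (linFn B y (v a)) * opProd y hB v s l := by
  have hea : ∀ e ∈ s, a ≠ e := fun e he h => ha (h ▸ he)
  have h1 : ∀ e ∈ s, (insert a s).erase e = insert a (s.erase e) := fun e he =>
    erase_insert_of_ne (hea e he)
  have hn : ∀ e, a ∉ s.erase e := fun e h => ha (mem_of_mem_erase h)
  have hn2 : ∀ e e', a ∉ (s.erase e).erase e' := fun e e' h => hn e (mem_of_mem_erase h)
  have h2 : ∑ e ∈ s, mulOp (linFn B y (v e)) * opProd y hB v ((insert a s).erase e) l =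
      ∑ e ∈ s, mulOp (linFn B y (v e)) * (opL B y l (v a) * opProd y hB v (s.erase e) l) :=
    sum_congr rfl fun e he => by rw [h1 e he, opProd_insert y hB v (hn e)]
  have h3 : ∑ e ∈ s, ∑ e' ∈ (insert a s).erase e,
      B (v e) (v e') • opProd y hB v (((insert a s).erase e).erase e') l =
      ∑ e ∈ s, (B (v a) (v e) • opProd y hB v (s.erase e) l + ∑ e' ∈ s.erase e,
        B (v e) (v e') • (opL B y l (v a) * opProd y hB v ((s.erase e).erase e') l)) := by
    refine sum_congr rfl fun e he => ?_; rw [h1 e he, sum_insert (hn e), erase_insert (hn e), hB]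
    congr 1; refine sum_congr rfl fun e' he' => ?_
    rw [erase_insert_of_ne (hea e' (mem_of_mem_erase he')), opProd_insert y hB v (hn2 e e')]
  have h4 : ∑ e ∈ s, opL B y l (v a) * (mulOp (linFn B y (v e)) * opProd y hB v (s.erase e) l)
      = ∑ e ∈ s, mulOp (linFn B y (v e)) * (opL B y l (v a) * opProd y hB v (s.erase e) l) +
        (1 / (2 * Real.pi)) • ∑ e ∈ s, B (v a) (v e) • opProd y hB v (s.erase e) l := by
    rw [smul_sum, ← sum_add_distrib]; refine sum_congr rfl fun e _ => ?_
    rw [← mul_assoc, opL_mul_mulOp hB, add_mul, mul_assoc, smul_mul_assoc, one_mul, smul_smul,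
      show 1 / (2 * Real.pi) * B (v a) (v e) = B (v a) (v e) / (2 * Real.pi) by ring]
  rw [opProdDeriv, sum_insert ha, sum_insert ha, erase_insert ha, h2, h3,
    opProdDeriv, mul_add, mul_sum, h4, sum_add_distrib]
  simp only [mul_smul_comm, mul_sum]; rw [smul_add, smul_add]
  have h5 : (1 / (2 * Real.pi)) • ∑ e ∈ s, B (v a) (v e) • opProd y hB v (s.erase e) l =
      (1 / (4 * Real.pi)) • (∑ e ∈ s, B (v a) (v e) • opProd y hB v (s.erase e) l) +
      (1 / (4 * Real.pi)) • (∑ e ∈ s, B (v a) (v e) • opProd y hB v (s.erase e) l) := by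
    rw [← add_smul]; congr 1; ring
  rw [h5]; abel

lemma hasDerivAt_opProd {α : Type} [DecidableEq α] (v : α → E) (s : Finset α)
    (θ : Module.End ℝ (smoothFns E) →ₗ[ℝ] ℝ) (l : ℝ) :
    HasDerivAt (fun l => θ (opProd y hB v s l)) (θ (opProdDeriv y hB v s l)) l := by
  induction s using Finset.induction_on generalizing θ with
  | empty =>
    simp only [opProd, opProdDeriv, prod_empty, map_one, sum_empty, smul_zero, add_zero, map_zero]
    exact hasDerivAt_const _ _
  | insert a s ha ih =>
    have h1 := ih (θ ∘ₗ LinearMap.mulLeft ℝ (opL B y 0 (v a)))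
    have h2 := ih (θ ∘ₗ LinearMap.mulLeft ℝ (mulOp (linFn B y (v a))))
    have h3 := h1.add ((hasDerivAt_id l).mul h2)
    have h4 : (fun l => θ (opProd y hB v (insert a s) l)) =
        (fun l => (θ ∘ₗ LinearMap.mulLeft ℝ (opL B y 0 (v a))) (opProd y hB v s l)) +
        fun l => id l * (θ ∘ₗ LinearMap.mulLeft ℝ (mulOp (linFn B y (v a))))
          (opProd y hB v s l) := by
      funext l; rw [opProd_insert y hB v ha, opL_eq y l, add_mul, map_add, smul_mul_assoc, map_smul]
      rfl
    rw [h4]; refine h3.congr_deriv ?_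
    rw [opProdDeriv_insert y hB v ha, opL_eq y l, add_mul, smul_mul_assoc, map_add, map_add, map_smul]
    simp only [LinearMap.comp_apply, LinearMap.mulLeft_apply, id, smul_eq_mul]; ring

/-- The value at `y` of the product of operators applied to a function. -/
def opVal {α : Type} (v : α → E) (s : Finset α) (l : ℝ) (F : smoothFns E) : ℝ :=
  (opProd y hB v s l F).1 y

lemma hasDerivAt_opVal {α : Type} [DecidableEq α] (v : α → E) (s : Finset α) (F : smoothFns E) (l : ℝ) :
    HasDerivAt (fun l => opVal y hB v s l F) ((1 / (4 * Real.pi)) * ∑ e ∈ s, ∑ e' ∈ s.erase e,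
    B (v e) (v e') * opVal y hB v ((s.erase e).erase e') l F) l := by
  let θ : Module.End ℝ (smoothFns E) →ₗ[ℝ] ℝ :=
    { toFun := fun P => (P F).1 y, map_add' := fun _ _ => rfl, map_smul' := fun _ _ => rfl }
  refine (hasDerivAt_opProd y hB v s θ l).congr_deriv ?_
  rw [opProdDeriv, map_add, map_sum, map_smul, map_sum, smul_eq_mul]; rw [sum_eq_zero, zero_add]
  · congr 1; refine sum_congr rfl fun e _ => ?_; rw [map_sum]
    exact sum_congr rfl fun e' _ => by rw [map_smul]; rfl
  · intro e _; change B (v e) (y - y) * _ = 0; grind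

end

/-! ## Pairs of arcs of trees -/

/-- The trees with an ordered pair of distinct arcs. -/
def arcPairs (V : Type) [Fintype V] : Finset (Arcs V × (V × V) × (V × V)) :=
  univ.filter fun t => IsOTree t.1 ∧ t.2.1 ∈ t.1 ∧ t.2.2 ∈ t.1 ∧ t.2.1 ≠ t.2.2

lemma mem_arcPairs {V : Type} [Fintype V] {D : Arcs V} {e e' : V × V} :
    (D, e, e') ∈ arcPairs V ↔ IsOTree D ∧ e ∈ D ∧ e' ∈ D ∧ e ≠ e' := by
  simp [arcPairs]

lemma sum_arcPairs {V : Type} [Fintype V] (h : Arcs V → V × V → V × V → ℝ) :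
    ∑ D ∈ otrees V, ∑ e ∈ D, ∑ e' ∈ D.erase e, h D e e' = ∑ t ∈ arcPairs V, h t.1 t.2.1 t.2.2 := by
  rw [sum_sigma', sum_sigma']; refine sum_bij (fun x _ => (x.1.1, x.1.2, x.2)) ?_ ?_ ?_ ?_
  · rintro ⟨⟨D, e⟩, e'⟩ hx; simp only [mem_sigma, mem_otrees, mem_erase] at hx
    exact mem_arcPairs.2 ⟨hx.1.1, hx.1.2, hx.2.2, hx.2.1.symm⟩
  · grind
  · rintro ⟨D, e, e'⟩ hx; obtain ⟨h1, h2, h3, h4⟩ := mem_arcPairs.1 hx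
    refine ⟨⟨⟨D, e⟩, e'⟩, ?_, rfl⟩; simp only [mem_sigma, mem_otrees, mem_erase]; grind
  · intro _ _; rfl

lemma flipArc_flipArc {V : Type} [Fintype V] {D : Arcs V} (hD : IsForest D) {e : V × V}
    (he : e ∈ D) : flipArc (flipArc D e) e.swap = D := by
  have h : e.swap ∉ D.erase e := fun h => hD.swap_notMem he (mem_of_mem_erase h)
  rw [flipArc, flipArc, erase_insert h, Prod.swap_swap, insert_erase he]

lemma flipArc_erase {V : Type} [Fintype V] {D : Arcs V} (hD : IsForest D) {e : V × V}
    (he : e ∈ D) : (flipArc D e).erase e.swap = D.erase e := by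
  have h : e.swap ∉ D.erase e := fun h => hD.swap_notMem he (mem_of_mem_erase h)
  rw [flipArc, erase_insert h]

/-- A sum over pairs of arcs which vanishes for disjoint arcs and is invariant under the reversal
of arcs and the exchange of the two arcs is determined by the chains. -/
lemma sum_arcPairs_eq {V : Type} [Fintype V] (h : Arcs V → V × V → V × V → ℝ)
    (hsymm : ∀ D e e', h D e e' = h D e' e)
    (hflip : ∀ D e e', IsOTree D → e ∈ D → e' ∈ D → e ≠ e' → h (flipArc D e) e.swap e' = h D e e')
    (hdisj : ∀ D e e', IsOTree D → e ∈ D → e' ∈ D → e.1 ≠ e'.1 → e.1 ≠ e'.2 → e.2 ≠ e'.1 →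
    e.2 ≠ e'.2 → h D e e' = 0) : ∑ t ∈ arcPairs V, h t.1 t.2.1 t.2.2 =
    4 * ∑ x ∈ chains V, h x.1 (x.2.1, x.2.2.1) (x.2.2.1, x.2.2.2) := by
  have hne' : ∀ {D : Arcs V} {e e' : V × V}, IsOTree D → e ∈ D → e' ∈ D → e ≠ e' →
      e.swap ≠ e' := fun hD he he' _ hs => hD.1.swap_notMem he (hs ▸ he')
  have hsplit : ∀ t ∈ arcPairs V, h t.1 t.2.1 t.2.2 =
      (if t.2.1.2 = t.2.2.1 then h t.1 t.2.1 t.2.2 else 0) +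
      (if t.2.1.1 = t.2.2.2 then h t.1 t.2.1 t.2.2 else 0) +
      (if t.2.1.1 = t.2.2.1 then h t.1 t.2.1 t.2.2 else 0) +
      (if t.2.1.2 = t.2.2.2 then h t.1 t.2.1 t.2.2 else 0) := by
    rintro ⟨D, ⟨a, c⟩, ⟨a', c'⟩⟩ ht; obtain ⟨hD, he, he', hne⟩ := mem_arcPairs.1 ht
    have h1 := hD.1.ne he; have h2 := hD.1.ne he'; have h3 := hne' hD he he' hne
    have h4 := hdisj D _ _ hD he he'
    simp only [Prod.swap_prod_mk, ne_eq, Prod.mk.injEq, not_and] at h1 h2 h3 h4 hne ⊢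
    by_cases p1 : c = a' <;> by_cases p2 : a = c' <;> by_cases p3 : a = a' <;>
      by_cases p4 : c = c' <;> simp [p1, p2, p3, p4] <;> grind
  have hswap : ∀ P : V × V → V × V → Prop,
      ∑ t ∈ arcPairs V, (if P t.2.1 t.2.2 then h t.1 t.2.1 t.2.2 else 0) =
      ∑ t ∈ arcPairs V, (if P t.2.2 t.2.1 then h t.1 t.2.1 t.2.2 else 0) := by
    intro P
    have hm : ∀ t ∈ arcPairs V, (t.1, t.2.2, t.2.1) ∈ arcPairs V := fun t ht => by
      obtain ⟨hD, he, he', hne⟩ := mem_arcPairs.1 ht; exact mem_arcPairs.2 ⟨hD, he', he, hne.symm⟩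
    refine sum_nbij' _ _ hm hm (fun _ _ => rfl) (fun _ _ => rfl) ?_; grind
  have hfl : ∀ P : V × V → V × V → Prop,
      ∑ t ∈ arcPairs V, (if P t.2.1 t.2.2 then h t.1 t.2.1 t.2.2 else 0) =
      ∑ t ∈ arcPairs V, (if P t.2.1.swap t.2.2 then h t.1 t.2.1 t.2.2 else 0) := by
    intro P
    have hmem : ∀ t ∈ arcPairs V, (flipArc t.1 t.2.1, t.2.1.swap, t.2.2) ∈ arcPairs V := by
      rintro ⟨D, e, e'⟩ ht; obtain ⟨hD, he, he', hne⟩ := mem_arcPairs.1 ht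
      exact mem_arcPairs.2 ⟨hD.flipArc he, mem_insert_self _ _,
        mem_insert_of_mem (mem_erase.2 ⟨hne.symm, he'⟩), hne' hD he he' hne⟩
    have hinv : ∀ t ∈ arcPairs V,
        (flipArc (flipArc t.1 t.2.1) t.2.1.swap, t.2.1.swap.swap, t.2.2) = t := by
      rintro ⟨D, e, e'⟩ ht; obtain ⟨hD, he, he', hne⟩ := mem_arcPairs.1 ht
      simp only [flipArc_flipArc hD.1 he, Prod.swap_swap]
    refine sum_nbij' (fun t => (flipArc t.1 t.2.1, t.2.1.swap, t.2.2))
      (fun t => (flipArc t.1 t.2.1, t.2.1.swap, t.2.2)) hmem hmem hinv hinv ?_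
    rintro ⟨D, e, e'⟩ ht; obtain ⟨hD, he, he', hne⟩ := mem_arcPairs.1 ht
    simp only [Prod.swap_swap, hflip D e e' hD he he' hne]
  have h1 : ∑ t ∈ arcPairs V, (if t.2.1.2 = t.2.2.1 then h t.1 t.2.1 t.2.2 else 0) =
      ∑ x ∈ chains V, h x.1 (x.2.1, x.2.2.1) (x.2.2.1, x.2.2.2) := by
    rw [← sum_filter]
    refine sum_nbij' (fun t => (t.1, t.2.1.1, t.2.1.2, t.2.2.2))
      (fun x => (x.1, (x.2.1, x.2.2.1), (x.2.2.1, x.2.2.2))) ?_ ?_ ?_ ?_ ?_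
    · rintro ⟨D, ⟨a, c⟩, ⟨a', c'⟩⟩ ht; rw [mem_filter] at ht
      obtain ⟨hD, he, he', hne⟩ := mem_arcPairs.1 ht.1; have hc : c = a' := ht.2; subst hc
      simp only [chains, mem_filter_univ]; exact ⟨hD, he, he'⟩
    · rintro ⟨D, i, j, k⟩ hx; simp only [chains, mem_filter_univ] at hx
      refine mem_filter.2 ⟨mem_arcPairs.2 ⟨hx.1, hx.2.1, hx.2.2, ?_⟩, rfl⟩; have := hx.1.1.ne hx.2.1
      grind
    · grind
    · intro _ _; rfl
    · grind
  have h2 := hswap fun e e' => e.2 = e'.1; have h3 := hfl fun e e' => e.2 = e'.1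
  have h4 := hfl fun e e' => e.1 = e'.2; simp only [Prod.snd_swap, Prod.fst_swap] at h2 h3 h4
  have h2' : ∑ t ∈ arcPairs V, (if t.2.1.1 = t.2.2.2 then h t.1 t.2.1 t.2.2 else 0) =
      ∑ t ∈ arcPairs V, (if t.2.2.2 = t.2.1.1 then h t.1 t.2.1 t.2.2 else 0) := by
    simp only [eq_comm]
  rw [sum_congr rfl hsplit, sum_add_distrib, sum_add_distrib,
    sum_add_distrib, ← h4, ← h3, h2', ← h2, h1]
  ring

/-! ## Independence of the parameter -/

section

variable {V : Type} [Fintype V] {E : Type} [NormedAddCommGroup E] [NormedSpace ℝ E]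
  [FiniteDimensional ℝ E] {B : E →ₗ[ℝ] E →ₗ[ℝ] ℝ} (y : E) (hB : ∀ v w, B v w = B w v)

lemma opVal_neg {α : Type} (v : α → E) (s : Finset α) (l : ℝ) (F : smoothFns E) :
    opVal y hB v s l (-F) = -opVal y hB v s l F := by
  rw [opVal, map_neg]; rfl

lemma opVal_add {α : Type} (v : α → E) (s : Finset α) (l : ℝ) (F G : smoothFns E) :
    opVal y hB v s l (F + G) = opVal y hB v s l F + opVal y hB v s l G := by
  rw [opVal, map_add]; rfl

lemma opVal_zero {α : Type} (v : α → E) (s : Finset α) (l : ℝ) : opVal y hB v s l 0 = 0 := by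
  rw [opVal, map_zero]; rfl

lemma sum_opVal_const (v : V × V → E) (hv : ∀ e, v e.swap = -v e)
    (hdisj : ∀ i j k l, i ≠ k → i ≠ l → j ≠ k → j ≠ l → B (v (i, j)) (v (k, l)) = 0)
    (T : V → V → V → ℝ) (hT : ∀ i j k, T i j k = T j k i)
    (hchain : ∀ i j k, i ≠ j → j ≠ k → i ≠ k → B (v (i, j)) (v (j, k)) = T i j k)
    (Φ : Arcs V → smoothFns E) (hflip : ∀ D, IsOTree D → ∀ e ∈ D, Φ (flipArc D e) = -Φ D)
    (hrot : ∀ x ∈ chains V, Φ x.1 + Φ (rotate x).1 + Φ (rotate (rotate x)).1 = 0) (l l' : ℝ) :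
    ∑ D ∈ otrees V, opVal y hB v D l (Φ D) = ∑ D ∈ otrees V, opVal y hB v D l' (Φ D) := by
  have hderiv : ∀ l, HasDerivAt (fun l => ∑ D ∈ otrees V, opVal y hB v D l (Φ D)) 0 l := by
    intro l; refine (HasDerivAt.fun_sum fun D _ => hasDerivAt_opVal y hB v D (Φ D) l).congr_deriv ?_
    rw [← mul_sum, sum_arcPairs (fun D e e' =>
      B (v e) (v e') * opVal y hB v ((D.erase e).erase e') l (Φ D)), sum_arcPairs_eq
      (fun D e e' => B (v e) (v e') * opVal y hB v ((D.erase e).erase e') l (Φ D))]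
    · rw [sum_chains_eq_zero (fun x => B (v (x.2.1, x.2.2.1)) (v (x.2.2.1, x.2.2.2)) *
        opVal y hB v ((x.1.erase (x.2.1, x.2.2.1)).erase (x.2.2.1, x.2.2.2)) l (Φ x.1)), mul_zero,
        mul_zero]
      have hstep : ∀ x ∈ chains V, ((rotate x).1.erase ((rotate x).2.1, (rotate x).2.2.1)).erase
            ((rotate x).2.2.1, (rotate x).2.2.2) =
          (x.1.erase (x.2.1, x.2.2.1)).erase (x.2.2.1, x.2.2.2) ∧
          B (v ((rotate x).2.1, (rotate x).2.2.1)) (v ((rotate x).2.2.1, (rotate x).2.2.2)) =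
          B (v (x.2.1, x.2.2.1)) (v (x.2.2.1, x.2.2.2)) := by
        rintro ⟨D, i, j, k⟩ hx; simp only [chains, mem_filter_univ] at hx
        obtain ⟨hD, hij, hjk⟩ := hx; have h1 := hD.1.ne hij; have h2 := hD.1.ne hjk
        have hki := (exchange_props hD hij hjk).1
        have h3 : i ≠ k := by rintro rfl; exact hD.1.swap_notMem hij hjk
        simp only [rotate]; refine ⟨?_, ?_⟩
        · rw [erase_right_comm, exchange, erase_insert fun h => hki (mem_of_mem_erase h)]
        · grind
      intro x hx; obtain ⟨a1, a2⟩ := hstep x hx; obtain ⟨b1, b2⟩ := hstep _ (rotate_mem hx)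
      simp only [b1, b2, a1, a2]
      rw [← mul_add, ← mul_add, ← opVal_add, ← opVal_add, hrot x hx, opVal_zero, mul_zero]
    · intro D e e'; simp only [hB (v e) (v e'), erase_right_comm]
    · intro D e e' hD he he' hne
      simp only [flipArc_erase hD.1 he, hflip D hD e he, hv, map_neg, LinearMap.neg_apply,
        opVal_neg, neg_mul_neg]
    · grind
  exact is_const_of_deriv_eq_zero (fun l => (hderiv l).differentiableAt)
    (fun l => (hderiv l).deriv) l l'

end

/-! ## Tree sums of products of signs -/

section

variable {V : Type} [Fintype V]

/-- `∑_K A(D ∖ K) ∏_{e ∈ K} s_e`. -/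
def signSum (s : V × V → ℝ) (D : Arcs V) : ℝ :=
  ∑ K ∈ D.powerset, (sgnAvg (D \ K) univ : ℝ) * ∏ e ∈ K, s e

lemma sum_powerset_insert_sdiff {α M : Type*} [DecidableEq α] [AddCommMonoid M] {a : α}
    {R : Finset α} (ha : a ∉ R) (f : Finset α → Finset α → M) :
    ∑ K ∈ (insert a R).powerset, f (insert a R \ K) K =
    ∑ K ∈ R.powerset, (f (insert a (R \ K)) K + f (R \ K) (insert a K)) := by
  rw [sum_powerset_insert ha, sum_add_distrib]; congr 1
  · refine sum_congr rfl fun K hK => ?_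
    rw [insert_sdiff_of_notMem _ fun h => ha (mem_powerset.1 hK h)]
  · refine sum_congr rfl fun K hK => ?_; rw [insert_sdiff_insert, sdiff_insert_of_notMem ha]

lemma signSum_insert (s : V × V → ℝ) {a : V × V} {R : Arcs V} (ha : a ∉ R) :
    signSum s (insert a R) = ∑ K ∈ R.powerset,
    ((sgnAvg (insert a (R \ K)) univ : ℝ) + sgnAvg (R \ K) univ * s a) * ∏ e ∈ K, s e := by
  rw [signSum, sum_powerset_insert_sdiff ha fun H K => (sgnAvg H univ : ℝ) * ∏ e ∈ K, s e]
  refine sum_congr rfl fun K hK => ?_; grind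

lemma signSum_insert_insert (s : V × V → ℝ) {a c : V × V} {R : Arcs V} (hc : c ∉ R)
    (ha : a ∉ insert c R) : signSum s (insert a (insert c R)) = ∑ K ∈ R.powerset,
    ((sgnAvg (insert a (insert c (R \ K))) univ : ℝ) +
    sgnAvg (insert c (R \ K)) univ * s a + sgnAvg (insert a (R \ K)) univ * s c +
    sgnAvg (R \ K) univ * (s a * s c)) * ∏ e ∈ K, s e := by
  rw [signSum_insert s ha, sum_powerset_insert_sdiff hc fun H K =>
    ((sgnAvg (insert a H) univ : ℝ) + sgnAvg H univ * s a) * ∏ e ∈ K, s e]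
  refine sum_congr rfl fun K hK => ?_; grind

lemma sign_neg_eq (x : ℝ) : sign (-x) = -sign x := Real.sign_neg

/-- The function `c ↦ ∑_K A(D ∖ K) ∏_{e ∈ K} sgn c_e` of a tree. -/
def treeWeight (D : Arcs V) (c : V → ℝ) : ℝ :=
  signSum (fun e => sign (flow D e (meanFree c))) D

lemma isBddMeas_treeWeight (D : Arcs V) : IsBddMeas (treeWeight D) :=
  IsBddMeas.sum fun K _ => (IsBddMeas.const _).mul
    (IsBddMeas.prod fun e (_ : e ∈ K) => isBddMeas_sign (flow D e ∘ₗ meanFree))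

lemma treeWeight_flipArc {D : Arcs V} (hD : IsOTree D) {e : V × V} (he : e ∈ D)
    (c : V → ℝ) : treeWeight (flipArc D e) c = -treeWeight D c := by
  have hs := hD.1.swap_notMem he; have hs' : e.swap ∉ D.erase e := fun h => hs (mem_of_mem_erase h)
  have h0 := sum_meanFree c; obtain ⟨h1, h2⟩ := flow_flipArc hD he h0
  have hD' : D = insert e (D.erase e) := (insert_erase he).symm
  have key : treeWeight D c = signSum (fun e' => sign (flow D e' (meanFree c)))
    (insert e (D.erase e)) := by rw [← hD']; rfl
  rw [key, treeWeight, signSum_insert _ (notMem_erase _ _), flipArc, signSum_insert _ hs',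
    ← sum_neg_distrib]
  refine sum_congr rfl fun K hK => ?_
  have hK' : ∀ e' ∈ K, e' ≠ e ∧ e' ∈ D := fun e' h =>
    mem_erase.1 (mem_powerset.1 hK h)
  change (_ + _ * sign (flow (flipArc D e) e.swap (meanFree c))) *
    ∏ e' ∈ K, sign (flow (flipArc D e) e' (meanFree c)) = _
  rw [h1, prod_congr rfl fun e' h => by rw [h2 e' (hK' e' h).2 (hK' e' h).1],
    sgnAvg_insert_swap (hD.1.ne he) (fun h => notMem_erase e D (sdiff_subset h))
      (fun h => hs' (sdiff_subset h)) (mem_univ _) (mem_univ _), sign_neg_eq]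
  push_cast; ring

lemma sign_cyclic {x z : ℝ} (hx : x ≠ 0) (hz : z ≠ 0) (hxz : z - x ≠ 0) :
    sign x * sign z + sign (z - x) * sign (-x) + sign (-z) * sign (x - z) = 1 := by
  have h := sign_neg_eq (z - x); rw [neg_sub] at h; rw [h, sign_neg_eq, sign_neg_eq]
  rcases hx.lt_or_gt with h1 | h1 <;> rcases hz.lt_or_gt with h2 | h2 <;>
    rcases hxz.lt_or_gt with h3 | h3 <;>
    simp only [Real.sign_of_neg, Real.sign_of_pos, h1, h2, h3] <;> grind

lemma treeWeight_rotate {x : Arcs V × V × V × V} (hx : x ∈ chains V) {c : V → ℝ}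
    (h1 : flow x.1 (x.2.1, x.2.2.1) (meanFree c) ≠ 0)
    (h2 : flow x.1 (x.2.2.1, x.2.2.2) (meanFree c) ≠ 0)
    (h3 : flow (rotate x).1 (x.2.2.1, x.2.2.2) (meanFree c) ≠ 0) :
    treeWeight x.1 c + treeWeight (rotate x).1 c + treeWeight (rotate (rotate x)).1 c = 0 := by
  have hx1 := rotate_mem hx; obtain ⟨D, i, j, k⟩ := x; simp only [chains, mem_filter_univ] at hx
  obtain ⟨hD, hij, hjk⟩ := hx; simp only [chains, rotate, mem_filter_univ] at hx1 h1 h2 h3 ⊢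
  obtain ⟨hD1, hjk1, hki1⟩ := hx1; have hne := hD.1.ne hij; have hne' := hD.1.ne hjk
  have hik : i ≠ k := by rintro rfl; exact hD.1.swap_notMem hij hjk
  obtain ⟨hki, -, hf1⟩ := exchange_props hD hij hjk
  obtain ⟨-, -, hf2⟩ := exchange_props hD1 hjk1 hki1; obtain ⟨a1, a2, a3⟩ := hf1 _ (sum_meanFree c)
  obtain ⟨b1, b2, b3⟩ := hf2 _ (sum_meanFree c); set φ := meanFree c; set D1 := exchange D i j k with hD1def
  set D2 := exchange D1 j k i with hD2def; set R := (D.erase (i, j)).erase (j, k) with hR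
  have nij : (i, j) ∉ R := fun h => notMem_erase _ _ (mem_of_mem_erase h)
  have njk : (j, k) ∉ R := notMem_erase _ _
  have nki : (k, i) ∉ R := fun h => hki (mem_of_mem_erase (mem_of_mem_erase h))
  have hjk' : (j, k) ∈ D.erase (i, j) := by simp [hjk, hne.symm]
  have e0 : D = insert (i, j) (insert (j, k) R) := by rw [hR, insert_erase hjk', insert_erase hij]
  have e1 : D1 = insert (j, k) (insert (k, i) R) := by
    rw [insert_comm, hR, insert_erase hjk', hD1def, exchange]
  have nki' : (j, k) ∉ insert (k, i) R := by grind
  have e2 : D2 = insert (k, i) (insert (i, j) R) := by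
    rw [hD2def, exchange, e1, erase_insert nki', insert_comm]
  have hRD : ∀ e ∈ R, e ≠ (i, j) ∧ e ≠ (j, k) ∧ e ≠ (k, i) ∧ e ∈ D := by
    intro e he; refine ⟨?_, ?_, ?_, mem_of_mem_erase (mem_of_mem_erase he)⟩
    · rintro rfl; exact nij he
    · rintro rfl; exact njk he
    · rintro rfl; exact nki he
  have hRD1 : ∀ e ∈ R, e ∈ D1 := fun e he => by
    rw [e1]; exact mem_insert_of_mem (mem_insert_of_mem he)
  have t : ∀ D S, D = S → treeWeight D c = signSum (fun e => sign (flow D e φ)) S := by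
    rintro D _ rfl; rfl
  rw [t _ _ e0, t _ _ e1, t _ _ e2, signSum_insert_insert _ njk, signSum_insert_insert _ nki nki',
    signSum_insert_insert _ nij, ← sum_add_distrib, ← sum_add_distrib]
  · refine sum_eq_zero fun K hK => ?_; have hKR : ∀ e ∈ K, e ∈ R := fun e h => mem_powerset.1 hK h
    have p1 : ∏ e ∈ K, sign (flow D1 e φ) = ∏ e ∈ K, sign (flow D e φ) :=
      prod_congr rfl fun e h => by obtain ⟨q1, q2, q3, q4⟩ := hRD e (hKR e h); rw [a3 e q4 q1 q2]
    have p2 : ∏ e ∈ K, sign (flow D2 e φ) = ∏ e ∈ K, sign (flow D e φ) :=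
      prod_congr rfl fun e h => by
        obtain ⟨q1, q2, q3, q4⟩ := hRD e (hKR e h)
        rw [b3 e (hRD1 e (hKR e h)) q2 q3, a3 e q4 q1 q2]
    have hA := sgnAvg_chain (R := R \ K) hne hne' hik
      (fun h => nij (sdiff_subset h)) (fun h => njk (sdiff_subset h))
      (fun h => nki (sdiff_subset h)) (mem_univ i) (mem_univ j)
      (mem_univ k)
    have hA' := congrArg (Rat.cast : ℚ → ℝ) hA; push_cast at hA'; rw [a1] at h3
    have hs := sign_cyclic h1 h2 h3; rw [a1] at b1 b2; rw [a2] at b1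
    have b1' : flow D2 (k, i) φ = -flow D (j, k) φ := by rw [b1]; ring
    have b2' : flow D2 (i, j) φ =
        flow D (i, j) φ - flow D (j, k) φ := by
      rw [b2]; ring
    have hneg := sign_neg_eq (flow D (j, k) φ - flow D (i, j) φ)
    rw [neg_sub] at hneg; rw [p1, p2, a1, a2, b1', b2']; rw [hneg] at hs ⊢
    rw [sign_neg_eq, sign_neg_eq] at hs ⊢
    linear_combination (∏ e ∈ K, sign (flow D e φ)) * hA' +
      (∏ e ∈ K, sign (flow D e φ)) * (sgnAvg (R \ K) univ : ℝ) * hs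
  · grind
  grind

lemma smear_add {t : V → V → ℝ} {s s' : (V → ℝ) → ℝ} (hs : IsBddMeas s) (hs' : IsBddMeas s')
    (c : V → ℝ) : smear t (fun w => s w + s' w) c = smear t s c + smear t s' c :=
  integral_add (hs.integrable t c) (hs'.integrable t c)

lemma smear_const_mul {t : V → V → ℝ} (s : (V → ℝ) → ℝ) (r : ℝ) (c : V → ℝ) :
    smear t (fun w => r * s w) c = r * smear t s c := integral_const_mul _ _

lemma smear_zero (t : V → V → ℝ) (c : V → ℝ) : smear t (fun _ => 0) c = 0 := by simp [smear]

variable {E : Type} [NormedAddCommGroup E] [NormedSpace ℝ E] [FiniteDimensional ℝ E]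

/-- The smooth function obtained by smearing a bounded function. -/
def smearFn (t : V → V → ℝ) (X : E →ₗ[ℝ] (V → ℝ)) (s : (V → ℝ) → ℝ) (hs : IsBddMeas s) :
    smoothFns E := ⟨fun x => smear t s (X x), mem_smoothFns.2 (contDiff_smear t hs X)⟩

/-- The smeared weight of a tree. -/
def treeFn (t : V → V → ℝ) (X : E →ₗ[ℝ] (V → ℝ)) (D : Arcs V) : smoothFns E :=
  smearFn t X (treeWeight D) (isBddMeas_treeWeight D)

lemma treeFn_flipArc (t : V → V → ℝ) (X : E →ₗ[ℝ] (V → ℝ)) {D : Arcs V} (hD : IsOTree D)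
    {e : V × V} (he : e ∈ D) : treeFn t X (flipArc D e) = -treeFn t X D := by
  ext x; change smear t (treeWeight (flipArc D e)) (X x) = -smear t (treeWeight D) (X x)
  rw [← neg_one_mul, ← smear_const_mul]; congr 1; funext c
  rw [treeWeight_flipArc hD he, neg_one_mul]

lemma treeFn_rotate (t : V → V → ℝ) (X : E →ₗ[ℝ] (V → ℝ))
    {x : Arcs V × V × V × V} (hx : x ∈ chains V) :
    treeFn t X x.1 + treeFn t X (rotate x).1 + treeFn t X (rotate (rotate x)).1 = 0 := by
  ext z
  change smear t (treeWeight x.1) (X z) + smear t (treeWeight (rotate x).1) (X z) +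
    smear t (treeWeight (rotate (rotate x)).1) (X z) = 0
  have hx1 := rotate_mem hx; have hx' := hx; simp only [chains, mem_filter_univ] at hx hx1
  rw [← smear_add (isBddMeas_treeWeight _) (isBddMeas_treeWeight _),
    ← smear_add ((isBddMeas_treeWeight _).add (isBddMeas_treeWeight _)) (isBddMeas_treeWeight _),
    ← smear_zero t (X z)]
  refine smear_congr ?_
  have hne : ∀ {D : Arcs V} {e : V × V}, IsForest D → e ∈ D → flow D e (dv e) ≠ 0 := by
    intro D e hD he; rw [flow_dv hD he he, if_pos rfl]; exact one_ne_zero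
  filter_upwards [ae_noise_ne t _ (hne hx.1.1 hx.2.1) (X z), ae_noise_ne t _ (hne hx.1.1 hx.2.2) (X z),
    ae_noise_ne t _ (hne hx1.1.1 hx1.2.1) (X z)] with w q1 q2 q3
  exact treeWeight_rotate hx' q1 q2 q3

end

section

variable {n b : ℕ} {κ : Triples b} {ample : Set (Fin b → ℝ)}

/-- The form as a bilinear map. -/
def dotB (hκ : IsAmpleCone κ ample) (γ : Charges n b) : Vec n b →ₗ[ℝ] Vec n b →ₗ[ℝ] ℝ where
  toFun v := dotL κ γ v
  map_add' v w := by
    refine LinearMap.ext fun x => ?_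
    change dot κ γ (v + w) x = dot κ γ v x + dot κ γ w x
    rw [dot_comm hκ, dot_comm hκ γ v, dot_comm hκ γ w]
    exact map_add (dotL κ γ x) v w
  map_smul' r v := by
    refine LinearMap.ext fun x => ?_
    exact dot_smul_left hκ γ r v x

lemma dotB_apply (hκ : IsAmpleCone κ ample) (γ : Charges n b) (v w : Vec n b) :
    dotB hκ γ v w = dot κ γ v w := rfl

lemma dotB_comm (hκ : IsAmpleCone κ ample) (γ : Charges n b) (v w : Vec n b) :
    dotB hκ γ v w = dotB hκ γ w v := dot_comm hκ γ v w

lemma sum_opVal_treeFn (hκ : IsAmpleCone κ ample) (γ : Charges n b) (y : Vec n b) (l l' : ℝ) :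
    ∑ D ∈ otrees (Fin n), opVal y (dotB_comm hκ γ) (fun e => vPair γ e.1 e.2) D l
    (treeFn (tW κ γ) (Xmap κ γ) D) =
    ∑ D ∈ otrees (Fin n), opVal y (dotB_comm hκ γ) (fun e => vPair γ e.1 e.2) D l'
    (treeFn (tW κ γ) (Xmap κ γ) D) := by
  refine sum_opVal_const y (dotB_comm hκ γ) (fun e => vPair γ e.1 e.2)
    (fun e => vPair_swap γ e.1 e.2) ?_
    (fun i j k => -triple κ (γ i).1 (γ j).1 (γ k).1) (fun i j k => ?_) ?_ _
    (fun D hD e he => treeFn_flipArc _ _ hD he) (fun x hx => treeFn_rotate _ _ hx) l l'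
  · intro i j k l h1 h2 h3 h4; rw [dotB_apply, dot_vPair_vPair_disjoint hκ γ h1 h2 h3 h4]
  · change -_ = -_; rw [triple_comm₁₂ hκ, triple_comm₂₃ hκ]
  · intro i j k h1 h2 h3; rw [dotB_apply, dot_vPair_vPair_chain hκ γ h1 h2 h3]

end

/-! ## Set partitions -/

section

variable {V : Type}

/-- A partition of `S` into nonempty blocks. -/
def IsPartition (S : Finset V) (P : Finset (Finset V)) : Prop :=
  (∀ B ∈ P, B.Nonempty ∧ B ⊆ S) ∧ ∀ i ∈ S, ∃! B, B ∈ P ∧ i ∈ B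

/-- The partitions of `S`. -/
def partitions (S : Finset V) : Finset (Finset (Finset V)) :=
  S.powerset.powerset.filter (IsPartition S)

lemma mem_partitions {S : Finset V} {P : Finset (Finset V)} :
    P ∈ partitions S ↔ IsPartition S P := by
  rw [partitions, mem_filter, mem_powerset, and_iff_right_iff_imp]
  exact fun h B hB => mem_powerset.2 (h.1 B hB).2

lemma IsPartition.eq_of_mem {S : Finset V} {P : Finset (Finset V)} (hP : IsPartition S P)
    {B C : Finset V} (hB : B ∈ P) (hC : C ∈ P) {i : V} (hi : i ∈ B) (hi' : i ∈ C) : B = C :=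
  (hP.2 i ((hP.1 B hB).2 hi)).unique ⟨hB, hi⟩ ⟨hC, hi'⟩

variable [Fintype V] {P : Finset (Finset V)}

/-- The block of an element. -/
def IsPartition.block (hP : IsPartition univ P) (i : V) : P :=
  ⟨(hP.2 i (mem_univ i)).choose, (hP.2 i (mem_univ i)).choose_spec.1.1⟩

lemma IsPartition.mem_block (hP : IsPartition univ P) (i : V) : i ∈ (hP.block i).1 :=
  (hP.2 i (mem_univ i)).choose_spec.1.2

lemma IsPartition.mem_iff (hP : IsPartition univ P) (i : V) (q : P) : i ∈ q.1 ↔ hP.block i = q :=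
  ⟨fun h => Subtype.ext (hP.eq_of_mem (hP.block i).2 q.2 (hP.mem_block i) h),
    fun h => h ▸ hP.mem_block i⟩

lemma IsPartition.block_surjective (hP : IsPartition univ P) : Surjective hP.block := fun q => by
  obtain ⟨i, hi⟩ := (hP.1 q.1 q.2).1; exact ⟨i, (hP.mem_iff i q).1 hi⟩

/-- The partition into classes of linked elements. -/
def classes (H : Arcs V) : Finset (Finset V) :=
  univ.image fun u => univ.filter fun w => Lk H u w

lemma isPartition_classes (H : Arcs V) : IsPartition univ (classes H) := by
  refine ⟨?_, fun i _ => ⟨univ.filter fun w => Lk H i w, ⟨?_, ?_⟩, ?_⟩⟩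
  · intro B hB; obtain ⟨u, -, rfl⟩ := mem_image.1 hB
    exact ⟨⟨u, by simpa using Lk.refl u⟩, subset_univ _⟩
  · exact mem_image_of_mem _ (mem_univ i)
  · simpa using Lk.refl i
  · rintro B ⟨hB, hi⟩; obtain ⟨u, -, rfl⟩ := mem_image.1 hB; have hu : Lk H u i := by simpa using hi
    ext w; simp only [mem_filter_univ]; exact ⟨fun h => hu.symm.trans h, fun h => hu.trans h⟩

lemma hasClasses_block_iff (hP : IsPartition univ P) {H : Arcs V} :
    HasClasses H hP.block ↔ classes H = P := by
  constructor
  · intro h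
    have hcl : ∀ u, (univ.filter fun w => Lk H u w) = (hP.block u).1 := by
      intro u; ext w; simp only [mem_filter_univ]; rw [h u w, hP.mem_iff w, eq_comm]
    ext B; rw [classes, mem_image]; constructor
    · grind
    · intro hB; obtain ⟨u, hu⟩ := hP.block_surjective ⟨B, hB⟩; grind
  · rintro rfl u w
    have h1 : (hP.block u).1 = univ.filter fun w => Lk H u w := by
      refine hP.eq_of_mem (hP.block u).2 ?_ (hP.mem_block u) ?_
      · exact mem_image_of_mem _ (mem_univ u)
      · simpa using Lk.refl u
    rw [eq_comm, ← hP.mem_iff w (hP.block u), h1]; simp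

lemma sum_forests {M : Type} [AddCommMonoid M] (f : Arcs V → M) :
    ∑ H ∈ forests V, f H = ∑ P ∈ (partitions (univ : Finset V)).attach,
    ∑ H ∈ (forests V).filter (fun H => HasClasses H (mem_partitions.1 P.2).block), f H := by
  have h : ∀ P ∈ (partitions (univ : Finset V)).attach,
      ∑ H ∈ (forests V).filter (fun H => HasClasses H (mem_partitions.1 P.2).block), f H =
      ∑ H ∈ (forests V).filter (fun H => classes H = P.1), f H := by
    intro P _; refine sum_congr (filter_congr fun H _ => hasClasses_block_iff _) fun _ _ => rfl
  rw [sum_congr rfl h, sum_attach (partitions univ)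
    fun P => ∑ H ∈ (forests V).filter (fun H => classes H = P), f H]
  exact (sum_fiberwise_of_maps_to (fun H _ => mem_partitions.2 (isPartition_classes H)) f).symm

lemma mem_forests {H : Arcs V} : H ∈ forests V ↔ IsForest H := by simp [forests]

/-- The image of a set of arcs. -/
def barImage {V Q : Type} (π : V → Q) (K : Arcs V) : Arcs Q := K.image (bar π)

/-- The sum over the preimages of an arc. -/
def barSum {V Q A : Type} [Fintype V] [AddCommMonoid A] (π : V → Q) (w : V × V → A)
    (a : Q × Q) : A := ∑ e with bar π e = a, w e

lemma sum_completions_bar {V Q A M : Type} [Fintype V] [Fintype Q] [CommSemiring A]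
    [AddCommMonoid M] [Module A M] {π : V → Q} {H : Arcs V}
    (hπ : Surjective π) (hF : IsForest H) (hH : HasClasses H π) (w : V × V → A) (k : Arcs Q → M) :
    ∑ K ∈ completions H, (∏ e ∈ K, w e) • k (barImage π K) =
    ∑ D ∈ otrees Q, (∏ a ∈ D, barSum π w a) • k D := sum_completions hπ hF hH w k

lemma isOTree_barImage {V Q : Type} [Fintype V] [Fintype Q] {π : V → Q} {H K : Arcs V}
    (hπ : Surjective π) (hF : IsForest H) (hH : HasClasses H π)
    (hd : Disjoint K H) (hT : IsOTree (H ∪ K)) :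
    Set.InjOn (bar π) (K : Set (V × V)) ∧ IsOTree (barImage π K) :=
  (isOTree_union_iff hπ hF hH).1 ⟨hd, hT⟩

lemma flow_barImage {V Q : Type} [Fintype V] [Fintype Q] {π : V → Q} {H K : Arcs V}
    (hπ : Surjective π) (hF : IsForest H) (hH : HasClasses H π)
    (hd : Disjoint K H) (hT : IsOTree (H ∪ K)) {c : V → ℝ} (hc : ∑ v, c v = 0) {e : V × V}
    (he : e ∈ K) : flow (barImage π K) (bar π e) (pushSum π c) = flow (H ∪ K) e c :=
  flow_pushSum hπ hF hH hd hT hc he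

lemma prod_barImage {V Q M : Type} [CommMonoid M] {π : V → Q} {K : Arcs V}
    (h : Set.InjOn (bar π) (K : Set (V × V))) (f : Q × Q → M) :
    ∏ a ∈ barImage π K, f a = ∏ e ∈ K, f (bar π e) := prod_image h

/-- Sums over trees with a set of marked arcs, organized by the partition of the vertices into the
components without the marked arcs. -/
lemma sum_otrees_partitions {A M : Type} [CommSemiring A] [AddCommMonoid M] [Module A M]
    (w : V × V → A) (Ψ : Arcs V → Arcs V → M)
    (h : ∀ P : Finset (Finset V), ∀ q : P, Finset (q.1 × q.1) → A)
    (k : ∀ P : Finset (Finset V), Arcs P → M)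
    (hΨ : ∀ (P : Finset (Finset V)) (hP : IsPartition univ P), ∀ H K : Arcs V,
    IsForest H → HasClasses H hP.block → Disjoint K H → IsOTree (H ∪ K) →
    Ψ H K = (∏ q : P, h P q (restr q.1 H)) • k P (barImage hP.block K)) :
    ∑ D ∈ otrees V, ∑ K ∈ D.powerset, (∏ e ∈ K, w e) • Ψ (D \ K) K =
    ∑ P ∈ (partitions (univ : Finset V)).attach, (∏ q : P.1, ∑ D ∈ otrees q.1, h P.1 q D) •
    ∑ D ∈ otrees P.1, (∏ a ∈ D, barSum (mem_partitions.1 P.2).block w a) • k P.1 D := by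
  rw [sum_otrees_powerset fun H K => (∏ e ∈ K, w e) • Ψ H K, sum_forests]
  refine sum_congr rfl fun P _ => ?_; have hP := mem_partitions.1 P.2
  rw [← sum_forests_classes (π := hP.block) (B := fun q : P.1 => q.1) hP.mem_iff, sum_smul]
  refine sum_congr rfl fun H hH => ?_; rw [mem_filter, mem_forests] at hH
  rw [← sum_completions_bar hP.block_surjective hH.1 hH.2, smul_sum]
  refine sum_congr rfl fun K hK => ?_; simp only [completions, mem_filter_univ] at hK
  rw [hΨ P.1 hP H K hH.1 hH.2 hK.1 hK.2, smul_comm]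

end

/-! ## Expansion of the tree sum over partitions -/

section

variable {V : Type} [Fintype V] {E : Type} [NormedAddCommGroup E] [NormedSpace ℝ E]
  [FiniteDimensional ℝ E] {B : E →ₗ[ℝ] E →ₗ[ℝ] ℝ} (y : E) (hB : ∀ v w, B v w = B w v) (l : ℝ)

lemma opConst_one : opConst y hB l 1 = 1 := by
  refine opRing.toEnd_injective y hB l ?_; exact one_smul ℝ (1 : Module.End ℝ (smoothFns E))

lemma opConst_mul (r q : ℝ) : opConst y hB l (r * q) = opConst y hB l r * opConst y hB l q := by
  refine opRing.toEnd_injective y hB l ?_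
  change (r * q) • (1 : Module.End ℝ (smoothFns E)) = (r • 1) * (q • 1)
  rw [smul_mul_smul_comm, one_mul]

lemma opConst_prod {ι : Type*} (s : Finset ι) (r : ι → ℝ) :
    opConst y hB l (∏ i ∈ s, r i) = ∏ i ∈ s, opConst y hB l (r i) := by
  induction s using Finset.induction_on with
  | empty => exact opConst_one y hB l
  | insert a s ha ih => rw [prod_insert ha, prod_insert ha, opConst_mul, ih]

lemma opRing_smul_smul (r : opRing B y hB l) (q : ℝ) (F : smoothFns E) :
    r • (q • F) = q • (r • F) := map_smul (opRing.toEnd y hB l r) q F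

lemma isBddMeas_signs {ι : Type*} (s : Finset ι) (f : ι → (V → ℝ) →ₗ[ℝ] ℝ) :
    IsBddMeas fun c => ∏ i ∈ s, sign (f i (meanFree c)) :=
  IsBddMeas.prod fun i _ => isBddMeas_sign (f i ∘ₗ meanFree)

/-- The smeared product of the signs of the flows through the arcs in `K`. -/
def signFn (t : V → V → ℝ) (X : E →ₗ[ℝ] (V → ℝ)) (H K : Arcs V) : smoothFns E :=
  smearFn t X (fun c => ∏ e ∈ K, sign (flow (H ∪ K) e (meanFree c)))
    (isBddMeas_signs K fun e => flow (H ∪ K) e)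

/-- The smeared product of the signs of the flows through the arcs of a tree of blocks. -/
def blockFn {Q : Type} [Fintype Q] (t : V → V → ℝ) (X : E →ₗ[ℝ] (V → ℝ)) (π : V → Q)
    (D : Arcs Q) : smoothFns E :=
  smearFn t X (fun c => ∏ e ∈ D, sign (flow D e (pushSum π (meanFree c))))
    (isBddMeas_signs D fun e => flow D e ∘ₗ pushSum π)

lemma smear_sum {ι : Type*} {t : V → V → ℝ} (S : Finset ι) {s : ι → (V → ℝ) → ℝ}
    (hs : ∀ i ∈ S, IsBddMeas (s i)) (c : V → ℝ) :
    smear t (fun w => ∑ i ∈ S, s i w) c = ∑ i ∈ S, smear t (s i) c :=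
  integral_finsetSum S fun i hi => (hs i hi).integrable t c

lemma treeFn_eq (t : V → V → ℝ) (X : E →ₗ[ℝ] (V → ℝ)) (D : Arcs V) : treeFn t X D =
    ∑ K ∈ D.powerset, (sgnAvg (D \ K) univ : ℝ) • signFn t X (D \ K) K := by
  ext x
  have h : ∀ s : Finset (Arcs V), ∀ f : Arcs V → smoothFns E,
      (∑ K ∈ s, f K).1 x = ∑ K ∈ s, (f K).1 x := by
    intro s f; rw [Submodule.coe_sum, Finset.sum_apply]
  rw [h]
  change smear t (fun c => ∑ K ∈ D.powerset, (sgnAvg (D \ K) univ : ℝ) *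
    ∏ e ∈ K, sign (flow D e (meanFree c))) (X x) = _
  rw [smear_sum]
  · refine sum_congr rfl fun K hK => ?_; rw [smear_const_mul]
    change _ = _ * smear t (fun c => ∏ e ∈ K, sign (flow (D \ K ∪ K) e (meanFree c))) (X x)
    rw [sdiff_union_of_subset (mem_powerset.1 hK)]
  · intro K _; exact (IsBddMeas.const _).mul (isBddMeas_signs K fun e => flow D e)

lemma signFn_eq_blockFn {Q : Type} [Fintype Q] (t : V → V → ℝ) (X : E →ₗ[ℝ] (V → ℝ))
    {π : V → Q} {H K : Arcs V} (hπ : Surjective π) (hF : IsForest H)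
    (hH : HasClasses H π) (hd : Disjoint K H) (hT : IsOTree (H ∪ K)) :
    signFn t X H K = blockFn t X π (barImage π K) := by
  ext x
  change smear t (fun c => ∏ e ∈ K, sign (flow (H ∪ K) e (meanFree c))) (X x) =
    smear t (fun c => ∏ a ∈ barImage π K, sign (flow (barImage π K) a
      (pushSum π (meanFree c)))) (X x)
  congr 1; funext c; rw [prod_barImage (isOTree_barImage hπ hF hH hd hT).1]
  refine prod_congr rfl fun e he => ?_; rw [flow_barImage hπ hF hH hd hT (sum_meanFree c) he]

/-- The factor of a block in the expansion over partitions. -/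
def blockOp (v : V × V → E) (S : Finset V) : opRing B y hB l :=
  ∑ D ∈ otrees S, opConst y hB l (sgnAvg D univ : ℝ) * ∏ e ∈ D, opGen y hB l (v (e.1, e.2))

lemma sum_opVal_eq (t : V → V → ℝ) (X : E →ₗ[ℝ] (V → ℝ)) (v : V × V → E) :
    ∑ D ∈ otrees V, opVal y hB v D l (treeFn t X D) = ∑ P ∈ (partitions (univ : Finset V)).attach,
    ((∏ q : P.1, blockOp y hB l v q.1) •
    ∑ D ∈ otrees P.1, (∏ a ∈ D, opGen y hB l (barSum (mem_partitions.1 P.2).block v a)) •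
    blockFn t X (mem_partitions.1 P.2).block D).1 y := by
  have h1 := sum_otrees_partitions (V := V) (A := opRing B y hB l) (M := smoothFns E)
    (fun e => opGen y hB l (v e))
    (fun H K => (opConst y hB l (sgnAvg H univ : ℝ) * ∏ e ∈ H, opGen y hB l (v e)) • signFn t X H K)
    (fun P q D => opConst y hB l (sgnAvg D univ : ℝ) * ∏ e ∈ D, opGen y hB l (v (e.1, e.2)))
    (fun P D => if hP : IsPartition univ P then blockFn t X hP.block D else 0)
    (by
      intro P hP H K hF hH hd hT
      rw [dif_pos hP, signFn_eq_blockFn t X hP.block_surjective hF hH hd hT,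
        prod_mul_distrib, ← opConst_prod,
        sgnAvg_eq_prod_restr (B := fun q : P => q.1) hP.mem_iff hH,
        prod_eq_prod_restr (B := fun q : P => q.1) hP.mem_iff hH]
      push_cast; rfl)
  have hval : ∀ {ι : Type} (s : Finset ι) (f : ι → smoothFns E),
      (∑ i ∈ s, f i).1 y = ∑ i ∈ s, (f i).1 y := by
    intro ι s f; rw [Submodule.coe_sum, Finset.sum_apply]
  have h2 := congrArg (fun F : smoothFns E => F.1 y) h1; simp only [hval] at h2
  refine Eq.trans (sum_congr rfl fun D hD => ?_) (h2.trans (sum_congr rfl ?_))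
  · change ((∏ e ∈ D, opGen y hB l (v e)) • treeFn t X D).1 y = _; rw [treeFn_eq, smul_sum, hval]
    refine sum_congr rfl fun K hK => ?_
    rw [← opConst_smul y hB l, smul_smul, smul_smul, ← prod_sdiff (mem_powerset.1 hK)]
    refine congrArg (fun r : opRing B y hB l => (r • signFn t X (D \ K) K).1 y) ?_; ring
  · intro P _
    refine congrArg (fun F : smoothFns E => F.1 y)
      (congrArg₂ (fun (r : opRing B y hB l) F => r • F) rfl (sum_congr rfl fun D _ => ?_))
    rw [dif_pos (mem_partitions.1 P.2)]; congr 1; refine prod_congr rfl fun a _ => ?_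
    exact (opGen_sum y hB l _ _).symm

end

/-! ## Sums over trees of blocks -/

section

variable {n b : ℕ} {κ : Triples b} {ample : Set (Fin b → ℝ)}

lemma applyOps_toList {B : Vec n b →ₗ[ℝ] Vec n b →ₗ[ℝ] ℝ} (y : Vec n b)
    (hB : ∀ v w, B v w = B w v) (l : ℝ) {ι : Type} (s : Finset ι)
    (f : ι → (Vec n b → ℝ) → (Vec n b → ℝ)) (g : ι → opRing B y hB l)
    (h : ∀ e (F : smoothFns (Vec n b)), f e F.1 = (g e • F).1) (F : smoothFns (Vec n b)) :
    applyOps (s.toList.map f) F.1 = ((∏ e ∈ s, g e) • F).1 := by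
  rw [← prod_map_toList]
  induction s.toList with
  | nil => rfl
  | cons a L ih =>
    rw [List.map_cons, List.map_cons, List.prod_cons]
    change f a (applyOps (L.map f) F.1) = (g a • ((L.map g).prod • F)).1; rw [← h, ih]

lemma opD_eq (hκ : IsAmpleCone κ ample) (γ : Charges n b) (y v : Vec n b)
    (F : smoothFns (Vec n b)) : opD κ γ v F.1 = (opGen y (dotB_comm hκ γ) 1 v • F).1 := by
  funext x
  change _ = dot κ γ v y * F.1 x + 1 * (dotB hκ γ v (x - y) * F.1 x) +
    1 / (2 * Real.pi) * fderiv ℝ F.1 x v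
  rw [map_sub, dotB_apply, dotB_apply, opD]; ring

lemma opDy_eq (hκ : IsAmpleCone κ ample) (γ : Charges n b) (y v : Vec n b)
    (F : smoothFns (Vec n b)) : opDy κ γ v y F.1 = (opGen y (dotB_comm hκ γ) 0 v • F).1 := by
  funext x
  change _ = dot κ γ v y * F.1 x + 0 * (dotB hκ γ v (x - y) * F.1 x) +
    1 / (2 * Real.pi) * fderiv ℝ F.1 x v
  rw [opDy]; ring

lemma sgnAvg_flipArc {V : Type} [Fintype V] {D : Arcs V} (hD : IsForest D) {e : V × V}
    (he : e ∈ D) : sgnAvg (flipArc D e) univ = -sgnAvg D univ := by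
  have hs : e.swap ∉ D.erase e := fun h => hD.swap_notMem he (mem_of_mem_erase h)
  conv_rhs => rw [← insert_erase he]
  exact sgnAvg_insert_swap (hD.ne he) (notMem_erase _ _) hs (mem_univ _) (mem_univ _)

lemma sgnAvg_univ_eq_zero {V : Type} [Fintype V] {D : Arcs V} (hD : IsForest D)
    (h : Odd D.card) : sgnAvg D univ = 0 := by
  refine sgnAvg_eq_zero_of_odd (fun e he => hD.ne he) ?_; simp_all

lemma flipInv_sgnAvg_mul_prod {V A : Type} [Fintype V] [CommRing A] (c : ℝ → A)
    (hc : ∀ r, c (-r) = -c r) (w : V × V → A) (hw : ∀ e, w e.swap = -w e) :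
    FlipInv fun D : Arcs V => c (sgnAvg D univ : ℝ) * ∏ e ∈ D, w e := by
  intro D hD e he; simp only
  rw [prod_flipArc hD.1 he w, sgnAvg_flipArc hD.1 he, Rat.cast_neg, hc, hw,
    ← mul_prod_erase D _ he, neg_mul (w e), neg_mul_neg]

lemma opConst_neg {E : Type} [NormedAddCommGroup E] [NormedSpace ℝ E] [FiniteDimensional ℝ E]
    {B : E →ₗ[ℝ] E →ₗ[ℝ] ℝ} (y : E) (hB : ∀ v w, B v w = B w v) (l r : ℝ) :
    opConst y hB l (-r) = -opConst y hB l r := by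
  refine opRing.toEnd_injective y hB l ?_; rw [map_neg]
  exact neg_smul r (1 : Module.End ℝ (smoothFns E))

lemma barSum_vPair (γ : Charges n b) {Q : Type} (π : Fin n → Q) (a : Q × Q) :
    barSum π (fun e => vPair γ e.1 e.2) a = vBlock γ (fiber π a.1) (fiber π a.2) := by
  rw [barSum, vBlock, ← sum_product']; refine sum_congr ?_ fun _ _ => rfl; ext e
  simp only [mem_filter, mem_univ, true_and, mem_product, fiber, bar, Prod.ext_iff]

variable {Q : Type} [Fintype Q]

lemma blockFn_flipArc {V E : Type} [Fintype V] [NormedAddCommGroup E] [NormedSpace ℝ E]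
    [FiniteDimensional ℝ E] (t : V → V → ℝ) (X : E →ₗ[ℝ] (V → ℝ)) (π : V → Q)
    {D : Arcs Q} (hD : IsOTree D) {e : Q × Q} (he : e ∈ D) :
    blockFn t X π (flipArc D e) = -blockFn t X π D := by
  ext x
  change smear t (fun c => ∏ a ∈ flipArc D e, sign (flow (flipArc D e) a
    (pushSum π (meanFree c)))) (X x) =
    -smear t (fun c => ∏ a ∈ D, sign (flow D a (pushSum π (meanFree c)))) (X x)
  rw [← neg_one_mul, ← smear_const_mul]; congr 1; funext c
  have h0 : ∑ q, pushSum π (meanFree c) q = 0 := by rw [sum_pushSum, sum_meanFree]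
  obtain ⟨h1, h2⟩ := flow_flipArc hD he h0
  rw [prod_flipArc hD.1 he fun a => sign (flow (flipArc D e) a (pushSum π (meanFree c))), h1,
    sign_neg_eq, ← mul_prod_erase D _ he]
  rw [prod_congr rfl fun a ha => by rw [h2 a (mem_of_mem_erase ha) (ne_of_mem_erase ha)]]
  ring

/-- The sum over the trees of blocks. -/
def blockSum (hκ : IsAmpleCone κ ample) (γ : Charges n b) (y : Vec n b) (l : ℝ)
    (π : Fin n → Q) : smoothFns (Vec n b) :=
  ∑ D ∈ otrees Q, (∏ a ∈ D, opGen y (dotB_comm hκ γ) l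
    (vBlock γ (fiber π a.1) (fiber π a.2))) • blockFn (tW κ γ) (Xmap κ γ) π D

lemma blockSum_eq (hκ : IsAmpleCone κ ample) (γ : Charges n b) (y : Vec n b) (l : ℝ)
    [Nonempty Q] (π : Fin n → Q) :
    blockSum hκ γ y l π = 2 ^ (Fintype.card Q - 1) • ∑ G ∈ labeledTrees Q,
    (∏ a ∈ (orient G).arcs, opGen y (dotB_comm hκ γ) l (vBlock γ (fiber π a.1) (fiber π a.2))) •
    blockFn (tW κ γ) (Xmap κ γ) π (orient G).arcs := by
  refine sum_otrees (F := fun D => (∏ a ∈ D, opGen y (dotB_comm hκ γ) l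
    (vBlock γ (fiber π a.1) (fiber π a.2))) • blockFn (tW κ γ) (Xmap κ γ) π D)
    fun D hD e he => ?_
  simp only
  rw [prod_flipArc hD.1 he, blockFn_flipArc _ _ _ hD he, Prod.fst_swap, Prod.snd_swap, vBlock_swap,
    opGen_neg, ← mul_prod_erase D _ he, neg_mul, neg_smul, smul_neg, neg_neg]

lemma treeErf_eq_blockFn (hκ : IsAmpleCone κ ample) {γ : Charges n b}
    (hγ : ∀ i, (γ i).1 ∈ ample) {π : Fin n → Q} (hπ : Surjective π)
    {G : SimpleGraph Q} (hG : G.IsTree) :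
    treeErf κ γ (orient G) (fun v w => vBlock γ (fiber π v) (fiber π w)) =
    (blockFn (tW κ γ) (Xmap κ γ) π (orient G).arcs).1 := by
  funext x; exact treeErf_eq_smear hκ hγ hπ (isOTree_orient hG) x

lemma mem_labeledTrees {G : SimpleGraph Q} : G ∈ labeledTrees Q ↔ G.IsTree := by simp [labeledTrees]

lemma smoothFns_sum_apply {E ι : Type} [NormedAddCommGroup E] [NormedSpace ℝ E] (s : Finset ι)
    (f : ι → smoothFns E) (x : E) : (∑ i ∈ s, f i).1 x = ∑ i ∈ s, (f i).1 x := by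
  simp_all

/-! ### The simplified function -/

lemma simplePhi_eq (hκ : IsAmpleCone κ ample) {γ : Charges n b}
    (hγ : ∀ i, (γ i).1 ∈ ample) (hn : 0 < n) (x : Vec n b) :
    (2 ^ (n - 1) * n.factorial : ℝ) * simplePhi κ γ x = (blockSum hκ γ x 0 id).1 x := by
  have : Nonempty (Fin n) := ⟨⟨0, hn⟩⟩
  have hn' : (n.factorial : ℝ) ≠ 0 := by exact_mod_cast n.factorial_ne_zero
  rw [blockSum_eq, Fintype.card_fin, simplePhi]
  have h : ∀ (k : ℕ) (F : smoothFns (Vec n b)), (k • F).1 x = k * F.1 x := by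
    intro k F; rw [Submodule.coe_smul_of_tower, Pi.smul_apply, nsmul_eq_mul]
  rw [h, smoothFns_sum_apply, mul_assoc, ← mul_assoc (n.factorial : ℝ), mul_one_div_cancel hn', one_mul]
  push_cast; congr 1; refine sum_congr rfl fun G hG => ?_; rw [mem_labeledTrees] at hG
  rw [vPair_eq_vBlock, treeErf_eq_blockFn hκ hγ Function.surjective_id hG,
    applyOps_toList x (dotB_comm hκ γ) 0 _ _ _ fun e F => opDy_eq hκ γ x _ F]

/-! ### The original function -/

/-- The operator of a vertex carrying the set `S` of charges. -/
def markOp (hκ : IsAmpleCone κ ample) (γ : Charges n b) (y : Vec n b) (S : Finset (Fin n)) :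
    opRing (dotB hκ γ) y (dotB_comm hκ γ) 1 :=
  ∑ G ∈ labeledTrees S, opConst y (dotB_comm hκ γ) 1 ((orient G).coeffA : ℝ) *
    ∏ e ∈ (orient G).arcs, opGen y (dotB_comm hκ γ) 1 (vPair γ e.1 e.2)

lemma opMark_eq (hκ : IsAmpleCone κ ample) (γ : Charges n b) (y : Vec n b)
    (S : Finset (Fin n)) (F : smoothFns (Vec n b)) :
    opMark κ γ S F.1 = (markOp hκ γ y S • F).1 := by
  funext x; rw [markOp, sum_smul, smoothFns_sum_apply, opMark]; refine sum_congr rfl fun G _ => ?_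
  rw [applyOps_toList y (dotB_comm hκ γ) 1 _ _ _ fun e F => opD_eq hκ γ y _ F]; rfl

lemma blockOp_eq (hκ : IsAmpleCone κ ample) (γ : Charges n b) (y : Vec n b)
    {S : Finset (Fin n)} (hS : S.Nonempty) :
    blockOp y (dotB_comm hκ γ) 1 (fun e => vPair γ e.1 e.2) S =
    2 ^ (S.card - 1) • markOp hκ γ y S := by
  have : Nonempty S := hS.to_subtype
  have key := sum_otrees (flipInv_sgnAvg_mul_prod (V := S) (opConst y (dotB_comm hκ γ) 1)
    (opConst_neg y (dotB_comm hκ γ) 1)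
    (fun e => opGen y (dotB_comm hκ γ) 1 (vPair γ e.1 e.2))
    (fun e => by rw [Prod.fst_swap, Prod.snd_swap, vPair_swap, opGen_neg]))
  rw [Fintype.card_coe] at key; refine key.trans ?_; congr 1; refine sum_congr rfl fun G hG => ?_
  rw [coeffA_orient (mem_labeledTrees.1 hG)]

lemma blockOp_eq_zero (hκ : IsAmpleCone κ ample) (γ : Charges n b) (y : Vec n b)
    {S : Finset (Fin n)} (hS : S.Nonempty) (hodd : ¬ Odd S.card) :
    blockOp y (dotB_comm hκ γ) 1 (fun e => vPair γ e.1 e.2) S = 0 := by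
  have : Nonempty S := hS.to_subtype; rw [blockOp_eq hκ γ y hS, markOp, sum_eq_zero, smul_zero]
  intro G hG; rw [mem_labeledTrees] at hG
  have h0 : opConst y (dotB_comm hκ γ) 1 0 = 0 := by
    refine opRing.toEnd_injective y (dotB_comm hκ γ) 1 ?_; rw [map_zero]
    exact zero_smul ℝ (1 : Module.End ℝ (smoothFns (Vec n b)))
  rw [coeffA_orient hG, sgnAvg_univ_eq_zero (isOTree_orient hG).1, Rat.cast_zero, h0, zero_mul]
  rw [card_orient_arcs hG, Fintype.card_coe]; grind

end

/-! ## The original function in terms of partitions -/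

section

variable {n b : ℕ} {κ : Triples b} {ample : Set (Fin b → ℝ)}

lemma IsPartition.sum_card {V : Type} [Fintype V] {P : Finset (Finset V)}
    (hP : IsPartition univ P) : ∑ B ∈ P, B.card = Fintype.card V := by
  rw [← card_biUnion]
  · rw [← card_univ]; congr 1; ext i; simp only [mem_biUnion, mem_univ, iff_true]
    exact ⟨_, (hP.block i).2, hP.mem_block i⟩
  · intro B hB C hC hne; exact disjoint_left.2 fun i h1 h2 => hne (hP.eq_of_mem hB hC h1 h2)

lemma IsPartition.card_add {V : Type} [Fintype V] {P : Finset (Finset V)}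
    (hP : IsPartition univ P) : ∑ B ∈ P, (B.card - 1) + P.card = Fintype.card V := by
  rw [← hP.sum_card, card_eq_sum_ones, ← sum_add_distrib]
  exact sum_congr rfl fun B hB => Nat.sub_add_cancel (hP.1 B hB).1.card_pos

lemma IsPartition.card_le {V : Type} [Fintype V] {P : Finset (Finset V)}
    (hP : IsPartition univ P) : P.card ≤ Fintype.card V := by
  have := hP.card_add; omega

lemma mem_fiber {Q : Type} {π : Fin n → Q} {q : Q} {i : Fin n} : i ∈ fiber π q ↔ π i = q := by
  simp [fiber]

lemma opRing_mul_smul {E : Type} [NormedAddCommGroup E] [NormedSpace ℝ E]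
    [FiniteDimensional ℝ E] {B : E →ₗ[ℝ] E →ₗ[ℝ] ℝ} {y : E} {hB : ∀ v w, B v w = B w v} {l : ℝ}
    (r q : opRing B y hB l) (F : smoothFns E) : (r * q) • F = r • (q • F) := rfl

lemma opRing_one_smul {E : Type} [NormedAddCommGroup E] [NormedSpace ℝ E]
    [FiniteDimensional ℝ E] {B : E →ₗ[ℝ] E →ₗ[ℝ] ℝ} {y : E} {hB : ∀ v w, B v w = B w v} {l : ℝ}
    (F : smoothFns E) : (1 : opRing B y hB l) • F = F := rfl

lemma IsPartition.fiber_block {P : Finset (Finset (Fin n))} (hP : IsPartition univ P)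
    (q : P) : fiber hP.block q = q.1 := by
  ext i; rw [mem_fiber, hP.mem_iff]

/-- The sums over marked trees run over the partitions into blocks of odd size. -/
lemma sum_markedVertexSets (hn : 0 < n) (f : Finset (Finset (Fin n)) → ℝ) :
    ∑ m ∈ range ((n - 1) / 2 + 1), ∑ P ∈ markedVertexSets n (n - 2 * m), f P =
    ∑ P ∈ (partitions (univ : Finset (Fin n))).filter (fun P => ∀ B ∈ P, Odd B.card), f P := by
  have hmem : ∀ P : Finset (Finset (Fin n)), IsPartition univ P → (∀ B ∈ P, Odd B.card) →
      0 < P.card ∧ P.card ≤ n ∧ (n - P.card) % 2 = 0 := by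
    intro P hP hodd; have h1 := hP.sum_card; rw [Fintype.card_fin] at h1; have h2 := hP.card_le
    rw [Fintype.card_fin] at h2; have h3 : P.Nonempty := ⟨_, (hP.block ⟨0, hn⟩).2⟩
    have h4 : ∃ c, ∑ B ∈ P, B.card = P.card + 2 * c := by
      refine ⟨∑ B ∈ P, B.card / 2, ?_⟩; rw [mul_sum, card_eq_sum_ones, ← sum_add_distrib]
      refine sum_congr rfl fun B hB => ?_; obtain ⟨c, hc⟩ := hodd B hB; omega
    obtain ⟨c, hc⟩ := h4; exact ⟨h3.card_pos, h2, by omega⟩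
  have hset : ∀ m ∈ range ((n - 1) / 2 + 1), markedVertexSets n (n - 2 * m) =
      ((partitions (univ : Finset (Fin n))).filter (fun P => ∀ B ∈ P, Odd B.card)).filter
        fun P => (n - P.card) / 2 = m := by
    intro m hm; rw [mem_range] at hm; ext P
    simp only [markedVertexSets, mem_filter, mem_univ, true_and, mem_partitions]; constructor
    · rintro ⟨h1, h2, h3⟩
      have hP : IsPartition univ P :=
        ⟨fun B hB => ⟨Finset.card_pos.1 (h2 B hB).pos, subset_univ _⟩, fun i _ => h3 i⟩
      exact ⟨⟨hP, h2⟩, by omega⟩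
    · rintro ⟨⟨hP, h2⟩, h3⟩; obtain ⟨a1, a2, a3⟩ := hmem P hP h2
      exact ⟨by omega, h2, fun i => hP.2 i (mem_univ i)⟩
  rw [sum_congr rfl fun m hm => by rw [hset m hm]]
  refine sum_fiberwise_of_maps_to (fun P hP => ?_) f; rw [mem_filter, mem_partitions] at hP; grind

lemma sum_opVal_eq_blockSum (hκ : IsAmpleCone κ ample) (γ : Charges n b) (y : Vec n b)
    (l : ℝ) : ∑ D ∈ otrees (Fin n), opVal y (dotB_comm hκ γ) (fun e => vPair γ e.1 e.2) D l
    (treeFn (tW κ γ) (Xmap κ γ) D) = ∑ P ∈ (partitions (univ : Finset (Fin n))).attach,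
    ((∏ B ∈ P.1, blockOp y (dotB_comm hκ γ) l (fun e => vPair γ e.1 e.2) B) •
    blockSum hκ γ y l (mem_partitions.1 P.2).block).1 y := by
  rw [sum_opVal_eq]; refine sum_congr rfl fun P _ => ?_; rw [← prod_coe_sort P.1]
  simp only [barSum_vPair]; rfl

lemma markedPhi_eq (hκ : IsAmpleCone κ ample) {γ : Charges n b}
    (hγ : ∀ i, (γ i).1 ∈ ample) (hn : 0 < n) (y : Vec n b) :
    (2 ^ (n - 1) * n.factorial : ℝ) * markedPhi κ γ y =
    ∑ D ∈ otrees (Fin n), opVal y (dotB_comm hκ γ) (fun e => vPair γ e.1 e.2) D 1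
    (treeFn (tW κ γ) (Xmap κ γ) D) := by
  have hn' : (n.factorial : ℝ) ≠ 0 := by exact_mod_cast n.factorial_ne_zero
  rw [sum_opVal_eq_blockSum, markedPhi, sum_markedVertexSets hn, mul_assoc,
    ← mul_assoc (n.factorial : ℝ), mul_one_div_cancel hn', one_mul, mul_sum,
    ← sum_attach (filter _ _)]
  rw [sum_attach _ fun P : Finset (Finset (Fin n)) => (2 : ℝ) ^ (n - 1) *
    ∑ G ∈ labeledTrees P, applyOps (P.toList.map fun B => opMark κ γ B)
        (applyOps ((orient G).arcs.toList.map fun e => opD κ γ (vBlock γ e.1.1 e.2.1))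
          (treeErf κ γ (orient G) fun B C => vBlock γ B.1 C.1)) y,
    sum_filter, ← sum_attach (partitions univ)]
  refine sum_congr rfl fun P _ => ?_; have hP := mem_partitions.1 P.2; split_ifs with hodd
  · have hne : Nonempty P.1 := ⟨hP.block ⟨0, hn⟩⟩
    have hprod : ∏ B ∈ P.1, blockOp y (dotB_comm hκ γ) 1 (fun e => vPair γ e.1 e.2) B =
        2 ^ (n - P.1.card) • ∏ B ∈ P.1, markOp hκ γ y B := by
      rw [prod_congr rfl fun B hB => blockOp_eq hκ γ y (hP.1 B hB).1]; simp only [nsmul_eq_mul]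
      rw [prod_mul_distrib]; push_cast; rw [prod_pow_eq_pow_sum]; congr 2; have h1 := hP.card_add
      rw [Fintype.card_fin] at h1; omega
    have hcard : (2 : ℝ) ^ (n - 1) = 2 ^ (n - P.1.card) * 2 ^ (P.1.card - 1) := by
      rw [← pow_add]; congr 1; have h2 := hP.card_le; rw [Fintype.card_fin] at h2
      have h3 : 0 < P.1.card := Finset.card_pos.2 ⟨_, (hP.block ⟨0, hn⟩).2⟩; omega
    have hns : ∀ (k : ℕ) (F : smoothFns (Vec n b)), (k • F).1 y = k * F.1 y := by
      intro k F; rw [Submodule.coe_smul_of_tower, Pi.smul_apply, nsmul_eq_mul]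
    have hfib : (fun B C : P.1 => vBlock γ B.1 C.1) =
        fun B C => vBlock γ (fiber hP.block B) (fiber hP.block C) := by
      funext B C; rw [hP.fiber_block, hP.fiber_block]
    rw [hprod, blockSum_eq, smul_assoc, smul_comm _ (2 ^ (Fintype.card P.1 - 1)), hns, hns,
      smul_sum, smoothFns_sum_apply, Fintype.card_coe, hcard, ← mul_assoc]
    push_cast; congr 1; refine sum_congr rfl fun G hG => ?_
    rw [hfib, treeErf_eq_blockFn hκ hγ hP.block_surjective (mem_labeledTrees.1 hG),
      applyOps_toList y (dotB_comm hκ γ) 1 _ _ _ fun e F => opD_eq hκ γ y _ F,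
      applyOps_toList y (dotB_comm hκ γ) 1 _ _ _ fun S F => opMark_eq hκ γ y S F]
    simp only [hP.fiber_block]
  · push Not at hodd; obtain ⟨B, hB, hB'⟩ := hodd
    rw [prod_eq_zero hB (blockOp_eq_zero hκ γ y (hP.1 B hB).1 hB'), zero_smul]; rfl

/-! ### Evaluation with frozen operators -/

lemma prod_smul_eq {E ι : Type} [NormedAddCommGroup E] [NormedSpace ℝ E]
    [FiniteDimensional ℝ E] {B : E →ₗ[ℝ] E →ₗ[ℝ] ℝ} (y : E) (hB : ∀ v w, B v w = B w v) (l : ℝ)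
    (s : Finset ι) (r : ι → opRing B y hB l) (a : ι → ℝ) (F : smoothFns E)
    (h : ∀ i ∈ s, r i • F = a i • F) : (∏ i ∈ s, r i) • F = (∏ i ∈ s, a i) • F := by
  induction s using Finset.induction_on with
  | empty => simp_all
  | insert i s hi ih =>
    rw [prod_insert hi, prod_insert hi, mul_comm (r i), opRing_mul_smul,
      h i (mem_insert_self _ _), opRing_smul_smul,
      ih fun j hj => h j (mem_insert_of_mem hj), mul_smul]

lemma opGen_smul_blockFn (hκ : IsAmpleCone κ ample) (γ : Charges n b) (y : Vec n b)
    {Q : Type} [Fintype Q] (π : Fin n → Q) (D : Arcs Q) {i j : Fin n} (hij : π i = π j) :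
    opGen y (dotB_comm hκ γ) 0 (vPair γ i j) • blockFn (tW κ γ) (Xmap κ γ) π D =
    dot κ γ (vPair γ i j) y • blockFn (tW κ γ) (Xmap κ γ) π D := by
  ext x; set F := blockFn (tW κ γ) (Xmap κ γ) π D with hF
  change dot κ γ (vPair γ i j) y * F.1 x + 0 * _ +
    1 / (2 * Real.pi) * fderiv ℝ F.1 x (vPair γ i j) = dot κ γ (vPair γ i j) y * F.1 x
  rw [zero_mul, add_zero, ← (smoothFns_differentiable F x).lineDeriv_eq_fderiv]
  have hconst : (fun s : ℝ => F.1 (x + s • vPair γ i j)) = fun _ => F.1 x := by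
    funext s
    change smear (tW κ γ) (fun c => ∏ e ∈ D, sign (flow D e (pushSum π (meanFree c))))
      (Xmap κ γ (x + s • vPair γ i j)) =
      smear (tW κ γ) (fun c => ∏ e ∈ D, sign (flow D e (pushSum π (meanFree c))))
      (Xmap κ γ x)
    rw [smear, smear]; congr 1; funext w
    have : pushSum π (meanFree (Xmap κ γ (x + s • vPair γ i j) + noise (tW κ γ) w)) =
        pushSum π (meanFree (Xmap κ γ x + noise (tW κ γ) w)) := by
      have h0 : dv (bar π (i, j)) = 0 := by rw [bar, hij, dv, sub_self]
      simp only [map_add, map_smul, Xmap_vPair hκ, meanFree_dv, pushSum_dv, h0, smul_zero, add_zero]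
    rw [this]
  rw [lineDeriv, hconst, deriv_const, mul_zero, add_zero]

/-- The factor of a block. -/
def blockFactor (κ : Triples b) (γ : Charges n b) (y : Vec n b) (S : Finset (Fin n)) : ℝ :=
  ∑ D ∈ otrees S, (sgnAvg D univ : ℝ) * ∏ e ∈ D, dot κ γ (vPair γ e.1 e.2) y

lemma blockOp_smul_blockFn (hκ : IsAmpleCone κ ample) (γ : Charges n b) (y : Vec n b)
    {Q : Type} [Fintype Q] (π : Fin n → Q) (D : Arcs Q) {S : Finset (Fin n)}
    (hS : ∀ i ∈ S, ∀ j ∈ S, π i = π j) : blockOp y (dotB_comm hκ γ) 0 (fun e => vPair γ e.1 e.2) S •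
    blockFn (tW κ γ) (Xmap κ γ) π D = blockFactor κ γ y S • blockFn (tW κ γ) (Xmap κ γ) π D := by
  rw [blockOp, blockFactor, sum_smul, sum_smul]; refine sum_congr rfl fun T _ => ?_
  rw [opRing_mul_smul, opConst_smul, prod_smul_eq y (dotB_comm hκ γ) 0 T _ _ _ fun e _ =>
    opGen_smul_blockFn hκ γ y π D (hS e.1 e.1.2 e.2 e.2.2), mul_smul]

lemma markedPhi_eq_sum (hκ : IsAmpleCone κ ample) {γ : Charges n b}
    (hγ : ∀ i, (γ i).1 ∈ ample) (hn : 0 < n) (y : Vec n b) :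
    (2 ^ (n - 1) * n.factorial : ℝ) * markedPhi κ γ y =
    ∑ P ∈ (partitions (univ : Finset (Fin n))).attach, (∏ B ∈ P.1, blockFactor κ γ y B) *
    (blockSum hκ γ y 0 (mem_partitions.1 P.2).block).1 y := by
  rw [markedPhi_eq hκ hγ hn, sum_opVal_treeFn hκ γ y 1 0, sum_opVal_eq_blockSum]
  refine sum_congr rfl fun P _ => ?_; have hP := mem_partitions.1 P.2
  have h : (∏ B ∈ P.1, blockOp y (dotB_comm hκ γ) 0 (fun e => vPair γ e.1 e.2) B) •
      blockSum hκ γ y 0 hP.block = (∏ B ∈ P.1, blockFactor κ γ y B) •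
        blockSum hκ γ y 0 hP.block := by
    rw [blockSum, smul_sum, smul_sum]; refine sum_congr rfl fun D _ => ?_
    rw [smul_comm, prod_smul_eq y (dotB_comm hκ γ) 0 P.1 _ _ _ fun B hB =>
      blockOp_smul_blockFn hκ γ y hP.block D fun i hi j hj => by
        rw [(hP.mem_iff i ⟨B, hB⟩).1 hi, (hP.mem_iff j ⟨B, hB⟩).1 hj], opRing_smul_smul]
  rw [h]; rfl

end

/-! ## Operators `a + (1/2π) ∂_v` -/

section

variable {E E' : Type} [NormedAddCommGroup E] [NormedSpace ℝ E] [FiniteDimensional ℝ E]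
  [NormedAddCommGroup E'] [NormedSpace ℝ E'] [FiniteDimensional ℝ E'] {α : Type}

/-- The commutative ring generated by the operators `(1/2π) ∂_v` and the scalars. -/
abbrev dirRing (E : Type) [NormedAddCommGroup E] [NormedSpace ℝ E] [FiniteDimensional ℝ E] : Type :=
  opRing (0 : E →ₗ[ℝ] E →ₗ[ℝ] ℝ) 0 (fun _ _ => rfl) 0

/-- The operator `a + (1/2π) ∂_v`. -/
def shiftOp (a : ℝ) (v : E) : dirRing E := opConst 0 (fun _ _ => rfl) 0 a + opGen 0 (fun _ _ => rfl) 0 v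

lemma shiftOp_smul_apply (a : ℝ) (v : E) (F : smoothFns E) (x : E) :
    (shiftOp a v • F).1 x = a * F.1 x + 1 / (2 * Real.pi) * fderiv ℝ F.1 x v := by
  change a * F.1 x + (0 * F.1 x + 0 * (0 * F.1 x) + 1 / (2 * Real.pi) * fderiv ℝ F.1 x v) = _; ring

/-- The composition of a smooth function with a linear map. -/
def pull (L : E →ₗ[ℝ] E') (F : smoothFns E') : smoothFns E :=
  ⟨fun x => F.1 (L x), mem_smoothFns.2
    ((smoothFns_contDiff F).comp (LinearMap.toContinuousLinearMap L).contDiff)⟩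

lemma shiftOp_smul_pull (a : ℝ) (v : E) (L : E →ₗ[ℝ] E') (F : smoothFns E') :
    shiftOp a v • pull L F = pull L (shiftOp a (L v) • F) := by
  ext x; change (shiftOp a v • pull L F).1 x = (shiftOp a (L v) • F).1 (L x)
  rw [shiftOp_smul_apply, shiftOp_smul_apply]
  have h : fderiv ℝ (pull L F).1 x v = fderiv ℝ F.1 (L x) (L v) := by
    have := ((smoothFns_differentiable F (L x)).hasFDerivAt.comp x
      (LinearMap.toContinuousLinearMap L).hasFDerivAt)
    change fderiv ℝ (F.1 ∘ LinearMap.toContinuousLinearMap L) x v = _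
    exact congrArg (fun f => f v) this.fderiv
  rw [h]; rfl

lemma prod_shiftOp_smul_pull (s : Finset α) (a : α → ℝ) (v : α → E) (L : E →ₗ[ℝ] E')
    (F : smoothFns E') : (∏ e ∈ s, shiftOp (a e) (v e)) • pull L F =
    pull L ((∏ e ∈ s, shiftOp (a e) (L (v e))) • F) := by
  induction s using Finset.induction_on with
  | empty => rw [prod_empty, prod_empty, opRing_one_smul, opRing_one_smul]
  | insert e s he ih =>
    rw [prod_insert he, prod_insert he, opRing_mul_smul, opRing_mul_smul, ih, shiftOp_smul_pull]

lemma prod_opGen_smul {B : E →ₗ[ℝ] E →ₗ[ℝ] ℝ} (y : E) (hB : ∀ v w, B v w = B w v) (s : Finset α)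
    (v : α → E) (F : smoothFns E) :
    (∏ e ∈ s, opGen y hB 0 (v e)) • F = (∏ e ∈ s, shiftOp (B (v e) y) (v e)) • F := by
  induction s using Finset.induction_on with
  | empty => simp_all
  | insert e s he ih =>
    rw [prod_insert he, prod_insert he, opRing_mul_smul, opRing_mul_smul, ih]; ext x
    rw [shiftOp_smul_apply]; change B (v e) y * _ + 0 * _ + 1 / (2 * Real.pi) * _ = _
    rw [zero_mul, add_zero]; rfl

end

/-! ## The tree sum in intrinsic form -/

section

variable {Q : Type} [Fintype Q]

/-- The smeared product of the signs of the flows through the arcs of a tree. -/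
def flowFn (t : Q → Q → ℝ) (D : Arcs Q) : smoothFns (Q → ℝ) :=
  smearFn t LinearMap.id (fun c => ∏ e ∈ D, sign (flow D e (meanFree c)))
    (isBddMeas_signs D fun e => flow D e)

/-- The tree sum with weights `t` of the noise and pairings `α`. -/
def treeNumber (t α : Q → Q → ℝ) : ℝ :=
  ∑ D ∈ otrees Q, ((∏ e ∈ D, shiftOp (α e.1 e.2) (t e.1 e.2 • dv e)) • flowFn t D).1
    fun q => ∑ q', α q q'

/-- The sums of `t` over pairs of blocks. -/
def tPush {n : ℕ} (π : Fin n → Q) (t : Fin n → Fin n → ℝ) (q q' : Q) : ℝ :=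
  ∑ i ∈ fiber π q, ∑ j ∈ fiber π q', t i j

lemma sum_fiber {n : ℕ} {M : Type*} [AddCommMonoid M] (π : Fin n → Q) (f : Fin n → M) :
    ∑ q, ∑ i ∈ fiber π q, f i = ∑ i, f i := sum_fiberwise _ _ _

lemma sum_tPush {n : ℕ} (π : Fin n → Q) (t : Fin n → Fin n → ℝ) (h : Q → Q → ℝ) :
    ∑ i, ∑ j, t i j * h (π i) (π j) = ∑ q, ∑ q', tPush π t q q' * h q q' := by
  have h1 : ∀ (f : Fin n → ℝ), ∑ i, f i = ∑ q, ∑ i ∈ fiber π q, f i := fun f =>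
    (sum_fiber π f).symm
  rw [h1]; refine sum_congr rfl fun q _ => ?_
  have h2 : ∀ i ∈ fiber π q, ∑ j, t i j * h (π i) (π j) =
      ∑ q', ∑ j ∈ fiber π q', t i j * h q q' := by
    intro i hi; rw [h1]; refine sum_congr rfl fun q' _ => sum_congr rfl fun j hj => ?_
    rw [mem_fiber.1 hi, mem_fiber.1 hj]
  rw [sum_congr rfl h2, sum_comm]; refine sum_congr rfl fun q' _ => ?_; rw [tPush, sum_mul]
  exact sum_congr rfl fun i _ => (sum_mul _ _ _).symm

lemma isWeight_tPush {n : ℕ} {π : Fin n → Q} (hπ : Surjective π)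
    {t : Fin n → Fin n → ℝ} (ht : IsWeight t) : IsWeight (tPush π t) := by
  refine ⟨fun q q' => ?_, fun q q' => ?_⟩
  · rw [tPush, tPush, sum_comm]; exact sum_congr rfl fun i _ => sum_congr rfl fun j _ => ht.1 _ _
  · have hne : ∀ q, (fiber π q).Nonempty := fun q => by
      obtain ⟨i, hi⟩ := hπ q; exact ⟨i, mem_fiber.2 hi⟩
    exact sum_pos (fun i _ => sum_pos (fun j _ => ht.2 i j) (hne q')) (hne q)

lemma blockFn_eq_pull {n : ℕ} {E : Type} [NormedAddCommGroup E] [NormedSpace ℝ E]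
    [FiniteDimensional ℝ E] {t : Fin n → Fin n → ℝ} (ht : IsWeight t) {X : E →ₗ[ℝ] (Fin n → ℝ)}
    (hX : ∀ x, ∑ i, X x i = 0) {π : Fin n → Q} (hπ : Surjective π) (D : Arcs Q) :
    blockFn t X π D = pull (pushSum π ∘ₗ X) (flowFn (tPush π t) D) := by
  ext x
  have h := smear_comp_eq ht (isWeight_tPush hπ ht) (ι := D) (fun e => flow D e.1 ∘ₗ pushSum π)
    (fun e => flow D e.1) (fun a c => by
      have := sum_tPush π t fun q q' => flow D a.1 (dv (q, q')) * flow D c.1 (dv (q, q'))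
      simpa only [mul_assoc, LinearMap.comp_apply, pushSum_dv, bar] using this)
    (g := fun s => ∏ e, sign (s e))
    (measurable_prod _ fun e _ => measurable_sign.comp (measurable_pi_apply e))
    (c := X x) (c' := pushSum π (X x)) (fun a => by
      have h0 : ∑ q, pushSum π (X x) q = 0 := by rw [sum_pushSum, hX]
      rw [meanFree_of_sum (hX x), meanFree_of_sum h0]; rfl)
  refine Eq.trans ?_ (h.trans ?_)
  · change smear t (fun c => ∏ e ∈ D, sign (flow D e (pushSum π (meanFree c)))) (X x) = _; congr 1
    funext c; exact (prod_coe_sort D fun e => sign (flow D e (pushSum π (meanFree c)))).symm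
  · change _ = smear (tPush π t) (fun c => ∏ e ∈ D, sign (flow D e (meanFree c))) (pushSum π (X x))
    congr 1; funext c; exact prod_coe_sort D fun e => sign (flow D e (meanFree c))

end

section

variable {n b : ℕ} {κ : Triples b} {ample : Set (Fin b → ℝ)} {Q : Type} [Fintype Q]
variable {γ : Charges n b} {π : Fin n → Q}

lemma blockSum_apply (hκ : IsAmpleCone κ ample)
    (hγ : ∀ i, (γ i).1 ∈ ample) (hπ : Surjective π) (y : Vec n b) :
    (blockSum hκ γ y 0 π).1 y = treeNumber (tPush π (tW κ γ))
    fun q q' => dot κ γ (vBlock γ (fiber π q) (fiber π q')) y := by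
  rw [blockSum, smoothFns_sum_apply, treeNumber]; refine sum_congr rfl fun D _ => ?_
  have h1 : ∀ a : Q × Q, (pushSum π ∘ₗ Xmap κ γ) (vBlock γ (fiber π a.1) (fiber π a.2)) =
      tPush π (tW κ γ) a.1 a.2 • dv a := by
    intro a; rw [vBlock, tPush, map_sum, sum_smul]; refine sum_congr rfl fun i hi => ?_
    rw [map_sum, sum_smul]; refine sum_congr rfl fun j hj => ?_
    rw [LinearMap.comp_apply, Xmap_vPair hκ, map_smul, pushSum_dv, bar, mem_fiber.1 hi,
      mem_fiber.1 hj]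
  rw [prod_opGen_smul, blockFn_eq_pull (isWeight_tW hκ hγ) (sum_Xmap hκ γ) hπ,
    prod_shiftOp_smul_pull]
  simp only [h1]; refine congrArg (Subtype.val _) (?_ : (pushSum π ∘ₗ Xmap κ γ) y = _); funext q
  have h2 := congrArg (fun v => dot κ γ v y) (sum_vBlock γ π q); simp only [dot_sum_left hκ] at h2
  rw [h2]; rfl

lemma kappaMatrix_isUnit_det (hκ : IsAmpleCone κ ample) {p : Fin b → ℝ} (hp : p ∈ ample) :
    IsUnit (kappaMatrix κ p).det := by
  obtain ⟨hs, v, hv, hw⟩ := hκ.signature p hp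
  rw [← Matrix.isUnit_iff_isUnit_det, ← Matrix.mulVec_injective_iff_isUnit]; intro w w' h
  by_contra hne
  have h0 : (kappaMatrix κ p).mulVec (w - w') = 0 := by rw [Matrix.mulVec_sub, sub_eq_zero]; exact h
  have := hw (w - w') (sub_ne_zero.2 hne) (by rw [h0, dotProduct_zero]); simp_all

lemma triple_eq_dotProduct (p y z : Fin b → ℝ) (hκ : IsAmpleCone κ ample) :
    triple κ p y z = y ⬝ᵥ (kappaMatrix κ p).mulVec z := by
  rw [triple_comm₁₂ hκ, triple_comm₂₃ hκ]
  simp only [triple, dotProduct, Matrix.mulVec, kappaMatrix, Matrix.of_apply, mul_sum, sum_mul]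
  refine sum_congr rfl fun a _ => sum_congr rfl fun c _ =>
    sum_congr rfl fun d _ => by ring

lemma dot_vPair_xVec (hκ : IsAmpleCone κ ample) (hγ : ∀ i, (γ i).1 ∈ ample) (τ : ℝ) (i j : Fin n) :
    dot κ γ (vPair γ i j) (xVec κ γ τ) = √(2 * τ) * dirac (γ i) (γ j) := by
  have h : ∀ k (y : Fin b → ℝ), triple κ (γ k).1 y (xVec κ γ τ k) = √(2 * τ) * (y ⬝ᵥ (γ k).2) := by
    intro k y
    rw [triple_eq_dotProduct _ _ _ hκ, xVec, Matrix.mulVec_smul, Matrix.mulVec_mulVec,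
      Matrix.mul_nonsing_inv _ (kappaMatrix_isUnit_det hκ (hγ k)), Matrix.one_mulVec,
      dotProduct_smul, smul_eq_mul]
  rw [dot_vPair hκ, h, triple_comm₁₂ hκ, h, dirac]; ring

lemma dirac_sum_left {ι : Type*} (s : Finset ι) (f : ι → Charge b) (δ : Charge b) :
    dirac (∑ i ∈ s, f i) δ = ∑ i ∈ s, dirac (f i) δ := by
  simp only [dirac, Prod.fst_sum, Prod.snd_sum, dotProduct_sum, sum_dotProduct, sum_sub_distrib]

lemma dirac_sum_right {ι : Type*} (s : Finset ι) (f : ι → Charge b) (δ : Charge b) :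
    dirac δ (∑ i ∈ s, f i) = ∑ i ∈ s, dirac δ (f i) := by
  simp only [dirac, Prod.fst_sum, Prod.snd_sum, dotProduct_sum, sum_dotProduct, sum_sub_distrib]

/-- The charges of blocks. -/
def blockCharge (γ : Charges n b) (π : Fin n → Q) (q : Q) : Charge b := ∑ i ∈ fiber π q, γ i

lemma sum_mem_ample (hκ : IsAmpleCone κ ample) {ι : Type*} {s : Finset ι} (hs : s.Nonempty)
    {f : ι → Fin b → ℝ} (hf : ∀ i ∈ s, f i ∈ ample) : ∑ i ∈ s, f i ∈ ample := by
  induction hs using Finset.Nonempty.cons_induction with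
  | singleton a => grind
  | cons a s ha hs ih =>
    rw [sum_cons]
    exact hκ.add_mem _ (hf a (mem_cons_self a s)) _ (ih fun i hi => hf i (mem_cons_of_mem hi))

lemma blockCharge_mem_ample (hκ : IsAmpleCone κ ample)
    (hγ : ∀ i, (γ i).1 ∈ ample) (hπ : Surjective π) (q : Q) : (blockCharge γ π q).1 ∈ ample := by
  obtain ⟨i, hi⟩ := hπ q; rw [blockCharge, Prod.fst_sum]
  exact sum_mem_ample hκ ⟨i, mem_fiber.2 hi⟩ fun i _ => hγ i

lemma fiber_id (i : Fin n) : fiber id i = {i} := by ext j; rw [mem_fiber, mem_singleton, id]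

lemma dot_vBlock_xVec (hκ : IsAmpleCone κ ample)
    (hγ : ∀ i, (γ i).1 ∈ ample) (τ : ℝ) (π : Fin n → Q) (q q' : Q) :
    dot κ γ (vBlock γ (fiber π q) (fiber π q')) (xVec κ γ τ) =
    √(2 * τ) * dirac (blockCharge γ π q) (blockCharge γ π q') := by
  rw [vBlock, dot_sum_left hκ, blockCharge, blockCharge, dirac_sum_left, mul_sum]
  refine sum_congr rfl fun i _ => ?_; rw [dot_sum_left hκ, dirac_sum_right, mul_sum]
  exact sum_congr rfl fun j _ => dot_vPair_xVec hκ hγ τ i j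

/-- The sum over trees of blocks is the simplified function of the charges of the blocks. -/
lemma blockSum_eq_simplePhi (hκ : IsAmpleCone κ ample) {γ : Charges n b}
    (hγ : ∀ i, (γ i).1 ∈ ample) {k : ℕ} (hk : 0 < k) {π : Fin n → Fin k}
    (hπ : Surjective π) (τ : ℝ) :
    (blockSum hκ γ (xVec κ γ τ) 0 π).1 (xVec κ γ τ) = (2 ^ (k - 1) * k.factorial : ℝ) *
    simplePhi κ (blockCharge γ π) (xVec κ (blockCharge γ π) τ) := by
  have hγ' := blockCharge_mem_ample hκ hγ hπ
  rw [simplePhi_eq hκ hγ' hk, blockSum_apply hκ hγ hπ, blockSum_apply hκ hγ' Function.surjective_id]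
  congr 1
  · funext q q'
    have hsum : ∑ q, (blockCharge γ π q).1 = ∑ i, (γ i).1 := by
      simp only [blockCharge, Prod.fst_sum]; exact sum_fiber π fun i => (γ i).1
    rw [tPush, tPush, fiber_id, fiber_id, sum_singleton, sum_singleton, tW, hsum,
      blockCharge, blockCharge, Prod.fst_sum, Prod.fst_sum, triple_sum_left hκ]
    refine sum_congr rfl fun i _ => ?_; rw [triple_comm₁₂ hκ, triple_sum_left hκ]
    exact sum_congr rfl fun j _ => triple_comm₁₂ hκ _ _ _
  · funext q q'; rw [dot_vBlock_xVec hκ hγ, dot_vBlock_xVec hκ hγ']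
    simp only [blockCharge, fiber_id, sum_singleton]

lemma hasClasses_empty {V Q : Type} {σ : V → Q} (hσ : Injective σ) :
    HasClasses (∅ : Arcs V) σ := fun u w => by
  refine ⟨fun h => ?_, fun h => hσ h ▸ Lk.refl _⟩
  exact h.eq_of σ fun e he => absurd he (notMem_empty e)

lemma completions_empty {V : Type} [Fintype V] : completions (∅ : Arcs V) = otrees V := by
  ext D; simp [completions, mem_otrees]

lemma isForest_empty {V : Type} : IsForest (∅ : Arcs V) := fun e he =>
  absurd he (notMem_empty e)

lemma sum_otrees_equiv {V Q A M : Type} [Fintype V] [Fintype Q] [CommSemiring A]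
    [AddCommMonoid M] [Module A M] (σ : V ≃ Q) (w : Q × Q → A) (k : Arcs Q → M) :
    ∑ D ∈ otrees V, (∏ e ∈ D, w (bar σ e)) • k (barImage σ D) =
    ∑ D ∈ otrees Q, (∏ e ∈ D, w e) • k D := by
  rw [← completions_empty, sum_completions_bar σ.surjective isForest_empty
    (hasClasses_empty σ.injective) (fun e => w (bar σ e)) k]
  refine sum_congr rfl fun D _ => ?_; congr 1; refine prod_congr rfl fun a _ => ?_
  rw [barSum, sum_eq_single (σ.symm a.1, σ.symm a.2)]
  · simp [bar]
  · intro e he hne; refine absurd ?_ hne; rw [← (mem_filter.1 he).2]; simp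
  grind

lemma flow_equiv {V Q : Type} [Fintype V] [Fintype Q] (σ : V ≃ Q) {D : Arcs V}
    (hD : IsOTree D) {c : V → ℝ} (hc : ∑ v, c v = 0) {e : V × V} (he : e ∈ D) :
    flow (barImage σ D) (bar σ e) (pushSum σ c) = flow D e c := by
  have := flow_barImage σ.surjective isForest_empty (hasClasses_empty σ.injective) (K := D)
    (disjoint_empty_right D) (by rwa [empty_union]) hc he
  simp_all

lemma pushSum_comp {V Q Q' : Type} [Fintype V] [Fintype Q] (π : V → Q) (σ : Q → Q') (c : V → ℝ) :
    pushSum (σ ∘ π) c = pushSum σ (pushSum π c) := by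
  ext q; simp only [pushSum_apply]
  rw [← sum_fiberwise_of_maps_to (s := univ.filter fun i => (σ ∘ π) i = q)
    (t := univ.filter fun x => σ x = q) (g := π) fun i hi => by simpa using hi]
  refine sum_congr rfl fun x hx => sum_congr ?_ fun _ _ => rfl; grind

lemma blockSum_equiv (hκ : IsAmpleCone κ ample) (γ : Charges n b) (y : Vec n b) (l : ℝ)
    {Q' : Type} [Fintype Q'] (π : Fin n → Q) (σ : Q ≃ Q') :
    blockSum hκ γ y l (σ ∘ π) = blockSum hκ γ y l π := by
  rw [blockSum, ← sum_otrees_equiv σ]; refine sum_congr rfl fun D hD => ?_; rw [mem_otrees] at hD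
  have hfib : ∀ q : Q, fiber (σ ∘ π) (σ q) = fiber π q := by
    intro q; ext i; rw [mem_fiber, mem_fiber, Function.comp_apply, σ.injective.eq_iff]
  have h1 : blockFn (tW κ γ) (Xmap κ γ) (σ ∘ π) (barImage σ D) =
      blockFn (tW κ γ) (Xmap κ γ) π D := by
    ext x
    change smear _ (fun c => ∏ e ∈ barImage σ D, sign (flow (barImage σ D) e
      (pushSum (σ ∘ π) (meanFree c)))) (Xmap κ γ x) =
      smear _ (fun c => ∏ e ∈ D, sign (flow D e (pushSum π (meanFree c)))) (Xmap κ γ x)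
    congr 1; funext c
    have hinj : Set.InjOn (bar σ) (D : Set (Q × Q)) := fun e _ e' _ h =>
      Prod.ext (σ.injective (Prod.mk.inj h).1) (σ.injective (Prod.mk.inj h).2)
    rw [prod_barImage hinj]; refine prod_congr rfl fun e he => ?_
    rw [pushSum_comp, flow_equiv σ hD (by rw [sum_pushSum, sum_meanFree]) he]
  simp_all

end

/-! ## The original function in terms of the simplified one -/

section

variable {n b : ℕ} {κ : Triples b} {ample : Set (Fin b → ℝ)}
variable {γ : Charges n b}

/-- The tree sum with sign averages for a pairing `g`. -/
def treeCoef {V : Type} [Fintype V] (g : V → V → ℝ) : ℝ :=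
  1 / 2 ^ (Fintype.card V - 1) * ∑ D ∈ otrees V, (sgnAvg D univ : ℝ) * ∏ e ∈ D, g e.1 e.2

/-- The factor of a block of charges. -/
def blockCoef (γ : Charges n b) (S : Finset (Fin n)) : ℝ :=
  treeCoef fun i j : S => dirac (γ i) (γ j)

/-- The charges of the blocks of a set of sets. -/
def partCharges (γ : Charges n b) (P : Finset (Finset (Fin n))) (i : Fin P.card) : Charge b :=
  ∑ j ∈ (P.equivFin.symm i).1, γ j

lemma IsOTree.card_eq {V : Type} [Fintype V] [Nonempty V] {D : Arcs V}
    (hD : IsOTree D) : D.card = Fintype.card V - 1 := by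
  have hF : FlipInv fun R : Arcs V => R.card := by
    intro R hR e he; have := sum_flipArc hR.1 he fun _ => 1
    simp only [sum_const, smul_eq_mul, mul_one] at this; simp only [this]; grind
  have h := orient_undirected_flip hD.1 rfl
  have h2 := (hF.flipArcs (isOTree_orient hD.isTree_undirected)
    (sdiff_subset (s := (orient (undirected D)).arcs) (t := D))).2
  rw [← h, card_orient_arcs hD.isTree_undirected] at h2; exact h2

lemma blockFactor_xVec (hκ : IsAmpleCone κ ample)
    (hγ : ∀ i, (γ i).1 ∈ ample) (τ : ℝ) {S : Finset (Fin n)} (hS : S.Nonempty) :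
    blockFactor κ γ (xVec κ γ τ) S = (2 * √(2 * τ)) ^ (S.card - 1) * blockCoef γ S := by
  have : Nonempty S := hS.to_subtype
  rw [blockFactor, blockCoef, treeCoef, mul_pow, Fintype.card_coe, mul_comm (2 ^ _),
    mul_assoc, ← mul_assoc (2 ^ _), mul_one_div_cancel (by positivity), one_mul, mul_sum]
  refine sum_congr rfl fun D hD => ?_; simp only [dot_vPair_xVec hκ hγ]
  rw [prod_mul_distrib, prod_const, (mem_otrees.1 hD).card_eq, Fintype.card_coe]; ring

lemma IsPartition.blockCharge_eq {P : Finset (Finset (Fin n))} (hP : IsPartition univ P)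
    (γ : Charges n b) : blockCharge γ (P.equivFin ∘ hP.block) = partCharges γ P := by
  funext q; refine sum_congr ?_ fun _ _ => rfl; ext i
  rw [mem_fiber, hP.mem_iff, Function.comp_apply, ← Equiv.eq_symm_apply]

lemma markedE_eq_sum (hκ : IsAmpleCone κ ample)
    (hγ : ∀ i, (γ i).1 ∈ ample) (hn : 0 < n) {τ : ℝ} (hτ : 0 < τ) :
    (n.factorial : ℝ) * markedE κ n γ τ =
    ∑ P ∈ partitions (univ : Finset (Fin n)), (∏ B ∈ P, blockCoef γ B) *
    (P.card.factorial * simpleE κ P.card (partCharges γ P) τ) := by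
  have hs : 0 < √(2 * τ) := Real.sqrt_pos.2 (by positivity)
  have h := markedPhi_eq_sum hκ hγ hn (xVec κ γ τ)
  have h2 : (2 * √(2 * τ)) ^ (n - 1) * (n.factorial * markedE κ n γ τ) =
      (2 ^ (n - 1) * n.factorial : ℝ) * markedPhi κ γ (xVec κ γ τ) := by
    rw [markedE, mul_pow]; field_simp
  refine mul_left_cancel₀ (pow_ne_zero (n - 1) (mul_pos two_pos hs).ne') (h2.trans ?_)
  rw [h, mul_sum, ← sum_attach (partitions univ)]; refine sum_congr rfl fun P _ => ?_
  have hP := mem_partitions.1 P.2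
  have hk : 0 < P.1.card := Finset.card_pos.2 ⟨_, (hP.block ⟨0, hn⟩).2⟩
  rw [← blockSum_equiv hκ γ (xVec κ γ τ) 0 hP.block P.1.equivFin,
    blockSum_eq_simplePhi hκ hγ hk (P.1.equivFin.surjective.comp hP.block_surjective), hP.blockCharge_eq,
    prod_congr rfl fun B hB => blockFactor_xVec hκ hγ τ (hP.1 B hB).1,
    prod_mul_distrib, prod_pow_eq_pow_sum, simpleE]
  have hpow : (2 * √(2 * τ)) ^ (n - 1) =
      (2 * √(2 * τ)) ^ (∑ B ∈ P.1, (B.card - 1)) * (2 * √(2 * τ)) ^ (P.1.card - 1) := by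
    rw [← pow_add]; congr 1; have h1 := hP.card_add; rw [Fintype.card_fin] at h1; omega
  rw [hpow, mul_pow _ _ (P.1.card - 1)]; field_simp

lemma simpleE_comp_perm (hκ : IsAmpleCone κ ample)
    (hγ : ∀ i, (γ i).1 ∈ ample) (σ : Equiv.Perm (Fin n)) (τ : ℝ) :
    simpleE κ n (γ ∘ σ) τ = simpleE κ n γ τ := by
  rcases n.eq_zero_or_pos with rfl | hn
  · rw [Subsingleton.elim (γ ∘ σ) γ]
  have h0 : (2 ^ (n - 1) * n.factorial : ℝ) ≠ 0 := by positivity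
  have h1 := blockSum_eq_simplePhi hκ hγ hn σ.symm.surjective τ
  have h2 := simplePhi_eq hκ hγ hn (xVec κ γ τ)
  have h3 : blockCharge γ σ.symm = γ ∘ σ := by
    funext q
    have : fiber σ.symm q = {σ q} := by ext i; rw [mem_fiber, mem_singleton, Equiv.symm_apply_eq]
    rw [blockCharge, this, sum_singleton, Function.comp_apply]
  have h4 : blockSum hκ γ (xVec κ γ τ) 0 σ.symm = blockSum hκ γ (xVec κ γ τ) 0 id :=
    blockSum_equiv hκ γ _ 0 id σ.symm
  rw [h4, ← h2, h3] at h1; rw [simpleE, simpleE, mul_left_cancel₀ h0 h1]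

end

/-! ## Schröder trees with given leaves -/

namespace SchroederTree

variable {L M : Type} [AddCommMonoid M]

/-- Relabel the leaves. -/
def map {L' : Type} (f : L → L') : SchroederTree L → SchroederTree L'
  | leaf l => leaf (f l)
  | node k ch => node k fun i => (ch i).map f

lemma frontier_map {L' : Type} (f : L → L') (T : SchroederTree L) :
    (T.map f).frontier = T.frontier.map f := by
  induction T with
  | leaf l => rfl
  | node k ch ih => simp only [map, frontier, List.map_flatten, List.map_ofFn, Function.comp_def, ih]

lemma map_map {L' L'' : Type} (f : L → L') (g : L' → L'') (T : SchroederTree L) :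
    (T.map f).map g = T.map (g ∘ f) := by
  induction T with
  | leaf l => rfl
  | node k ch ih => simp only [map, ih]

lemma map_id (T : SchroederTree L) : T.map id = T := by
  induction T with
  | leaf l => rfl
  | node k ch ih => simp only [map, ih]

lemma numVertices_map {L' : Type} (f : L → L') (T : SchroederTree L) :
    (T.map f).numVertices = T.numVertices := by
  induction T with
  | leaf l => rfl
  | node k ch ih => simp only [map, numVertices, ih]

lemma charge_map {L' : Type} (f : L → L') (γ : L' → M) (T : SchroederTree L) :
    (T.map f).charge γ = T.charge (γ ∘ f) := by
  induction T with
  | leaf l => rfl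
  | node k ch ih => simp only [map, charge, ih]

lemma weightProd_map {L' : Type} (f : L → L') (γ : L' → M) (w : (k : ℕ) → (Fin k → M) → ℝ)
    (T : SchroederTree L) : (T.map f).weightProd γ w = T.weightProd (γ ∘ f) w := by
  induction T with
  | leaf l => rfl
  | node k ch ih => simp only [map, weightProd, ih, charge_map]

lemma rootedWeightProd_map {L' : Type} (f : L → L') (γ : L' → M)
    (w₀ w : (k : ℕ) → (Fin k → M) → ℝ) (T : SchroederTree L) :
    (T.map f).rootedWeightProd γ w₀ w = T.rootedWeightProd (γ ∘ f) w₀ w := by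
  cases T with
  | leaf l => rfl
  | node k ch => simp only [map, rootedWeightProd, weightProd_map, charge_map]

lemma charge_eq_sum [DecidableEq L] (γ : L → M) {T : SchroederTree L} (hT : T.frontier.Nodup) :
    T.charge γ = ∑ l ∈ T.frontier.toFinset, γ l := by
  have h : ∀ T : SchroederTree L, T.charge γ = (T.frontier.map γ).sum := by
    intro T
    induction T with
    | leaf l => simp [charge, frontier]
    | node k ch ih =>
      simp only [charge, frontier, List.map_flatten, List.map_ofFn, List.sum_flatten,
        List.sum_ofFn, Function.comp_def, ih]
  rw [h, List.sum_toFinset _ hT]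

variable {n : ℕ}

/-- The trees whose leaves carry each element of `S` exactly once. -/
def treesOn (S : Finset (Fin n)) : Finset (SchroederTree (Fin n)) :=
  (finite_length_le (Fin n) n).toFinset.filter fun T =>
    T.frontier.Nodup ∧ T.frontier.toFinset = S

lemma mem_treesOn {S : Finset (Fin n)} {T : SchroederTree (Fin n)} :
    T ∈ treesOn S ↔ T.frontier.Nodup ∧ T.frontier.toFinset = S := by
  rw [treesOn, mem_filter, and_iff_right_iff_imp, Set.Finite.mem_toFinset]; rintro ⟨h, -⟩
  rw [Set.mem_ofPred_eq]; simpa using h.length_le_card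

/-- The ordered partitions of `S` into `k` blocks. -/
def _root_.orderedPartitions (k : ℕ) (S : Finset (Fin n)) : Finset (Fin k → Finset (Fin n)) :=
  univ.filter fun s => Injective s ∧ univ.image s ∈ partitions S

lemma frontier_node_iff {k : ℕ} {ch : Fin (k + 2) → SchroederTree (Fin n)}
    {S : Finset (Fin n)} : node k ch ∈ treesOn S ↔ (∀ i, (ch i).frontier.Nodup) ∧
    (fun i => (ch i).frontier.toFinset) ∈ orderedPartitions (k + 2) S := by
  have hne : ∀ i, (ch i).frontier.toFinset.Nonempty := fun i => by
    rw [List.toFinset_nonempty_iff]; intro h; have := (ch i).one_le_length_frontier; grind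
  have hmem : ∀ x, x ∈ (node k ch).frontier ↔ ∃ i, x ∈ (ch i).frontier := by
    intro x; simp only [frontier, List.mem_flatten, List.mem_ofFn]
    exact ⟨fun ⟨_, ⟨i, hi⟩, hx⟩ => ⟨i, hi ▸ hx⟩, fun ⟨i, hx⟩ => ⟨_, ⟨i, rfl⟩, hx⟩⟩
  have hnd : (node k ch).frontier.Nodup ↔ (∀ i, (ch i).frontier.Nodup) ∧
      ∀ i j, i ≠ j → ∀ x ∈ (ch i).frontier, x ∉ (ch j).frontier := by
    rw [frontier, List.nodup_flatten, List.pairwise_ofFn]; refine and_congr ?_ ?_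
    · grind
    · constructor
      · intro h i j hij x hx hx'; rcases lt_or_gt_of_ne hij with h' | h'
        · exact h h' hx hx'
        · exact h h' hx' hx
      · intro h i j hij x hx hx'; grind
  rw [mem_treesOn, hnd, and_assoc]; refine and_congr_right fun _ => ?_
  rw [orderedPartitions, mem_filter, mem_partitions]; simp only [mem_univ, true_and]; constructor
  · rintro ⟨hd, rfl⟩
    have hinj : Injective fun i => (ch i).frontier.toFinset := by
      intro i j hij; by_contra hne'; obtain ⟨x, hx⟩ := hne i; have hx' := hx
      rw [show (ch i).frontier.toFinset = (ch j).frontier.toFinset from hij] at hx'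
      exact hd i j hne' x (List.mem_toFinset.1 hx) (List.mem_toFinset.1 hx')
    refine ⟨hinj, fun B hB => ?_, fun x hx => ?_⟩
    · obtain ⟨i, -, rfl⟩ := mem_image.1 hB
      exact ⟨hne i, fun x hx => List.mem_toFinset.2 ((hmem x).2 ⟨i, List.mem_toFinset.1 hx⟩)⟩
    · obtain ⟨i, hi⟩ := (hmem x).1 (List.mem_toFinset.1 hx)
      refine ⟨_, ⟨mem_image_of_mem _ (mem_univ i), List.mem_toFinset.2 hi⟩, ?_⟩; rintro B ⟨hB, hxB⟩
      obtain ⟨j, -, rfl⟩ := mem_image.1 hB; by_contra hne'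
      refine hd i j ?_ x hi (List.mem_toFinset.1 hxB); grind
  · rintro ⟨hinj, hP⟩; refine ⟨fun i j hij x hx hx' => hij (hinj ?_), ?_⟩
    · exact hP.eq_of_mem (mem_image_of_mem _ (mem_univ i))
        (mem_image_of_mem _ (mem_univ j)) (List.mem_toFinset.2 hx)
        (List.mem_toFinset.2 hx')
    · ext x; rw [List.mem_toFinset, hmem]; constructor
      · rintro ⟨i, hi⟩; exact (hP.1 _ (mem_image_of_mem _ (mem_univ i))).2 (List.mem_toFinset.2 hi)
      · intro hx; obtain ⟨B, ⟨hB, hxB⟩, -⟩ := hP.2 x hx; obtain ⟨i, -, rfl⟩ := mem_image.1 hB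
        exact ⟨i, List.mem_toFinset.1 hxB⟩

lemma _root_.le_of_mem_orderedPartitions {k : ℕ} {S : Finset (Fin n)} {s : Fin k → Finset (Fin n)}
    (hs : s ∈ orderedPartitions k S) : k ≤ n := by
  rw [orderedPartitions, mem_filter, mem_partitions] at hs; obtain ⟨-, hinj, hP⟩ := hs
  have hne : ∀ i, ∃ x, x ∈ s i := fun i =>
    (hP.1 _ (mem_image_of_mem _ (mem_univ i))).1
  choose x hx using hne
  have : Injective x := fun i j hij => hinj (hP.eq_of_mem (mem_image_of_mem _ (mem_univ i))
      (mem_image_of_mem _ (mem_univ j)) (hx i) (hij ▸ hx j))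
  simpa using Fintype.card_le_of_injective x this

lemma sum_treesOn (S : Finset (Fin n)) (hS : 2 ≤ S.card) (Φ : SchroederTree (Fin n) → ℝ) :
    ∑ T ∈ treesOn S, Φ T = ∑ k ∈ range n, ∑ s ∈ orderedPartitions (k + 2) S,
    ∑ ch ∈ Fintype.piFinset fun i => treesOn (s i), Φ (node k ch) := by
  symm; rw [sum_congr rfl fun k _ => sum_sigma' _ _ _, sum_sigma']
  refine sum_bij (fun x _ => node x.1 x.2.2) ?_ ?_ ?_ fun _ _ => rfl
  · rintro ⟨k, s, ch⟩ hx; simp only [mem_sigma, Fintype.mem_piFinset, mem_treesOn] at hx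
    rw [frontier_node_iff]; simp_all
  · rintro ⟨k, s, ch⟩ hx ⟨k', s', ch'⟩ hx' heq
    simp only [mem_sigma, Fintype.mem_piFinset, mem_treesOn] at hx hx'
    simp only [node.injEq] at heq; obtain ⟨rfl, heq⟩ := heq; rw [heq_eq_eq] at heq; subst heq
    have : s = s' := funext fun i => ((hx.2.2 i).2).symm.trans (hx'.2.2 i).2; rw [this]
  · rintro (l | ⟨k, ch⟩) hT
    · rw [mem_treesOn] at hT; rw [← hT.2] at hS; simp [frontier] at hS
    · have h := frontier_node_iff.1 hT; refine ⟨⟨k, fun i => (ch i).frontier.toFinset, ch⟩, ?_, rfl⟩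
      simp only [mem_sigma, Fintype.mem_piFinset, mem_treesOn, mem_range]
      exact ⟨by have := le_of_mem_orderedPartitions h.2; omega, h.2, fun i => ⟨h.1 i, trivial⟩⟩

lemma treesOn_singleton (l : Fin n) : treesOn {l} = {leaf l} := by
  ext T; rw [mem_singleton]; constructor
  · intro hT
    cases T with
    | leaf l' =>
      have := (mem_treesOn.1 hT).2
      simp only [frontier, List.toFinset_cons, List.toFinset_nil, insert_empty_eq,
        singleton_inj] at this
      rw [this]
    | node k ch =>
      obtain ⟨h1, h2⟩ := mem_treesOn.1 hT; have h3 := List.toFinset_card_of_nodup h1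
      rw [h2, card_singleton, frontier, List.length_flatten, List.map_ofFn, List.sum_ofFn] at h3
      have h4 : ∑ _i : Fin (k + 2), 1 ≤ ∑ i, (List.length ∘ fun i => (ch i).frontier) i :=
        sum_le_sum fun i _ => (ch i).one_le_length_frontier
      simp only [sum_const, card_univ, Fintype.card_fin, smul_eq_mul, mul_one] at h4; omega
  · rintro rfl; exact mem_treesOn.2 ⟨List.nodup_singleton l, by simp [frontier]⟩

variable (γ : Fin n → M)

/-- The signed sum over the trees with leaves `S`. -/
def signedSum (w : (k : ℕ) → (Fin k → M) → ℝ) (S : Finset (Fin n)) : ℝ :=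
  ∑ T ∈ treesOn S, (-1) ^ T.numVertices * T.weightProd γ w

/-- The signed sum over the trees with leaves `S`, with another weight at the root. -/
def rootedSum (w₀ w : (k : ℕ) → (Fin k → M) → ℝ) (S : Finset (Fin n)) : ℝ :=
  ∑ T ∈ treesOn S, (-1) ^ (T.numVertices - 1) * T.rootedWeightProd γ w₀ w

lemma signedSum_singleton (w : (k : ℕ) → (Fin k → M) → ℝ) (l : Fin n) : signedSum γ w {l} = 1 := by
  rw [signedSum, treesOn_singleton, sum_singleton]; simp [numVertices, weightProd]

lemma rootedSum_eq (w₀ w : (k : ℕ) → (Fin k → M) → ℝ) {S : Finset (Fin n)} (hS : 2 ≤ S.card) :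
    rootedSum γ w₀ w S = ∑ k ∈ range n, ∑ s ∈ orderedPartitions (k + 2) S,
    w₀ (k + 2) (fun i => ∑ l ∈ s i, γ l) * ∏ i, signedSum γ w (s i) := by
  rw [rootedSum, sum_treesOn S hS]; refine sum_congr rfl fun k _ => sum_congr rfl fun s _ => ?_
  simp only [signedSum]; rw [prod_univ_sum, mul_sum]; refine sum_congr rfl fun ch hch => ?_
  simp only [Fintype.mem_piFinset, mem_treesOn] at hch
  have h : (fun i => (ch i).charge γ) = fun i => ∑ l ∈ s i, γ l := funext fun i => by
    rw [charge_eq_sum γ (hch i).1, (hch i).2]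
  rw [numVertices, rootedWeightProd, h, Nat.add_sub_cancel_left, prod_mul_distrib,
    prod_pow_eq_pow_sum]
  ring

lemma signedSum_eq (w : (k : ℕ) → (Fin k → M) → ℝ) {S : Finset (Fin n)} (hS : 2 ≤ S.card) :
    signedSum γ w S = -rootedSum γ w w S := by
  rw [signedSum, rootedSum, ← sum_neg_distrib]; refine sum_congr rfl fun T hT => ?_
  cases T with
  | leaf l =>
    rw [← (mem_treesOn.1 hT).2] at hS; simp [frontier] at hS
  | node k ch =>
    rw [numVertices, rootedWeightProd, weightProd, Nat.add_sub_cancel_left, pow_add]; ring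

lemma sum_perm_schroederTrees (w₀ w : (k : ℕ) → (Fin k → M) → ℝ) :
    ∑ σ : Equiv.Perm (Fin n), ∑ T ∈ schroederTrees n,
    (-1) ^ (T.numVertices - 1) * T.rootedWeightProd (γ ∘ σ) w₀ w = rootedSum γ w₀ w univ := by
  rw [rootedSum, ← sum_product']
  have hmem : ∀ T, T ∈ schroederTrees n ↔ T.frontier = List.finRange n := fun T => by
    rw [schroederTrees, Set.Finite.mem_toFinset, Set.mem_ofPred_eq]
  refine sum_bij (fun x _ => x.2.map x.1) ?_ ?_ ?_ ?_
  · rintro ⟨σ, T⟩ hx; have hT := (hmem T).1 (mem_product.1 hx).2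
    simp only [mem_treesOn, frontier_map, hT]; refine ⟨(List.nodup_finRange n).map σ.injective, ?_⟩
    ext i
    simp only [List.mem_toFinset, List.mem_map, List.mem_finRange, true_and, mem_univ, iff_true]
    exact σ.surjective i
  · rintro ⟨σ, T⟩ hx ⟨σ', T'⟩ hx' heq; have hT := (hmem T).1 (mem_product.1 hx).2
    have hT' := (hmem T').1 (mem_product.1 hx').2; have h1 := congrArg frontier heq
    simp only [frontier_map, hT, hT'] at h1; have h2 : σ = σ' := Equiv.ext fun i => by simp_all
    subst h2; have h3 := congrArg (map σ.symm) heq; simp only [map_map] at h3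
    rw [Equiv.symm_comp_self, map_id, map_id] at h3; rw [h3]
  · intro T hT; obtain ⟨h1, h2⟩ := mem_treesOn.1 hT
    have hlen : T.frontier.length = n := by
      rw [← List.toFinset_card_of_nodup h1, h2, card_univ, Fintype.card_fin]
    have hinj : Injective fun i : Fin n => T.frontier.get (i.cast hlen.symm) := by
      intro i j hij; have := h1.injective_get hij; simpa [Fin.ext_iff] using this
    let σ : Equiv.Perm (Fin n) := Equiv.ofBijective _ (Finite.injective_iff_bijective.1 hinj)
    have hσ : (List.finRange n).map σ = T.frontier := by
      refine List.ext_get (by simp [hlen]) fun i h3 h4 => ?_; simp [σ]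
    refine ⟨(σ, T.map σ.symm), ?_, ?_⟩
    · rw [mem_product, hmem, frontier_map, ← hσ, List.map_map, Equiv.symm_comp_self, List.map_id]
      grind
    · simp only [map_map]; rw [Equiv.self_comp_symm, map_id]
  · rintro ⟨σ, T⟩ _; simp only [numVertices_map, rootedWeightProd_map]

end SchroederTree

/-! ## Partitions of partitions -/

section

variable {V : Type} [DecidableEq V]
variable {S : Finset V} {P : Finset (Finset V)} {R : Finset (Finset (Finset V))}

lemma IsPartition.biUnion_id (hP : IsPartition S P) : P.biUnion id = S := by
  ext i; rw [mem_biUnion]; constructor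
  · rintro ⟨B, hB, hi⟩; exact (hP.1 B hB).2 hi
  · intro hi; obtain ⟨B, ⟨hB, hi'⟩, -⟩ := hP.2 i hi; exact ⟨B, hB, hi'⟩

lemma IsPartition.nonempty (hP : IsPartition S P) (hS : S.Nonempty) : P.Nonempty := by
  obtain ⟨i, hi⟩ := hS; obtain ⟨B, ⟨hB, -⟩, -⟩ := hP.2 i hi; exact ⟨B, hB⟩

lemma IsPartition.eq_of_biUnion (hP : IsPartition S P)
    (hR : IsPartition P R) {C C' : Finset (Finset V)}
    (hC : C ∈ R) (hC' : C' ∈ R) {i : V} (hi : i ∈ C.biUnion id) (hi' : i ∈ C'.biUnion id) :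
    C = C' := by
  obtain ⟨B, hB, hiB⟩ := mem_biUnion.1 hi; obtain ⟨B', hB', hiB'⟩ := mem_biUnion.1 hi'
  have : B = B' := hP.eq_of_mem ((hR.1 C hC).2 hB) ((hR.1 C' hC').2 hB') hiB hiB'
  exact hR.eq_of_mem hC hC' hB (this ▸ hB')

lemma IsPartition.biUnion_nonempty (hP : IsPartition S P)
    (hR : IsPartition P R) {C : Finset (Finset V)} (hC : C ∈ R) : (C.biUnion id).Nonempty := by
  obtain ⟨B, hB⟩ := (hR.1 C hC).1; obtain ⟨i, hi⟩ := (hP.1 B ((hR.1 C hC).2 hB)).1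
  exact ⟨i, mem_biUnion.2 ⟨B, hB, hi⟩⟩

lemma IsPartition.injOn_biUnion (hP : IsPartition S P) (hR : IsPartition P R) :
    Set.InjOn (fun C : Finset (Finset V) => C.biUnion id) (R : Set (Finset (Finset V))) := by
  intro C hC C' hC' h; obtain ⟨i, hi⟩ := hP.biUnion_nonempty hR hC
  exact hP.eq_of_biUnion hR hC hC' hi (by grind)

lemma IsPartition.isPartition_image (hP : IsPartition S P) (hR : IsPartition P R) :
    IsPartition S (R.image fun C => C.biUnion id) ∧ ∀ C ∈ R, IsPartition (C.biUnion id) C := by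
  refine ⟨⟨fun U hU => ?_, fun i hi => ?_⟩, fun C hC => ⟨fun B hB => ⟨?_, ?_⟩, fun i hi => ?_⟩⟩
  · obtain ⟨C, hC, rfl⟩ := mem_image.1 hU
    refine ⟨hP.biUnion_nonempty hR hC, biUnion_subset.2 fun B hB => ?_⟩
    exact (hP.1 B ((hR.1 C hC).2 hB)).2
  · obtain ⟨B, ⟨hB, hiB⟩, -⟩ := hP.2 i hi; obtain ⟨C, ⟨hC, hBC⟩, -⟩ := hR.2 B hB
    have hiC : i ∈ C.biUnion id := mem_biUnion.2 ⟨B, hBC, hiB⟩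
    refine ⟨C.biUnion id, ⟨mem_image_of_mem _ hC, hiC⟩, ?_⟩; rintro U ⟨hU, hiU⟩
    obtain ⟨C', hC', rfl⟩ := mem_image.1 hU; rw [hP.eq_of_biUnion hR hC' hC hiU hiC]
  · exact (hP.1 B ((hR.1 C hC).2 hB)).1
  · grind
  · obtain ⟨B, hB, hiB⟩ := mem_biUnion.1 hi
    exact ⟨B, ⟨hB, hiB⟩, fun B' hB' => hP.eq_of_mem ((hR.1 C hC).2 hB'.1)
      ((hR.1 C hC).2 hB) hB'.2 hiB⟩

lemma isPartition_glue {Q : Finset (Finset V)} (hQ : IsPartition S Q)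
    {C : ∀ U ∈ Q, Finset (Finset V)} (hC : ∀ U hU, IsPartition U (C U hU)) :
    IsPartition S ((Q.attach.image fun x => C x.1 x.2).biUnion id) ∧
    IsPartition ((Q.attach.image fun x => C x.1 x.2).biUnion id)
    (Q.attach.image fun x => C x.1 x.2) := by
  have hmem : ∀ B, B ∈ (Q.attach.image fun x => C x.1 x.2).biUnion id ↔
      ∃ U, ∃ hU : U ∈ Q, B ∈ C U hU := by
    intro B; simp only [mem_biUnion, mem_image, mem_attach, true_and, Subtype.exists, id]
    exact ⟨fun ⟨_, ⟨U, hU, rfl⟩, hB⟩ => ⟨U, hU, hB⟩, fun ⟨U, hU, hB⟩ => ⟨_, ⟨U, hU, rfl⟩, hB⟩⟩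
  refine ⟨⟨fun B hB => ?_, fun i hi => ?_⟩, fun D hD => ⟨?_, ?_⟩, fun B hB => ?_⟩
  · obtain ⟨U, hU, hB⟩ := (hmem B).1 hB
    exact ⟨((hC U hU).1 B hB).1, ((hC U hU).1 B hB).2.trans (hQ.1 U hU).2⟩
  · obtain ⟨U, ⟨hU, hiU⟩, -⟩ := hQ.2 i hi; obtain ⟨B, ⟨hB, hiB⟩, -⟩ := (hC U hU).2 i hiU
    refine ⟨B, ⟨(hmem B).2 ⟨U, hU, hB⟩, hiB⟩, ?_⟩; rintro B' ⟨hB', hiB'⟩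
    obtain ⟨U', hU', hB'⟩ := (hmem B').1 hB'
    obtain rfl := hQ.eq_of_mem hU hU' hiU (((hC U' hU').1 B' hB').2 hiB')
    exact (hC U hU).eq_of_mem hB' hB hiB' hiB
  · obtain ⟨x, -, rfl⟩ := mem_image.1 hD; exact (hC x.1 x.2).nonempty (hQ.1 x.1 x.2).1
  · grind
  · obtain ⟨U, hU, hB⟩ := (hmem B).1 hB
    refine ⟨C U hU, ⟨mem_image.2 ⟨⟨U, hU⟩, mem_attach _ _, rfl⟩, hB⟩, ?_⟩; rintro D ⟨hD, hBD⟩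
    obtain ⟨⟨U', hU'⟩, -, rfl⟩ := mem_image.1 hD; obtain ⟨i, hi⟩ := ((hC U hU).1 B hB).1
    obtain rfl := hQ.eq_of_mem hU hU' (((hC U hU).1 B hB).2 hi) (((hC U' hU').1 B hBD).2 hi); rfl

/-- The composition of partition sums. -/
lemma sum_partitions_partitions (S : Finset V) (F : Finset (Finset V) → ℝ)
    (G : Finset (Finset V) → ℝ) (h : Finset V → ℝ) :
    ∑ P ∈ partitions S, (∑ R ∈ partitions P, (∏ C ∈ R, G C) * F (R.image fun C => C.biUnion id)) *
    ∏ B ∈ P, h B = ∑ Q ∈ partitions S, F Q * ∏ U ∈ Q, ∑ C ∈ partitions U, G C * ∏ B ∈ C, h B := by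
  symm; simp only [prod_sum, mul_sum, sum_mul]; rw [sum_sigma', sum_sigma']
  refine sum_bij (fun x _ =>
    ⟨(x.1.attach.image fun y => x.2 y.1 y.2).biUnion id, x.1.attach.image fun y => x.2 y.1 y.2⟩)
    ?_ ?_ ?_ ?_
  · rintro ⟨Q, C⟩ hx; simp only [mem_sigma, Finset.mem_pi, mem_partitions] at hx ⊢
    exact isPartition_glue hx.1 hx.2
  · rintro ⟨Q, C⟩ hx ⟨Q', C'⟩ hx' heq
    simp only [mem_sigma, Finset.mem_pi, mem_partitions] at hx hx'
    have hR : (Q.attach.image fun y => C y.1 y.2) = Q'.attach.image fun y => C' y.1 y.2 := by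
      simpa using (Sigma.mk.inj heq).2
    have hU : ∀ {Q : Finset (Finset V)} {C : ∀ U ∈ Q, Finset (Finset V)},
        (∀ U hU, IsPartition U (C U hU)) →
        (Q.attach.image fun y => C y.1 y.2).image (fun C => C.biUnion id) = Q := by
      intro Q C hC; ext U; simp only [mem_image, mem_attach, true_and, Subtype.exists]; constructor
      · rintro ⟨_, ⟨U', hU', rfl⟩, rfl⟩
        rwa [(hC U' hU').biUnion_id]
      · intro hU; exact ⟨_, ⟨U, hU, rfl⟩, (hC U hU).biUnion_id⟩
    have hQ : Q = Q' := by rw [← hU hx.2, ← hU hx'.2, hR]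
    subst hQ; congr 1; funext U hUQ
    have h1 : C U hUQ ∈ Q.attach.image fun y => C' y.1 y.2 := by
      rw [← hR]; exact mem_image.2 ⟨⟨U, hUQ⟩, mem_attach _ _, rfl⟩
    obtain ⟨⟨U', hU'⟩, -, h2⟩ := mem_image.1 h1
    have h3 : U' = U := by
      rw [← (hx'.2 U' hU').biUnion_id, ← (hx.2 U hUQ).biUnion_id]
      exact congrArg (fun C : Finset (Finset V) => C.biUnion id) h2
    grind
  · rintro ⟨P, R⟩ hx; simp only [mem_sigma, mem_partitions] at hx; obtain ⟨hP, hR⟩ := hx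
    obtain ⟨hQ, hC⟩ := hP.isPartition_image hR
    have hch : ∀ U ∈ R.image fun C => C.biUnion id, ∃ C ∈ R, C.biUnion id = U := fun U hU => by
      simpa using hU
    choose! c hcR hcU using hch
    have hc : ∀ C ∈ R, c (C.biUnion id) = C := fun C hCR =>
      hP.injOn_biUnion hR (hcR _ (mem_image_of_mem _ hCR)) hCR (hcU _ (mem_image_of_mem _ hCR))
    have himg : ((R.image fun C => C.biUnion id).attach.image fun y => c y.1) = R := by
      ext C; simp only [mem_image, mem_attach, true_and, Subtype.exists]; constructor <;> grind
    refine ⟨⟨R.image fun C => C.biUnion id, fun U _ => c U⟩, ?_, ?_⟩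
    · simp only [mem_sigma, Finset.mem_pi, mem_partitions]; grind
    · simp only [himg]; exact Sigma.ext (by convert hR.biUnion_id) HEq.rfl
  · rintro ⟨Q, C⟩ hx; simp only [mem_sigma, Finset.mem_pi, mem_partitions] at hx
    obtain ⟨hP, hR⟩ := isPartition_glue hx.1 hx.2
    have hinj : Set.InjOn (fun y : {x // x ∈ Q} => C y.1 y.2) Q.attach := by
      intro y _ y' _ heq; refine Subtype.ext ?_
      rw [← (hx.2 y.1 y.2).biUnion_id, ← (hx.2 y'.1 y'.2).biUnion_id]
      exact congrArg (fun C : Finset (Finset V) => C.biUnion id) heq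
    have h1 : (Q.attach.image fun y => C y.1 y.2).image (fun C => C.biUnion id) = Q := by
      rw [image_image]
      conv_rhs => rw [← attach_image_val (s := Q)]
      exact image_congr fun y _ => (hx.2 y.1 y.2).biUnion_id
    have h2 : ∏ B ∈ (Q.attach.image fun y => C y.1 y.2).biUnion id, h B =
        ∏ x ∈ Q.attach, ∏ B ∈ C x.1 x.2, h B := by
      rw [prod_biUnion, prod_image hinj]
      · rfl
      · intro D hD D' hD' hne; exact disjoint_left.2 fun B h1 h2 => hne (hR.eq_of_mem hD hD' h1 h2)
    simp only [h1, h2, prod_image hinj, prod_mul_distrib]; ring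

lemma IsPartition.image {k : ℕ} {s : Fin k → V}
    {R : Finset (Finset (Fin k))} (hR : IsPartition univ R) (hs : Injective s) :
    IsPartition (univ.image s) (R.image (Finset.image s)) := by
  refine ⟨fun C hC => ?_, fun x hx => ?_⟩
  · obtain ⟨B, hB, rfl⟩ := mem_image.1 hC
    exact ⟨(hR.1 B hB).1.image s, image_subset_image (subset_univ B)⟩
  · obtain ⟨i, -, rfl⟩ := mem_image.1 hx; obtain ⟨B, ⟨hB, hi⟩, -⟩ := hR.2 i (mem_univ i)
    refine ⟨B.image s, ⟨mem_image_of_mem _ hB, mem_image_of_mem _ hi⟩, ?_⟩; rintro C ⟨hC, hiC⟩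
    obtain ⟨B', hB', rfl⟩ := mem_image.1 hC
    rw [hR.eq_of_mem hB' hB ((hs.mem_finset_image).1 hiC) hi]

lemma sum_partitions_image {k : ℕ} {α : Type} [Fintype α] [DecidableEq α] {s : Fin k → α} (hs : Injective s)
    (Ψ : Finset (Finset α) → ℝ) :
    ∑ R ∈ partitions (univ : Finset (Fin k)), Ψ (R.image (Finset.image s)) =
    ∑ R ∈ partitions (univ.image s), Ψ R := by
  have hinj : Injective (Finset.image s) := image_injective hs
  refine sum_bij (fun R _ => R.image (Finset.image s)) ?_ ?_ ?_ fun _ _ => rfl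
  · exact fun R hR => mem_partitions.2 ((mem_partitions.1 hR).image hs)
  · intro R _ R' _ h; exact image_injective hinj h
  · intro R hR; rw [mem_partitions] at hR
    have himg : ∀ C ∈ R, (univ.filter fun i => s i ∈ C).image s = C := by
      intro C hC; ext x; simp only [mem_image, mem_filter_univ]; constructor
      · rintro ⟨i, hi, rfl⟩; exact hi
      · intro hx; obtain ⟨i, -, rfl⟩ := mem_image.1 ((hR.1 C hC).2 hx); exact ⟨i, hx, rfl⟩
    refine ⟨R.image fun C => univ.filter fun i => s i ∈ C, ?_, ?_⟩
    · rw [mem_partitions]; refine ⟨fun B hB => ⟨?_, subset_univ _⟩, fun i _ => ?_⟩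
      · obtain ⟨C, hC, rfl⟩ := mem_image.1 hB; rw [← image_nonempty (f := s), himg C hC]
        exact (hR.1 C hC).1
      · obtain ⟨C, ⟨hC, hi⟩, -⟩ := hR.2 (s i) (mem_image_of_mem _ (mem_univ i))
        refine ⟨_, ⟨mem_image_of_mem _ hC, by simpa using hi⟩, ?_⟩
        rintro B ⟨hB, hiB⟩; obtain ⟨C', hC', rfl⟩ := mem_image.1 hB
        rw [hR.eq_of_mem hC' hC (by simpa using hiB) hi]
    grind

lemma isPartition_singleton (hS : S.Nonempty) : IsPartition S {S} := by
  refine ⟨fun B hB => ?_, fun i hi => ⟨S, ⟨mem_singleton_self S, hi⟩, fun B hB => ?_⟩⟩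
  · rw [mem_singleton.1 hB]; exact ⟨hS, subset_rfl⟩
  grind

lemma IsPartition.eq_singleton_or (hS : S.Nonempty) (hP : IsPartition S P) :
    P = {S} ∨ (2 ≤ P.card ∧ ∀ B ∈ P, B.Nonempty ∧ B ⊂ S) := by
  by_cases hne : P = {S}
  · exact Or.inl hne
  have hS' : S ∉ P := by
    intro hSP; refine hne (eq_singleton_iff_unique_mem.2 ⟨hSP, fun B hB => ?_⟩)
    obtain ⟨i, hi⟩ := (hP.1 B hB).1; exact hP.eq_of_mem hB hSP hi ((hP.1 B hB).2 hi)
  refine Or.inr ⟨?_, fun B hB => ⟨(hP.1 B hB).1, (hP.1 B hB).2.ssubset_of_ne ?_⟩⟩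
  · by_contra hlt; have h1 := (hP.nonempty hS).card_pos
    obtain ⟨B, rfl⟩ := card_eq_one.1 (show P.card = 1 by omega)
    have := hP.biUnion_id; rw [singleton_biUnion, id] at this
    exact hS' (by rw [this]; exact mem_singleton_self S)
  grind

end

/-! ## Sums over Schröder trees and partitions -/

section

variable {n b : ℕ}
variable {S : Finset (Fin n)}

/-- The value of a weight on a set of sets of charges, times the number of its orderings. -/
def partVal (γ : Charges n b) (w : ChargeFn b) (P : Finset (Finset (Fin n))) : ℝ :=
  P.card.factorial * w P.card (partCharges γ P)

/-- The weight does not depend on the order of the blocks of a partition. -/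
def IsOrderFree (γ : Charges n b) (w : ChargeFn b) : Prop :=
  ∀ S : Finset (Fin n), S.Nonempty → ∀ (k : ℕ) (s : Fin k → Finset (Fin n)), Injective s →
    IsPartition S (univ.image s) →
    (k.factorial : ℝ) * w k (fun i => ∑ l ∈ s i, γ l) = partVal γ w (univ.image s)

/-- The sum over the partitions of `S` with weight `w` and factors `h`. -/
def partTransform (γ : Charges n b) (w : ChargeFn b)
    (h : Finset (Fin n) → ℝ) (S : Finset (Fin n)) : ℝ :=
  ∑ P ∈ partitions S, partVal γ w P * ∏ B ∈ P, h B

lemma card_orderings {α : Type} [DecidableEq α] [Fintype α] (P : Finset α) :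
    (univ.filter fun s : Fin P.card → α =>
    Injective s ∧ univ.image s = P).card = P.card.factorial := by
  have h : Fintype.card (Fin P.card ≃ P) = P.card.factorial := by
    rw [Fintype.card_equiv P.equivFin.symm, Fintype.card_fin]
  rw [← h, ← card_univ]; symm
  refine card_bij (fun e _ i => (e i).1) (fun e _ => ?_) (fun e _ e' _ he => ?_) fun s hs => ?_
  · rw [mem_filter]; refine ⟨mem_univ _, Subtype.val_injective.comp e.injective, ?_⟩; ext x
    simp only [mem_image, mem_univ, true_and]; constructor
    · grind
    · intro hx; exact ⟨e.symm ⟨x, hx⟩, by grind⟩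
  · exact Equiv.ext fun i => Subtype.ext (congrFun he i)
  · rw [mem_filter] at hs
    have hmem : ∀ i, s i ∈ P := fun i => by rw [← hs.2.2]; exact mem_image_of_mem _ (mem_univ i)
    refine ⟨Equiv.ofBijective (fun i => ⟨s i, hmem i⟩) ⟨fun i j hij => ?_, fun x => ?_⟩,
      mem_univ _, rfl⟩
    · exact hs.2.1 (congrArg Subtype.val hij)
    grind

lemma sum_orderedPartitions {γ : Charges n b} {w : ChargeFn b}
    (hw : IsOrderFree γ w) (h : Finset (Fin n) → ℝ) {S : Finset (Fin n)} (hS : S.Nonempty) :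
    ∑ k ∈ range n, ∑ s ∈ orderedPartitions (k + 2) S,
    w (k + 2) (fun i => ∑ l ∈ s i, γ l) * ∏ i, h (s i) =
    ∑ P ∈ partitions S with 2 ≤ P.card, partVal γ w P * ∏ B ∈ P, h B := by
  have hmaps : ∀ k, ∀ s ∈ orderedPartitions (k + 2) S,
      univ.image s ∈ (partitions S).filter fun P => 2 ≤ P.card := by
    intro k s hs; simp only [orderedPartitions, mem_filter_univ] at hs
    rw [mem_filter, card_image_of_injective _ hs.1, card_univ, Fintype.card_fin]
    exact ⟨hs.2, by omega⟩
  simp only [← sum_fiberwise_of_maps_to (hmaps _)]; rw [sum_comm]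
  refine sum_congr rfl fun P hP => ?_; rw [mem_filter] at hP
  obtain ⟨k, hk⟩ : ∃ k, P.card = k + 2 := ⟨P.card - 2, by omega⟩
  have hkn : k ∈ range n := by
    have h1 : P.card ≤ n := by
      have := (card_orderings P).symm
      obtain ⟨s, hs⟩ : (univ.filter fun s : Fin P.card → Finset (Fin n) =>
          Injective s ∧ univ.image s = P).Nonempty := by
        rw [← Finset.card_pos, card_orderings]; positivity
      rw [mem_filter] at hs; refine le_of_mem_orderedPartitions (s := s) (S := S) ?_
      simp only [orderedPartitions, mem_filter_univ]; exact ⟨hs.2.1, by rw [hs.2.2]; exact hP.1⟩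
    rw [mem_range]; omega
  rw [sum_eq_single_of_mem k hkn]
  · have hconst : ∀ s ∈ (orderedPartitions (k + 2) S).filter fun s => univ.image s = P,
        ((k + 2).factorial : ℝ) * (w (k + 2) (fun i => ∑ l ∈ s i, γ l) * ∏ i, h (s i)) =
          partVal γ w P * ∏ B ∈ P, h B := by
      intro s hs; simp only [orderedPartitions, mem_filter, mem_univ, true_and] at hs
      have h1 := hw S hS (k + 2) s hs.1.1 (mem_partitions.1 hs.1.2); rw [hs.2] at h1
      rw [← mul_assoc, h1, ← hs.2, prod_image fun i _ j _ hij => hs.1.1 hij]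
    have hcard : ((orderedPartitions (k + 2) S).filter fun s => univ.image s = P).card =
        (k + 2).factorial := by
      rw [← hk, ← card_orderings P]; congr 1; ext s; simp only [orderedPartitions, mem_filter_univ]
      constructor <;> grind
    have hf : ((k + 2).factorial : ℝ) ≠ 0 := by positivity
    refine mul_left_cancel₀ hf ?_
    rw [mul_sum, sum_congr rfl hconst, sum_const, hcard, nsmul_eq_mul]
  · intro j _ hj; refine sum_eq_zero fun s hs => absurd ?_ hj
    simp only [orderedPartitions, mem_filter, mem_univ, true_and] at hs
    have := card_image_of_injective univ hs.1.1; simp_all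

lemma partTransform_eq (γ : Charges n b) (w : ChargeFn b)
    (h : Finset (Fin n) → ℝ) {S : Finset (Fin n)} (hS : S.Nonempty) :
    partTransform γ w h S = partVal γ w {S} * h S +
    ∑ P ∈ partitions S with 2 ≤ P.card, partVal γ w P * ∏ B ∈ P, h B := by
  have h1 : (partitions S).filter (fun P => ¬ 2 ≤ P.card) = {{S}} := by
    ext P; rw [mem_filter, mem_partitions, mem_singleton]; constructor
    · rintro ⟨h1, h2⟩; exact (h1.eq_singleton_or hS).resolve_right fun h3 => h2 h3.1
    · rintro rfl; exact ⟨isPartition_singleton hS, by grind⟩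
  rw [partTransform, ← sum_filter_add_sum_filter_not _ (fun P => 2 ≤ P.card), h1,
    sum_singleton, prod_singleton, add_comm]

lemma ssubset_of_mem_partitions (hS : S.Nonempty)
    {P : Finset (Finset (Fin n))} (hP : P ∈ partitions S) (h2 : 2 ≤ P.card) {B : Finset (Fin n)}
    (hB : B ∈ P) : B.Nonempty ∧ B ⊂ S := by
  rcases (mem_partitions.1 hP).eq_singleton_or hS with rfl | hP
  · grind
  · exact hP.2 B hB

lemma eq_of_partTransform_eq (γ : Charges n b) {w : ChargeFn b}
    (hw : ∀ S : Finset (Fin n), S.Nonempty → partVal γ w {S} = 1) {h h' : Finset (Fin n) → ℝ}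
    (heq : ∀ S : Finset (Fin n), S.Nonempty → partTransform γ w h S = partTransform γ w h' S)
    (S : Finset (Fin n)) (hS : S.Nonempty) : h S = h' S := by
  induction S using strongInduction with
  | H S ih =>
    have h1 := heq S hS
    have h2 : ∑ P ∈ partitions S with 2 ≤ P.card, partVal γ w P * ∏ B ∈ P, h B =
        ∑ P ∈ partitions S with 2 ≤ P.card, partVal γ w P * ∏ B ∈ P, h' B := by
      refine sum_congr rfl fun P hP => ?_; rw [mem_filter] at hP
      rw [prod_congr rfl fun B hB =>
        ih B (ssubset_of_mem_partitions hS hP.1 hP.2 hB).2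
          (ssubset_of_mem_partitions hS hP.1 hP.2 hB).1]
    rw [partTransform_eq γ w h hS, partTransform_eq γ w h' hS, hw S hS, one_mul, one_mul, h2] at h1
    grind

variable {γ : Charges n b} {w w' : ChargeFn b}

lemma partTransform_rooted (hw : IsOrderFree γ w')
    (h1 : ∀ S : Finset (Fin n), S.Nonempty → partVal γ w' {S} = 0)
    (hS : 2 ≤ S.card) : partTransform γ w' (SchroederTree.signedSum γ w) S =
    SchroederTree.rootedSum γ w' w S := by
  have hne : S.Nonempty := Finset.card_pos.1 (by omega)
  rw [partTransform_eq γ w' _ hne, h1 S hne, zero_mul, zero_add,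
    ← sum_orderedPartitions hw _ hne, SchroederTree.rootedSum_eq γ w' w hS]

lemma partTransform_signedSum (hw : IsOrderFree γ w)
    (h1 : ∀ S : Finset (Fin n), S.Nonempty → partVal γ w {S} = 1)
    (hne : S.Nonempty) : partTransform γ w (SchroederTree.signedSum γ w) S =
    if S.card = 1 then 1 else 0 := by
  rw [partTransform_eq γ w _ hne, h1 S hne, one_mul]; have hpos := hne.card_pos; split_ifs with hc
  · obtain ⟨l, rfl⟩ := card_eq_one.1 hc
    rw [SchroederTree.signedSum_singleton, sum_eq_zero, add_zero]; intro P hP; rw [mem_filter] at hP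
    obtain ⟨B, hB⟩ : P.Nonempty := Finset.card_pos.1 (by omega)
    obtain ⟨h3, h4⟩ := ssubset_of_mem_partitions hne hP.1 hP.2 hB; grind
  · have hS : 2 ≤ S.card := by omega
    rw [← sum_orderedPartitions hw _ hne, SchroederTree.signedSum_eq γ w hS,
      SchroederTree.rootedSum_eq γ w w hS, neg_add_cancel]

variable {v v' : ChargeFn b} {G : Finset (Finset (Fin n)) → ℝ}

/-- `v` is obtained from `w` by grouping the charges, with a factor `G` for each group. -/
def IsGrouping (γ : Charges n b) (v w : ChargeFn b) (G : Finset (Finset (Fin n)) → ℝ) : Prop :=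
  ∀ S : Finset (Fin n), S.Nonempty → ∀ P, IsPartition S P →
    partVal γ v P = ∑ R ∈ partitions P, (∏ C ∈ R, G C) * partVal γ w (R.image fun C => C.biUnion id)

lemma IsGrouping.partTransform (hG : IsGrouping γ v w G) (h : Finset (Fin n) → ℝ)
    (hS : S.Nonempty) : partTransform γ v h S =
    partTransform γ w (fun U => ∑ C ∈ partitions U, G C * ∏ B ∈ C, h B) S := by
  refine Eq.trans (sum_congr rfl fun P hP => ?_) (sum_partitions_partitions S (partVal γ w) G h)
  rw [hG S hS P (mem_partitions.1 hP)]

lemma IsGrouping.singleton (hG : IsGrouping γ v w G)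
    (h1 : ∀ S : Finset (Fin n), G {S} = 1) (S : Finset (Fin n)) (hS : S.Nonempty) :
    partVal γ v {S} = partVal γ w {S} := by
  rw [hG S hS {S} (isPartition_singleton hS)]
  have h : partitions {S} = {{{S}}} := by
    ext R; rw [mem_partitions, mem_singleton]; constructor
    · intro hR; refine (hR.eq_singleton_or (singleton_nonempty S)).resolve_right fun h3 => ?_
      obtain ⟨B, hB⟩ : R.Nonempty := Finset.card_pos.1 (by have := h3.1; omega)
      obtain ⟨⟨x, hx⟩, h5⟩ := h3.2 B hB; refine h5.2 ?_
      rw [singleton_subset_iff, ← mem_singleton.1 (h5.1 hx)]; exact hx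
    · rintro rfl; exact isPartition_singleton (singleton_nonempty S)
  simp_all

/-- The tree sums of two weights which are related by grouping agree. -/
lemma rootedSum_eq_of_isGrouping (hv : IsOrderFree γ v) (hw : IsOrderFree γ w)
    (hvp : IsOrderFree γ v') (hwp : IsOrderFree γ w')
    (hG : IsGrouping γ v w G) (hG' : IsGrouping γ v' w' G) (hG1 : ∀ S : Finset (Fin n), G {S} = 1)
    (hw1 : ∀ S : Finset (Fin n), S.Nonempty → partVal γ w {S} = 1)
    (hw0 : ∀ S : Finset (Fin n), S.Nonempty → partVal γ w' {S} = 0) (hS : 2 ≤ S.card) :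
    SchroederTree.rootedSum γ v' v S = SchroederTree.rootedSum γ w' w S := by
  have hne : S.Nonempty := Finset.card_pos.1 (by omega)
  have hv1 : ∀ S : Finset (Fin n), S.Nonempty → partVal γ v {S} = 1 := fun S hS => by
    rw [hG.singleton hG1 S hS, hw1 S hS]
  have hv0 : ∀ S : Finset (Fin n), S.Nonempty → partVal γ v' {S} = 0 := fun S hS => by
    rw [hG'.singleton hG1 S hS, hw0 S hS]
  have key := eq_of_partTransform_eq γ hw1
    (h := fun U => ∑ C ∈ partitions U, G C * ∏ B ∈ C, SchroederTree.signedSum γ v B)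
    (h' := SchroederTree.signedSum γ w) fun S hS => by
      rw [← hG.partTransform _ hS, partTransform_signedSum hv hv1 hS,
        partTransform_signedSum hw hw1 hS]
  rw [← partTransform_rooted hvp hv0 hS, ← partTransform_rooted hwp hw0 hS, hG'.partTransform _ hne]
  refine sum_congr rfl fun P hP => ?_
  rw [prod_congr rfl fun B hB => key B ((mem_partitions.1 hP).1 B hB).1]

end

/-! ## The original functions as groupings of the simplified ones -/

section

lemma vsign_barImage {V Q : Type} {f : V → Q} (hf : Injective f) (R : Arcs V)
    (U : Finset V) (v : V) : vsign (barImage f R) (U.map ⟨f, hf⟩) (f v) = vsign R U v := by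
  have hb : Injective (bar f) := fun e e' h =>
    Prod.ext (hf (congrArg Prod.fst h)) (hf (congrArg Prod.snd h))
  rw [vsign, vsign, barImage, filter_image, prod_image fun e _ e' _ h => hb h]
  refine prod_congr ?_ fun e _ => ?_
  · ext e
    simp only [mem_filter, Finset.mem_map, Function.Embedding.coeFn_mk, hf.eq_iff, exists_eq_right]
  grind

lemma sgnAvg_barImage {V Q : Type} {f : V → Q} (hf : Injective f) (R : Arcs V) (U : Finset V) :
    sgnAvg (barImage f R) (U.map ⟨f, hf⟩) = sgnAvg R U := by
  refine eq_sgnAvg_of_rec R (fun U => sgnAvg (barImage f R) (U.map ⟨f, hf⟩)) (W := U) ?_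
    (fun U' _ hne => ?_) U subset_rfl
  · simp [sgnAvg_empty]
  · have h := card_mul_sgnAvg (barImage f R) (U := U'.map ⟨f, hf⟩) (by simpa using hne)
    rw [card_map, sum_map] at h; rw [h]; refine sum_congr rfl fun v _ => ?_
    rw [Function.Embedding.coeFn_mk, vsign_barImage hf]; simp_all

lemma sgnAvg_barImage_univ {V Q : Type} [Fintype V] [Fintype Q] (σ : V ≃ Q)
    (R : Arcs V) : sgnAvg (barImage σ R) univ = sgnAvg R univ := by
  rw [← sgnAvg_barImage σ.injective R univ]; simp_all

lemma treeCoef_equiv {V Q : Type} [Fintype V] [Fintype Q] (σ : V ≃ Q) (g : Q → Q → ℝ) :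
    treeCoef (fun v w => g (σ v) (σ w)) = treeCoef g := by
  rw [treeCoef, treeCoef, Fintype.card_congr σ]; congr 1
  have h := sum_otrees_equiv (A := ℝ) (M := ℝ) σ (fun e => g e.1 e.2) fun D => (sgnAvg D univ : ℝ)
  simp only [smul_eq_mul, sgnAvg_barImage_univ] at h; grind

variable {n b : ℕ} {κ : Triples b} {ample : Set (Fin b → ℝ)}

/-- The factor of a group of sets of charges. -/
def groupCoef (γ : Charges n b) (C : Finset (Finset (Fin n))) : ℝ :=
  treeCoef fun B B' : C => dirac (∑ l ∈ B.1, γ l) (∑ l ∈ B'.1, γ l)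

lemma otrees_of_unique {V : Type} [Fintype V] [Unique V] : otrees V = {∅} := by
  ext D; rw [mem_otrees, mem_singleton]; constructor
  · intro h; have := h.card_eq; simp_all
  · rintro rfl; exact ⟨isForest_empty, fun u w => by rw [Subsingleton.elim u w]; exact Lk.refl _⟩

lemma treeCoef_of_unique {V : Type} [Fintype V] [Unique V] (g : V → V → ℝ) : treeCoef g = 1 := by
  rw [treeCoef, otrees_of_unique, sum_singleton, prod_empty, Fintype.card_unique]
  have h2 := card_mul_sgnAvg (∅ : Arcs V) (U := univ) univ_nonempty
  rw [card_univ, Fintype.card_unique, univ_unique, sum_singleton,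
    erase_singleton, sgnAvg_empty, vsign, filter_empty, prod_empty,
    Nat.cast_one, one_mul] at h2
  simp_all

lemma groupCoef_singleton (γ : Charges n b) (S : Finset (Fin n)) : groupCoef γ {S} = 1 := by
  have : Unique ({S} : Finset (Finset (Fin n))) :=
    { default := ⟨S, mem_singleton_self S⟩
      uniq := fun x => Subtype.ext (mem_singleton.1 x.2) }
  rw [groupCoef, ← treeCoef_of_unique fun B B' : ({S} : Finset (Finset (Fin n))) =>
    dirac (∑ l ∈ B.1, γ l) (∑ l ∈ B'.1, γ l)]

lemma sum_charge_mem_ample (hκ : IsAmpleCone κ ample) {γ : Charges n b}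
    (hγ : ∀ i, (γ i).1 ∈ ample) {S : Finset (Fin n)} (hS : S.Nonempty) :
    (∑ i ∈ S, γ i).1 ∈ ample := by
  rw [Prod.fst_sum]; exact sum_mem_ample hκ hS fun i _ => hγ i

/-- Symmetry of a weight on ample charges. -/
def IsSymmetricWeight (ample : Set (Fin b → ℝ)) (w : ChargeFn b) : Prop :=
  ∀ (k : ℕ) (δ : Charges k b), (∀ i, (δ i).1 ∈ ample) → ∀ σ : Equiv.Perm (Fin k),
    w k (δ ∘ σ) = w k δ

lemma IsSymmetricWeight.eq_partCharges (hκ : IsAmpleCone κ ample)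
    {w : ChargeFn b} (hw : IsSymmetricWeight ample w)
    {γ : Charges n b} (hγ : ∀ i, (γ i).1 ∈ ample) {P : Finset (Finset (Fin n))}
    (hP : ∀ B ∈ P, B.Nonempty) {k : ℕ} (hk : k = P.card) (s : Fin k → Finset (Fin n))
    (hs : Injective s) (hsP : ∀ i, s i ∈ P) :
    (k.factorial : ℝ) * w k (fun i => ∑ l ∈ s i, γ l) = partVal γ w P := by
  subst hk; rw [partVal]; congr 1
  have hinj : Injective fun i => P.equivFin ⟨s i, hsP i⟩ := fun i j h =>
    hs (congrArg Subtype.val (P.equivFin.injective h))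
  let σ : Equiv.Perm (Fin P.card) := Equiv.ofBijective _ (Finite.injective_iff_bijective.1 hinj)
  rw [← hw P.card (partCharges γ P) (fun i => ?_) σ]
  · congr 1; funext i
    simp only [Function.comp_apply, partCharges, σ, Equiv.ofBijective_apply, Equiv.symm_apply_apply]
  · exact sum_charge_mem_ample hκ hγ (hP _ (P.equivFin.symm i).2)

/-- The relation between two weights given by the formula for the original functions. -/
def IsTreeGrouping (ample : Set (Fin b → ℝ)) (v w : ChargeFn b) : Prop :=
  ∀ (k : ℕ), 0 < k → ∀ δ : Charges k b, (∀ i, (δ i).1 ∈ ample) →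
    (k.factorial : ℝ) * v k δ = ∑ R ∈ partitions (univ : Finset (Fin k)),
      (∏ B ∈ R, blockCoef δ B) * (R.card.factorial * w R.card (partCharges δ R))

lemma IsTreeGrouping.eq_sum (hκ : IsAmpleCone κ ample)
    {v w : ChargeFn b} (hv : IsTreeGrouping ample v w)
    (hw : IsSymmetricWeight ample w) {γ : Charges n b} (hγ : ∀ i, (γ i).1 ∈ ample)
    {S : Finset (Fin n)} (hS : S.Nonempty) {k : ℕ} {s : Fin k → Finset (Fin n)}
    (hs : Injective s) (hP : IsPartition S (univ.image s)) :
    (k.factorial : ℝ) * v k (fun i => ∑ l ∈ s i, γ l) =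
    ∑ R ∈ partitions (univ.image s), (∏ C ∈ R, groupCoef γ C) *
    partVal γ w (R.image fun C => C.biUnion id) := by
  have hsn : ∀ i, (s i).Nonempty := fun i =>
    (hP.1 _ (mem_image_of_mem _ (mem_univ i))).1
  have hk : 0 < k := by
    obtain ⟨B, hB⟩ := hP.nonempty hS; obtain ⟨i, -, -⟩ := mem_image.1 hB; exact i.pos
  rw [hv k hk _ fun i => sum_charge_mem_ample hκ hγ (hsn i), ← sum_partitions_image hs]
  refine sum_congr rfl fun R hR => ?_
  have hR' : IsPartition (univ.image s) (R.image (Finset.image s)) := (mem_partitions.1 hR).image hs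
  have hinj : Injective (Finset.image s) := image_injective hs
  rw [prod_image fun B _ B' _ h => hinj h]; congr 1
  · refine prod_congr rfl fun B _ => ?_
    have hbij : Function.Bijective fun i : B =>
        (⟨s i.1, mem_image_of_mem s i.2⟩ : (B.image s)) := by
      refine ⟨fun i j h => Subtype.ext (hs (congrArg Subtype.val h)), fun x => ?_⟩
      obtain ⟨i, hi, h⟩ := mem_image.1 x.2; exact ⟨⟨i, hi⟩, Subtype.ext h⟩
    rw [groupCoef, ← treeCoef_equiv (Equiv.ofBijective _ hbij)]; rfl
  · have hcard : R.card = ((R.image (Finset.image s)).image fun C => C.biUnion id).card := by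
      rw [card_image_of_injOn (hP.injOn_biUnion hR'), card_image_of_injective _ hinj]
    rw [← hw.eq_partCharges hκ hγ (fun U hU => ((hP.isPartition_image hR').1.1 U hU).1) hcard
      (fun i => ((R.equivFin.symm i).1.image s).biUnion id)]
    · congr 2; funext i; rw [partCharges, sum_biUnion, sum_image fun i _ j _ h => hs h]
      · rfl
      · intro B hB B' hB' hne
        have hsub : ∀ B ∈ (R.equivFin.symm i).1.image s, B ∈ univ.image s := fun B hB =>
          image_subset_image (subset_univ _) hB
        exact disjoint_left.2 fun x h1 h2 =>
          hne (hP.eq_of_mem (hsub B hB) (hsub B' hB') h1 h2)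
    · intro i j h
      have h1 := hP.injOn_biUnion hR' (mem_image_of_mem _ (R.equivFin.symm i).2)
        (mem_image_of_mem _ (R.equivFin.symm j).2) h
      exact R.equivFin.symm.injective (Subtype.ext (hinj h1))
    grind

lemma IsSymmetricWeight.isOrderFree (hκ : IsAmpleCone κ ample)
    {w : ChargeFn b} (hw : IsSymmetricWeight ample w)
    {γ : Charges n b} (hγ : ∀ i, (γ i).1 ∈ ample) : IsOrderFree γ w := by
  intro S _ k s hs hP
  refine hw.eq_partCharges hκ hγ (fun B hB => (hP.1 B hB).1) ?_ s hs fun i =>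
    mem_image_of_mem _ (mem_univ i)
  rw [card_image_of_injective _ hs, card_univ, Fintype.card_fin]

lemma image_equivFin_symm {α : Type} [DecidableEq α] (P : Finset α) :
    (univ.image fun i => (P.equivFin.symm i).1) = P := by
  ext x; simp only [mem_image, mem_univ, true_and]; constructor
  · grind
  · intro hx; exact ⟨P.equivFin ⟨x, hx⟩, by grind⟩

lemma IsTreeGrouping.isGrouping (hκ : IsAmpleCone κ ample)
    {v w : ChargeFn b} (hv : IsTreeGrouping ample v w)
    (hw : IsSymmetricWeight ample w) {γ : Charges n b} (hγ : ∀ i, (γ i).1 ∈ ample) :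
    IsGrouping γ v w (groupCoef γ) := by
  intro S hS P hP
  have hs : Injective fun i => (P.equivFin.symm i).1 :=
    Subtype.val_injective.comp P.equivFin.symm.injective
  have h := hv.eq_sum hκ hw hγ hS hs (by rw [image_equivFin_symm]; exact hP)
  rw [image_equivFin_symm] at h; exact h

lemma IsTreeGrouping.isOrderFree (hκ : IsAmpleCone κ ample)
    {v w : ChargeFn b} (hv : IsTreeGrouping ample v w)
    (hw : IsSymmetricWeight ample w) {γ : Charges n b} (hγ : ∀ i, (γ i).1 ∈ ample) :
    IsOrderFree γ v := by
  intro S hS k s hs hP; rw [hv.eq_sum hκ hw hγ hS hs hP, hv.isGrouping hκ hw hγ S hS _ hP]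

lemma partVal_singleton {γ : Charges n b} {w : ChargeFn b}
    (hw : IsOrderFree γ w) {S : Finset (Fin n)} (hS : S.Nonempty) :
    partVal γ w {S} = w 1 fun _ => ∑ l ∈ S, γ l := by
  have h1 : univ.image (fun _ : Fin 1 => S) = {S} := by rw [univ_unique, image_singleton]
  have h := hw S hS 1 (fun _ => S) (Function.injective_of_subsingleton _)
    (by rw [h1]; exact isPartition_singleton hS)
  simp_all

lemma symmetrize_kernelR {f : (k : ℕ) → Charges k b → ℝ → ℝ} (γ : Charges n b)
    (τ : ℝ) : symmetrize (fun δ => kernelR f n δ τ) γ = 1 / (n.factorial : ℝ) *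
    (1 / 2 ^ (n - 1) * SchroederTree.rootedSum γ (fun k δ => decayingPart (f k δ) τ)
    (fun k δ => constPart (f k δ)) univ) := by
  rw [symmetrize, ← SchroederTree.sum_perm_schroederTrees]; congr 1; rw [mul_sum]; rfl

lemma symmetrize_kernelR_eq (hκ : IsAmpleCone κ ample) {f g : (k : ℕ) → Charges k b → ℝ → ℝ}
    (hg : ∀ τ, IsSymmetricWeight ample fun k δ => g k δ τ)
    (hlim : ∀ k, 0 < k → ∀ δ : Charges k b, (∀ i, (δ i).1 ∈ ample) →
    Tendsto (g k δ) atTop (𝓝 (constPart (g k δ))))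
    (hlim' : ∀ k, 0 < k → ∀ δ : Charges k b, (∀ i, (δ i).1 ∈ ample) →
    Tendsto (f k δ) atTop (𝓝 (constPart (f k δ))))
    (hfg : ∀ τ, 0 < τ → IsTreeGrouping ample (fun k δ => f k δ τ) fun k δ => g k δ τ)
    (hg1 : ∀ δ : Charges 1 b, (∀ i, (δ i).1 ∈ ample) → ∀ τ, g 1 δ τ = 1)
    {γ : Charges n b} (hγ : ∀ i, (γ i).1 ∈ ample) (hn : 2 ≤ n) {τ : ℝ} (hτ : 0 < τ) :
    symmetrize (fun δ => kernelR f n δ τ) γ = symmetrize (fun δ => kernelR g n δ τ) γ := by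
  have hc : IsSymmetricWeight ample fun k δ => constPart (g k δ) := fun k δ hδ σ =>
    congrArg constPart (funext fun τ => hg τ k δ hδ σ)
  have hd : IsSymmetricWeight ample fun k δ => decayingPart (g k δ) τ := fun k δ hδ σ =>
    congrArg (fun f => decayingPart f τ) (funext fun τ => hg τ k δ hδ σ)
  have hcg : IsTreeGrouping ample (fun k δ => constPart (f k δ)) fun k δ => constPart (g k δ) := by
    intro k hk δ hδ; refine tendsto_nhds_unique ((hlim' k hk δ hδ).const_mul (k.factorial : ℝ)) ?_
    refine Tendsto.congr' (f₁ := fun τ => ∑ R ∈ partitions (univ : Finset (Fin k)),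
      (∏ B ∈ R, blockCoef δ B) * (R.card.factorial * g R.card (partCharges δ R) τ)) ?_ ?_
    · filter_upwards [eventually_gt_atTop 0] with τ hτ using (hfg τ hτ k hk δ hδ).symm
    · refine tendsto_finsetSum _ fun R hR => ((hlim R.card ?_ _ ?_).const_mul _).const_mul _
      · rw [mem_partitions] at hR; exact Finset.card_pos.2 (hR.nonempty ⟨⟨0, hk⟩, mem_univ _⟩)
      · rw [mem_partitions] at hR
        exact fun i => sum_charge_mem_ample hκ hδ (hR.1 _ (R.equivFin.symm i).2).1
  have hdg : IsTreeGrouping ample (fun k δ => decayingPart (f k δ) τ)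
      fun k δ => decayingPart (g k δ) τ := by
    intro k hk δ hδ; have h1 := hfg τ hτ k hk δ hδ; have h2 := hcg k hk δ hδ
    simp only [decayingPart, mul_sub, sum_sub_distrib]; simp only at h1 h2; rw [h1, h2]
  have ho := hc.isOrderFree hκ hγ; have ho' := hd.isOrderFree hκ hγ
  have hg0 : ∀ S : Finset (Fin n), S.Nonempty →
      g 1 (fun _ => ∑ l ∈ S, γ l) = fun _ => 1 := fun S hS =>
    funext fun τ => hg1 _ (fun _ => sum_charge_mem_ample hκ hγ hS) τ
  have hc1 : constPart (fun _ => 1) = 1 := tendsto_const_nhds.limUnder_eq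
  rw [symmetrize_kernelR, symmetrize_kernelR, rootedSum_eq_of_isGrouping
    (hcg.isOrderFree hκ hc hγ) ho (hdg.isOrderFree hκ hd hγ) ho' (hcg.isGrouping hκ hc hγ)
    (hdg.isGrouping hκ hd hγ) (groupCoef_singleton γ)
    (fun S hS => by rw [partVal_singleton ho hS, hg0 S hS, hc1])
    (fun S hS => by rw [partVal_singleton ho' hS, hg0 S hS, decayingPart, hc1, sub_self])
    (by rw [card_univ, Fintype.card_fin]; exact hn)]

end

/-! ## The coefficients of contracted trees -/

section

lemma vsign_image {V Q : Type} {f : V → Q} {W : Finset V} (hf : Set.InjOn f (W : Set V))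
    {R : Arcs V} (hR : ∀ e ∈ R, e.1 ∈ W ∧ e.2 ∈ W) {U : Finset V} (hU : U ⊆ W) {v : V}
    (hv : v ∈ W) : vsign (barImage f R) (U.image f) (f v) = vsign R U v := by
  have hb : Set.InjOn (bar f) (R : Set (V × V)) := fun e he e' he' h =>
    Prod.ext (hf (hR e he).1 (hR e' he').1 (congrArg Prod.fst h))
      (hf (hR e he).2 (hR e' he').2 (congrArg Prod.snd h))
  have hmem : ∀ u ∈ W, (f u ∈ U.image f ↔ u ∈ U) := fun u hu => by
    rw [mem_image]; exact ⟨fun ⟨u', h, h'⟩ => hf (hU h) hu h' ▸ h, fun h => ⟨u, h, rfl⟩⟩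
  have heq : ∀ u ∈ W, (f u = f v ↔ u = v) := fun u hu => ⟨fun h => hf hu hv h, fun h => h ▸ rfl⟩
  rw [vsign, vsign, barImage, filter_image,
    prod_image fun e he e' he' h => hb (mem_filter.1 he).1 (mem_filter.1 he').1 h]
  refine prod_congr (filter_congr fun e he => ?_) fun e he => ?_
  · change (f e.1 ∈ _ ∧ f e.2 ∈ _) ∧ (f e.1 = _ ∨ f e.2 = _) ↔ _
    rw [hmem _ (hR e he).1, hmem _ (hR e he).2, heq _ (hR e he).1, heq _ (hR e he).2]
  grind

lemma sgnAvg_image {V Q : Type} {f : V → Q} {W : Finset V} (hf : Set.InjOn f (W : Set V))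
    {R : Arcs V} (hR : ∀ e ∈ R, e.1 ∈ W ∧ e.2 ∈ W) :
    ∀ U ⊆ W, sgnAvg (barImage f R) (U.image f) = sgnAvg R U := by
  refine eq_sgnAvg_of_rec R (fun U => sgnAvg (barImage f R) (U.image f)) ?_ fun U hU hne => ?_
  · rw [image_empty, sgnAvg_empty]
  · have hf' : Set.InjOn f (U : Set V) := hf.mono (coe_subset.2 hU)
    have h := card_mul_sgnAvg (barImage f R) (hne.image f)
    rw [card_image_of_injOn hf', sum_image hf'] at h; rw [h]; refine sum_congr rfl fun v hv => ?_
    rw [vsign_image hf hR hU (hU hv)]; congr 2; ext x; simp only [mem_erase, mem_image]; constructor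
    · grind
    · rintro ⟨u, ⟨h1, hu⟩, rfl⟩; exact ⟨fun h => h1 (hf' hu hv h), u, hu, rfl⟩

namespace OrientedGraph

/-- A forest whose arcs join vertices of the graph. -/
structure IsForestOn {V : Type} (D : OrientedGraph V) : Prop where
  forest : IsForest D.arcs
  mem_verts : ∀ e ∈ D.arcs, e.1 ∈ D.verts ∧ e.2 ∈ D.verts

variable {V Q : Type} {D : OrientedGraph V}
variable {f : V → Q}

lemma IsForestOn.removeArcs (hD : D.IsForestOn) (K : Arcs V) : (D.removeArcs K).IsForestOn :=
  ⟨hD.forest.mono sdiff_subset, fun e he => hD.mem_verts e (sdiff_subset he)⟩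

lemma coeffE_eq (hD : D.IsForestOn) (hne : D.arcs.Nonempty) :
    D.coeffE = -∑ K ∈ D.arcs.powerset, if K = D.arcs then 0 else
    (D.contract K).coeffE * sgnAvg (D.arcs \ K) D.verts := by
  rw [coeffE, if_neg hne.ne_empty, sum_attach D.arcs.ssubsets fun K => (D.contract K).coeffE *
    ∏ r ∈ D.verts.image (D.removeArcs K).rep, coeffA ((D.removeArcs K).component r)]
  congr 1; rw [ssubsets]; refine Eq.trans ?_ (sum_erase (a := D.arcs) D.arcs.powerset (if_pos rfl))
  refine sum_congr rfl fun K hK => ?_; rw [if_neg (mem_erase.1 hK).1]; congr 1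
  exact prod_coeffA (D := D.removeArcs K) (hD.removeArcs K).forest (hD.removeArcs K).mem_verts

lemma lk_rep {K R : Arcs V} (hR : D.arcs \ K ⊆ R) (u : V) : Lk R u ((D.removeArcs K).rep u) :=
  Lk.mono (R := (D.removeArcs K).arcs) ((D.removeArcs K).linked_rep u) hR

lemma IsForestOn.injOn_rep (hD : D.IsForestOn) {K : Arcs V} (hK : K ⊆ D.arcs) :
    Set.InjOn (bar (D.removeArcs K).rep) (K : Set (V × V)) := by
  intro e he e' he' h; by_contra hne
  have hsub : D.arcs \ K ⊆ D.arcs.erase e := fun x hx =>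
    mem_erase.2 ⟨fun h => (Finset.mem_sdiff.1 hx).2 (h ▸ he), (Finset.mem_sdiff.1 hx).1⟩
  have h1 : (D.removeArcs K).rep e.1 = (D.removeArcs K).rep e'.1 := congrArg Prod.fst h
  have h2 : (D.removeArcs K).rep e.2 = (D.removeArcs K).rep e'.2 := congrArg Prod.snd h
  refine hD.forest e (hK he) ?_; have h3 := lk_rep hsub e.1; have h4 := lk_rep hsub e.2
  rw [h1] at h3; rw [h2] at h4
  exact h3.trans ((lk_rep hsub e'.1).symm.trans ((Lk.of_mem (mem_erase.2
    ⟨fun h => hne h.symm, hK he'⟩)).trans ((lk_rep hsub e'.2).trans h4.symm)))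

lemma IsForestOn.contract (hD : D.IsForestOn) {K : Arcs V} (hK : K ⊆ D.arcs) :
    (D.contract K).IsForestOn := by
  constructor
  · intro b hb hl; obtain ⟨e, he, rfl⟩ := mem_image.1 hb
    have hsub : D.arcs \ K ⊆ D.arcs.erase e := fun x hx =>
      mem_erase.2 ⟨fun h => (Finset.mem_sdiff.1 hx).2 (h ▸ he), (Finset.mem_sdiff.1 hx).1⟩
    refine hD.forest e (hK he) ?_
    have h1 := hl.map (R' := D.arcs.erase e) id fun b' hb' => by
      obtain ⟨hne, hb'⟩ := mem_erase.1 hb'; obtain ⟨e', he', rfl⟩ := mem_image.1 hb'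
      exact (lk_rep hsub e'.1).symm.trans ((Lk.of_mem (mem_erase.2
        ⟨fun h => hne (by rw [h]), hK he'⟩)).trans (lk_rep hsub e'.2))
    exact (lk_rep hsub e.1).trans (h1.trans (lk_rep hsub e.2).symm)
  · intro b hb; obtain ⟨e, he, rfl⟩ := mem_image.1 hb; obtain ⟨h1, h2⟩ := hD.mem_verts e (hK he)
    exact ⟨mem_image_of_mem _ h1, mem_image_of_mem _ h2⟩

/-- Relabel the vertices. -/
def map (f : V → Q) (D : OrientedGraph V) : OrientedGraph Q where
  verts := D.verts.image f
  arcs := barImage f D.arcs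

lemma linked_map {u w : V} (h : D.Linked u w) : (D.map f).Linked (f u) (f w) :=
  Lk.map (R := D.arcs) (R' := (D.map f).arcs) h f fun e he =>
    Lk.of_mem (e := bar f e) (mem_image_of_mem _ he)

lemma linked_of_map (hf : Set.InjOn f (D.verts : Set V))
    (hD : ∀ e ∈ D.arcs, e.1 ∈ D.verts ∧ e.2 ∈ D.verts) {u w : V} (hu : u ∈ D.verts)
    (hw : w ∈ D.verts) (h : (D.map f).Linked (f u) (f w)) : D.Linked u w := by
  have := Lk.eq_of (R := (D.map f).arcs) h (fun x => ∃ v ∈ D.verts, f v = x ∧ Lk D.arcs u v)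
    fun e he => by
      obtain ⟨e', he', rfl⟩ := mem_image.1 he; obtain ⟨h1, h2⟩ := hD e' he'; refine propext ⟨?_, ?_⟩
      · rintro ⟨v, hv, hv', hl⟩; have : v = e'.1 := hf hv h1 hv'
        exact ⟨e'.2, h2, rfl, hl.trans (this ▸ Lk.of_mem he')⟩
      · rintro ⟨v, hv, hv', hl⟩; have : v = e'.2 := hf hv h2 hv'
        exact ⟨e'.1, h1, rfl, hl.trans (this ▸ (Lk.of_mem he').symm)⟩
  obtain ⟨v, hv, hv', hl⟩ := this.mp ⟨u, hu, rfl, Lk.refl u⟩; rw [← hf hv hw hv']; exact hl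

lemma coeffE_map (hD : D.IsForestOn) (hf : Set.InjOn f (D.verts : Set V)) :
    (D.map f).coeffE = D.coeffE := by
  induction hm : D.arcs.card using Nat.strong_induction_on generalizing D f V Q with
  | _ m ih =>
    have hb : Set.InjOn (bar f) (D.arcs : Set (V × V)) := fun e he e' he' h =>
      Prod.ext (hf (hD.mem_verts e he).1 (hD.mem_verts e' he').1 (congrArg Prod.fst h))
        (hf (hD.mem_verts e he).2 (hD.mem_verts e' he').2 (congrArg Prod.snd h))
    rcases D.arcs.eq_empty_or_nonempty with h0 | hne
    · rw [coeffE, coeffE, if_pos h0, if_pos]; rw [map, barImage, h0, image_empty]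
    have hmem : ∀ K ⊆ D.arcs, ∀ e ∈ D.arcs, bar f e ∈ barImage f K → e ∈ K := by
      intro K hK e he h; obtain ⟨e', he', h2⟩ := mem_image.1 h
      rwa [← hb (hK he') he h2]
    have hmap : (D.map f).IsForestOn := by
      constructor
      · intro b hb' hl; obtain ⟨e, he, rfl⟩ := mem_image.1 hb'; refine hD.forest e he ?_
        have h1 : (D.map f).arcs.erase (bar f e) = barImage f (D.arcs.erase e) := by
          ext x; simp only [map, barImage, mem_erase, mem_image]; constructor
          · grind
          · rintro ⟨e', ⟨h, he'⟩, rfl⟩; exact ⟨fun h' => h (hb he' he h'), e', he', rfl⟩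
        rw [h1] at hl
        exact linked_of_map (D := ⟨D.verts, D.arcs.erase e⟩) hf
          (fun e' he' => hD.mem_verts e' (mem_of_mem_erase he')) (hD.mem_verts e he).1
          (hD.mem_verts e he).2 hl
      · intro b hb'; obtain ⟨e, he, rfl⟩ := mem_image.1 hb'; obtain ⟨h1, h2⟩ := hD.mem_verts e he
        exact ⟨mem_image_of_mem _ h1, mem_image_of_mem _ h2⟩
    rw [coeffE_eq hD hne, coeffE_eq hmap (hne.image _)]; congr 1; symm
    refine sum_bij (fun K _ => barImage f K) ?_ ?_ ?_ ?_
    · intro K hK; exact mem_powerset.2 (image_subset_image (mem_powerset.1 hK))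
    · intro K hK K' hK' h; rw [mem_powerset] at hK hK'; change barImage f K = barImage f K' at h
      exact Subset.antisymm (fun e he => hmem K' hK' e (hK he) (h ▸ mem_image_of_mem _ he))
        fun e he => hmem K hK e (hK' he) (h ▸ mem_image_of_mem _ he)
    · intro K' hK'; obtain ⟨K, hK, rfl⟩ := subset_image_iff.1 (mem_powerset.1 hK')
      exact ⟨K, mem_powerset.2 (by exact_mod_cast hK), rfl⟩
    · intro K hK; rw [mem_powerset] at hK
      have himg : barImage f K = (D.map f).arcs ↔ K = D.arcs := by
        refine ⟨fun h => hK.antisymm fun e he => hmem K hK e he ?_, by rintro rfl; rfl⟩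
        rw [h]; exact mem_image_of_mem _ he
      by_cases hKD : K = D.arcs
      · grind
      rw [if_neg hKD, if_neg fun h => hKD (himg.1 h)]
      have hsd : (D.map f).arcs \ barImage f K = barImage f (D.arcs \ K) := by
        ext x; simp only [map, barImage, Finset.mem_sdiff, mem_image]; constructor
        · grind
        · rintro ⟨e, ⟨he, h⟩, rfl⟩
          exact ⟨⟨e, he, rfl⟩, fun ⟨e', he', h2⟩ => h (hb (hK he') he h2 ▸ he')⟩
      have hrem : (D.map f).removeArcs (barImage f K) = (D.removeArcs K).map f := by
        rw [removeArcs, hsd]; rfl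
      set r := (D.removeArcs K).rep with hr; set r' := ((D.removeArcs K).map f).rep with hr'
      have hrr : ∀ u, r' (f (r u)) = r' (f u) := fun u =>
        ((D.removeArcs K).map f).rep_eq_iff.2 (Lk.symm (linked_map ((D.removeArcs K).linked_rep u)))
      have hcon : (D.map f).contract (barImage f K) = (D.contract K).map (r' ∘ f) := by
        rw [contract, hrem, ← hr']; unfold map contract barImage; simp only [image_image, ← hr]
        congr 1 <;> grind
      have hinj : Set.InjOn (r' ∘ f) ((D.contract K).verts : Set V) := by
        intro u hu w hw h; obtain ⟨u', hu', rfl⟩ := mem_image.1 hu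
        obtain ⟨w', hw', rfl⟩ := mem_image.1 hw
        have h1 : r' (f u') = r' (f w') := by rw [← hrr, ← hrr w']; exact h
        exact (D.removeArcs K).rep_eq_iff.2 (linked_of_map (D := D.removeArcs K) hf
          (hD.removeArcs K).mem_verts hu' hw' (((D.removeArcs K).map f).rep_eq_iff.1 h1))
      rw [hcon, hsd, ih _ (hm ▸ card_arcs_contract_lt D K (hK.ssubset_of_ne hKD))
        (hD.contract hK) hinj rfl]
      congr 1
      exact (sgnAvg_image hf (fun e he => hD.mem_verts e (sdiff_subset he)) _ subset_rfl).symm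

lemma rep_congr {D D' : OrientedGraph V} (h : ∀ u w, D.Linked u w ↔ D'.Linked u w) :
    D.rep = D'.rep := by
  have hs : Relation.EqvGen.setoid (fun a c => (a, c) ∈ D.arcs) =
      Relation.EqvGen.setoid (fun a c => (a, c) ∈ D'.arcs) := Setoid.ext h
  funext u; unfold rep; rw [hs]

lemma coeffE_flip [Fintype V] {R : Arcs V} {W : Finset V} {e : V × V} (he : e ∉ R)
    (hD : IsForestOn ⟨W, insert e R⟩) : coeffE ⟨W, insert e.swap R⟩ = -coeffE ⟨W, insert e R⟩ := by
  induction hm : R.card using Nat.strong_induction_on generalizing R W e with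
  | _ m ih =>
    have heD : e ∈ insert e R := mem_insert_self e R; have hne := hD.forest.ne heD
    have hs : e.swap ∉ R := fun h => hD.forest.swap_notMem heD (mem_insert_of_mem h)
    have hlk : ∀ S ⊆ R, ∀ u w, Lk (insert e.swap S) u w ↔ Lk (insert e S) u w := by
      have h : ∀ (e : V × V) (S : Arcs V) (u w : V), Lk (insert e.swap S) u w →
          Lk (insert e S) u w := by
        refine fun e S u w h => h.map id fun x hx => ?_; rcases mem_insert.1 hx with rfl | hx
        · exact (Lk.of_mem (mem_insert_self e S)).symm
        · exact Lk.of_mem (mem_insert_of_mem hx)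
      exact fun S _ u w => ⟨h e S u w, h e.swap S u w⟩
    have hD' : IsForestOn ⟨W, insert e.swap R⟩ := by
      constructor
      · have := hD.forest.flipArc heD; rwa [flipArc, erase_insert he] at this
      · intro x hx; rcases mem_insert.1 hx with rfl | hx
        · exact (hD.mem_verts e heD).symm
        · exact hD.mem_verts x (mem_insert_of_mem hx)
    rw [coeffE_eq hD (insert_nonempty _ _), coeffE_eq hD' (insert_nonempty _ _)]; simp only
    rw [sum_powerset_insert he, sum_powerset_insert hs, ← sum_add_distrib, ← sum_add_distrib]
    congr 1; rw [← sum_neg_distrib]; refine sum_congr rfl fun K hK => ?_; rw [mem_powerset] at hK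
    have heK : e ∉ K := fun h => he (hK h); have hsK : e.swap ∉ K := fun h => hs (hK h)
    have hK1 : K ≠ insert e R := fun h => heK (by rw [h]; exact heD)
    have hK2 : K ≠ insert e.swap R := fun h => hsK (by grind); rw [if_neg hK1, if_neg hK2, neg_add]
    congr 1
    · rw [insert_sdiff_of_notMem _ hsK, insert_sdiff_of_notMem _ heK,
        sgnAvg_insert_swap hne (fun h => he (sdiff_subset h))
          (fun h => hs (sdiff_subset h)) (hD.mem_verts e heD).1 (hD.mem_verts e heD).2,
        mul_neg]
      have hrep : (removeArcs ⟨W, insert e.swap R⟩ K).rep = (removeArcs ⟨W, insert e R⟩ K).rep := by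
        refine rep_congr fun u w => ?_
        change Lk (insert e.swap R \ K) u w ↔ Lk (insert e R \ K) u w
        rw [insert_sdiff_of_notMem _ hsK, insert_sdiff_of_notMem _ heK]
        exact hlk _ sdiff_subset u w
      rw [contract, contract, hrep]
    · by_cases hKR : K = R
      · grind
      have hne1 : insert e K ≠ insert e R := fun h => hKR (by
        rw [← erase_insert heK, h, erase_insert he])
      have hne2 : insert e.swap K ≠ insert e.swap R := fun h => hKR (by
        rw [← erase_insert hsK, h, erase_insert hs])
      rw [if_neg hne1, if_neg hne2, insert_sdiff_insert, insert_sdiff_insert,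
        sdiff_insert_of_notMem he, sdiff_insert_of_notMem hs, ← neg_mul]
      congr 1
      have hrem : removeArcs ⟨W, insert e.swap R⟩ (insert e.swap K) =
          removeArcs ⟨W, insert e R⟩ (insert e K) := by
        rw [removeArcs, removeArcs, insert_sdiff_insert, insert_sdiff_insert,
          sdiff_insert_of_notMem he, sdiff_insert_of_notMem hs]
      set r := (removeArcs ⟨W, insert e R⟩ (insert e K)).rep with hr
      have hsub : insert e K ⊆ insert e R := insert_subset_insert _ hK
      have hinj := hD.injOn_rep hsub; have hc := hD.contract hsub
      have h1 : contract ⟨W, insert e R⟩ (insert e K) =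
          ⟨W.image r, insert (bar r e) (K.image (bar r))⟩ := by
        rw [contract, image_insert]
      have h2 : contract ⟨W, insert e.swap R⟩ (insert e.swap K) =
          ⟨W.image r, insert (bar r e).swap (K.image (bar r))⟩ := by
        rw [contract, hrem, image_insert]; rfl
      rw [h1] at hc; rw [h1, h2]; refine ih (K.image (bar r)).card ?_ ?_ hc rfl
      · rw [← hm]; exact lt_of_le_of_lt card_image_le (card_lt_card (hK.ssubset_of_ne hKR))
      · intro h; obtain ⟨x, hx, h3⟩ := mem_image.1 h
        have := hinj (mem_insert_of_mem hx) (mem_insert_self e K) h3; exact heK (this ▸ hx)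

end OrientedGraph

end

/-! ## Vanishing of tree sums -/

section

open OrientedGraph (otherEnd)

variable {V : Type}
variable {e : V × V} {a : V} {R : Arcs V} {D : Arcs V}

/-- Being an arc at the vertex `a`. -/
def AtVertex (a : V) (e : V × V) : Prop := e.1 = a ∨ e.2 = a

/-- Move the vertex `a` to `x`. -/
def retract (a x v : V) : V := if v = a then x else v

lemma retract_self (a x : V) : retract a x a = x := if_pos rfl

lemma retract_of_ne {a x v : V} (h : v ≠ a) : retract a x v = v := if_neg h

lemma retract_ne {a x : V} (hx : x ≠ a) (v : V) : retract a x v ≠ a := by unfold retract; grind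

lemma arc_cases (h : AtVertex a e) : e = (a, otherEnd a e) ∨ e = (otherEnd a e, a) := by
  unfold otherEnd; by_cases h1 : e.1 = a
  · grind
  · rw [if_neg h1]; exact Or.inr (Prod.ext rfl (h.resolve_left h1))

lemma otherEnd_ne (h : AtVertex a e) (hne : e.1 ≠ e.2) : otherEnd a e ≠ a := by
  intro h1; rcases arc_cases h with h2 | h2 <;> rw [h1] at h2 <;> exact hne (by rw [h2])

lemma otherEnd_left (a x : V) : otherEnd a (a, x) = x := if_pos rfl

lemma otherEnd_right (a x : V) : otherEnd a (x, a) = x := by unfold otherEnd; grind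

lemma bar_retract_of_not {a x : V} (h : ¬ AtVertex a e) : bar (retract a x) e = e :=
  Prod.ext (retract_of_ne fun h' => h (Or.inl h')) (retract_of_ne fun h' => h (Or.inr h'))

lemma not_atVertex_bar {a x : V} (hx : x ≠ a) (e : V × V) :
    ¬ AtVertex a (bar (retract a x) e) := fun h =>
  h.elim (retract_ne hx e.1) (retract_ne hx e.2)

lemma barImage_insert {Q : Type} (π : V → Q) (e : V × V) (K : Arcs V) :
    barImage π (insert e K) = insert (bar π e) (barImage π K) := image_insert _ _ _

lemma barImage_eq_self {π : V → V} (h : ∀ b ∈ D, bar π b = b) : barImage π D = D := by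
  rw [barImage]; grind

lemma barImage_comp {Q Q' : Type} (π : V → Q) (ρ : Q → Q') (K : Arcs V) :
    barImage ρ (barImage π K) = barImage (ρ ∘ π) K := image_image

/-- Merge the vertex `a` into `x`. -/
def mergeInto (a : V) {x : V} (hx : x ≠ a) (v : V) : {v : V // v ≠ a} :=
  ⟨retract a x v, retract_ne hx v⟩

lemma mergeInto_surjective (a : V) {x : V} (hx : x ≠ a) : Surjective (mergeInto a hx) := fun q =>
  ⟨q.1, Subtype.ext (retract_of_ne q.2)⟩

lemma mergeInto_val (a : V) {x : V} (hx : x ≠ a) (q : {v : V // v ≠ a}) :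
    mergeInto a hx q.1 = q := Subtype.ext (retract_of_ne q.2)

lemma barImage_retract (a : V) {x : V} (hx : x ≠ a) (K : Arcs V) :
    barImage (retract a x) K = barImage Subtype.val (barImage (mergeInto a hx) K) := by
  rw [barImage_comp]; rfl

lemma hasClasses_mergeInto (he : AtVertex a e) (hx : otherEnd a e ≠ a) :
    HasClasses {e} (mergeInto a hx) := by
  have hl : Lk {e} a (otherEnd a e) := by
    rcases arc_cases he with h | h
    · have := Lk.of_mem (mem_singleton_self e); grind
    · have := (Lk.of_mem (mem_singleton_self e)).symm; grind
  have hr : ∀ v, Lk {e} v (retract a (otherEnd a e) v) := by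
    intro v; by_cases h : v = a
    · rw [h, retract_self]; exact hl
    · rw [retract_of_ne h]; exact Lk.refl v
  intro u w; constructor
  · intro h; refine h.eq_of _ fun e' he' => Subtype.ext ?_; rw [mem_singleton.1 he']
    change retract a (otherEnd a e) e.1 = retract a (otherEnd a e) e.2
    rcases arc_cases he with h | h <;> generalize otherEnd a e = x at h hx <;> subst h <;>
      simp [retract, hx]
  · intro h
    have h' : retract a (otherEnd a e) u = retract a (otherEnd a e) w := congrArg Subtype.val h
    have h1 := hr u; rw [h'] at h1; exact h1.trans (hr w).symm

lemma isForest_singleton (h : e.1 ≠ e.2) : IsForest {e} := by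
  intro e' he' hl; rw [mem_singleton] at he'; subst he'; rw [erase_singleton] at hl
  exact h (hl.eq_of id fun x hx => absurd hx (notMem_empty x))

lemma otherEnd_injective (hD : IsForest D) {e f : V × V}
    (he : e ∈ D) (hf : f ∈ D) (hea : AtVertex a e) (hfa : AtVertex a f) (hne : e ≠ f) :
    otherEnd a e ≠ otherEnd a f := by
  intro h; refine hD e he ?_; have hf' : f ∈ D.erase e := mem_erase.2 ⟨hne.symm, hf⟩
  have hl := Lk.of_mem hf'; rcases arc_cases hea with h1 | h1 <;> rcases arc_cases hfa with h2 | h2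
  · exact absurd (h1.trans (by rw [h, ← h2])) hne
  · rw [congrArg Prod.fst h1, congrArg Prod.snd h1, h]
    rw [congrArg Prod.fst h2, congrArg Prod.snd h2] at hl; exact hl.symm
  · rw [congrArg Prod.fst h1, congrArg Prod.snd h1, h]
    rw [congrArg Prod.fst h2, congrArg Prod.snd h2] at hl; exact hl.symm
  grind

lemma isOTree_union_of_barImage {Q : Type} [Fintype V] [Fintype Q] {π : V → Q}
    {H K : Arcs V} (hπ : Surjective π) (hF : IsForest H) (hH : HasClasses H π)
    (hinj : Set.InjOn (bar π) (K : Set (V × V))) (hT : IsOTree (barImage π K)) : IsOTree (H ∪ K) :=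
  ((isOTree_union_iff hπ hF hH).2 ⟨hinj, hT⟩).2

section

variable [Fintype V] {Φ : Arcs V → ℝ}

lemma isOTree_card (hD : IsOTree D) : D.card = Fintype.card V - 1 := by
  cases isEmpty_or_nonempty V with
  | inl h =>
    rw [Fintype.card_eq_zero, card_eq_zero]
    exact eq_empty_of_forall_notMem fun e => isEmptyElim e.1
  | inr h => exact hD.card_eq

lemma flip_insert (hflip : ∀ D, IsOTree D → ∀ e ∈ D, Φ (flipArc D e) = -Φ D)
    {S : Arcs V} (hS : S.card + 1 = Fintype.card V - 1) (hT : IsOTree (insert e S)) :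
    IsOTree (insert e.swap S) ∧ Φ (insert e.swap S) = -Φ (insert e S) := by
  have he : e ∉ S := fun h => by have := isOTree_card hT; grind
  have h1 : flipArc (insert e S) e = insert e.swap S := by rw [flipArc, erase_insert he]
  rw [← h1]; exact ⟨hT.flipArc (mem_insert_self e S), hflip _ hT e (mem_insert_self e S)⟩

lemma card_insert_of_isOTree {e f : V × V}
    (hR : R.card + 2 = Fintype.card V - 1) (hT : IsOTree (insert e (insert f R))) :
    (insert f R).card + 1 = Fintype.card V - 1 := by
  have h1 := isOTree_card hT; have h2 := card_insert_le e (insert f R)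
  have h3 := card_insert_le f R; omega

/-- The relation for two arcs at a vertex. -/
def PairRel (Φ : Arcs V → ℝ) (a : V) (R : Arcs V) (e f : V × V) : Prop :=
  IsOTree (insert e (insert (bar (retract a (otherEnd a e)) f) R)) ∧
  IsOTree (insert f (insert (bar (retract a (otherEnd a f)) e) R)) ∧
  Φ (insert e (insert f R)) = Φ (insert e (insert (bar (retract a (otherEnd a e)) f) R)) +
    Φ (insert f (insert (bar (retract a (otherEnd a f)) e) R))

lemma PairRel.symm {e f : V × V} (h : PairRel Φ a R e f) :
    PairRel Φ a R f e := ⟨h.2.1, h.1, by rw [insert_comm, h.2.2, add_comm]⟩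

lemma PairRel.flip (hflip : ∀ D, IsOTree D → ∀ e ∈ D, Φ (flipArc D e) = -Φ D) {a x : V}
    {f : V × V} (hR : R.card + 2 = Fintype.card V - 1)
    (hT : IsOTree (insert (a, x) (insert f R))) (h : PairRel Φ a R (a, x) f) :
    PairRel Φ a R (x, a) f := by
  obtain ⟨h1, h2, h3⟩ := h; rw [otherEnd_left] at h1 h3
  have k0 := flip_insert hflip (card_insert_of_isOTree hR hT) hT
  have k1 := flip_insert hflip (card_insert_of_isOTree hR h1) h1; rw [insert_comm] at h2
  have k2 := flip_insert hflip (card_insert_of_isOTree hR h2) h2; refine ⟨?_, ?_, ?_⟩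
  · rw [otherEnd_right]; exact k1.1
  · rw [insert_comm]; exact k2.1
  · rw [otherEnd_right]; have e1 := k0.2; have e2 := k1.2; have e3 := k2.2
    rw [insert_comm _ f, insert_comm _ f] at e3; grind

lemma pairRel (hflip : ∀ D, IsOTree D → ∀ e ∈ D, Φ (flipArc D e) = -Φ D)
    (hrot : ∀ x ∈ chains V, Φ x.1 + Φ (rotate x).1 + Φ (rotate (rotate x)).1 = 0)
    {e f : V × V} (he : AtVertex a e) (hf : AtVertex a f)
    (hR : R.card + 2 = Fintype.card V - 1) (hT : IsOTree (insert e (insert f R))) :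
    PairRel Φ a R e f := by
  have base : ∀ x y, IsOTree (insert (a, x) (insert (a, y) R)) → PairRel Φ a R (a, x) (a, y) := by
    intro x y hT; have c0 := card_insert_of_isOTree hR hT
    have n1 : (a, x) ∉ insert (a, y) R := fun h => by have := isOTree_card hT; grind
    have n2 : (a, y) ∉ R := fun h => by grind
    have hax : a ≠ x := hT.1.ne (mem_insert_self _ _)
    have hay : a ≠ y := hT.1.ne (mem_insert_of_mem (mem_insert_self (a, y) R))
    have hxy : x ≠ y := fun h => n1 (h ▸ mem_insert_self _ _)
    obtain ⟨t1, f1⟩ := flip_insert hflip c0 hT; simp only [Prod.swap_prod_mk] at t1 f1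
    have n3 : (x, a) ∉ insert (a, y) R := fun h => by have := isOTree_card t1; grind
    have hc : (insert (x, a) (insert (a, y) R), x, a, y) ∈ chains V := by simp [chains, t1]
    have hc2 := rotate_mem hc; have hc3 := rotate_mem hc2; have hr := hrot _ hc
    have r1 : rotate (insert (x, a) (insert (a, y) R), x, a, y) =
        (insert (y, x) (insert (a, y) R), a, y, x) := by
      simp only [rotate, exchange]; rw [erase_insert n3]
    rw [r1] at hc2 hc3 hr
    have t2 : IsOTree (insert (y, x) (insert (a, y) R)) := by simpa [chains] using hc2
    have r2 : rotate (insert (y, x) (insert (a, y) R), a, y, x) =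
        (insert (x, a) (insert (y, x) R), y, x, a) := by
      simp only [rotate, exchange]; rw [insert_comm, erase_insert]; rw [mem_insert, not_or]
      exact ⟨fun h => hay (Prod.mk.inj h).1, n2⟩
    rw [r2] at hc3 hr
    have t3 : IsOTree (insert (x, a) (insert (y, x) R)) := by
      simp only [chains, mem_filter_univ] at hc3; exact hc3.1
    obtain ⟨t4, f4⟩ := flip_insert hflip (card_insert_of_isOTree hR t3) t3
    simp only [Prod.swap_prod_mk] at t4 f4; rw [insert_comm] at t4 f4
    obtain ⟨t5, f5⟩ := flip_insert hflip (card_insert_of_isOTree hR t4) t4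
    simp only [Prod.swap_prod_mk] at t5 f5; rw [insert_comm] at t5 f5
    rw [PairRel, otherEnd_left, otherEnd_left]
    have b1 : bar (retract a x) (a, y) = (x, y) :=
      Prod.ext (retract_self a x) (retract_of_ne hay.symm)
    have b2 : bar (retract a y) (a, x) = (y, x) :=
      Prod.ext (retract_self a y) (retract_of_ne hax.symm)
    rw [b1, b2]; refine ⟨t5, by rwa [insert_comm], ?_⟩
    simp only at hr; rw [f5, f4, neg_neg, insert_comm (a, y) (y, x)]; linarith
  have step : ∀ x f, AtVertex a f → IsOTree (insert (a, x) (insert f R)) →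
      PairRel Φ a R (a, x) f := by
    intro x f hf hT; rcases arc_cases hf with h | h
    · grind
    · rw [h] at hT ⊢; rw [insert_comm] at hT
      have hT' := (flip_insert hflip (card_insert_of_isOTree hR hT) hT).1
      simp only [Prod.swap_prod_mk] at hT'
      refine PairRel.symm (PairRel.flip hflip hR hT' (PairRel.symm (base _ _ ?_)))
      rwa [insert_comm]
  rcases arc_cases he with h | h
  · grind
  · rw [h] at hT ⊢; have hT' := (flip_insert hflip (card_insert_of_isOTree hR hT) hT).1
    simp only [Prod.swap_prod_mk] at hT'; exact PairRel.flip hflip hR hT' (step _ _ hf hT')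

lemma isOTree_insert_lift (he : AtVertex a e) (hne : e.1 ≠ e.2)
    {D : Finset ({v : V // v ≠ a} × {v : V // v ≠ a})} (hD : IsOTree D) :
    IsOTree (insert e (barImage Subtype.val D)) := by
  have hx := otherEnd_ne he hne; have hcl := hasClasses_mergeInto he hx
  have hmb : ∀ b : {v : V // v ≠ a} × {v : V // v ≠ a},
      bar (mergeInto a hx) (bar Subtype.val b) = b := fun b =>
    Prod.ext (mergeInto_val a hx b.1) (mergeInto_val a hx b.2)
  rw [insert_eq]
  refine isOTree_union_of_barImage (mergeInto_surjective a hx) (isForest_singleton hne) hcl ?_ ?_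
  · intro b hb b' hb' h; obtain ⟨c, -, rfl⟩ := mem_image.1 hb
    obtain ⟨c', -, rfl⟩ := mem_image.1 hb'; grind
  · have : barImage (mergeInto a hx) (barImage Subtype.val D) = D := by
      rw [barImage_comp]; exact barImage_eq_self fun b _ => hmb b
    rw [this]; exact hD

lemma isOTree_retract (he : AtVertex a e) {K : Arcs V} (heK : e ∉ K) (hT : IsOTree (insert e K)) :
    IsOTree (insert e (barImage (retract a (otherEnd a e)) K)) := by
  have hne := hT.1.ne (mem_insert_self e K); have hx := otherEnd_ne he hne
  rw [barImage_retract a hx]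
  exact isOTree_insert_lift he hne (isOTree_barImage (H := {e}) (mergeInto_surjective a hx)
    (isForest_singleton hne) (hasClasses_mergeInto he hx) (disjoint_singleton_right.2 heK)
    (by grind)).2

/-- The value of a tree after moving all other arcs at `a` along the arc `e`. -/
def movedVal (Φ : Arcs V → ℝ) (a : V) (D : Arcs V) (e : V × V) : ℝ :=
  Φ (insert e (barImage (retract a (otherEnd a e)) (D.erase e)))

lemma eq_sum_movedVal (hflip : ∀ D, IsOTree D → ∀ e ∈ D, Φ (flipArc D e) = -Φ D)
    (hrot : ∀ x ∈ chains V, Φ x.1 + Φ (rotate x).1 + Φ (rotate (rotate x)).1 = 0) (a : V)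
    (hD : IsOTree D) (hne : (D.filter (AtVertex a)).Nonempty) :
    Φ D = ∑ e ∈ D.filter (AtVertex a), movedVal Φ a D e := by
  induction hm : (D.filter (AtVertex a)).card generalizing D with
  | zero => exact absurd (card_eq_zero.1 hm) hne.ne_empty
  | succ m ih =>
    obtain ⟨e, he⟩ := hne; obtain ⟨heD, hea⟩ := mem_filter.1 he
    rcases Nat.eq_zero_or_pos m with rfl | hm0
    · have h1 : D.filter (AtVertex a) = {e} := by
        obtain ⟨e', he'⟩ := card_eq_one.1 hm; rw [he'] at he ⊢; rw [mem_singleton.1 he]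
      rw [h1, sum_singleton, movedVal]
      have h2 : barImage (retract a (otherEnd a e)) (D.erase e) = D.erase e := by
        refine barImage_eq_self fun x hx => bar_retract_of_not fun h => ?_
        obtain ⟨h3, h4⟩ := mem_erase.1 hx
        have h5 : x ∈ D.filter (AtVertex a) := mem_filter.2 ⟨h4, h⟩; rw [h1] at h5
        exact h3 (mem_singleton.1 h5)
      rw [h2, insert_erase heD]
    obtain ⟨f, hf, hfe⟩ := exists_mem_ne (s := D.filter (AtVertex a)) (by omega) e
    obtain ⟨hfD, hfa⟩ := mem_filter.1 hf; set R := (D.erase e).erase f with hRdef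
    have hfD' : f ∈ D.erase e := mem_erase.2 ⟨hfe, hfD⟩
    have hDR : D = insert e (insert f R) := by rw [hRdef, insert_erase hfD', insert_erase heD]
    have heR : e ∉ R := fun h => notMem_erase e D (mem_of_mem_erase h)
    have hfR : f ∉ R := notMem_erase _ _
    have hcard : R.card + 2 = Fintype.card V - 1 := by
      have h1 := isOTree_card hD; have h2 : (D.erase e).card + 1 = D.card := card_erase_add_one heD
      have h3 : R.card + 1 = (D.erase e).card := card_erase_add_one hfD'; omega
    have hTD : IsOTree (insert e (insert f R)) := by rw [← hDR]; exact hD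
    have hrel := pairRel hflip hrot hea hfa hcard hTD; have hex := otherEnd_ne hea (hD.1.ne heD)
    have hfx := otherEnd_ne hfa (hD.1.ne hfD); set A := R.filter (AtVertex a) with hA
    have heA : e ∉ A := fun h => heR (mem_filter.1 h).1
    have hfA : f ∉ A := fun h => hfR (mem_filter.1 h).1
    have filt : ∀ p q, AtVertex a p → ¬ AtVertex a q →
        (insert p (insert q R)).filter (AtVertex a) = insert p A := by
      intro p q hp hq; rw [filter_insert, if_pos hp, filter_insert, if_neg hq]
    have hfilt : D.filter (AtVertex a) = insert e (insert f A) := by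
      rw [hDR, filter_insert, if_pos hea, filter_insert, if_pos hfa]
    have hAcard : A.card + 1 = m := by
      have := hm; rw [hfilt, card_insert_of_notMem, card_insert_of_notMem hfA] at this
      · omega
      · rw [mem_insert, not_or]; exact ⟨hfe.symm, heA⟩
    have side : ∀ p q, AtVertex a p → p ∉ R → p ≠ q → otherEnd a p ≠ a →
        IsOTree (insert p (insert (bar (retract a (otherEnd a p)) q) R)) →
        Φ (insert p (insert (bar (retract a (otherEnd a p)) q) R)) =
          movedVal Φ a (insert p (insert q R)) p +
            ∑ e' ∈ A, Φ (insert e' (insert (bar (retract a (otherEnd a e')) p)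
              (insert (bar (retract a (otherEnd a p)) q)
                (barImage (retract a (otherEnd a e')) (R.erase e'))))) := by
      intro p q hpa hpR hpq hpx hT; have hq' := not_atVertex_bar (a := a) hpx q
      have hpq' : p ≠ bar (retract a (otherEnd a p)) q := fun h => hq' (h ▸ hpa)
      have hpA : p ∉ A := fun h => hpR (mem_filter.1 h).1; have hfl := filt p _ hpa hq'
      rw [ih hT (by rw [hfl]; exact insert_nonempty _ _)
        (by rw [hfl, card_insert_of_notMem hpA, hAcard]), hfl, sum_insert hpA]
      congr 1
      · rw [movedVal, movedVal, erase_insert (by grind), erase_insert (by grind), barImage_insert, barImage_insert,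
          bar_retract_of_not hq']
      · refine sum_congr rfl fun e' he' => ?_; obtain ⟨he'R, he'a⟩ := mem_filter.1 he'
        rw [movedVal, erase_insert_of_ne (fun h : p = e' => hpR (h ▸ he'R)),
          erase_insert_of_ne (fun h => hq' (by rw [h]; exact he'a)), barImage_insert, barImage_insert,
          bar_retract_of_not hq']
    rw [hfilt, sum_insert (by grind), sum_insert hfA]
    conv_lhs => rw [hDR, hrel.2.2]
    rw [side e f hea heR hfe.symm hex hrel.1, side f e hfa hfR hfe hfx hrel.2.1,
      insert_comm f e, ← hDR]
    have key : ∀ e' ∈ A, movedVal Φ a D e' =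
        Φ (insert e' (insert (bar (retract a (otherEnd a e')) e)
          (insert (bar (retract a (otherEnd a e)) f)
            (barImage (retract a (otherEnd a e')) (R.erase e'))))) +
        Φ (insert e' (insert (bar (retract a (otherEnd a e')) f)
          (insert (bar (retract a (otherEnd a f)) e)
            (barImage (retract a (otherEnd a e')) (R.erase e'))))) := by
      intro e' he'; obtain ⟨he'R, he'a⟩ := mem_filter.1 he'
      have he'D : e' ∈ D := by rw [hDR]; exact mem_insert_of_mem (mem_insert_of_mem he'R)
      have hee' : e' ≠ e := fun h => heR (h ▸ he'R); have hfe' : e' ≠ f := fun h => hfR (h ▸ he'R)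
      have hz := otherEnd_ne he'a (hD.1.ne he'D)
      have hzx := otherEnd_injective hD.1 he'D heD he'a hea hee'
      have hzy := otherEnd_injective hD.1 he'D hfD he'a hfa hfe'; set z := otherEnd a e' with hzdef
      have moved : ∀ p, AtVertex a p → z ≠ otherEnd a p →
          otherEnd a p ≠ a → AtVertex z (bar (retract a z) p) ∧
          otherEnd z (bar (retract a z) p) = otherEnd a p ∧
          ∀ u, bar (retract z u) (bar (retract a z) p) = bar (retract a u) p := by
        intro p hp hzp hpa
        rcases arc_cases hp with h | h <;> generalize otherEnd a p = x at h hzp hpa <;> subst h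
        · have h1 : bar (retract a z) (a, x) = (z, x) :=
            Prod.ext (retract_self a z) (retract_of_ne hpa)
          rw [h1]
          exact ⟨Or.inl rfl, otherEnd_left z x, fun u => Prod.ext
            ((retract_self z u).trans (retract_self a u).symm)
            ((retract_of_ne hzp.symm).trans (retract_of_ne hpa).symm)⟩
        · have h1 : bar (retract a z) (x, a) = (x, z) :=
            Prod.ext (retract_of_ne hpa) (retract_self a z)
          rw [h1]
          exact ⟨Or.inr rfl, otherEnd_right z x, fun u => Prod.ext
            ((retract_of_ne hzp.symm).trans (retract_of_ne hpa).symm)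
            ((retract_self z u).trans (retract_self a u).symm)⟩
      obtain ⟨e1, e2, e3⟩ := moved e hea hzx hex; obtain ⟨f1, f2, f3⟩ := moved f hfa hzy hfx
      have hmv : insert e' (barImage (retract a z) (D.erase e')) =
          insert (bar (retract a z) e) (insert (bar (retract a z) f)
            (insert e' (barImage (retract a z) (R.erase e')))) := by
        rw [hDR, erase_insert_of_ne hee'.symm, erase_insert_of_ne hfe'.symm,
          barImage_insert, barImage_insert, insert_comm e', insert_comm e']
      have hT' : IsOTree (insert e' (barImage (retract a z) (D.erase e'))) :=
        isOTree_retract he'a (notMem_erase _ _) (by rwa [insert_erase he'D])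
      have hc' : (insert e' (barImage (retract a z) (R.erase e'))).card + 2 =
          Fintype.card V - 1 := by
        have h1 := isOTree_card hT'; rw [hmv] at h1
        have h2 := card_insert_le (bar (retract a z) e) (insert (bar (retract a z) f)
            (insert e' (barImage (retract a z) (R.erase e'))))
        have h3 := card_insert_le (bar (retract a z) f)
            (insert e' (barImage (retract a z) (R.erase e')))
        have h4 := card_insert_le e' (barImage (retract a z) (R.erase e'))
        have h5 : (barImage (retract a z) (R.erase e')).card ≤ (R.erase e').card := card_image_le
        have h6 := card_erase_add_one he'R; omega
      have hr := (pairRel hflip hrot e1 f1 hc' (by rw [← hmv]; exact hT')).2.2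
      rw [e2, f2, e3, f3] at hr; rw [movedVal, ← hzdef, hmv, hr]; congr 2 <;> rw [insert_comm _ e', insert_comm _ e']
    rw [sum_congr rfl key, sum_add_distrib]; ring

end

end

section

open OrientedGraph (otherEnd)

variable {V Q : Type}
variable [Fintype V] [Fintype Q] {π : V → Q} {w : V × V → ℝ} {c : V → ℝ}

lemma sum_barSum_right (π : V → Q) (w : V × V → ℝ) (q : Q) :
    ∑ q', barSum π w (q, q') = pushSum π (fun v => ∑ v', w (v, v')) q := by
  have h : ∀ q', barSum π w (q, q') = ∑ v with π v = q, ∑ v' with π v' = q', w (v, v') :=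
    fun q' => by rw [← sum_product', barSum]; exact sum_congr (by grind) fun _ _ => rfl
  rw [sum_congr rfl fun q' _ => h q', sum_comm]
  exact sum_congr rfl fun v _ =>
    sum_fiberwise univ π fun v' => w (v, v')

lemma barSum_swap (hw : ∀ e, w e.swap = -w e) (π : V → Q) (e : Q × Q) :
    barSum π w e.swap = -barSum π w e := by
  rw [barSum, barSum, ← sum_neg_distrib]
  exact sum_equiv (Equiv.prodComm V V) (fun a => by
    grind)
    fun a _ => by rw [← hw]; simp

/-- The arc weight `w` is antisymmetric, and its sum over the arcs at each vertex vanishes. -/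
def IsConserved (w : V × V → ℝ) : Prop :=
  (∀ e, w e.swap = -w e) ∧ ∀ v, ∑ v', w (v, v') = 0

lemma IsConserved.barSum (hw : IsConserved w) (π : V → Q) : IsConserved (barSum π w) :=
  ⟨barSum_swap hw.1 π, fun q => by
    rw [sum_barSum_right, funext hw.2]; exact congrFun (map_zero (pushSum π)) q⟩

lemma flipArc_barImage (hπ : Injective π) (D : Arcs V) (e : V × V) :
    barImage π (flipArc D e) = flipArc (barImage π D) (bar π e) := by
  have hb : Injective (bar π) := fun a b h => Prod.ext
    (hπ (congrArg Prod.fst h)) (hπ (congrArg Prod.snd h))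
  rw [flipArc, barImage_insert, barImage, image_erase hb]; rfl

lemma bar_mem_barImage {D : Arcs V} {e : V × V} (he : e ∈ D) :
    bar π e ∈ barImage π D := mem_image_of_mem _ he

lemma mem_chains {x : Arcs V × V × V × V} : x ∈ chains V ↔
    IsOTree x.1 ∧ (x.2.1, x.2.2.1) ∈ x.1 ∧ (x.2.2.1, x.2.2.2) ∈ x.1 := by simp [chains]

lemma exchange_barImage (hπ : Injective π) (D : Arcs V) (i j k : V) :
    barImage π (exchange D i j k) = exchange (barImage π D) (π i) (π j) (π k) := by
  have hb : Injective (bar π) := fun a b h => Prod.ext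
    (hπ (congrArg Prod.fst h)) (hπ (congrArg Prod.snd h))
  rw [exchange, barImage_insert, barImage, image_erase hb]; rfl

lemma sum_prod_mul_eq_zero (N : ℕ) : ∀ {V : Type} [Fintype V], Fintype.card V = N + 2 →
    ∀ {w : V × V → ℝ}, IsConserved w → ∀ {Φ : Arcs V → ℝ},
    (∀ D, IsOTree D → ∀ e ∈ D, Φ (flipArc D e) = -Φ D) →
    (∀ x ∈ chains V, Φ x.1 + Φ (rotate x).1 + Φ (rotate (rotate x)).1 = 0) →
    ∑ D ∈ otrees V, (∏ e ∈ D, w e) * Φ D = 0 := by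
  induction N with
  | zero =>
    intro V _ hV w hw Φ _ _; refine sum_eq_zero fun D hD => ?_; have hD := mem_otrees.1 hD
    obtain ⟨e, he⟩ := Finset.card_pos.1 (show 0 < D.card by rw [isOTree_card hD, hV]; norm_num)
    have hne := hD.1.ne he
    have hu : ({e.1, e.2} : Finset V) = univ := eq_univ_of_card _ (by
      rw [card_pair hne, hV])
    have h0 : w (e.1, e.1) = 0 := self_eq_neg.1 (hw.1 (e.1, e.1)); have h1 := hw.2 e.1
    rw [← hu, sum_pair hne, h0, zero_add] at h1; rw [prod_eq_zero he h1, zero_mul]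
  | succ N ih =>
    intro V _ hV w hw Φ hflip hrot; obtain ⟨a⟩ : Nonempty V := Fintype.card_pos_iff.1 (by omega)
    have h1 : ∀ D ∈ otrees V, (∏ e ∈ D, w e) * Φ D =
        ∑ e ∈ D.filter (AtVertex a), (∏ e ∈ D, w e) * movedVal Φ a D e := fun D hD => by
      have hD := mem_otrees.1 hD; rw [eq_sum_movedVal hflip hrot a hD, mul_sum]
      obtain ⟨b, hb⟩ := Fintype.exists_ne_of_one_lt_card (by omega) a; by_contra hne
      rw [not_nonempty_iff_eq_empty, filter_eq_empty_iff] at hne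
      exact hb (cast ((hD.2 a b).eq_of (fun v => v = a) fun e he => by
        have := hne he; simp only [AtVertex, not_or] at this; simp [this.1, this.2]) rfl)
    rw [sum_congr rfl h1, sum_comm' (t' := univ.filter (AtVertex a))
      (s' := fun e => (otrees V).filter fun D => e ∈ D) (by simp; tauto)]
    refine sum_eq_zero fun e he => ?_; have hea := (mem_filter.1 he).2; by_cases hne : e.1 = e.2
    · exact sum_eq_zero fun D hD => absurd hne
        ((mem_otrees.1 (mem_filter.1 hD).1).1.ne (mem_filter.1 hD).2)
    have hx := otherEnd_ne hea hne; have hcl := hasClasses_mergeInto hea hx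
    set k : Finset ({v : V // v ≠ a} × {v : V // v ≠ a}) → ℝ :=
      fun D => Φ (insert e (barImage Subtype.val D)) with hk
    have h2 : ∑ D ∈ otrees V with e ∈ D, (∏ e ∈ D, w e) * movedVal Φ a D e =
        w e * ∑ K ∈ completions {e}, (∏ e ∈ K, w e) • k (barImage (mergeInto a hx) K) := by
      rw [mul_sum]; refine sum_nbij' (fun D => D.erase e) (fun K => insert e K) ?_ ?_ ?_ ?_ ?_
      · intro D hD; obtain ⟨h3, h4⟩ := mem_filter.1 hD
        refine mem_filter.2 ⟨mem_univ _, by simp, ?_⟩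
        rw [← insert_eq, insert_erase h4]; exact mem_otrees.1 h3
      · intro K hK; have h3 := (mem_filter.1 hK).2.2; rw [← insert_eq] at h3
        exact mem_filter.2 ⟨mem_otrees.2 h3, mem_insert_self _ _⟩
      · grind
      · intro K hK; exact erase_insert (disjoint_singleton_right.1 (mem_filter.1 hK).2.1)
      · intro D hD
        rw [← mul_prod_erase _ _ (mem_filter.1 hD).2, movedVal,
          barImage_retract a hx, smul_eq_mul, mul_assoc]
    have hcard : Fintype.card {v : V // v ≠ a} = N + 2 := by
      rw [Fintype.card_subtype_compl, Fintype.card_subtype_eq, hV]; rfl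
    have hval : Injective (Subtype.val : {v : V // v ≠ a} → V) := Subtype.val_injective
    have hnb : ∀ b : {v : V // v ≠ a} × {v : V // v ≠ a}, bar Subtype.val b ≠ e := fun b h =>
      hea.elim (fun h' => b.1.2 ((congrArg Prod.fst h).trans h'))
        (fun h' => b.2.2 ((congrArg Prod.snd h).trans h'))
    have hins : ∀ (D : Arcs V) (i j l : {v : V // v ≠ a}),
        insert e (exchange D i.1 j.1 l.1) = exchange (insert e D) i.1 j.1 l.1 := fun D i j l => by
      rw [exchange, exchange, insert_comm, erase_insert_of_ne (hnb (i, j)).symm]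
    rw [h2, sum_completions_bar (mergeInto_surjective a hx) (isForest_singleton hne) hcl w k]
    simp only [smul_eq_mul]; rw [ih hcard (hw.barSum (mergeInto a hx)) (Φ := k) ?_ ?_, mul_zero]
    · intro D hD b hb; have h3 := isOTree_insert_lift hea hne hD
      rw [hk, ← hflip _ h3 (bar Subtype.val b) (mem_insert_of_mem (bar_mem_barImage hb))]
      simp only [flipArc_barImage hval]
      rw [flipArc, flipArc, insert_comm, erase_insert_of_ne (hnb b).symm]
    · rintro ⟨D, i, j, l⟩ hx'; obtain ⟨hD, h3, h4⟩ := mem_chains.1 hx'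
      have := hrot (insert e (barImage Subtype.val D), i.1, j.1, l.1)
        (mem_chains.2 ⟨isOTree_insert_lift hea hne hD, mem_insert_of_mem (bar_mem_barImage h3),
          mem_insert_of_mem (bar_mem_barImage h4)⟩)
      simp only [rotate, hk, exchange_barImage hval, hins] at this ⊢; exact this

/-- No sum of `c` over a proper nonempty subset vanishes. -/
def IsGenericVec (c : V → ℝ) : Prop :=
  ∑ v, c v = 0 ∧ ∀ S : Finset V, S.Nonempty → S ≠ univ → ∑ v ∈ S, c v ≠ 0

lemma IsGenericVec.flow_ne (hc : IsGenericVec c) {D : Arcs V}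
    (hD : IsForest D) {e : V × V} (he : e ∈ D) : flow D e c ≠ 0 := by
  rw [flow_apply]; refine hc.2 _ ⟨e.1, by simp [side, Lk.refl]⟩ fun h => hD e he ?_
  have := h ▸ mem_univ e.2; simpa [side] using this

lemma pushSum_eq_sum (π : V → Q) (c : V → ℝ) (S : Finset Q) :
    ∑ q ∈ S, pushSum π c q = ∑ v with π v ∈ S, c v := by
  simp only [pushSum_apply]
  rw [← sum_fiberwise_of_maps_to (s := univ.filter fun v => π v ∈ S) (t := S) (g := π)
    (fun v hv => (mem_filter.1 hv).2)]
  refine sum_congr rfl fun q hq => sum_congr ?_ fun _ _ => rfl; grind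

lemma IsGenericVec.pushSum (hc : IsGenericVec c)
    (hπ : Surjective π) : IsGenericVec (pushSum π c) := by
  refine ⟨by rw [sum_pushSum]; exact hc.1, fun S ⟨q, hq⟩ hS => ?_⟩; rw [pushSum_eq_sum]
  obtain ⟨v, rfl⟩ := hπ q
  refine hc.2 _ ⟨v, by simpa using hq⟩ fun h => hS (eq_univ_of_forall fun q' => ?_)
  obtain ⟨v', rfl⟩ := hπ q'; simp_all

lemma sgnAvg_no_arcs (U : Finset V) : sgnAvg (∅ : Arcs V) U = 1 := by
  induction U using strongInduction with
  | H U ih =>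
    rcases U.eq_empty_or_nonempty with rfl | hU
    · exact sgnAvg_empty _
    have h := card_mul_sgnAvg (∅ : Arcs V) hU
    rw [sum_congr rfl fun v hv => by rw [ih _ (erase_ssubset hv)]] at h
    simpa [vsign, hU.ne_empty] using h

lemma sum_prod_signSum_eq_zero (hV : 2 ≤ Fintype.card V)
    (hw : IsConserved w) (hc : IsGenericVec c) :
    ∑ D ∈ otrees V, (∏ e ∈ D, w e) * signSum (fun e => sign (flow D e c)) D = 0 := by
  obtain ⟨N, hN⟩ := Nat.exists_eq_add_of_le' hV
  have h := sum_prod_mul_eq_zero N hN hw (Φ := fun D => treeWeight D c)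
    (fun D hD e he => treeWeight_flipArc hD he c) fun x hx => by
      obtain ⟨h1, h2, h3⟩ := mem_chains.1 hx; obtain ⟨h4, h5, h6⟩ := mem_chains.1 (rotate_mem hx)
      rw [← meanFree_of_sum hc.1] at hc
      exact treeWeight_rotate hx (hc.flow_ne h1.1 h2) (hc.flow_ne h1.1 h3) (hc.flow_ne h4.1 h5)
  simpa only [treeWeight, meanFree_of_sum hc.1] using h

lemma OrientedGraph.mem_map_verts {D : OrientedGraph V} (f : V → Q) {v : V} (hv : v ∈ D.verts) :
    f v ∈ (D.map f).verts := mem_image_of_mem f hv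

lemma contract_map_block {P : Finset (Finset V)} (hP : IsPartition univ P)
    {H K : Arcs V} (hH : HasClasses H hP.block) (hd : Disjoint K H) :
    ((OrientedGraph.mk univ (H ∪ K)).contract K).map hP.block = ⟨univ, barImage hP.block K⟩ ∧
    Set.InjOn hP.block (((OrientedGraph.mk univ (H ∪ K)).contract K).verts : Set V) := by
  set D := OrientedGraph.mk univ (H ∪ K) with hD
  have hsd : (D.removeArcs K).arcs = H := by
    show (H ∪ K) \ K = H; rw [union_sdiff_right]; exact sdiff_eq_self_of_disjoint hd.symm
  have hlk : ∀ u v, (D.removeArcs K).Linked u v ↔ Lk H u v := fun u v => by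
    rw [← hsd]; exact Iff.rfl
  have hrep : ∀ v, hP.block ((D.removeArcs K).rep v) = hP.block v := fun v =>
    ((hH _ _).1 ((hlk _ _).1 (OrientedGraph.linked_rep (D.removeArcs K) v))).symm
  constructor
  · refine congrArg₂ OrientedGraph.mk (eq_univ_of_forall fun q => ?_) ?_
    · obtain ⟨v, rfl⟩ := hP.block_surjective q; rw [← hrep v]
      exact OrientedGraph.mem_map_verts _ (mem_image_of_mem _ (mem_univ v))
    · show barImage hP.block (barImage (D.removeArcs K).rep K) = _; rw [barImage_comp]
      exact congrArg (fun f => barImage f K) (funext hrep)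
  · intro x hx y hy h; obtain ⟨u, -, rfl⟩ := mem_image.1 hx; obtain ⟨v, -, rfl⟩ := mem_image.1 hy
    rw [hrep, hrep] at h; exact (OrientedGraph.rep_eq_iff _).2 ((hlk _ _).2 ((hH _ _).2 h))

lemma coeffE_contract {P : Finset (Finset V)} (hP : IsPartition univ P)
    {H K : Arcs V} (hH : HasClasses H hP.block) (hd : Disjoint K H) (hT : IsOTree (H ∪ K)) :
    ((OrientedGraph.mk univ (H ∪ K)).contract K).coeffE =
    (OrientedGraph.mk univ (barImage hP.block K)).coeffE := by
  obtain ⟨h1, h2⟩ := contract_map_block hP hH hd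
  rw [← h1, OrientedGraph.coeffE_map (OrientedGraph.IsForestOn.contract
    ⟨hT.1, fun e _ => ⟨mem_univ _, mem_univ _⟩⟩ subset_union_right) h2]

lemma card_lt_of_hasClasses (hπ : Surjective π)
    {H : Arcs V} (hF : IsForest H) (hH : HasClasses H π) (hne : H ≠ ∅) :
    Fintype.card Q < Fintype.card V := by
  obtain ⟨e, he⟩ := nonempty_iff_ne_empty.2 hne
  exact Fintype.card_lt_of_surjective_not_injective π hπ fun hi =>
    hF.ne he (hi ((hH _ _).1 (Lk.of_mem he)))

lemma sum_otrees_congr (w : V × V → ℝ) {X Y : Arcs V → Arcs V → ℝ}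
    (h : ∀ (P : Finset (Finset V)) (hP : IsPartition univ P) (H : Arcs V),
    IsForest H → HasClasses H hP.block → ∑ K ∈ completions H, (∏ e ∈ K, w e) * X (H ∪ K) K =
    ∑ K ∈ completions H, (∏ e ∈ K, w e) * Y (H ∪ K) K) :
    ∑ D ∈ otrees V, (∏ e ∈ D, w e) * ∑ K ∈ D.powerset, X D K =
    ∑ D ∈ otrees V, (∏ e ∈ D, w e) * ∑ K ∈ D.powerset, Y D K := by
  have key : ∀ X : Arcs V → Arcs V → ℝ, ∑ D ∈ otrees V, (∏ e ∈ D, w e) * ∑ K ∈ D.powerset, X D K =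
        ∑ H ∈ forests V, (∏ e ∈ H, w e) *
          ∑ K ∈ completions H, (∏ e ∈ K, w e) * X (H ∪ K) K := fun X => by
    simp only [mul_sum]
    rw [← sum_otrees_powerset fun H K => (∏ e ∈ H, w e) * ((∏ e ∈ K, w e) * X (H ∪ K) K)]
    refine sum_congr rfl fun D _ => sum_congr rfl fun K hK => ?_; have hK := mem_powerset.1 hK
    rw [sdiff_union_of_subset hK, ← mul_assoc, prod_sdiff hK]
  rw [key, key]; refine sum_congr rfl fun H hH => ?_; have hF := mem_forests.1 hH
  rw [h _ (isPartition_classes H) H hF ((hasClasses_block_iff _).2 rfl)]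

lemma sum_completions_of_eq (hπ : Surjective π)
    {H : Arcs V} (hF : IsForest H) (hH : HasClasses H π) (w : V × V → ℝ)
    {X : Arcs V → ℝ} {k : Arcs Q → ℝ}
    (h : ∀ K, Disjoint K H → IsOTree (H ∪ K) → X K = k (barImage π K)) :
    ∑ K ∈ completions H, (∏ e ∈ K, w e) * X K = ∑ D ∈ otrees Q, (∏ a ∈ D, barSum π w a) * k D := by
  refine (sum_congr rfl fun K hK => ?_).trans (sum_completions_bar hπ hF hH w k)
  obtain ⟨h1, h2⟩ := (mem_filter.1 hK).2; simp_all

lemma prod_sign_barImage {H K : Arcs V} (hπ : Surjective π) (hF : IsForest H) (hH : HasClasses H π)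
    (hd : Disjoint K H) (hT : IsOTree (H ∪ K)) (hc : ∑ v, c v = 0) (f : ℝ → ℝ) :
    ∏ e ∈ K, f (flow (H ∪ K) e c) =
    ∏ a ∈ barImage π K, f (flow (barImage π K) a (pushSum π c)) := by
  rw [prod_barImage (isOTree_barImage hπ hF hH hd hT).1]
  exact prod_congr rfl fun e he => by rw [flow_barImage hπ hF hH hd hT hc he]

lemma sum_prod_sign_eq_sum_coeffE (N : ℕ) : ∀ {V : Type} [Fintype V], Fintype.card V ≤ N →
    ∀ {w : V × V → ℝ}, IsConserved w → ∀ {c : V → ℝ}, IsGenericVec c →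
    ∑ D ∈ otrees V, (∏ e ∈ D, w e) * ∏ e ∈ D, sign (flow D e c) =
    ∑ D ∈ otrees V, (∏ e ∈ D, w e) * ((OrientedGraph.mk univ D).coeffE : ℝ) := by
  induction N with
  | zero =>
    intro V _ hV w _ c _; refine sum_congr rfl fun D hD => ?_
    have : D = ∅ := card_eq_zero.1 (by rw [isOTree_card (mem_otrees.1 hD)]; omega)
    rw [this, OrientedGraph.coeffE, if_pos rfl]; simp
  | succ N ih =>
    intro V _ hV w hw c hc; rcases Nat.lt_or_ge 1 (Fintype.card V) with hV2 | hV1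
    swap
    · refine sum_congr rfl fun D hD => ?_
      have : D = ∅ := card_eq_zero.1 (by rw [isOTree_card (mem_otrees.1 hD)]; omega)
      rw [this, OrientedGraph.coeffE, if_pos rfl]; simp
    have h0 := sum_prod_signSum_eq_zero hV2 hw hc
    have h1 := sum_otrees_congr w (X := fun D K => if K = D then 0 else
        (sgnAvg (D \ K) univ : ℝ) * ∏ e ∈ K, sign (flow D e c))
      (Y := fun D K => if K = D then 0 else (sgnAvg (D \ K) univ : ℝ) *
          (((OrientedGraph.mk univ D).contract K).coeffE : ℝ)) (by
        intro P hP H hF hH; by_cases hne : H = ∅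
        · subst hne; simp
        have hs : ∀ f : Arcs V → ℝ, ∑ K ∈ completions H, (∏ e ∈ K, w e) *
            (if K = H ∪ K then 0 else (sgnAvg ((H ∪ K) \ K) univ : ℝ) * f K) =
            (sgnAvg H univ : ℝ) * ∑ K ∈ completions H, (∏ e ∈ K, w e) * f K := fun f => by
          rw [mul_sum]; refine sum_congr rfl fun K hK => ?_; have hd := (mem_filter.1 hK).2.1
          rw [if_neg, union_sdiff_right, sdiff_eq_self_of_disjoint hd.symm]
          · ring
          · intro h
            exact hne (disjoint_self_iff_empty _ |>.1 (hd.mono_left (h ▸ subset_union_left)))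
        rw [hs, hs, sum_completions_of_eq hP.block_surjective hF hH w (k := fun D =>
          ∏ a ∈ D, sign (flow D a (pushSum hP.block c))) fun K hd hT =>
          prod_sign_barImage hP.block_surjective hF hH hd hT hc.1 sign,
          sum_completions_of_eq hP.block_surjective hF hH w (k := fun D =>
          ((OrientedGraph.mk univ D).coeffE : ℝ)) fun K hd hT => by
          rw [coeffE_contract hP hH hd hT]]
        congr 1
        exact ih (by have := card_lt_of_hasClasses hP.block_surjective hF hH hne; omega)
          (hw.barSum hP.block) (hc.pushSum hP.block_surjective))
    have h3 : ∀ D ∈ otrees V, (∏ e ∈ D, w e) * signSum (fun e => sign (flow D e c)) D =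
        (∏ e ∈ D, w e) * ∏ e ∈ D, sign (flow D e c) +
        (∏ e ∈ D, w e) * ∑ K ∈ D.powerset, (if K = D then 0 else
          (sgnAvg (D \ K) univ : ℝ) * ∏ e ∈ K, sign (flow D e c)) := fun D _ => by
      have hm := mem_powerset_self D
      rw [signSum, ← mul_add, ← add_sum_erase _ _ hm, ← add_sum_erase _ (fun K =>
        if K = D then (0 : ℝ) else _) hm, if_pos rfl, zero_add, Finset.sdiff_self, sgnAvg_no_arcs,
        Rat.cast_one, one_mul]
      congr 2; exact sum_congr rfl fun K hK => by grind
    have h4 : ∀ D ∈ otrees V, (∏ e ∈ D, w e) * ((OrientedGraph.mk univ D).coeffE : ℝ) =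
        -((∏ e ∈ D, w e) * ∑ K ∈ D.powerset, (if K = D then 0 else
          (sgnAvg (D \ K) univ : ℝ) *
          (((OrientedGraph.mk univ D).contract K).coeffE : ℝ))) := fun D hD => by
      have hD := mem_otrees.1 hD
      have hne : D.Nonempty := Finset.card_pos.1 (by rw [isOTree_card hD]; omega)
      rw [OrientedGraph.coeffE_eq ⟨hD.1, fun e _ => ⟨mem_univ _, mem_univ _⟩⟩ hne,
        Rat.cast_neg, Rat.cast_sum, mul_neg]
      congr 2; refine sum_congr rfl fun K _ => ?_; split_ifs <;> push_cast <;> ring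
    rw [sum_congr rfl h3, sum_add_distrib] at h0
    rw [sum_congr rfl h4, sum_neg_distrib, ← h1, eq_neg_of_add_eq_zero_left h0]

end

section

variable {V : Type} [Fintype V]

/-- The weight `∏_{e ∈ K} δ_{Γ_e} ∏_{e ∈ D ∖ K} sgn Γ_e`. -/
def deltaSign (c : V → ℝ) (D K : Arcs V) : ℝ :=
  (∏ e ∈ K, if flow D e c = 0 then 1 else 0) * ∏ e ∈ D \ K, sign (flow D e c)

lemma deltaSign_union {Q : Type} [Fintype Q] {π : V → Q} {H K : Arcs V}
    (hπ : Surjective π) (hF : IsForest H) (hH : HasClasses H π)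
    (hd : Disjoint K H) (hT : IsOTree (H ∪ K)) {c : V → ℝ} (hc : ∑ v, c v = 0) :
    deltaSign c (H ∪ K) K = (if pushSum π c = 0 then 1 else 0) * ∏ e ∈ H, sign (flow H e c) := by
  rw [deltaSign, union_sdiff_right, sdiff_eq_self_of_disjoint hd.symm]
  have hbt := isOTree_barImage hπ hF hH hd hT; by_cases h0 : pushSum π c = 0
  · have hz : ∀ e ∈ K, flow (H ∪ K) e c = 0 := fun e he => by
      rw [← flow_barImage hπ hF hH hd hT hc he, h0, map_zero]
    have hrep : c = ∑ e ∈ H, flow (H ∪ K) e c • dv e := by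
      conv_lhs => rw [hT.eq_sum_flow hc, sum_union hd.symm]
      rw [sum_eq_zero (s := K) fun e he => by rw [hz e he, zero_smul], add_zero]
    rw [if_pos h0, prod_eq_one fun e he => if_pos (hz e he)]; congr 1
    exact prod_congr rfl fun e he => by rw [flow_of_repr hF hrep he]
  · rw [if_neg h0, zero_mul]
    have : ∃ e ∈ K, flow (H ∪ K) e c ≠ 0 := by
      by_contra! h; refine h0 ?_
      rw [hbt.2.eq_sum_flow (c := pushSum π c) (by rw [sum_pushSum]; exact hc)]
      refine sum_eq_zero fun a ha => ?_; obtain ⟨e, he, rfl⟩ := mem_image.1 ha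
      have := flow_barImage hπ hF hH hd hT hc he; rw [h e he] at this; rw [this, zero_smul]
    obtain ⟨e, he, hne⟩ := this; rw [prod_eq_zero he (if_neg hne), zero_mul]

/-- Arcs without flow may be replaced by the rational coefficients of the trees they form. -/
lemma sum_sign_deltaSign {w : V × V → ℝ} (hw : ∀ e, w e.swap = -w e) {c : V → ℝ}
    (hc : ∀ v, c v = ∑ v', w (v, v')) {y : V → ℝ} (hy : IsGenericVec y) :
    ∑ D ∈ otrees V, (∏ e ∈ D, w e) * ∑ K ∈ D.powerset,
    deltaSign c D K * ∏ e ∈ K, sign (flow D e y) =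
    ∑ D ∈ otrees V, (∏ e ∈ D, w e) * ∑ K ∈ D.powerset,
    deltaSign c D K * (((OrientedGraph.mk univ D).contract K).coeffE : ℝ) := by
  have hc0 : ∑ v, c v = 0 := by
    simp only [hc]; refine self_eq_neg.1 ?_
    conv_lhs => rw [sum_comm]
    simp only [← sum_neg_distrib, ← hw, Prod.swap_prod_mk]
  refine sum_otrees_congr w fun P hP H hF hH => ?_
  have hs : ∀ f : Arcs V → ℝ, ∑ K ∈ completions H, (∏ e ∈ K, w e) *
      (deltaSign c (H ∪ K) K * f K) = ((if pushSum hP.block c = 0 then 1 else 0) *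
        ∏ e ∈ H, sign (flow H e c)) * ∑ K ∈ completions H, (∏ e ∈ K, w e) * f K := fun f => by
    rw [mul_sum]; refine sum_congr rfl fun K hK => ?_; obtain ⟨hd, hT⟩ := (mem_filter.1 hK).2
    rw [deltaSign_union hP.block_surjective hF hH hd hT hc0]; ring
  rw [hs, hs]; by_cases h0 : pushSum hP.block c = 0; swap
  · rw [if_neg h0, zero_mul, zero_mul, zero_mul]
  rw [sum_completions_of_eq hP.block_surjective hF hH w (k := fun D =>
    ∏ a ∈ D, sign (flow D a (pushSum hP.block y))) fun K hd hT =>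
    prod_sign_barImage hP.block_surjective hF hH hd hT hy.1 sign,
    sum_completions_of_eq hP.block_surjective hF hH w (k := fun D =>
    ((OrientedGraph.mk univ D).coeffE : ℝ)) fun K hd hT => by
    rw [coeffE_contract hP hH hd hT]]
  congr 1
  exact sum_prod_sign_eq_sum_coeffE _ le_rfl ⟨barSum_swap hw _, fun q => by
    rw [sum_barSum_right, ← funext hc, h0]; rfl⟩ (hy.pushSum hP.block_surjective)

/-- The limit of `sgn (s Γ + y)` for `s → ∞`. -/
def limSign (Γ y : ℝ) : ℝ := if Γ = 0 then sign y else sign Γ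

lemma prod_limSign (c y : V → ℝ) (D : Arcs V) : ∏ e ∈ D, limSign (flow D e c) (flow D e y) =
    ∑ K ∈ D.powerset, deltaSign c D K * ∏ e ∈ K, sign (flow D e y) := by
  have : ∀ e ∈ D, limSign (flow D e c) (flow D e y) =
      (if flow D e c = 0 then 1 else 0) * sign (flow D e y) + sign (flow D e c) :=
    fun e _ => by
      rw [limSign]; split_ifs with h
      · simp_all
      · ring
  rw [prod_congr rfl this, prod_add]; refine sum_congr rfl fun K _ => ?_
  rw [prod_mul_distrib, deltaSign]; ring

lemma tendsto_sign_limSign (Γ y : ℝ) :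
    Tendsto (fun s : ℝ => sign (s * Γ + y)) atTop (𝓝 (limSign Γ y)) := by
  rw [limSign]; split_ifs with h
  · simp [h]
  rcases lt_or_gt_of_ne h with h | h
  · rw [Real.sign_of_neg h]; refine tendsto_const_nhds.congr' ?_
    filter_upwards [(tendsto_atBot_add_const_right _ y
      (tendsto_id.atTop_mul_const_of_neg h)).eventually_lt_atBot 0] with s hs
    exact (Real.sign_of_neg hs).symm
  · rw [Real.sign_of_pos h]; refine tendsto_const_nhds.congr' ?_
    filter_upwards [(tendsto_atTop_add_const_right _ y
      (tendsto_id.atTop_mul_const h)).eventually_gt_atTop 0] with s hs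
    exact (Real.sign_of_pos hs).symm

end

section

open OrientedGraph

variable {V : Type} [Fintype V] {b n : ℕ}

/-- The factor `S_T` of a tree in terms of the flow of `c`. -/
def constSign (c : V → ℝ) (D : Arcs V) : ℝ :=
  ∑ K ∈ D.powerset, deltaSign c D K * (((OrientedGraph.mk univ D).contract K).coeffE : ℝ)

lemma sum_eq_zero_of_antisymm {w : V × V → ℝ} (hw : ∀ e, w e.swap = -w e) :
    ∑ v, ∑ v', w (v, v') = 0 := by
  refine self_eq_neg.1 ?_
  conv_lhs => rw [sum_comm]
  simp only [← sum_neg_distrib, ← hw, Prod.swap_prod_mk]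

lemma constSign_flipArc {c : V → ℝ} (hc : ∑ v, c v = 0) {D : Arcs V} (hD : IsOTree D)
    {e : V × V} (he : e ∈ D) : constSign c (flipArc D e) = -constSign c D := by
  obtain ⟨hf, hf'⟩ := flow_flipArc hD he hc
  obtain ⟨R, heR, rfl⟩ : ∃ R, e ∉ R ∧ insert e R = D :=
    ⟨D.erase e, notMem_erase e D, insert_erase he⟩
  have hfl : flipArc (insert e R) e = insert e.swap R := by rw [flipArc, erase_insert heR]
  have hs : e.swap ∉ R := fun h => hD.1.swap_notMem he (mem_insert_of_mem h); rw [hfl] at hf hf' ⊢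
  have hf' : ∀ a ∈ R, flow (insert e.swap R) a c = flow (insert e R) a c := fun a ha =>
    hf' a (mem_insert_of_mem ha) fun h => heR (h ▸ ha)
  rw [constSign, constSign, sum_powerset_insert hs, sum_powerset_insert heR, neg_add,
    ← sum_neg_distrib, ← sum_neg_distrib]
  have hprod : ∀ (K : Arcs V), K ⊆ R → ∀ f : ℝ → ℝ,
      ∏ a ∈ K, f (flow (insert e.swap R) a c) = ∏ a ∈ K, f (flow (insert e R) a c) := fun K hK f =>
    prod_congr rfl fun a ha => by rw [hf' a (hK ha)]
  congr 1
  · refine sum_congr rfl fun K hK => ?_; have hK := mem_powerset.1 hK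
    have hrep : ((OrientedGraph.mk univ (insert e.swap R)).removeArcs K).rep =
        ((OrientedGraph.mk univ (insert e R)).removeArcs K).rep := rep_congr fun u v => by
      show Lk (insert e.swap R \ K) u v ↔ Lk (insert e R \ K) u v
      rw [insert_sdiff_of_notMem _ fun h => hs (hK h), insert_sdiff_of_notMem _ fun h => heR (hK h)]
      have := lk_flipArc (mem_insert_self e (R \ K)) (u := u) (w := v)
      rwa [flipArc, erase_insert fun h => heR (Finset.mem_sdiff.1 h).1] at this
    have hcon : (OrientedGraph.mk univ (insert e.swap R)).contract K =
        (OrientedGraph.mk univ (insert e R)).contract K := by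
      unfold contract; rw [hrep]
    rw [hcon, deltaSign, deltaSign, hprod K hK fun x => if x = 0 then 1 else 0,
      insert_sdiff_of_notMem _ fun h => hs (hK h),
      insert_sdiff_of_notMem _ fun h => heR (hK h),
      prod_insert fun h => hs (Finset.mem_sdiff.1 h).1,
      prod_insert fun h => heR (Finset.mem_sdiff.1 h).1, hf, Real.sign_neg,
      hprod _ sdiff_subset]
    ring
  · refine sum_congr rfl fun K hK => ?_; have hK := mem_powerset.1 hK
    have hsd : ∀ a : V × V, a ∉ R → insert a R \ insert a K = R \ K := fun a ha => by grind
    have hrep : ((OrientedGraph.mk univ (insert e.swap R)).removeArcs (insert e.swap K)).rep =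
        ((OrientedGraph.mk univ (insert e R)).removeArcs (insert e K)).rep :=
      rep_congr fun u v => by
        show Lk (insert e.swap R \ insert e.swap K) u v ↔ Lk (insert e R \ insert e K) u v; grind
    have hsub : insert e K ⊆ insert e R := insert_subset_insert e hK
    have hF : (OrientedGraph.mk univ (insert e R)).IsForestOn :=
      ⟨hD.1, fun e _ => ⟨mem_univ _, mem_univ _⟩⟩
    have hcon := hF.contract hsub; have hinj := hF.injOn_rep hsub
    have heq : ((OrientedGraph.mk univ (insert e.swap R)).contract (insert e.swap K)).coeffE =
        -((OrientedGraph.mk univ (insert e R)).contract (insert e K)).coeffE := by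
      have h1 : (OrientedGraph.mk univ (insert e.swap R)).contract (insert e.swap K) =
        ⟨_, barImage _ (insert e.swap K)⟩ := rfl
      have h2 : (OrientedGraph.mk univ (insert e R)).contract (insert e K) =
        ⟨_, barImage _ (insert e K)⟩ := rfl
      rw [h2, barImage_insert] at hcon ⊢; rw [h1, hrep, barImage_insert]
      refine coeffE_flip (fun h => ?_) hcon; obtain ⟨a, ha, hae⟩ := mem_image.1 h
      have := hinj (mem_insert_of_mem ha) (mem_insert_self e K) hae; exact heR (this ▸ hK ha)
    rw [heq, deltaSign, deltaSign, hsd _ hs, hsd _ heR, prod_insert fun h => hs (hK h),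
      prod_insert fun h => heR (hK h), hf, hprod K hK fun x => if x = 0 then 1 else 0,
      hprod _ sdiff_subset]
    simp only [neg_eq_zero]; push_cast; ring

lemma flipInv_prod_mul_constSign {w : V × V → ℝ} (hw : ∀ e, w e.swap = -w e) {c : V → ℝ}
    (hc : ∑ v, c v = 0) : FlipInv fun D => (∏ e ∈ D, w e) * constSign c D := by
  intro D hD e he
  beta_reduce
  rw [constSign_flipArc hc hD he, prod_flipArc hD.1 he, hw, ← mul_prod_erase D _ he]; ring

lemma simpleEConst_eq (hn : 0 < n) (γ : Charges n b) :
    (2 ^ (n - 1) * n.factorial : ℝ) * simpleEConst n γ =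
    ∑ D ∈ otrees (Fin n), (∏ e ∈ D, dirac (γ e.1) (γ e.2)) *
    constSign (fun i => ∑ j, dirac (γ i) (γ j)) D := by
  have : Nonempty (Fin n) := ⟨⟨0, hn⟩⟩
  have hn' : (n.factorial : ℝ) ≠ 0 := by exact_mod_cast n.factorial_ne_zero
  have hw : ∀ e : Fin n × Fin n, dirac (γ e.swap.1) (γ e.swap.2) = -dirac (γ e.1) (γ e.2) :=
    fun e => by simp only [dirac, Prod.fst_swap, Prod.snd_swap]; ring
  have hc : ∑ i, ∑ j, dirac (γ i) (γ j) = 0 :=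
    sum_eq_zero_of_antisymm (w := fun e : Fin n × Fin n => dirac (γ e.1) (γ e.2)) hw
  rw [sum_otrees, Fintype.card_fin, nsmul_eq_mul, simpleEConst]
  · push_cast; field_simp; refine sum_congr rfl fun G hG => ?_
    have hT := isOTree_orient (mem_filter.1 hG).2; congr 1; refine sum_congr rfl fun K hK => ?_
    have hed : ∀ e ∈ (orient G).arcs, edgeDirac γ (orient G) e =
        flow (orient G).arcs e fun i => ∑ j, dirac (γ i) (γ j) := fun e he => edgeDirac_eq γ hT he
    rw [deltaSign, mul_assoc, mul_comm]; congr 1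
    · congr 1
      · exact prod_congr rfl fun e he => by grind
      · refine prod_congr (by ext; simp only [Finset.mem_sdiff]) fun e he => ?_; grind
  · exact flipInv_prod_mul_constSign (w := fun e : Fin n × Fin n => dirac (γ e.1) (γ e.2)) hw hc

end

/-! ## The limit of the simplified functions -/

section

variable {E ι α : Type} [NormedAddCommGroup E] [NormedSpace ℝ E] [FiniteDimensional ℝ E] [Fintype ι]
  {σ : (ι → ℝ) → ℝ} {L : E →L[ℝ] (ι → ℝ)} {x : ℝ → E} {φ : ℝ → ℝ}

lemma shiftOp_mul_prod_smul (a : ℝ) (v : E) (S : Finset α) (f : α → dirRing E) (F : smoothFns E)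
    (y : E) : ((shiftOp a v * ∏ e ∈ S, f e) • F).1 y =
    a * ((∏ e ∈ S, f e) • F).1 y + ((∏ e ∈ S, f e) • shiftOp 0 v • F).1 y := by
  have h : shiftOp a v • F = a • F + shiftOp 0 v • F := by
    ext y; change _ = a * F.1 y + (shiftOp 0 v • F).1 y
    rw [shiftOp_smul_apply, shiftOp_smul_apply]; ring
  rw [mul_comm, opRing_mul_smul, h, smul_add, opRing_smul_smul]; rfl

lemma exists_bound_prod_shiftOp (hσ : Measurable σ) {M : ℝ} (hM : ∀ w, |σ w| ≤ M)
    (hφ : ∀ G ∈ smoothSpan σ L, ∃ C : ℝ, ∀ s, 1 ≤ s → |G (x s)| ≤ C * φ s) (g : α → ℝ) (v : α → E)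
    (S : Finset α) : ∀ F : smoothFns E, F.1 ∈ smoothSpan σ L → ∃ C : ℝ, ∀ s, 1 ≤ s →
    |((∏ e ∈ S, shiftOp (s * g e) (v e)) • F).1 (x s)| ≤ C * (s ^ S.card * φ s) := by
  have hd : ∀ F : smoothFns E, F.1 ∈ smoothSpan σ L → ∀ u, (shiftOp 0 u • F).1 ∈ smoothSpan σ L :=
    fun F hF u => by
      have : (shiftOp 0 u • F).1 = (1 / (2 * Real.pi)) • fun y => fderiv ℝ F.1 y u :=
        funext fun y => by rw [shiftOp_smul_apply, zero_mul, zero_add]; rfl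
      rw [this]; exact Submodule.smul_mem _ _ ((differentiable_of_mem_smoothSpan hσ hM hF).2 u)
  induction S using Finset.induction_on with
  | empty => simp_all
  | insert e S he ih =>
    intro F hF; obtain ⟨C, hC⟩ := ih F hF; obtain ⟨C', hC'⟩ := ih _ (hd F hF (v e))
    refine ⟨|g e| * C + C', fun s hs => ?_⟩
    have h1 := (abs_nonneg _).trans (hC' s hs)
    rw [prod_insert he, card_insert_of_notMem he, shiftOp_mul_prod_smul]
    calc _ ≤ s * |g e| * (C * (s ^ S.card * φ s)) + C' * (s ^ S.card * φ s) := by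
          refine (abs_add_le _ _).trans (add_le_add ?_ (hC' s hs))
          rw [abs_mul, abs_mul, abs_of_nonneg (by linarith : 0 ≤ s)]
          exact mul_le_mul_of_nonneg_left (hC s hs) (by positivity)
      _ ≤ s * |g e| * (C * (s ^ S.card * φ s)) + s * (C' * (s ^ S.card * φ s)) := by
          exact add_le_add_right (le_mul_of_one_le_left h1 hs) _
      _ = _ := by ring

lemma exists_bound_prod_shiftOp_sub (hσ : Measurable σ) {M : ℝ} (hM : ∀ w, |σ w| ≤ M)
    (hφ : ∀ G ∈ smoothSpan σ L, ∃ C : ℝ, ∀ s, 1 ≤ s → |G (x s)| ≤ C * φ s) (g : α → ℝ) (v : α → E)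
    (F : smoothFns E) (hF : ∀ u, (fun y => fderiv ℝ F.1 y u) ∈ smoothSpan σ L) (S : Finset α) :
    ∃ C : ℝ, ∀ s, 1 ≤ s → s * |((∏ e ∈ S, shiftOp (s * g e) (v e)) • F).1 (x s) -
    s ^ S.card * (∏ e ∈ S, g e) * F.1 (x s)| ≤ C * (s ^ S.card * φ s) := by
  induction S using Finset.induction_on with
  | empty => exact ⟨0, fun s _ => by simp⟩
  | insert e S he ih =>
    obtain ⟨C, hC⟩ := ih
    obtain ⟨C', hC'⟩ := exists_bound_prod_shiftOp hσ hM hφ g v S (shiftOp 0 (v e) • F) (by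
      have : (shiftOp 0 (v e) • F).1 = (1 / (2 * Real.pi)) • fun y => fderiv ℝ F.1 y (v e) :=
        funext fun y => by rw [shiftOp_smul_apply, zero_mul, zero_add]; rfl
      rw [this]; exact Submodule.smul_mem _ _ (hF _))
    refine ⟨|g e| * C + C', fun s hs => ?_⟩
    have h0 : 0 ≤ s := by linarith
    rw [prod_insert he, prod_insert he, card_insert_of_notMem he, shiftOp_mul_prod_smul]
    set A := ((∏ e ∈ S, shiftOp (s * g e) (v e)) • F).1 (x s)
    have h2 : ∀ B : ℝ, s * g e * A + B - s ^ (S.card + 1) * (g e * ∏ e ∈ S, g e) * F.1 (x s) =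
        s * g e * (A - s ^ S.card * (∏ e ∈ S, g e) * F.1 (x s)) + B := fun B => by ring
    rw [h2]
    calc _ ≤ s * (s * |g e| * |A - s ^ S.card * (∏ e ∈ S, g e) * F.1 (x s)| +
          C' * (s ^ S.card * φ s)) := by
          gcongr; refine (abs_add_le _ _).trans (add_le_add ?_ (hC' s hs))
          rw [abs_mul, abs_mul, abs_of_nonneg h0]
      _ = s * |g e| * (s * |A - s ^ S.card * (∏ e ∈ S, g e) * F.1 (x s)|) +
          s * (C' * (s ^ S.card * φ s)) := by ring
      _ ≤ s * |g e| * (C * (s ^ S.card * φ s)) + s * (C' * (s ^ S.card * φ s)) := by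
          exact add_le_add_left (mul_le_mul_of_nonneg_left (hC s hs) (by positivity)) _
      _ = _ := by ring

end

section

variable {V : Type} [Fintype V]

/-- The product of the signs of the flows of `c` through the arcs of a tree. -/
def flowSign (D : Arcs V) (c : V → ℝ) : ℝ := ∏ e ∈ D, sign (flow D e (meanFree c))

lemma isBddMeas_flowSign (D : Arcs V) : IsBddMeas (flowSign D) :=
  isBddMeas_signs D fun e => flow D e

lemma flowFn_empty (t : V → V → ℝ) (c : V → ℝ) : (flowFn t ∅).1 c = 1 := by
  change smear t (flowSign ∅) c = 1; simp [smear, flowSign]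

/-- The leading part of the tree sum. -/
def leadingSum (t g : V → V → ℝ) (c : V → ℝ) : ℝ :=
  ∑ D ∈ otrees V, (∏ e ∈ D, g e.1 e.2) * (flowFn t D).1 c

lemma flowFn_add_mem_smoothSpan (t : V → V → ℝ) (D : Arcs V) (r : ℝ) :
    (fun c => (flowFn t D).1 c + r) ∈ smoothSpan (fun w => flowSign D (noise t w) + r)
    (noiseInv t LinearMap.id) := by
  have h := smear_mem_smoothSpan t (fun c => flowSign D c + r) (LinearMap.id : (V → ℝ) →ₗ[ℝ] _)
  rwa [show (fun c => smear t (fun c => flowSign D c + r) ((LinearMap.id : (V → ℝ) →ₗ[ℝ] _) c)) =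
    fun c => (flowFn t D).1 c + r from funext fun c =>
      (smear_add (isBddMeas_flowSign D) (.const _) c).trans (congrArg _ (by simp [smear]))] at h

lemma exists_bound_treeNumber_sub (t g : V → V → ℝ) {φ : ℝ → ℝ} (k : Arcs V → ℝ)
    (hφ : ∀ D ∈ otrees V, ∀ G ∈ smoothSpan (fun w => flowSign D (noise t w) + k D)
    (noiseInv t LinearMap.id),
    ∃ C : ℝ, ∀ s : ℝ, 1 ≤ s → |G (s • fun q => ∑ q', g q q')| ≤ C * φ s) : ∃ C : ℝ, ∀ s : ℝ, 1 ≤ s →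
    s * |treeNumber t (fun i j => s * g i j) / s ^ (Fintype.card V - 1) -
    leadingSum t g (s • fun q => ∑ q', g q q')| ≤ C * φ s := by
  have h : ∀ D : otrees V, ∃ C : ℝ, ∀ s : ℝ, 1 ≤ s → s * |((∏ e ∈ D.1, shiftOp (s * g e.1 e.2)
      (t e.1 e.2 • dv e)) • flowFn t D.1).1 (s • fun q => ∑ q', g q q') -
      s ^ D.1.card * (∏ e ∈ D.1, g e.1 e.2) * (flowFn t D.1).1 (s • fun q => ∑ q', g q q')| ≤
      C * (s ^ D.1.card * φ s) := fun D => by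
    have hb : IsBddMeas fun c => flowSign D.1 c + k D.1 := (isBddMeas_flowSign D.1).add (.const _)
    obtain ⟨hm, M, hM⟩ := hb.comp_noise t
    refine exists_bound_prod_shiftOp_sub hm hM (hφ D.1 D.2) _ _ (flowFn t D.1) (fun u => ?_) D.1
    simpa using (differentiable_of_mem_smoothSpan hm hM (flowFn_add_mem_smoothSpan t D.1 _)).2 u
  choose C hC using h; refine ⟨∑ D, C D, fun s hs => ?_⟩; have hs0 : 0 < s := by linarith
  have hev : (fun q => ∑ q', s * g q q') = s • fun q => ∑ q', g q q' := funext fun q => by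
    simp [mul_sum]
  rw [treeNumber, leadingSum, sum_div, ← sum_sub_distrib, hev, sum_mul, ← sum_coe_sort (otrees V)]
  calc _ ≤ s * ∑ D : otrees V, |_| := by gcongr; exact abs_sum_le_sum_abs _ _
    _ = ∑ D : otrees V, s * |_| := mul_sum _ _ _
    _ ≤ _ := sum_le_sum fun D _ => ?_
  have hp : 0 < s ^ D.1.card := by positivity
  have hq : ∀ A B : ℝ, A / s ^ D.1.card - B = (A - s ^ D.1.card * B) / s ^ D.1.card :=
    fun A B => by field_simp
  rw [← isOTree_card (mem_otrees.1 D.2), hq, ← mul_assoc, abs_div, abs_of_pos hp, ← mul_div_assoc,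
    div_le_iff₀ hp]
  exact (hC D s hs).trans_eq (by ring)

lemma leadingSum_eq (t g : V → V → ℝ) (c : V → ℝ) : leadingSum t g c =
    smear t (fun c => ∑ D ∈ otrees V, (∏ e ∈ D, g e.1 e.2) * flowSign D c) c := by
  rw [smear_sum _ fun D _ => (IsBddMeas.const _).mul (isBddMeas_flowSign D)]
  exact sum_congr rfl fun D _ => (smear_const_mul (flowSign D) _ c).symm

lemma ae_isGenericVec (t : V → V → ℝ) : ∀ᵐ w ∂stdGauss V, IsGenericVec (meanFree (noise t w)) := by
  have h : ∀ S : Finset V, ∀ᵐ w ∂stdGauss V, S.Nonempty → S ≠ univ →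
      ∑ v ∈ S, meanFree (noise t w) v ≠ 0 := fun S => by
    by_cases hS : S.Nonempty ∧ S ≠ univ; swap
    · exact ae_of_all _ fun w h1 h2 => absurd ⟨h1, h2⟩ hS
    obtain ⟨⟨i, hi⟩, hu⟩ := hS
    obtain ⟨j, hj⟩ : ∃ j, j ∉ S := by by_contra! h; exact hu (eq_univ_of_forall h)
    have hf : ∀ c, (∑ v ∈ S, LinearMap.proj v : (V → ℝ) →ₗ[ℝ] ℝ) c = ∑ v ∈ S, c v := fun c => by
      simp
    filter_upwards [ae_noise_ne t (∑ v ∈ S, LinearMap.proj v) (e := (i, j))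
      (by rw [hf, sum_dv]; simp [hi, hj]) 0] with w hw _ _
    grind
  filter_upwards [ae_all_iff.2 h] with w hw; exact ⟨sum_meanFree _, hw⟩

lemma tendsto_leadingSum (t : V → V → ℝ) {g : V → V → ℝ} (hg : ∀ i j, g j i = -g i j) :
    Tendsto (fun s : ℝ => leadingSum t g (s • fun q => ∑ q', g q q')) atTop
    (𝓝 (∑ D ∈ otrees V, (∏ e ∈ D, g e.1 e.2) * constSign (fun q => ∑ q', g q q') D)) := by
  set c : V → ℝ := fun q => ∑ q', g q q' with hc; set w : V × V → ℝ := fun e => g e.1 e.2 with hw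
  have hws : ∀ e, w e.swap = -w e := fun e => hg e.1 e.2
  have hc0 : ∑ v, c v = 0 := sum_eq_zero_of_antisymm (w := w) hws
  have hb : IsBddMeas fun c => ∑ D ∈ otrees V, (∏ e ∈ D, g e.1 e.2) * flowSign D c :=
    IsBddMeas.sum fun D _ => (IsBddMeas.const _).mul (isBddMeas_flowSign D)
  obtain ⟨K, hK⟩ := hb.2; simp only [leadingSum_eq, smear]
  have hconst : ∀ a : ℝ, a = ∫ _ : V → ℝ, a ∂stdGauss V := fun a => by simp
  rw [hconst (∑ D ∈ otrees V, _)]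
  refine tendsto_integral_filter_of_dominated_convergence (fun _ => K)
    (Eventually.of_forall fun s => (hb.integrable t _).aestronglyMeasurable)
    (Eventually.of_forall fun s => ae_of_all _ fun w => hK _) (integrable_const K) ?_
  filter_upwards [ae_isGenericVec t] with z hz
  have h1 := sum_sign_deltaSign hws (c := c) (fun v => rfl) hz; simp only [← prod_limSign, hw] at h1
  simp only [constSign]; rw [← h1]
  refine tendsto_finsetSum _ fun D _ => Tendsto.const_mul _ (tendsto_finsetProd _ fun e _ => ?_)
  simp only [map_add, map_smul, smul_eq_mul, meanFree_of_sum hc0]; exact tendsto_sign_limSign _ _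

end

section

variable {V : Type} [Fintype V] {b n : ℕ} {κ : Triples b} {ample : Set (Fin b → ℝ)}
variable {γ : Charges n b}

lemma smoothSpan_bound_noise {t : V → V → ℝ} {σ : (V → ℝ) → ℝ} (hσ : IsBddMeas σ)
    {G : (V → ℝ) → ℝ} (hG : G ∈ smoothSpan (fun w => σ (noise t w)) (noiseInv t LinearMap.id)) :
    ∃ C : ℝ, ∀ (c : V → ℝ) (r : ℝ), 0 ≤ r → (∀ w, (∀ i, |w i| < r) → σ (c + noise t w) = 0) →
    |G c| ≤ C * exp (-(Real.pi / 4) * r ^ 2) := by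
  obtain ⟨K, hK⟩ := hσ.2
  obtain ⟨C, hC⟩ := exists_bound_of_mem_smoothSpan (fun w => hK (noise t w)) hG
  refine ⟨C, fun c r hr h => hC c r hr fun w hw => ?_⟩
  have : noise t (noiseInv t LinearMap.id c) = c := (noise t).apply_symm_apply c; rw [map_add, this]
  exact h w hw

lemma tendsto_treeNumber [Nonempty V] (t : V → V → ℝ) {g : V → V → ℝ} (hg : ∀ i j, g j i = -g i j) :
    Tendsto (fun s : ℝ => treeNumber t (fun i j => s * g i j) / s ^ (Fintype.card V - 1)) atTop
    (𝓝 (∑ D ∈ otrees V, (∏ e ∈ D, g e.1 e.2) * constSign (fun q => ∑ q', g q q') D)) := by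
  obtain ⟨C, hC⟩ := exists_bound_treeNumber_sub t g (φ := fun _ => 1) (fun _ => 0) (by
    intro D _ G hG
    obtain ⟨C, hC⟩ := smoothSpan_bound_noise ((isBddMeas_flowSign D).add (.const 0)) hG
    refine ⟨C, fun s _ => ?_⟩
    have := hC (s • fun q => ∑ q', g q q') 0 le_rfl fun w hw =>
      absurd (hw (Classical.arbitrary V)) (abs_nonneg _).not_gt
    simpa using this)
  have h := tendsto_leadingSum t hg
  have h0 : Tendsto (fun s : ℝ => treeNumber t (fun i j => s * g i j) /
      s ^ (Fintype.card V - 1) - leadingSum t g (s • fun q => ∑ q', g q q')) atTop (𝓝 0) := by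
    refine squeeze_zero_norm' (a := fun s : ℝ => C * s⁻¹) ?_ ?_
    · filter_upwards [eventually_ge_atTop 1] with s hs
      rw [Real.norm_eq_abs, ← div_eq_mul_inv, le_div_iff₀ (by linarith), mul_comm]
      simpa using hC s hs
    · simpa using tendsto_inv_atTop_zero.const_mul C
  simpa using h0.add h

/-- Without vanishing flows, the approach to the limit is exponentially fast. -/
lemma exists_exp_bound_treeNumber (t : V → V → ℝ) {g : V → V → ℝ}
    (hgen : IsGenericVec fun q => ∑ q', g q q') : ∃ ℓ C δ : ℝ, 0 < δ ∧ ∀ s : ℝ, 1 ≤ s →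
    |treeNumber t (fun i j => s * g i j) / s ^ (Fintype.card V - 1) - ℓ| ≤
    C * exp (-δ * s ^ 2) := by
  set c : V → ℝ := fun q => ∑ q', g q q' with hc
  have hmem : ∀ᶠ w in 𝓝 (0 : V → ℝ), ∀ D ∈ otrees V, ∀ e ∈ D,
      |flow D e (meanFree (noise t w))| < |flow D e c| := by
    refine (eventually_all_finset _).2 fun D hD => (eventually_all_finset _).2 fun e he => ?_
    have hcont : Continuous fun w => |(flow D e ∘ₗ meanFree ∘ₗ (noise t).toLinearMap) w| :=
      (LinearMap.continuous_of_finiteDimensional _).abs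
    refine hcont.continuousAt.eventually_lt_const ?_
    simpa using hgen.flow_ne (mem_otrees.1 hD).1 he
  obtain ⟨δ, hδ, hball⟩ := Metric.eventually_nhds_iff.1 hmem
  set k : Arcs V → ℝ := fun D => ∏ e ∈ D, sign (flow D e c) with hk
  have hconst : ∀ D ∈ otrees V, ∀ s : ℝ, 1 ≤ s → ∀ w : V → ℝ, (∀ i, |w i| < δ * s) →
      flowSign D (s • c + noise t w) + -k D = 0 := fun D hD s hs w hw => by
    have hs0 : 0 < s := by linarith
    have hw' : dist (s⁻¹ • w) 0 < δ := by
      rw [dist_pi_lt_iff hδ]; intro i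
      rw [Pi.smul_apply, Pi.zero_apply, dist_zero_right, smul_eq_mul, norm_mul, norm_inv,
        Real.norm_eq_abs, Real.norm_eq_abs, abs_of_pos hs0, inv_mul_lt_iff₀ hs0, mul_comm]
      exact hw i
    rw [add_neg_eq_zero, flowSign, hk]; refine prod_congr rfl fun e he => ?_
    have h := hball hw' D hD e he
    rw [map_smul, map_smul, map_smul, smul_eq_mul, abs_mul, abs_inv, abs_of_pos hs0,
      inv_mul_lt_iff₀ hs0] at h
    rw [map_add, map_add, map_smul, map_smul, meanFree_of_sum hgen.1, smul_eq_mul]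
    rcases lt_or_gt_of_ne (hgen.flow_ne (mem_otrees.1 hD).1 he) with h0 | h0
    · rw [abs_of_neg h0] at h
      rw [Real.sign_of_neg h0, Real.sign_of_neg (by linarith [(abs_lt.1 h).2])]
    · rw [abs_of_pos h0] at h
      rw [Real.sign_of_pos h0, Real.sign_of_pos (by linarith [(abs_lt.1 h).1])]
  set φ : ℝ → ℝ := fun s => exp (-(Real.pi / 4) * (δ * s) ^ 2) with hφ
  have hspan : ∀ D ∈ otrees V, ∀ G ∈ smoothSpan (fun w => flowSign D (noise t w) + -k D)
      (noiseInv t LinearMap.id), ∃ C : ℝ, ∀ s : ℝ, 1 ≤ s → |G (s • c)| ≤ C * φ s := by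
    intro D hD G hG
    obtain ⟨C, hC⟩ := smoothSpan_bound_noise ((isBddMeas_flowSign D).add (.const _)) hG
    exact ⟨C, fun s hs => hC _ _ (by positivity) (hconst D hD s hs)⟩
  obtain ⟨C, hC⟩ := exists_bound_treeNumber_sub t g (φ := φ) (fun D => -k D) hspan
  have h1 : ∀ D : otrees V, ∃ C : ℝ, ∀ s : ℝ, 1 ≤ s →
      |(flowFn t D.1).1 (s • c) + -k D.1| ≤ C * φ s := fun D =>
    hspan D.1 D.2 _ (flowFn_add_mem_smoothSpan t D.1 _)
  choose C' hC' using h1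
  refine ⟨∑ D ∈ otrees V, (∏ e ∈ D, g e.1 e.2) * k D,
    C + ∑ D : otrees V, |∏ e ∈ D.1, g e.1 e.2| * C' D, Real.pi / 4 * δ ^ 2, by positivity,
    fun s hs => ?_⟩
  have hφs : exp (-(Real.pi / 4 * δ ^ 2) * s ^ 2) = φ s := by rw [hφ]; congr 1; ring
  have h2 : |leadingSum t g (s • c) - ∑ D ∈ otrees V, (∏ e ∈ D, g e.1 e.2) * k D| ≤
      (∑ D : otrees V, |∏ e ∈ D.1, g e.1 e.2| * C' D) * φ s := by
    rw [leadingSum, ← sum_sub_distrib, ← sum_coe_sort (otrees V), sum_mul]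
    refine (abs_sum_le_sum_abs _ _).trans (sum_le_sum fun D _ => ?_)
    rw [← mul_sub, abs_mul, sub_eq_add_neg, mul_assoc]
    exact mul_le_mul_of_nonneg_left (hC' D s hs) (abs_nonneg _)
  rw [hφs, add_mul]; refine (abs_sub_le _ (leadingSum t g (s • c)) _).trans (add_le_add ?_ h2)
  exact (le_mul_of_one_le_left (abs_nonneg _) hs).trans (hC s hs)

lemma simpleE_eq (hκ : IsAmpleCone κ ample) (hγ : ∀ i, (γ i).1 ∈ ample) (hn : 0 < n) (τ : ℝ) :
    simpleE κ n γ τ = treeNumber (tPush id (tW κ γ)) (fun i j => √(2 * τ) * dirac (γ i) (γ j)) /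
    √(2 * τ) ^ (n - 1) / (2 ^ (n - 1) * n.factorial : ℝ) := by
  have h0 : (2 ^ (n - 1) * n.factorial : ℝ) ≠ 0 := by positivity
  have h1 := simplePhi_eq hκ hγ hn (xVec κ γ τ)
  rw [blockSum_apply hκ hγ Function.surjective_id] at h1
  have h2 : (fun q q' => dot κ γ (vBlock γ (fiber id q) (fiber id q')) (xVec κ γ τ)) =
      fun i j => √(2 * τ) * dirac (γ i) (γ j) := by
    funext i j; rw [← dot_vPair_xVec hκ hγ, vPair_eq_vBlock]
  rw [h2] at h1; rw [simpleE, ← h1, div_right_comm, mul_div_cancel_left₀ _ h0]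

lemma tendsto_sqrt_two_mul : Tendsto (fun τ : ℝ => √(2 * τ)) atTop atTop :=
  Real.tendsto_sqrt_atTop.comp (tendsto_id.const_mul_atTop two_pos)

lemma tendsto_simpleE (hκ : IsAmpleCone κ ample) (hγ : ∀ i, (γ i).1 ∈ ample) (hn : 0 < n) :
    Tendsto (simpleE κ n γ) atTop (𝓝 (simpleEConst n γ)) := by
  have : Nonempty (Fin n) := ⟨⟨0, hn⟩⟩
  have h0 : (2 ^ (n - 1) * n.factorial : ℝ) ≠ 0 := by positivity
  have h := (tendsto_treeNumber (tPush id (tW κ γ)) (g := fun i j => dirac (γ i) (γ j))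
    fun i j => by simp only [dirac]; ring).comp tendsto_sqrt_two_mul
  rw [← simpleEConst_eq hn, Fintype.card_fin] at h
  have h1 := h.div_const (2 ^ (n - 1) * n.factorial : ℝ); rw [mul_div_cancel_left₀ _ h0] at h1
  exact h1.congr fun τ => (simpleE_eq hκ hγ hn τ).symm

/-- Exponential convergence to the limit. -/
def HasExpLimit (f : ℝ → ℝ) : Prop :=
  ∃ ℓ c : ℝ, 0 < c ∧ (fun τ => f τ - ℓ) =O[atTop] fun τ => exp (-c * τ)

lemma HasExpLimit.const_mul {f : ℝ → ℝ} (hf : HasExpLimit f) (r : ℝ) :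
    HasExpLimit fun τ => r * f τ := by
  obtain ⟨ℓ, c, hc, h⟩ := hf; exact ⟨r * ℓ, c, hc, by simpa only [mul_sub] using h.const_mul_left r⟩

lemma isBigO_exp_of_le {a c : ℝ} (h : c ≤ a) :
    (fun τ : ℝ => exp (-a * τ)) =O[atTop] fun τ => exp (-c * τ) := by
  refine IsBigO.of_bound 1 ?_; filter_upwards [eventually_ge_atTop 0] with τ hτ
  rw [one_mul, Real.norm_eq_abs, Real.norm_eq_abs, Real.abs_exp, Real.abs_exp, Real.exp_le_exp]
  nlinarith

lemma HasExpLimit.sum {ι : Type*} {S : Finset ι} {f : ι → ℝ → ℝ}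
    (hf : ∀ i ∈ S, HasExpLimit (f i)) : HasExpLimit fun τ => ∑ i ∈ S, f i τ := by
  induction S using Finset.induction_on with
  | empty => exact ⟨0, 1, one_pos, by simpa using isBigO_zero _ _⟩
  | insert i S hi ih =>
    obtain ⟨ℓ, c, hc, h⟩ := hf i (mem_insert_self _ _)
    obtain ⟨ℓ', c', hc', h'⟩ := ih fun j hj => hf j (mem_insert_of_mem hj)
    refine ⟨ℓ + ℓ', min c c', lt_min hc hc', ((h.trans (isBigO_exp_of_le (min_le_left _ _))).add
      (h'.trans (isBigO_exp_of_le (min_le_right _ _)))).congr_left fun τ => ?_⟩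
    grind

lemma HasExpLimit.decayingPart {f : ℝ → ℝ} (hf : HasExpLimit f) :
    ∃ c : ℝ, 0 < c ∧ decayingPart f =O[atTop] fun τ => exp (-c * τ) := by
  obtain ⟨ℓ, c, hc, h⟩ := hf; refine ⟨c, hc, ?_⟩
  have h1 : Tendsto (fun τ : ℝ => exp (-c * τ)) atTop (𝓝 0) :=
    Real.tendsto_exp_atBot.comp (tendsto_id.const_mul_atTop_of_neg (by linarith))
  have h2 : constPart f = ℓ := (tendsto_sub_nhds_zero_iff.1 (h.trans_tendsto h1)).limUnder_eq
  unfold _root_.decayingPart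
  rwa [h2]

lemma hasExpLimit_simpleE (hκ : IsAmpleCone κ ample) (hγ : ∀ i, (γ i).1 ∈ ample) (hn : 0 < n)
    (hgen : IsGenericVec fun i => ∑ j, dirac (γ i) (γ j)) : HasExpLimit (simpleE κ n γ) := by
  obtain ⟨ℓ, C, δ, hδ, h⟩ := exists_exp_bound_treeNumber (tPush id (tW κ γ)) hgen
  have h1 : HasExpLimit fun τ => treeNumber (tPush id (tW κ γ))
      (fun i j => √(2 * τ) * dirac (γ i) (γ j)) / √(2 * τ) ^ (n - 1) := by
    refine ⟨ℓ, 2 * δ, by positivity, IsBigO.of_bound C ?_⟩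
    filter_upwards [tendsto_sqrt_two_mul.eventually_ge_atTop 1, eventually_ge_atTop 0] with τ hτ h0
    have h2 := h _ hτ; rw [Fintype.card_fin, Real.sq_sqrt (by positivity)] at h2
    rw [Real.norm_eq_abs, Real.norm_eq_abs, Real.abs_exp]; refine h2.trans_eq ?_; congr 2; ring
  have := h1.const_mul (2 ^ (n - 1) * n.factorial : ℝ)⁻¹
  refine cast (congrArg HasExpLimit (funext fun τ => ?_)) this
  rw [simpleE_eq hκ hγ hn, div_eq_inv_mul _ (2 ^ (n - 1) * n.factorial : ℝ)]

end

section

variable {b n : ℕ} {κ : Triples b} {ample : Set (Fin b → ℝ)}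
variable {γ : Charges n b} {P : Finset (Finset (Fin n))}

lemma sum_dirac_eq (γ : Charges n b) (S : Finset (Fin n)) :
    ∑ i ∈ S, ∑ j, dirac (γ i) (γ j) = dirac (∑ i ∈ S, γ i) (∑ j, γ j) := by
  rw [dirac_sum_left]; exact sum_congr rfl fun i _ => (dirac_sum_right _ _ _).symm

lemma GenericCharges.isGenericVec (h : GenericCharges γ) :
    IsGenericVec fun i => ∑ j, dirac (γ i) (γ j) := by
  have hself : ∀ x : Charge b, dirac x x = 0 := fun x => by simp [dirac]
  refine ⟨by rw [sum_dirac_eq, hself], fun S hS hu => ?_⟩; rw [sum_dirac_eq, ← sum_add_sum_compl S]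
  have h1 : ∀ x y : Charge b, dirac x (x + y) = dirac x y := fun x y => by
    simp only [dirac, Prod.fst_add, Prod.snd_add, add_dotProduct, dotProduct_add]; ring
  rw [h1]; refine h S hS (nonempty_iff_ne_empty.2 fun h => hu ?_); simp_all

lemma IsPartition.partCharges_mem_ample (hκ : IsAmpleCone κ ample)
    (hγ : ∀ i, (γ i).1 ∈ ample) (hP : IsPartition univ P)
    (i : Fin P.card) : (partCharges γ P i).1 ∈ ample := by
  rw [← hP.blockCharge_eq]
  exact blockCharge_mem_ample hκ hγ (P.equivFin.surjective.comp hP.block_surjective) i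

lemma IsPartition.isGenericVec_partCharges (h : IsGenericVec fun i => ∑ j, dirac (γ i) (γ j))
    (hP : IsPartition univ P) :
    IsGenericVec fun i => ∑ j, dirac (partCharges γ P i) (partCharges γ P j) := by
  have h1 : (fun i => ∑ j, dirac (partCharges γ P i) (partCharges γ P j)) =
      pushSum (P.equivFin ∘ hP.block) fun i => ∑ j, dirac (γ i) (γ j) := by
    funext q; rw [← dirac_sum_right, ← hP.blockCharge_eq, pushSum_apply]
    have : ∑ j, blockCharge γ (P.equivFin ∘ hP.block) j = ∑ j, γ j := sum_fiber _ _
    rw [this, blockCharge, ← sum_dirac_eq]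
    exact sum_congr (by ext; simp [mem_fiber]) fun _ _ => rfl
  rw [h1]; exact h.pushSum (P.equivFin.surjective.comp hP.block_surjective)

lemma markedE_eventuallyEq (hκ : IsAmpleCone κ ample) (hγ : ∀ i, (γ i).1 ∈ ample) (hn : 0 < n) :
    (fun τ => ∑ P ∈ partitions (univ : Finset (Fin n)),
    ((n.factorial : ℝ)⁻¹ * (∏ B ∈ P, blockCoef γ B) * P.card.factorial) *
    simpleE κ P.card (partCharges γ P) τ) =ᶠ[atTop] markedE κ n γ := by
  filter_upwards [eventually_gt_atTop 0] with τ hτ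
  have h0 : (n.factorial : ℝ) ≠ 0 := by exact_mod_cast n.factorial_ne_zero
  rw [← mul_right_inj' h0, markedE_eq_sum hκ hγ hn hτ, mul_sum]; grind

lemma IsPartition.card_pos (hP : IsPartition univ P)
    (hn : 0 < n) : 0 < P.card := Finset.card_pos.2 ⟨_, (hP.block ⟨0, hn⟩).2⟩

lemma tendsto_markedE (hκ : IsAmpleCone κ ample) (hγ : ∀ i, (γ i).1 ∈ ample) (hn : 0 < n) :
    Tendsto (markedE κ n γ) atTop (𝓝 (constPart (markedE κ n γ))) :=
  tendsto_nhds_limUnder ⟨_, (tendsto_finsetSum _ fun P hP => Tendsto.const_mul _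
    (tendsto_simpleE hκ ((mem_partitions.1 hP).partCharges_mem_ample hκ hγ)
      ((mem_partitions.1 hP).card_pos hn))).congr' (markedE_eventuallyEq hκ hγ hn)⟩

lemma hasExpLimit_markedE (hκ : IsAmpleCone κ ample) (hγ : ∀ i, (γ i).1 ∈ ample) (hn : 0 < n)
    (hgen : IsGenericVec fun i => ∑ j, dirac (γ i) (γ j)) : HasExpLimit (markedE κ n γ) := by
  obtain ⟨ℓ, c, hc, h⟩ := HasExpLimit.sum fun P hP => (hasExpLimit_simpleE hκ
    ((mem_partitions.1 hP).partCharges_mem_ample hκ hγ) ((mem_partitions.1 hP).card_pos hn)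
    ((mem_partitions.1 hP).isGenericVec_partCharges hgen)).const_mul
      ((n.factorial : ℝ)⁻¹ * (∏ B ∈ P, blockCoef γ B) * P.card.factorial)
  exact ⟨ℓ, c, hc, h.congr' ((markedE_eventuallyEq hκ hγ hn).sub (EventuallyEq.refl _ _))
    EventuallyEq.rfl⟩

lemma simpleE_one (hκ : IsAmpleCone κ ample) {δ : Charges 1 b}
    (hδ : ∀ i, (δ i).1 ∈ ample) (τ : ℝ) : simpleE κ 1 δ τ = 1 := by
  rw [simpleE_eq hκ hδ one_pos, treeNumber, otrees_of_unique, sum_singleton,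
    prod_empty, opRing_one_smul, flowFn_empty]
  simp

lemma contDiff_treeErf (hκ : IsAmpleCone κ ample)
    (hγ : ∀ i, (γ i).1 ∈ ample) {G : SimpleGraph (Fin n)} (hG : G.IsTree) :
    ContDiff ℝ ∞ (treeErf κ γ (orient G) (vPair γ)) := by
  rw [vPair_eq_vBlock, treeErf_eq_blockFn hκ hγ Function.surjective_id hG]
  exact smoothFns_contDiff _

lemma opDy_opDy_comm (hκ : IsAmpleCone κ ample) (γ : Charges n b) (v w y : Vec n b)
    {F : Vec n b → ℝ} (hF : ContDiff ℝ ∞ F) :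
    opDy κ γ v y (opDy κ γ w y F) = opDy κ γ w y (opDy κ γ v y F) := by
  have h := opDy_eq hκ γ y; have h' := fun v => h v ⟨F, mem_smoothFns.2 hF⟩
  rw [h' v, h' w, h, h, ← opRing_mul_smul, ← opRing_mul_smul, mul_comm]

lemma symmetrize_kernelR_markedE (hκ : IsAmpleCone κ ample)
    (hγ : ∀ i, (γ i).1 ∈ ample) (hn : 2 ≤ n) {τ : ℝ} (hτ : 0 < τ) :
    symmetrize (fun δ => kernelR (markedE κ) n δ τ) γ =
    symmetrize (fun δ => kernelR (simpleE κ) n δ τ) γ :=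
  symmetrize_kernelR_eq hκ (fun τ _ _ hδ σ => simpleE_comp_perm hκ hδ σ τ)
    (fun _ hk _ hδ => tendsto_nhds_limUnder ⟨_, tendsto_simpleE hκ hδ hk⟩)
    (fun _ hk _ hδ => tendsto_markedE hκ hδ hk)
    (fun _ hτ _ hk _ hδ => markedE_eq_sum hκ hδ hk hτ) (fun _ hδ τ => simpleE_one hκ hδ τ) hγ hn hτ

lemma exists_isBigO_decayingPart (hκ : IsAmpleCone κ ample)
    (hγ : ∀ i, (γ i).1 ∈ ample) (hn : 0 < n) (hgen : GenericCharges γ) : ∃ c : ℝ, 0 < c ∧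
    (decayingPart (markedE κ n γ) =O[atTop] fun τ₂ => exp (-c * τ₂)) ∧
    decayingPart (simpleE κ n γ) =O[atTop] fun τ₂ => exp (-c * τ₂) := by
  obtain ⟨c, hc, h⟩ := (hasExpLimit_markedE hκ hγ hn hgen.isGenericVec).decayingPart
  obtain ⟨c', hc', h'⟩ := (hasExpLimit_simpleE hκ hγ hn hgen.isGenericVec).decayingPart
  exact ⟨min c c', lt_min hc hc', h.trans (isBigO_exp_of_le (min_le_left _ _)),
    h'.trans (isBigO_exp_of_le (min_le_right _ _))⟩

end

end

theorem mainTheorem3 {b : ℕ} (κ : Fin b → Fin b → Fin b → ℝ) (ample : Set (Fin b → ℝ))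
    (hκ : IsAmpleCone κ ample) (n : ℕ) (hn : 2 ≤ n) (γ : Fin n → Charge b)
    (hγ : ∀ i, (γ i).1 ∈ ample) :
    -- the kernel is the same Schröder tree sum over the simplified functions
    (∀ τ₂ : ℝ, 0 < τ₂ →
      symmetrize (fun δ => kernelR (markedE κ) n δ τ₂) γ =
        symmetrize (fun δ => kernelR (simpleE κ) n δ τ₂) γ) ∧
    -- the constant parts exist, and that of the simplified function is explicit
    Tendsto (markedE κ n γ) atTop (𝓝 (constPart (markedE κ n γ))) ∧
    Tendsto (simpleE κ n γ) atTop (𝓝 (simpleEConst n γ)) ∧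
    constPart (simpleE κ n γ) = simpleEConst n γ ∧
    -- for generic charges the other parts are exponentially suppressed
    (GenericCharges γ → ∃ c : ℝ, 0 < c ∧
      (decayingPart (markedE κ n γ) =O[atTop] fun τ₂ => Real.exp (-c * τ₂)) ∧
      decayingPart (simpleE κ n γ) =O[atTop] fun τ₂ => Real.exp (-c * τ₂)) ∧
    -- the operators `D(v, y)` act on smooth functions, and commute
    (∀ G ∈ labeledTrees (Fin n), ContDiff ℝ ∞ (treeErf κ γ (orient G) (vPair γ))) ∧
    (∀ v w y : Vec n b, ∀ F : Vec n b → ℝ, ContDiff ℝ ∞ F →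
      opDy κ γ v y (opDy κ γ w y F) = opDy κ γ w y (opDy κ γ v y F)) := by
  have hn0 : 0 < n := by omega
  exact ⟨fun τ₂ hτ => symmetrize_kernelR_markedE hκ hγ hn hτ, tendsto_markedE hκ hγ hn0,
    tendsto_simpleE hκ hγ hn0, (tendsto_simpleE hκ hγ hn0).limUnder_eq,
    exists_isBigO_decayingPart hκ hγ hn0,
    fun G hG => contDiff_treeErf hκ hγ (mem_labeledTrees.1 hG),
    fun v w y F hF => opDy_opDy_comm hκ γ v w y hF⟩
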